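/- **Setting.** An instance consists of integers $n,m\ge 0$, a circuit $U=g_s\cdots g_1$ of $s$ gates on $n+m$ qubits, and one designated output qubit. Each gate is a Clifford gate $H$, $S$ or $\mathrm{CNOT}$, or a phase gate $\mathrm{diag}(1,e^{i\theta})$ with arbitrary $\theta\in\mathbb R$; let $t$ be the number of phase gates. Put $$\mathsf{Val}=\max_{\psi}\ \langle\psi,0^m|\,U^\dagger\,|1\rangle\langle 1|_{\mathrm{out}}\,U\,|\psi,0^m\rangle ,$$ the maximum over normalized $n$-qubit states $\psi$. Let $\mathcal P$ be the set of Paulis on $n+m$ qubits (up to phase) obtained from $Z_{\mathrm{out}}$ by processing the gates from $g_s$ to $g_1$: a Clifford gate $g$ replaces each $P$ by $g^\dagger P g$; a phase gate on qubit $q$ keeps each $P$ and, if $P$ acts on $q$ as $X$ or $Y$, adds $P Z_q$. Let $b$ be the size of a basis of the group generated by $\mathcal P$ up to phase, viewed as an $\mathbb F_2$-vector space. Algorithms are finite programs of a random access machine that has registers for natural numbers (constants, addition, truncated subtraction, comparison, indirect addressing) and for real numbers (natural number constants, $+,-,\times,/$, comparison), each instruction and each test costing one step. The integer part of the input is the circuit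 without its angles; the real part is $c$, $\delta$ and the numbers $\cos\theta,\sin\theta$ of the phase gates. **Theorem.** There are constants $K,k$, a decision algorithm, and a routine that uses natural numbers only, such that for every instance with $t\le n$: 1. $b\le t+1$, and there are $b$ independent Paulis $B_1,\dots,B_b$, a basis of the group generated by $\mathcal P$ (up to phase), such that $U^\dagger Z_{\mathrm{out}}U$ is a linear combination of at most $2^t$ of the products $\prod_{k\in S}B_k$, $S\subseteq\{1,\dots,b\}$. 2. There are $r\le b$, independent Paulis $P_1,\dots,P_r$ on $n$ qubits, independent Paulis $A_1,\dots,A_r$ on $b$ qubits with the same commutation relations, and coefficients $\beta_S\in\mathbb C$, at most $2^t$ of them nonzero, with $\langle 0^m|U^\dagger Z_{\mathrm{out}}U|0^m\rangle=\sum_{S}\beta_S\prod_{k\in S}P_k$, such that the $2^b\times 2^b$ matrix $H'=\sum_S\beta_S\prod_{k\in S}A_k$ is Hermitian and has the same spectrum (as a set) as $\langle 0^m|U^\dagger Z_{\mathrm{out}}U|0^m\rangle$; its smallest eigenvalue is $1-2\,\mathsf{Val}$. 3. The routine, on the integer part of the input, outputs $b$ after at most $K(n+s+1)^k$ steps. 4.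 For all real $c$ and all $\delta>0$, the decision algorithm halts; it outputs $1$ if $\mathsf{Val}>c$ and $0$ if $\mathsf{Val}<c-\delta$. Its number of steps is at most $K(n+s+1)^k\,2^{3b}\max(1,\log(t/\delta))$, and at most $K(n+s+1)^k\,2^{3t}\max(1,\log(t/\delta))$. -/

import Mathlib

namespace QCSAT

/-! ### Quantum circuits -/

/-- Gates on `N` qubits: the Clifford gates `H`, `S`, `CNOT` (control `a`, target `b`), and the
phase gates `diag (1, e^{iθ})`. -/
inductive Gate (N : ℕ) : Type
  | H (q : Fin N)
  | S (q : Fin N)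
  | CNOT (a b : Fin N) (h : a ≠ b)
  | phase (q : Fin N) (θ : ℝ)

/-- Computational basis states of `N` qubits. -/
abbrev Bits (N : ℕ) : Type := Fin N → ZMod 2

/-- Operators on `N` qubits, in the computational basis. -/
abbrev Op (N : ℕ) : Type := Matrix (Bits N) (Bits N) ℂ

/-- The unitary of a gate, acting as the identity on the qubits it does not touch. -/
noncomputable def Gate.toOp {N : ℕ} : Gate N → Op N
  | .H q => Matrix.of fun v w =>
      if ∀ j, j ≠ q → v j = w j then
        (if v q = 1 ∧ w q = 1 then -1 else 1) / ((Real.sqrt 2 : ℝ) : ℂ)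
      else 0
  | .S q => Matrix.diagonal fun v => if v q = 1 then Complex.I else 1
  | .CNOT a b _ => Matrix.of fun v w =>
      if v = Function.update w b (w b + w a) then 1 else 0
  | .phase q θ => Matrix.diagonal fun v =>
      if v q = 1 then Complex.exp ((θ : ℂ) * Complex.I) else 1

def Gate.isPhase {N : ℕ} : Gate N → Bool
  | .phase _ _ => true
  | _ => false

/-- The unitary `g_s ⋯ g_2 g_1` of the circuit `[g_1, …, g_s]`. -/
noncomputable def circuitOp {N : ℕ} (gs : List (Gate N)) : Op N :=
  gs.foldl (fun U g => g.toOp * U) 1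

/-- A quantum circuit satisfiability instance with one output qubit. The first `n` qubits carry the
witness, the last `m` qubits are ancillas that start in `|0⟩`. -/
structure Instance where
  n : ℕ
  m : ℕ
  gates : List (Gate (n + m))
  out : Fin (n + m)

namespace Instance

/-- The number of gates. -/
def s (I : Instance) : ℕ := I.gates.length

/-- The number of phase gates. -/
def t (I : Instance) : ℕ := I.gates.countP Gate.isPhase

/-- The state `|ψ⟩ ⊗ |0^m⟩`. -/
def withAncillas (I : Instance) (ψ : EuclideanSpace ℂ (Bits I.n)) : Bits (I.n + I.m) → ℂ :=
  fun v => if ∀ j : Fin I.m, v (Fin.natAdd I.n j) = 0 then ψ fun i => v (Fin.castAdd I.m i) else 0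

/-- The probability that measuring the output qubit of `U (|ψ⟩ ⊗ |0^m⟩)` gives `1`. -/
noncomputable def acceptProb (I : Instance) (ψ : EuclideanSpace ℂ (Bits I.n)) : ℝ :=
  ∑ v : Bits (I.n + I.m),
    if v I.out = 1 then ‖(circuitOp I.gates).mulVec (I.withAncillas ψ) v‖ ^ 2 else 0

/-- The maximal acceptance probability over all normalized witness states. -/
noncomputable def Val (I : Instance) : ℝ :=
  sSup {p : ℝ | ∃ ψ : EuclideanSpace ℂ (Bits I.n), ‖ψ‖ = 1 ∧ p = I.acceptProb ψ}

end Instance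

/-! ### Pauli operators and their propagation through a circuit -/

/-- A Pauli operator on `N` qubits up to phase, as the pair of its `X` part and its `Z` part. The
product of Paulis (up to phase) is the sum of pairs. -/
abbrev Pauli (N : ℕ) : Type := (Fin N → ZMod 2) × (Fin N → ZMod 2)

/-- The one-qubit Pauli matrices `𝕀`, `X`, `Z`, `Y` for `(x, z) = (0,0), (1,0), (0,1), (1,1)`. -/
noncomputable def pauliOne (x z : ZMod 2) : Matrix (ZMod 2) (ZMod 2) ℂ :=
  Matrix.of fun a b =>
    if a = b + x then Complex.I ^ (x.val * z.val) * (-1) ^ (z.val * b.val) else 0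

/-- The tensor product of the one-qubit Pauli matrices labelled by `p`. -/
noncomputable def Pauli.toOp {N : ℕ} (p : Pauli N) : Op N :=
  Matrix.of fun v w => ∏ j, pauliOne (p.1 j) (p.2 j) (v j) (w j)

/-- The Pauli `Z` on qubit `q`. -/
def Pauli.Z {N : ℕ} (q : Fin N) : Pauli N := (0, Pi.single q 1)

/-- The set of Paulis in the expansion of `g† P g`, for `P` in `T`: a Clifford gate maps a Pauli to
a Pauli; a phase gate on qubit `q` fixes the Paulis that act on `q` as `𝕀` or `Z`, and
sends a Pauli `P` that acts on `q` as `X` or `Y` to a combination of `P` and `P Z_q`. -/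
def Gate.propagate {N : ℕ} : Gate N → Set (Pauli N) → Set (Pauli N)
  | .H q, T => (fun p => (Function.update p.1 q (p.2 q), Function.update p.2 q (p.1 q))) '' T
  | .S q, T => (fun p => (p.1, Function.update p.2 q (p.2 q + p.1 q))) '' T
  | .CNOT a b _, T =>
      (fun p => (Function.update p.1 b (p.1 b + p.1 a),
        Function.update p.2 a (p.2 a + p.2 b))) '' T
  | .phase q _, T => T ∪ {p' | ∃ p ∈ T, p.1 q = 1 ∧ p' = p + Pauli.Z q}

/-- The ordered product `∏_{k ∈ S} B_k` of Pauli operators. -/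
noncomputable def pauliProd {b N : ℕ} (B : Fin b → Pauli N) (S : Finset (Fin b)) : Op N :=
  ((List.finRange b).map fun k => if k ∈ S then (B k).toOp else 1).prod

namespace Instance

/-- The Paulis obtained from `Z_out` by propagation through the circuit, last gate first. -/
def paulis (I : Instance) : Set (Pauli (I.n + I.m)) :=
  I.gates.foldr Gate.propagate {Pauli.Z I.out}

/-- The size of a basis of (the group generated, up to phase, by) the propagated Paulis. -/
noncomputable def b (I : Instance) : ℕ :=
  Module.finrank (ZMod 2) (Submodule.span (ZMod 2) I.paulis)

/-- The observable `U† Z_out U` on all `n + m` qubits. -/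
noncomputable def observable (I : Instance) : Op (I.n + I.m) :=
  (circuitOp I.gates).conjTranspose * (Pauli.Z I.out).toOp * circuitOp I.gates

/-- The operator `⟨0^m| U† Z_out U |0^m⟩` on the `n` witness qubits. -/
noncomputable def witnessObservable (I : Instance) : Op I.n :=
  I.observable.submatrix (fun u => Fin.append u fun _ => 0) (fun u => Fin.append u fun _ => 0)

end Instance

/-! ### Random access machines with integer and real registers

Programs are finite, with natural number constants only. They have a read-only input and two
unbounded memories, of natural numbers and of real numbers, which are initially zero. Every
instruction and every test costs one step. -/

/-- Instructions on the natural numbers; `d`, `a`, `b` are addresses. -/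
inductive NatInstr : Type
  | const (d v : ℕ)
  | add (d a b : ℕ)
  | sub (d a b : ℕ)
  | load (d a : ℕ)
  | store (a b : ℕ)
  | read (d a : ℕ)

/-- Instructions on the real numbers; indirect addresses are taken from the natural numbers. -/
inductive RealInstr : Type
  | const (d v : ℕ)
  | add (d a b : ℕ)
  | sub (d a b : ℕ)
  | mul (d a b : ℕ)
  | div (d a b : ℕ)
  | load (d a : ℕ)
  | store (a b : ℕ)
  | read (d a : ℕ)

inductive Test : Type
  | natLt (a b : ℕ)
  | realLt (a b : ℕ)

inductive Program : Type
  | skip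
  | nat (i : NatInstr)
  | real (i : RealInstr)
  | seq (p q : Program)
  | branch (c : Test) (p q : Program)
  | loop (c : Test) (p : Program)

/-- Both the read-only input and the working memory of a machine have this form. -/
structure Memory where
  nat : ℕ → ℕ
  real : ℕ → ℝ

def NatInstr.exec (inp mem : ℕ → ℕ) : NatInstr → ℕ → ℕ
  | .const d v => Function.update mem d v
  | .add d a b => Function.update mem d (mem a + mem b)
  | .sub d a b => Function.update mem d (mem a - mem b)
  | .load d a => Function.update mem d (mem (mem a))
  | .store a b => Function.update mem (mem a) (mem b)
  | .read d a => Function.update mem d (inp (mem a))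

noncomputable def RealInstr.exec (inp : ℕ → ℝ) (σ : Memory) : RealInstr → ℕ → ℝ
  | .const d v => Function.update σ.real d v
  | .add d a b => Function.update σ.real d (σ.real a + σ.real b)
  | .sub d a b => Function.update σ.real d (σ.real a - σ.real b)
  | .mul d a b => Function.update σ.real d (σ.real a * σ.real b)
  | .div d a b => Function.update σ.real d (σ.real a / σ.real b)
  | .load d a => Function.update σ.real d (σ.real (σ.nat a))
  | .store a b => Function.update σ.real (σ.nat a) (σ.real b)
  | .read d a => Function.update σ.real d (inp (σ.nat a))

def Test.Holds (σ : Memory) : Test → Prop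
  | .natLt a b => σ.nat a < σ.nat b
  | .realLt a b => σ.real a < σ.real b

/-- `Runs inp p σ σ' T`: on input `inp`, the program `p` started in memory `σ` halts
in memory `σ'` after exactly `T` steps. -/
inductive Runs (inp : Memory) : Program → Memory → Memory → ℕ → Prop
  | skip (σ : Memory) : Runs inp .skip σ σ 1
  | nat (i : NatInstr) (σ : Memory) :
      Runs inp (.nat i) σ ⟨i.exec inp.nat σ.nat, σ.real⟩ 1
  | real (i : RealInstr) (σ : Memory) :
      Runs inp (.real i) σ ⟨σ.nat, i.exec inp.real σ⟩ 1
  | seq {p q : Program} {σ₁ σ₂ σ₃ : Memory} {T₁ T₂ : ℕ} :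
      Runs inp p σ₁ σ₂ T₁ → Runs inp q σ₂ σ₃ T₂ → Runs inp (.seq p q) σ₁ σ₃ (T₁ + T₂)
  | branch_true {c : Test} {p q : Program} {σ₁ σ₂ : Memory} {T : ℕ} :
      c.Holds σ₁ → Runs inp p σ₁ σ₂ T → Runs inp (.branch c p q) σ₁ σ₂ (T + 1)
  | branch_false {c : Test} {p q : Program} {σ₁ σ₂ : Memory} {T : ℕ} :
      ¬ c.Holds σ₁ → Runs inp q σ₁ σ₂ T → Runs inp (.branch c p q) σ₁ σ₂ (T + 1)
  | loop_true {c : Test} {p : Program} {σ₁ σ₂ σ₃ : Memory} {T₁ T₂ : ℕ} :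
      c.Holds σ₁ → Runs inp p σ₁ σ₂ T₁ → Runs inp (.loop c p) σ₂ σ₃ T₂ →
      Runs inp (.loop c p) σ₁ σ₃ (T₁ + T₂ + 1)
  | loop_false {c : Test} {p : Program} {σ : Memory} :
      ¬ c.Holds σ → Runs inp (.loop c p) σ σ 1

/-- `p` on input `inp` halts after exactly `T` steps with output `y` (natural register `0`). -/
def Program.HaltsWith (p : Program) (inp : Memory) (T y : ℕ) : Prop :=
  ∃ σ : Memory, Runs inp p ⟨fun _ => 0, fun _ => 0⟩ σ T ∧ σ.nat 0 = y

/-- The program has no instruction and no test on real numbers. -/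
def Program.IsDiscrete : Program → Prop
  | .skip => True
  | .nat _ => True
  | .real _ => False
  | .seq p q => p.IsDiscrete ∧ q.IsDiscrete
  | .branch (.natLt _ _) p q => p.IsDiscrete ∧ q.IsDiscrete
  | .branch (.realLt _ _) _ _ => False
  | .loop (.natLt _ _) p => p.IsDiscrete
  | .loop (.realLt _ _) _ => False

/-! ### Encoding of instances -/

/-- Kind of gate and the qubits it acts on. -/
def Gate.natCode {N : ℕ} : Gate N → List ℕ
  | .H q => [0, q, 0]
  | .S q => [1, q, 0]
  | .CNOT a b _ => [2, a, b]
  | .phase q _ => [3, q, 0]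

/-- The entry `e^{iθ}` of a phase gate, by its real and imaginary parts. -/
noncomputable def Gate.realCode {N : ℕ} : Gate N → List ℝ
  | .phase _ θ => [Real.cos θ, Real.sin θ]
  | _ => [0, 0]

/-- The integer part of the input. -/
def Instance.natInput (I : Instance) : ℕ → ℕ :=
  fun j => ([I.n, I.m, I.s, (I.out : ℕ)] ++ I.gates.flatMap Gate.natCode).getD j 0

/-- The real part of the input. -/
noncomputable def Instance.realInput (I : Instance) (c δ : ℝ) : ℕ → ℝ :=
  fun j => ([c, δ] ++ I.gates.flatMap Gate.realCode).getD j 0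

end QCSAT

/-! Conjugation by a Clifford gate permutes the Paulis up to sign. Conjugation by a phase gate on
qubit `q` fixes the Paulis with `𝕀` or `Z` at `q` and sends any other `P` to a combination of `P`
and `P Z_q`. A phase gate therefore at most doubles the number of terms of `U† Z_out U`, but
enlarges the group that they generate by at most the single generator `Z_q` (`propSpan_phase_pos`).
This gives at most `2^t` terms and `b ≤ t + 1`.

Taking the matrix element in `|0^m⟩` removes the Paulis with `X` or `Y` on an ancilla and restricts
the others to the witness qubits. So the witness observable `W` is a combination of Paulis from a
group of rank `r ≤ b`. Ordered products of independent Paulis are linearly independent, and their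
multiplication table is determined by the commutation signs, since every factor squares to one.
Replacing the Paulis by independent ones with the same signs, here strings `X_i ∏ Z_j` on `b` qubits
(`modelPauli`), preserves all polynomial identities, hence the annihilating polynomials, the
spectrum (`spectrum_prodSum_eq`) and Hermiticity (`isHermitian_prodSum`). Because `|1⟩⟨1| = (1 -
Z)/2`, the least eigenvalue is `1 - 2 Val` (`Instance.isLeast_spectrum`).

The decision algorithm is exact: it decides `Val ≤ c`, that is, `W - (1 - 2c) ≥ 0`, with exact real
arithmetic, so neither `δ` nor the logarithm is needed for its time bound. It does not build the
small Hamiltonian. It tests the real quadratic form `Y ↦ tr (Y (W - (1 - 2c)) Y)` on real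
combinations `Y` of the Paulis of the group. This suffices: if `λ` is the least eigenvalue of `W`
and `f` is the minimal polynomial divided by `X - λ`, then `Y = f(W)` is such a combination,
nonzero, with `W Y = λ Y`, so the form at `Y` has the sign of `λ - (1 - 2c)`
(`formEntry_nonneg_iff`). The matrix of the form has size `2^b`, and symmetric Gaussian elimination
(`quadFrom_nonneg_iff`) takes about `2^(3b)` steps.

The number `b` is a rank over the field with two elements. The programs are written in a small loop
language whose compilation to the machine is verified once (`Cmd.ends`). Running times are bounded
by monomials `k L^l D^d` computed from the syntax (`Cmd.cost_le`), where `L` is linear in `n + s`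
and `D = 2^b`. The number of ancillas must not enter the bound, so the programs visit only columns
of qubits that occur in a gate code or as output, besides the witness qubits. -/

namespace QCSAT

/-! ### Pauli operators and their conjugation by gates -/

open Matrix

/-! ### Tensor products of one-qubit operators -/

/-- The tensor product of one-qubit operators. -/
def tens {N : ℕ} (A : Fin N → Matrix (ZMod 2) (ZMod 2) ℂ) : Op N :=
  Matrix.of fun v w => ∏ j, A j (v j) (w j)

theorem tens_mul {N : ℕ} (A B : Fin N → Matrix (ZMod 2) (ZMod 2) ℂ) :
    tens A * tens B = tens fun j => A j * B j := by
  ext v w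
  simp only [tens, Matrix.mul_apply, Matrix.of_apply, ← Finset.prod_mul_distrib]
  rw [Finset.prod_univ_sum, Fintype.piFinset_univ]

theorem tens_conjTranspose {N : ℕ} (A : Fin N → Matrix (ZMod 2) (ZMod 2) ℂ) :
    (tens A)ᴴ = tens fun j => (A j)ᴴ := by
  ext v w
  simp [tens, Matrix.conjTranspose_apply]

theorem tens_one {N : ℕ} : tens (fun _ : Fin N => 1) = 1 := by
  ext v w
  simp only [tens, Matrix.of_apply, Matrix.one_apply, Finset.prod_ite_zero, Finset.prod_const_one,
    Finset.mem_univ, true_imp_iff, funext_iff]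

theorem tens_smul {N : ℕ} (c : Fin N → ℂ) (A : Fin N → Matrix (ZMod 2) (ZMod 2) ℂ) :
    tens (fun j => c j • A j) = (∏ j, c j) • tens A := by
  ext v w
  simp [tens, Finset.prod_mul_distrib]

theorem tens_update_smul {N : ℕ} (q : Fin N) (c : ℂ) (A : Fin N → Matrix (ZMod 2) (ZMod 2) ℂ)
    (M : Matrix (ZMod 2) (ZMod 2) ℂ) :
    tens (Function.update A q (c • M)) = c • tens (Function.update A q M) := by
  have : Function.update A q (c • M) =
      fun j => (if j = q then c else 1) • Function.update A q M j := by
    funext j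
    by_cases h : j = q
    · subst h; simp
    · simp [h]
  rw [this, tens_smul]
  simp

theorem tens_update_add {N : ℕ} (q : Fin N) (A : Fin N → Matrix (ZMod 2) (ZMod 2) ℂ)
    (M M' : Matrix (ZMod 2) (ZMod 2) ℂ) :
    tens (Function.update A q (M + M')) =
      tens (Function.update A q M) + tens (Function.update A q M') := by
  ext v w
  simp only [tens, Matrix.of_apply, Matrix.add_apply]
  have key : ∀ M'' : Matrix (ZMod 2) (ZMod 2) ℂ, ∏ j, Function.update A q M'' j (v j) (w j) =
      M'' (v q) (w q) * ∏ j ∈ Finset.univ.erase q, A j (v j) (w j) := by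
    intro M''
    rw [← Finset.mul_prod_erase _ _ (Finset.mem_univ q)]
    congr 1
    · simp
    · refine Finset.prod_congr rfl fun j hj => ?_
      rw [Function.update_of_ne (Finset.ne_of_mem_erase hj)]
  rw [key, key, key, Matrix.add_apply, add_mul]

theorem trace_tens {N : ℕ} (A : Fin N → Matrix (ZMod 2) (ZMod 2) ℂ) :
    (tens A).trace = ∏ j, (A j).trace := by
  simp only [tens, Matrix.trace, Matrix.diag_apply, Matrix.of_apply]
  rw [Finset.prod_univ_sum, Fintype.piFinset_univ]

/-! ### One-qubit Pauli matrices -/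

theorem zmod_two_cases (x : ZMod 2) : x = 0 ∨ x = 1 := by
  revert x; decide

theorem sum_zmod_two {M : Type*} [AddCommMonoid M] (f : ZMod 2 → M) : ∑ a, f a = f 0 + f 1 :=
  Fin.sum_univ_two f

/-- The exponent of `i` in the product of the one-qubit Paulis with bits `x z` and `x' z'`. -/
def phaseExp (x z x' z' : ZMod 2) : ℕ :=
  x.val * z.val + x'.val * z'.val + 2 * (z.val * x'.val) + 3 * ((x + x').val * (z + z').val)

/-- The matrix with bits `x, z` is `i^(xz) X^x Z^z`. Moving `Z^z` past `X^x'` gives the sign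
`(-1)^(z x')`, which is the term with factor 2 in `phaseExp`. The factor 3 is `-1` modulo 4: the
phase of the resulting Pauli has to be divided out. -/
theorem pauliOne_mul (x z x' z' : ZMod 2) :
    pauliOne x z * pauliOne x' z' =
      Complex.I ^ phaseExp x z x' z' • pauliOne (x + x') (z + z') := by
  have h2 : (1 + 1 : ZMod 2) = 0 := by decide
  have e : (2 : ZMod 2) = 0 := by decide
  have v1 : ZMod.val (1 : ZMod 2) = 1 := by decide
  ext a b
  rw [Matrix.mul_apply, sum_zmod_two]
  rcases zmod_two_cases x with rfl | rfl <;> rcases zmod_two_cases z with rfl | rfl <;>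
  rcases zmod_two_cases x' with rfl | rfl <;> rcases zmod_two_cases z' with rfl | rfl <;>
  rcases zmod_two_cases a with rfl | rfl <;> rcases zmod_two_cases b with rfl | rfl <;>
  simp [pauliOne, phaseExp, h2, v1, pow_succ]

theorem pauliOne_conjTranspose (x z : ZMod 2) : (pauliOne x z)ᴴ = pauliOne x z := by
  have h2 : (1 + 1 : ZMod 2) = 0 := by decide
  have v1 : ZMod.val (1 : ZMod 2) = 1 := by decide
  ext a b
  rcases zmod_two_cases x with rfl | rfl <;> rcases zmod_two_cases z with rfl | rfl <;>
  rcases zmod_two_cases a with rfl | rfl <;> rcases zmod_two_cases b with rfl | rfl <;>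
  simp [pauliOne, h2, v1, Matrix.conjTranspose_apply]

theorem pauliOne_zero : pauliOne 0 0 = 1 := by
  ext a b
  simp [pauliOne, Matrix.one_apply]

theorem trace_pauliOne (x z : ZMod 2) :
    (pauliOne x z).trace = if x = 0 ∧ z = 0 then 2 else 0 := by
  have h2 : (1 + 1 : ZMod 2) = 0 := by decide
  have v1 : ZMod.val (1 : ZMod 2) = 1 := by decide
  rw [Matrix.trace, sum_zmod_two]
  rcases zmod_two_cases x with rfl | rfl <;> rcases zmod_two_cases z with rfl | rfl <;>
  simp [pauliOne, h2, v1]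
  norm_num

/-! ### Pauli operators -/

theorem Pauli.toOp_eq_tens {N : ℕ} (p : Pauli N) :
    p.toOp = tens fun j => pauliOne (p.1 j) (p.2 j) := rfl

theorem Pauli.toOp_mul {N : ℕ} (p q : Pauli N) :
    p.toOp * q.toOp =
      Complex.I ^ (∑ j, phaseExp (p.1 j) (p.2 j) (q.1 j) (q.2 j)) • (p + q).toOp := by
  rw [toOp_eq_tens, toOp_eq_tens, tens_mul, toOp_eq_tens]
  simp only [pauliOne_mul]
  rw [tens_smul, Finset.prod_pow_eq_pow_sum]
  rfl

theorem Pauli.toOp_conjTranspose {N : ℕ} (p : Pauli N) : p.toOpᴴ = p.toOp := by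
  rw [toOp_eq_tens, tens_conjTranspose]
  simp only [pauliOne_conjTranspose]

theorem Pauli.toOp_zero {N : ℕ} : (0 : Pauli N).toOp = 1 := by
  rw [toOp_eq_tens, ← tens_one]
  congr 1
  funext j
  exact pauliOne_zero

theorem Pauli.add_self {N : ℕ} (p : Pauli N) : p + p = 0 := by
  have h : ∀ x : ZMod 2, x + x = 0 := by decide
  ext j <;> exact h _

theorem phaseExp_self (x z : ZMod 2) : Complex.I ^ phaseExp x z x z = 1 := by
  rcases zmod_two_cases x with rfl | rfl <;> rcases zmod_two_cases z with rfl | rfl <;>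
  simp [phaseExp, ZMod.val_one, show (1 + 1 : ZMod 2) = 0 by decide]

theorem Pauli.toOp_mul_self {N : ℕ} (p : Pauli N) : p.toOp * p.toOp = 1 := by
  rw [toOp_mul, add_self, toOp_zero, ← Finset.prod_pow_eq_pow_sum]
  simp [phaseExp_self]

theorem Pauli.trace_toOp {N : ℕ} (p : Pauli N) : p.toOp.trace = if p = 0 then (2 : ℂ) ^ N else 0 := by
  rw [toOp_eq_tens, trace_tens]
  simp only [trace_pauliOne, Finset.prod_ite_zero, Finset.prod_const, Finset.card_univ,
    Fintype.card_fin]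
  congr 1
  rw [eq_iff_iff]
  constructor
  · intro h
    ext j
    · exact (h j (Finset.mem_univ _)).1
    · exact (h j (Finset.mem_univ _)).2
  · rintro rfl j -
    exact ⟨rfl, rfl⟩

theorem Pauli.trace_toOp_mul {N : ℕ} (p q : Pauli N) :
    (p.toOp * q.toOp).trace = if p = q then (2 : ℂ) ^ N else 0 := by
  by_cases h : p = q
  · subst h
    rw [toOp_mul_self, ← toOp_zero, trace_toOp]
    simp
  · have h' : p + q ≠ 0 := by
      intro h0
      apply h
      calc p = p + (q + q) := by rw [add_self, add_zero]
        _ = q := by rw [← add_assoc, h0, zero_add]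
    rw [toOp_mul, Matrix.trace_smul, trace_toOp]
    simp [h, h']

/-- Paulis are orthogonal for the trace form, so multiplying a vanishing combination by `p` and
taking the trace leaves `2^N` times the coefficient of `p`. -/
theorem Pauli.linearIndependent_toOp {N : ℕ} :
    LinearIndependent ℂ (fun p : Pauli N => p.toOp) := by
  rw [Fintype.linearIndependent_iff]
  intro g hg p
  have h := congrArg (fun M => (p.toOp * M).trace) hg
  simp only [Finset.mul_sum, Matrix.trace_sum, Matrix.mul_smul, Matrix.trace_smul,
    trace_toOp_mul, Matrix.mul_zero, Matrix.trace_zero] at h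
  simpa using h

/-- The symplectic form on Paulis, which is zero if and only if the operators commute. -/
def Pauli.symp {N : ℕ} (p q : Pauli N) : ZMod 2 := ∑ j, (p.1 j * q.2 j + p.2 j * q.1 j)

/-- The sign `(-1)^x`. -/
noncomputable def bitSign (x : ZMod 2) : ℂ := if x = 0 then 1 else -1

theorem bitSign_add (x y : ZMod 2) : bitSign (x + y) = bitSign x * bitSign y := by
  rcases zmod_two_cases x with rfl | rfl <;> rcases zmod_two_cases y with rfl | rfl <;>
  simp [bitSign, show (1 + 1 : ZMod 2) = 0 by decide]

theorem bitSign_sum {ι : Type*} (s : Finset ι) (f : ι → ZMod 2) :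
    bitSign (∑ i ∈ s, f i) = ∏ i ∈ s, bitSign (f i) := by
  classical
  induction s using Finset.induction_on with
  | empty => simp [bitSign]
  | insert i s hi ih => rw [Finset.sum_insert hi, Finset.prod_insert hi, bitSign_add, ih]

theorem phaseExp_comm (x z x' z' : ZMod 2) :
    Complex.I ^ phaseExp x z x' z' = bitSign (x * z' + z * x') * Complex.I ^ phaseExp x' z' x z := by
  rcases zmod_two_cases x with rfl | rfl <;> rcases zmod_two_cases z with rfl | rfl <;>
  rcases zmod_two_cases x' with rfl | rfl <;> rcases zmod_two_cases z' with rfl | rfl <;>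
  simp [phaseExp, bitSign, ZMod.val_one, pow_succ, show (1 + 1 : ZMod 2) = 0 by decide]

theorem Pauli.toOp_mul_comm {N : ℕ} (p q : Pauli N) :
    p.toOp * q.toOp = bitSign (p.symp q) • (q.toOp * p.toOp) := by
  rw [toOp_mul, toOp_mul, add_comm q p, smul_smul]
  congr 1
  rw [← Finset.prod_pow_eq_pow_sum, ← Finset.prod_pow_eq_pow_sum, symp, bitSign_sum,
    ← Finset.prod_mul_distrib]
  exact Finset.prod_congr rfl fun j _ => phaseExp_comm _ _ _ _

theorem Pauli.toOp_ne_zero {N : ℕ} (p : Pauli N) : p.toOp ≠ 0 := by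
  intro h
  have h1 := p.toOp_mul_self
  rw [h, Matrix.zero_mul] at h1
  exact zero_ne_one h1

/-- Two Paulis commute or anticommute. They cannot do both, since their product is a nonzero
multiple of a Pauli and hence nonzero. -/
theorem Pauli.commute_iff {N : ℕ} (p q : Pauli N) : Commute p.toOp q.toOp ↔ p.symp q = 0 := by
  constructor
  · intro h
    by_contra h0
    have h1 := toOp_mul_comm p q
    rw [← h.eq] at h1
    simp only [bitSign, h0, if_false, neg_smul, one_smul] at h1
    have h2 : p.toOp * q.toOp = 0 := by
      ext v w
      exact self_eq_neg.mp (congrFun (congrFun h1 v) w)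
    rw [toOp_mul] at h2
    rcases smul_eq_zero.mp h2 with h3 | h3
    · exact pow_ne_zero _ Complex.I_ne_zero h3
    · exact toOp_ne_zero _ h3
  · intro h
    have h1 := toOp_mul_comm p q
    rw [h] at h1
    simp only [bitSign, if_true, one_smul] at h1
    exact h1

/-! ### Gates -/

/-- The one-qubit operator `M` on qubit `q`. -/
def tensAt {N : ℕ} (q : Fin N) (M : Matrix (ZMod 2) (ZMod 2) ℂ) : Op N :=
  tens (Function.update (fun _ => 1) q M)

theorem tensAt_apply {N : ℕ} (q : Fin N) (M : Matrix (ZMod 2) (ZMod 2) ℂ) (v w : Bits N) :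
    tensAt q M v w = if ∀ j, j ≠ q → v j = w j then M (v q) (w q) else 0 := by
  simp only [tensAt, tens, Matrix.of_apply]
  rw [← Finset.mul_prod_erase _ _ (Finset.mem_univ q)]
  rw [Finset.prod_congr rfl (g := fun j => if v j = w j then (1 : ℂ) else 0)]
  · rw [Finset.prod_ite_zero]
    simp
  · intro j hj
    rw [Function.update_of_ne (Finset.ne_of_mem_erase hj), Matrix.one_apply]

theorem tensAt_conjTranspose {N : ℕ} (q : Fin N) (M : Matrix (ZMod 2) (ZMod 2) ℂ) :
    (tensAt q M)ᴴ = tensAt q Mᴴ := by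
  rw [tensAt, tens_conjTranspose, tensAt]
  congr 1
  funext j
  by_cases h : j = q
  · subst h; simp
  · simp [h]

theorem tensAt_mul {N : ℕ} (q : Fin N) (M M' : Matrix (ZMod 2) (ZMod 2) ℂ) :
    tensAt q M * tensAt q M' = tensAt q (M * M') := by
  rw [tensAt, tensAt, tens_mul, tensAt]
  congr 1
  funext j
  by_cases h : j = q
  · subst h; simp
  · simp [h]

theorem tensAt_one {N : ℕ} (q : Fin N) : tensAt q 1 = 1 := by
  rw [tensAt, ← tens_one]
  congr 1
  exact Function.update_eq_self q _

theorem tensAt_conj {N : ℕ} (q : Fin N) (M : Matrix (ZMod 2) (ZMod 2) ℂ) (p : Pauli N) :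
    (tensAt q M)ᴴ * p.toOp * tensAt q M =
      tens (Function.update (fun j => pauliOne (p.1 j) (p.2 j)) q
        (Mᴴ * pauliOne (p.1 q) (p.2 q) * M)) := by
  rw [tensAt_conjTranspose, tensAt, tensAt, Pauli.toOp_eq_tens, tens_mul, tens_mul]
  congr 1
  funext j
  by_cases h : j = q
  · subst h; simp
  · simp [h]

theorem tens_update_pauliOne {N : ℕ} (q : Fin N) (p : Pauli N) (x z : ZMod 2) :
    tens (Function.update (fun j => pauliOne (p.1 j) (p.2 j)) q (pauliOne x z)) =
      Pauli.toOp (Function.update p.1 q x, Function.update p.2 q z) := by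
  rw [Pauli.toOp_eq_tens]
  congr 1
  funext j
  by_cases h : j = q
  · subst h; simp
  · simp [h]

/-- The one-qubit Hadamard matrix. -/
noncomputable def hadOne : Matrix (ZMod 2) (ZMod 2) ℂ :=
  Matrix.of fun a b => (if a = 1 ∧ b = 1 then -1 else 1) / ((Real.sqrt 2 : ℝ) : ℂ)

/-- The one-qubit diagonal matrix with entries `1, e`. -/
noncomputable def diagOne (e : ℂ) : Matrix (ZMod 2) (ZMod 2) ℂ :=
  Matrix.diagonal fun a => if a = 1 then e else 1

theorem Gate.toOp_H {N : ℕ} (q : Fin N) : (Gate.H q).toOp = tensAt q hadOne := by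
  ext v w
  rw [tensAt_apply]
  rfl

theorem tensAt_diagOne {N : ℕ} (q : Fin N) (e : ℂ) :
    tensAt q (diagOne e) = Matrix.diagonal fun v : Bits N => if v q = 1 then e else 1 := by
  ext v w
  rw [tensAt_apply, diagOne, Matrix.diagonal_apply, Matrix.diagonal_apply]
  by_cases h : v = w
  · subst h; simp
  · rw [if_neg h]
    split_ifs with h1 h2
    · exfalso
      apply h
      funext j
      by_cases hj : j = q
      · rw [hj]; exact h2
      · exact h1 j hj
    · exfalso
      apply h
      funext j
      by_cases hj : j = q
      · rw [hj]; exact h2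
      · exact h1 j hj
    · rfl
    · rfl

theorem Gate.toOp_S {N : ℕ} (q : Fin N) : (Gate.S q).toOp = tensAt q (diagOne Complex.I) := by
  rw [tensAt_diagOne]; rfl

theorem Gate.toOp_phase {N : ℕ} (q : Fin N) (θ : ℝ) :
    (Gate.phase q θ).toOp = tensAt q (diagOne (Complex.exp ((θ : ℂ) * Complex.I))) := by
  rw [tensAt_diagOne]; rfl

theorem inv_sqrt_two_mul_self :
    (((Real.sqrt 2 : ℝ) : ℂ))⁻¹ * (((Real.sqrt 2 : ℝ) : ℂ))⁻¹ = 1 / 2 := by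
  rw [← mul_inv, ← Complex.ofReal_mul, Real.mul_self_sqrt (by norm_num)]
  norm_num

theorem hadOne_conj (x z : ZMod 2) :
    hadOneᴴ * pauliOne x z * hadOne = bitSign (x * z) • pauliOne z x := by
  have key := inv_sqrt_two_mul_self
  ext a b
  simp only [Matrix.mul_apply, sum_zmod_two, Matrix.conjTranspose_apply]
  rcases zmod_two_cases x with rfl | rfl <;> rcases zmod_two_cases z with rfl | rfl <;>
  rcases zmod_two_cases a with rfl | rfl <;> rcases zmod_two_cases b with rfl | rfl <;>
  simp [hadOne, pauliOne, bitSign, ZMod.val_one, show (1 + 1 : ZMod 2) = 0 by decide,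
    Complex.conj_ofReal, div_eq_mul_inv] <;>
  first
    | linear_combination 2 * key
    | linear_combination -2 * key
    | linear_combination 2 * Complex.I * key
    | linear_combination -2 * Complex.I * key

theorem hadOne_conj_self : hadOneᴴ * hadOne = 1 := by
  have h := hadOne_conj 0 0
  rw [pauliOne_zero, Matrix.mul_one] at h
  simpa [bitSign] using h

theorem diagOne_conj_zero {e : ℂ} (he : (starRingEnd ℂ) e * e = 1) (z : ZMod 2) :
    (diagOne e)ᴴ * pauliOne 0 z * diagOne e = pauliOne 0 z := by
  ext a b
  simp only [Matrix.mul_apply, sum_zmod_two, Matrix.conjTranspose_apply]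
  rcases zmod_two_cases z with rfl | rfl <;>
  rcases zmod_two_cases a with rfl | rfl <;> rcases zmod_two_cases b with rfl | rfl <;>
  simp [diagOne, pauliOne, ZMod.val_one, he]

theorem diagOne_conj_self {e : ℂ} (he : (starRingEnd ℂ) e * e = 1) :
    (diagOne e)ᴴ * diagOne e = 1 := by
  have h := diagOne_conj_zero he 0
  rwa [pauliOne_zero, Matrix.mul_one] at h

/-- Every nonzero entry of `X` or `Y` is off the diagonal and picks up either the diagonal entry or
its conjugate, exactly once. The identity is therefore linear in that entry and does not need
modulus one. With modulus one it is a rotation in the plane of `X` and `Y`. -/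
theorem diagOne_conj_one (c s : ℝ) (z : ZMod 2) :
    (diagOne (c + s * Complex.I))ᴴ * pauliOne 1 z * diagOne (c + s * Complex.I) =
      (c : ℂ) • pauliOne 1 z + (-bitSign z * s) • pauliOne 1 (z + 1) := by
  ext a b
  simp only [Matrix.mul_apply, sum_zmod_two, Matrix.conjTranspose_apply]
  rcases zmod_two_cases z with rfl | rfl <;>
  rcases zmod_two_cases a with rfl | rfl <;> rcases zmod_two_cases b with rfl | rfl <;>
  simp [diagOne, pauliOne, bitSign, ZMod.val_one, show (1 + 1 : ZMod 2) = 0 by decide] <;>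
  first
    | linear_combination (s : ℂ) * Complex.I_mul_I
    | linear_combination -(s : ℂ) * Complex.I_mul_I

theorem conj_exp_mul_exp (θ : ℝ) :
    (starRingEnd ℂ) (Complex.exp ((θ : ℂ) * Complex.I)) * Complex.exp ((θ : ℂ) * Complex.I) = 1 := by
  rw [← Complex.exp_conj, ← Complex.exp_add]
  simp

/-- The permutation of the basis states by a `CNOT` gate. -/
def cnotPerm {N : ℕ} (a b : Fin N) (w : Bits N) : Bits N := Function.update w b (w b + w a)

theorem zmod_two_add_cancel (x y : ZMod 2) : x + y + y = x := by
  revert x y; decide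

theorem cnotPerm_cnotPerm {N : ℕ} {a b : Fin N} (h : a ≠ b) (w : Bits N) :
    cnotPerm a b (cnotPerm a b w) = w := by
  funext j
  by_cases hj : j = b
  · subst hj
    simp [cnotPerm, h, zmod_two_add_cancel]
  · simp [cnotPerm, hj]

theorem cnot_conj_apply {N : ℕ} {a b : Fin N} (h : a ≠ b) (M : Op N) (v w : Bits N) :
    ((Gate.CNOT a b h).toOpᴴ * M * (Gate.CNOT a b h).toOp) v w =
      M (cnotPerm a b v) (cnotPerm a b w) := by
  have h1 : ∀ (M : Op N) v w, (M * (Gate.CNOT a b h).toOp) v w = M v (cnotPerm a b w) := by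
    intro M v w
    simp [Matrix.mul_apply, Gate.toOp, cnotPerm]
  have h2 : ∀ (M : Op N) v w, ((Gate.CNOT a b h).toOpᴴ * M) v w = M (cnotPerm a b v) w := by
    intro M v w
    simp [Matrix.mul_apply, Gate.toOp, cnotPerm, Matrix.conjTranspose_apply, apply_ite]
  rw [h1, h2]

theorem Gate.conjTranspose_mul_self {N : ℕ} (g : Gate N) : g.toOpᴴ * g.toOp = 1 := by
  cases g with
  | H q => rw [toOp_H, tensAt_conjTranspose, tensAt_mul, hadOne_conj_self, tensAt_one]
  | S q =>
    rw [toOp_S, tensAt_conjTranspose, tensAt_mul, diagOne_conj_self (by simp), tensAt_one]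
  | CNOT a b h =>
    ext v w
    have := cnot_conj_apply h 1 v w
    rw [Matrix.mul_one] at this
    rw [this, Matrix.one_apply, Matrix.one_apply]
    congr 1
    rw [eq_iff_iff]
    constructor
    · intro h1
      rw [← cnotPerm_cnotPerm h v, h1, cnotPerm_cnotPerm h]
    · rintro rfl; rfl
  | phase q θ =>
    rw [toOp_phase, tensAt_conjTranspose, tensAt_mul, diagOne_conj_self (conj_exp_mul_exp θ),
      tensAt_one]

/-! ### Conjugation of Paulis by gates -/

/-- The Pauli to which a Clifford gate `g` maps `P`, up to sign; phase gates are ignored. -/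
def Gate.act {N : ℕ} : Gate N → Pauli N → Pauli N
  | .H q, p => (Function.update p.1 q (p.2 q), Function.update p.2 q (p.1 q))
  | .S q, p => (p.1, Function.update p.2 q (p.2 q + p.1 q))
  | .CNOT a b _, p =>
      (Function.update p.1 b (p.1 b + p.1 a), Function.update p.2 a (p.2 a + p.2 b))
  | .phase _ _, p => p

/-- The bit of the sign in `g† P g` for a Clifford gate `g`. -/
def Gate.signBit {N : ℕ} : Gate N → Pauli N → ZMod 2
  | .H q, p => p.1 q * p.2 q
  | .S q, p => p.1 q * (p.2 q + 1)
  | .CNOT a b _, p => p.1 a * p.2 b * (p.1 b + p.2 a + 1)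
  | .phase _ _, _ => 0

/-- `H` and `CNOT` are involutions, and `S² = Z` changes Paulis only by a sign. One map thus
describes both the permutation of the Paulis and its inverse. -/
theorem Gate.act_act {N : ℕ} (g : Gate N) (p : Pauli N) : g.act (g.act p) = p := by
  cases g with
  | H q => ext j <;> by_cases hj : j = q <;> simp [act, hj]
  | S q => ext j <;> by_cases hj : j = q <;> simp [act, hj, zmod_two_add_cancel]
  | CNOT a b h =>
    ext j
    · by_cases hj : j = b <;> simp [act, hj, h, zmod_two_add_cancel]
    · by_cases hj : j = a <;> simp [act, hj, h.symm, zmod_two_add_cancel]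
  | phase q θ => rfl

/-- The two tensor factors that a `CNOT` touches have to be treated together: conjugation permutes
the matrix entries by a linear map of the pair of bits, and neither factor is transformed
separately. Where the entries do not vanish, what remains is a comparison of signs over all bit
values. -/
theorem pauliOne_cnot (xa za xb zb va wa vb wb : ZMod 2) :
    pauliOne xa za va wa * pauliOne xb zb (vb + va) (wb + wa) =
      bitSign (xa * zb * (xb + za + 1)) *
        (pauliOne xa (za + zb) va wa * pauliOne (xb + xa) zb vb wb) := by
  have e : (va = wa + xa ∧ vb + va = wb + wa + xb) ↔ (va = wa + xa ∧ vb = wb + (xb + xa)) := by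
    revert va wa xa vb wb xb; decide
  by_cases h1 : va = wa + xa
  · by_cases h2 : vb = wb + (xb + xa)
    · have h3 := (e.mpr ⟨h1, h2⟩).2
      simp only [pauliOne, Matrix.of_apply, if_pos h1, if_pos h2, if_pos h3]
      clear h3 h2 h1 e
      rcases zmod_two_cases xa with rfl | rfl <;> rcases zmod_two_cases za with rfl | rfl <;>
      rcases zmod_two_cases xb with rfl | rfl <;> rcases zmod_two_cases zb with rfl | rfl <;>
      rcases zmod_two_cases wa with rfl | rfl <;> rcases zmod_two_cases wb with rfl | rfl <;>
      simp [bitSign, ZMod.val_one, show (1 + 1 : ZMod 2) = 0 by decide]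
    · have h3 : ¬ vb + va = wb + wa + xb := fun h3 => h2 (e.mp ⟨h1, h3⟩).2
      simp [pauliOne, h2, h3]
  · simp [pauliOne, h1]

theorem Gate.conj_toOp {N : ℕ} (g : Gate N) (hg : g.isPhase = false) (p : Pauli N) :
    g.toOpᴴ * p.toOp * g.toOp = bitSign (g.signBit p) • (g.act p).toOp := by
  cases g with
  | H q => rw [toOp_H, tensAt_conj, hadOne_conj, tens_update_smul, tens_update_pauliOne]; rfl
  | S q =>
    have hI : (Complex.I : ℂ) = ((0 : ℝ) : ℂ) + ((1 : ℝ) : ℂ) * Complex.I := by simp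
    rw [toOp_S, tensAt_conj]
    rcases zmod_two_cases (p.1 q) with hx | hx
    · have h1 : Function.update p.1 q 0 = p.1 := by rw [← hx, Function.update_eq_self]
      rw [hx, diagOne_conj_zero (by simp), tens_update_pauliOne, h1]
      simp [signBit, hx, bitSign, act]
    · rw [hx, hI, diagOne_conj_one, Complex.ofReal_zero, zero_smul, zero_add, tens_update_smul,
        tens_update_pauliOne]
      congr 1
      · rcases zmod_two_cases (p.2 q) with hz | hz <;>
        simp [signBit, hx, hz, bitSign, show (1 + 1 : ZMod 2) = 0 by decide]
      · have h1 : Function.update p.1 q 1 = p.1 := by rw [← hx, Function.update_eq_self]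
        rw [h1]
        simp [act, hx]
  | CNOT a b h =>
    ext v w
    rw [cnot_conj_apply, Matrix.smul_apply]
    simp only [Pauli.toOp, Matrix.of_apply, smul_eq_mul]
    have hb : b ∈ Finset.univ.erase a := Finset.mem_erase.mpr ⟨h.symm, Finset.mem_univ _⟩
    rw [← Finset.mul_prod_erase _ _ (Finset.mem_univ a), ← Finset.mul_prod_erase _ _ hb,
      ← Finset.mul_prod_erase Finset.univ _ (Finset.mem_univ a),
      ← Finset.mul_prod_erase (Finset.univ.erase a) _ hb, ← mul_assoc, ← mul_assoc, ← mul_assoc]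
    congr 1
    · have := pauliOne_cnot (p.1 a) (p.2 a) (p.1 b) (p.2 b) (v a) (w a) (v b) (w b)
      simpa [cnotPerm, act, signBit, h, h.symm, mul_assoc] using this
    · refine Finset.prod_congr rfl fun j hj => ?_
      have h1 : j ≠ b := Finset.ne_of_mem_erase hj
      have h2 : j ≠ a := Finset.ne_of_mem_erase (Finset.mem_of_mem_erase hj)
      simp [cnotPerm, act, h1, h2]
  | phase q θ => simp [isPhase] at hg

theorem Gate.conj_phase_zero {N : ℕ} (q : Fin N) (θ : ℝ) (p : Pauli N) (hx : p.1 q = 0) :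
    (Gate.phase q θ).toOpᴴ * p.toOp * (Gate.phase q θ).toOp = p.toOp := by
  rw [toOp_phase, tensAt_conj, hx, diagOne_conj_zero (conj_exp_mul_exp θ), tens_update_pauliOne]
  simp [← hx]

theorem Gate.conj_phase_one {N : ℕ} (q : Fin N) (θ : ℝ) (p : Pauli N) (hx : p.1 q = 1) :
    (Gate.phase q θ).toOpᴴ * p.toOp * (Gate.phase q θ).toOp =
      ((Real.cos θ : ℝ) : ℂ) • p.toOp +
        (-bitSign (p.2 q) * (Real.sin θ : ℝ)) • (p + Pauli.Z q).toOp := by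
  rw [toOp_phase, tensAt_conj, hx, Complex.exp_mul_I, ← Complex.ofReal_cos, ← Complex.ofReal_sin,
    diagOne_conj_one, tens_update_add, tens_update_smul, tens_update_smul, tens_update_pauliOne,
    tens_update_pauliOne]
  have h1 : (Function.update p.1 q 1, Function.update p.2 q (p.2 q)) = p := by simp [← hx]
  have h2 : (Function.update p.1 q 1, Function.update p.2 q (p.2 q + 1)) = p + Pauli.Z q := by
    ext j <;> by_cases hj : j = q
    · subst hj; simp [Pauli.Z, hx]
    · simp [Pauli.Z, hj]
    · subst hj; simp [Pauli.Z]
    · simp [Pauli.Z, hj]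
  rw [h1, h2]

end QCSAT

/-! ### Evolution of the observable and growth of the group of propagated Paulis -/

namespace QCSAT

open Matrix

/-! ### Evolution of Pauli coefficients -/

/-- The real sign `(-1)^x`. -/
noncomputable def realSign (x : ZMod 2) : ℝ := if x = 0 then 1 else -1

theorem ofReal_realSign (x : ZMod 2) : ((realSign x : ℝ) : ℂ) = bitSign x := by
  unfold realSign bitSign
  split_ifs <;> simp

/-- The operator with Pauli coefficients `a`. -/
noncomputable def pauliSum {N : ℕ} (a : Pauli N → ℝ) : Op N := ∑ p, ((a p : ℝ) : ℂ) • p.toOp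

/-- The Pauli coefficients of `g† O g`, for those of `O`. -/
noncomputable def Gate.evolve {N : ℕ} : Gate N → (Pauli N → ℝ) → Pauli N → ℝ
  | .phase q θ, a, p =>
      if p.1 q = 0 then a p
      else Real.cos θ * a p + realSign (p.2 q) * Real.sin θ * a (p + Pauli.Z q)
  | g, a, p => realSign (g.signBit (g.act p)) * a (g.act p)

theorem Gate.evolve_of_not_isPhase {N : ℕ} (g : Gate N) (hg : g.isPhase = false) (a : Pauli N → ℝ)
    (p : Pauli N) : g.evolve a p = realSign (g.signBit (g.act p)) * a (g.act p) := by
  cases g with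
  | phase q θ => simp [isPhase] at hg
  | _ => rfl

/-- The Clifford action as a permutation of the Paulis. -/
def Gate.actEquiv {N : ℕ} (g : Gate N) : Pauli N ≃ Pauli N where
  toFun := g.act
  invFun := g.act
  left_inv := g.act_act
  right_inv := g.act_act

/-- Multiplication by the Pauli `q`, up to phase, as a permutation of the Paulis. -/
def Pauli.addEquiv {N : ℕ} (q : Pauli N) : Pauli N ≃ Pauli N where
  toFun p := p + q
  invFun p := p + q
  left_inv p := by simp [add_assoc, Pauli.add_self]
  right_inv p := by simp [add_assoc, Pauli.add_self]

theorem Pauli.add_Z_fst {N : ℕ} (p : Pauli N) (q : Fin N) : (p + Pauli.Z q).1 = p.1 := by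
  simp [Pauli.Z]

theorem Pauli.add_Z_snd {N : ℕ} (p : Pauli N) (q : Fin N) : (p + Pauli.Z q).2 q = p.2 q + 1 := by
  simp [Pauli.Z]

theorem realSign_add_one (x : ZMod 2) : realSign (x + 1) = -realSign x := by
  rcases zmod_two_cases x with rfl | rfl <;> simp [realSign, show (1 + 1 : ZMod 2) = 0 by decide]

/-- `Gate.evolve` gives the coefficient of each resulting Pauli, whereas the conjugation rules give
the image of each original one. The proof reindexes the sum by the permutation that relates the two.
-/
theorem Gate.conj_pauliSum {N : ℕ} (g : Gate N) (a : Pauli N → ℝ) :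
    g.toOpᴴ * pauliSum a * g.toOp = pauliSum (g.evolve a) := by
  have hsum : g.toOpᴴ * pauliSum a * g.toOp =
      ∑ p, ((a p : ℝ) : ℂ) • (g.toOpᴴ * p.toOp * g.toOp) := by
    simp [pauliSum, Finset.mul_sum, Finset.sum_mul]
  rw [hsum, pauliSum]
  by_cases hg : g.isPhase = false
  · rw [← Equiv.sum_comp g.actEquiv fun p => (((g.evolve a p : ℝ)) : ℂ) • p.toOp]
    refine Finset.sum_congr rfl fun p _ => ?_
    rw [g.conj_toOp hg, g.evolve_of_not_isPhase hg]
    simp only [actEquiv, Equiv.coe_fn_mk, act_act, Complex.ofReal_mul, ofReal_realSign, smul_smul,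
      mul_comm]
  · cases g with
    | phase q θ =>
      have h1 : ∀ p : Pauli N, ((a p : ℝ) : ℂ) • ((phase q θ).toOpᴴ * p.toOp * (phase q θ).toOp) =
          (((if p.1 q = 0 then a p else Real.cos θ * a p : ℝ)) : ℂ) • p.toOp +
          (((if p.1 q = 0 then 0 else -realSign (p.2 q) * Real.sin θ * a p : ℝ)) : ℂ) •
            (p + Pauli.Z q).toOp := by
        intro p
        rcases zmod_two_cases (p.1 q) with hx | hx
        · rw [conj_phase_zero q θ p hx]; simp [hx]
        · rw [conj_phase_one q θ p hx, smul_add, smul_smul, smul_smul, ← ofReal_realSign]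
          simp only [hx, one_ne_zero, if_false]
          push_cast
          congr 2 <;> ring
      have h2 : ∀ p : Pauli N, (((phase q θ).evolve a p : ℝ) : ℂ) • p.toOp =
          (((if p.1 q = 0 then a p else Real.cos θ * a p : ℝ)) : ℂ) • p.toOp +
          (((if p.1 q = 0 then 0 else
            realSign (p.2 q) * Real.sin θ * a (p + Pauli.Z q) : ℝ)) : ℂ) • p.toOp := by
        intro p
        rw [← add_smul, ← Complex.ofReal_add]
        congr 2
        simp only [evolve]
        split_ifs <;> simp
      rw [Finset.sum_congr rfl fun p _ => h1 p, Finset.sum_congr rfl fun p _ => h2 p,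
        Finset.sum_add_distrib, Finset.sum_add_distrib]
      congr 1
      -- The second term of the image of `p` contributes to `p + Z_q`. This shift flips the `Z` bit
      -- at `q`, which turns the factor `-(-1)^z` of the conjugation rule into the factor `(-1)^z`
      -- of `evolve`.
      rw [← Equiv.sum_comp (Pauli.addEquiv (Pauli.Z q)) fun p =>
        (((if p.1 q = 0 then 0 else
            realSign (p.2 q) * Real.sin θ * a (p + Pauli.Z q) : ℝ)) : ℂ) • p.toOp]
      refine Finset.sum_congr rfl fun p _ => ?_
      simp only [Pauli.addEquiv, Equiv.coe_fn_mk, Pauli.add_Z_fst, Pauli.add_Z_snd,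
        realSign_add_one, add_assoc, Pauli.add_self, add_zero]
    | _ => simp [isPhase] at hg

/-- The Paulis obtained from `Z_o` by propagation through a list of gates, last gate first. -/
def propagated {N : ℕ} (gs : List (Gate N)) (o : Fin N) : Set (Pauli N) :=
  gs.foldr Gate.propagate {Pauli.Z o}

/-- The Pauli coefficients of `U† Z_o U`. -/
noncomputable def coeffs {N : ℕ} (gs : List (Gate N)) (o : Fin N) : Pauli N → ℝ :=
  gs.foldr Gate.evolve (Pi.single (Pauli.Z o) 1)

theorem circuitOp_cons {N : ℕ} (g : Gate N) (gs : List (Gate N)) :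
    circuitOp (g :: gs) = circuitOp gs * g.toOp := by
  have h : ∀ (gs : List (Gate N)) (U : Op N),
      gs.foldl (fun U g => g.toOp * U) U = gs.foldl (fun U g => g.toOp * U) 1 * U := by
    intro gs
    induction gs with
    | nil => simp
    | cons g gs ih =>
      intro U
      rw [List.foldl_cons, ih, List.foldl_cons, ih (g.toOp * 1), Matrix.mul_one, Matrix.mul_assoc]
  rw [circuitOp, List.foldl_cons, h, Matrix.mul_one]
  rfl

theorem circuitOp_conj_Z {N : ℕ} (gs : List (Gate N)) (o : Fin N) :
    (circuitOp gs)ᴴ * (Pauli.Z o).toOp * circuitOp gs = pauliSum (coeffs gs o) := by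
  induction gs with
  | nil =>
    simp only [circuitOp, List.foldl_nil, conjTranspose_one, Matrix.one_mul, Matrix.mul_one,
      coeffs, List.foldr_nil, pauliSum]
    rw [Finset.sum_eq_single (Pauli.Z o)]
    · simp
    · intro p _ hp; simp [hp]
    · simp
  | cons g gs ih =>
    rw [circuitOp_cons, conjTranspose_mul]
    calc _ = g.toOpᴴ * ((circuitOp gs)ᴴ * (Pauli.Z o).toOp * circuitOp gs) * g.toOp := by
          simp only [Matrix.mul_assoc]
      _ = _ := by rw [ih, Gate.conj_pauliSum]; rfl

theorem circuitOp_conj_self {N : ℕ} (gs : List (Gate N)) :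
    (circuitOp gs)ᴴ * circuitOp gs = 1 := by
  induction gs with
  | nil => simp [circuitOp]
  | cons g gs ih =>
    rw [circuitOp_cons, conjTranspose_mul]
    calc _ = g.toOpᴴ * ((circuitOp gs)ᴴ * circuitOp gs) * g.toOp := by
          simp only [Matrix.mul_assoc]
      _ = 1 := by rw [ih, Matrix.mul_one, g.conjTranspose_mul_self]

theorem Gate.propagate_of_not_isPhase {N : ℕ} (g : Gate N) (hg : g.isPhase = false)
    (T : Set (Pauli N)) : g.propagate T = g.act '' T := by
  cases g with
  | phase q θ => simp [isPhase] at hg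
  | _ => rfl

theorem Gate.evolve_support {N : ℕ} (g : Gate N) {a : Pauli N → ℝ} {T : Set (Pauli N)}
    (h : ∀ p, a p ≠ 0 → p ∈ T) (p : Pauli N) (hp : g.evolve a p ≠ 0) : p ∈ g.propagate T := by
  by_cases hg : g.isPhase = false
  · rw [g.evolve_of_not_isPhase hg] at hp
    rw [g.propagate_of_not_isPhase hg]
    exact ⟨g.act p, h _ (right_ne_zero_of_mul hp), g.act_act p⟩
  · cases g with
    | phase q θ =>
      by_cases ha : a p = 0
      · right
        simp only [evolve, ha, mul_zero, zero_add] at hp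
        split_ifs at hp with hx
        · exact absurd rfl hp
        · refine ⟨p + Pauli.Z q, h _ (right_ne_zero_of_mul hp), ?_, ?_⟩
          · rw [Pauli.add_Z_fst]
            exact (zmod_two_cases _).resolve_left hx
          · rw [add_assoc, Pauli.add_self, add_zero]
      · exact Or.inl (h p ha)
    | _ => simp [isPhase] at hg

theorem coeffs_support {N : ℕ} (gs : List (Gate N)) (o : Fin N) (p : Pauli N)
    (hp : coeffs gs o p ≠ 0) : p ∈ propagated gs o := by
  induction gs generalizing p with
  | nil =>
    by_contra h
    apply hp
    simp only [propagated, List.foldr_nil, Set.mem_singleton_iff] at h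
    simp [coeffs, h]
  | cons g gs ih => exact g.evolve_support ih p hp

/-- A Clifford gate maps the set onto its image, and a phase gate adds at most the translate of the
set by `Z_q`. -/
theorem ncard_propagated_le {N : ℕ} (gs : List (Gate N)) (o : Fin N) :
    (propagated gs o).ncard ≤ 2 ^ gs.countP Gate.isPhase := by
  induction gs with
  | nil => simp [propagated]
  | cons g gs ih =>
    by_cases hg : g.isPhase = false
    · rw [List.countP_cons_of_neg (by simp [hg])]
      change (g.propagate (propagated gs o)).ncard ≤ _
      rw [g.propagate_of_not_isPhase hg]
      exact (Set.ncard_image_le).trans ih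
    · rw [List.countP_cons_of_pos (by simpa using hg)]
      cases g with
      | phase q θ =>
        have hsub : propagated (Gate.phase q θ :: gs) o ⊆
            propagated gs o ∪ (fun p => p + Pauli.Z q) '' propagated gs o := by
          apply Set.union_subset_union_right
          rintro p' ⟨p, hp, -, rfl⟩
          exact ⟨p, hp, rfl⟩
        calc _ ≤ _ := Set.ncard_le_ncard hsub (Set.toFinite _)
          _ ≤ _ := Set.ncard_union_le _ _
          _ ≤ (propagated gs o).ncard + (propagated gs o).ncard :=
            Nat.add_le_add_left Set.ncard_image_le _
          _ ≤ _ := by rw [pow_succ]; omega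
      | _ => simp [Gate.isPhase] at hg

/-! ### The span of the propagated Paulis -/

/-- The group generated by the propagated Paulis. -/
def propSpan {N : ℕ} (gs : List (Gate N)) (o : Fin N) : Submodule (ZMod 2) (Pauli N) :=
  Submodule.span (ZMod 2) (propagated gs o)

/-- The Clifford action as a linear map. -/
def Gate.actLin {N : ℕ} (g : Gate N) : Pauli N ≃ₗ[ZMod 2] Pauli N where
  toFun := g.act
  invFun := g.act
  left_inv := g.act_act
  right_inv := g.act_act
  map_add' p p' := by
    cases g with
    | H q => ext j <;> by_cases hj : j = q <;> simp [act, hj]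
    | S q =>
      ext j <;> by_cases hj : j = q <;> simp [act, hj]
      ring
    | CNOT a b h =>
      ext j
      · by_cases hj : j = b <;> simp [act, hj]
        ring
      · by_cases hj : j = a <;> simp [act, hj]
        ring
    | phase q θ => rfl
  map_smul' c p := by
    cases g with
    | H q => ext j <;> by_cases hj : j = q <;> simp [act, hj]
    | S q => ext j <;> by_cases hj : j = q <;> simp [act, hj, mul_add]
    | CNOT a b h =>
      ext j
      · by_cases hj : j = b <;> simp [act, hj, mul_add]
      · by_cases hj : j = a <;> simp [act, hj, mul_add]
    | phase q θ => rfl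

theorem propSpan_cons {N : ℕ} (g : Gate N) (hg : g.isPhase = false) (gs : List (Gate N))
    (o : Fin N) : propSpan (g :: gs) o = (propSpan gs o).map g.actLin.toLinearMap := by
  rw [propSpan, propSpan, Submodule.map_span]
  congr 1
  exact g.propagate_of_not_isPhase hg _

/-- The `X` bit at `q` is a linear functional, so it vanishes on a span as soon as it vanishes on
generators. Consequently any generating set shows whether a phase gate has an effect; the
exponentially large set of propagated Paulis is not needed. -/
theorem exists_fst_ne_zero_iff {N : ℕ} (T : Set (Pauli N)) (q : Fin N) :
    (∃ p ∈ Submodule.span (ZMod 2) T, p.1 q = 1) ↔ ∃ p ∈ T, p.1 q = 1 := by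
  constructor
  · rintro ⟨p, hp, hpq⟩
    by_contra h
    push Not at h
    have h0 : ∀ p ∈ Submodule.span (ZMod 2) T, p.1 q = 0 := by
      intro p hp
      induction hp using Submodule.span_induction with
      | mem x hx => exact (zmod_two_cases _).resolve_right (h x hx)
      | zero => rfl
      | add x y _ _ hx hy => simp [hx, hy]
      | smul a x _ hx => simp [hx]
    rw [h0 p hp] at hpq
    exact zero_ne_one hpq
  · rintro ⟨p, hp, h⟩
    exact ⟨p, Submodule.subset_span hp, h⟩

/-- The gate keeps some `P` and adds `P Z_q`, and their product is `Z_q`. Every other new Pauli is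
an old one times the same `Z_q`. This is why a phase gate costs at most one dimension although it
may double the set. -/
theorem propSpan_phase_pos {N : ℕ} (q : Fin N) (θ : ℝ) (gs : List (Gate N)) (o : Fin N)
    (h : ∃ p ∈ propSpan gs o, p.1 q = 1) :
    propSpan (Gate.phase q θ :: gs) o =
      propSpan gs o ⊔ Submodule.span (ZMod 2) {Pauli.Z q} := by
  obtain ⟨p, hp, hpq⟩ := (exists_fst_ne_zero_iff _ q).mp h
  apply le_antisymm
  · refine Submodule.span_le.mpr ?_
    rintro p' (hp' | ⟨p, hp, -, rfl⟩)
    · exact Submodule.mem_sup_left (Submodule.subset_span hp')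
    · exact Submodule.add_mem_sup (Submodule.subset_span hp) (Submodule.subset_span rfl)
  · refine sup_le (Submodule.span_mono Set.subset_union_left) ?_
    rw [Submodule.span_singleton_le_iff_mem]
    have h1 : p ∈ propSpan (Gate.phase q θ :: gs) o := Submodule.subset_span (Or.inl hp)
    have h2 : p + Pauli.Z q ∈ propSpan (Gate.phase q θ :: gs) o :=
      Submodule.subset_span (Or.inr ⟨p, hp, hpq, rfl⟩)
    have h3 := Submodule.add_mem _ h1 h2
    rwa [← add_assoc, Pauli.add_self, zero_add] at h3

theorem propSpan_phase_neg {N : ℕ} (q : Fin N) (θ : ℝ) (gs : List (Gate N)) (o : Fin N)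
    (h : ¬ ∃ p ∈ propSpan gs o, p.1 q = 1) :
    propSpan (Gate.phase q θ :: gs) o = propSpan gs o := by
  have h' : ¬ ∃ p ∈ propagated gs o, p.1 q = 1 := fun h' => h ((exists_fst_ne_zero_iff _ q).mpr h')
  push Not at h'
  rw [propSpan, propSpan]
  congr 1
  apply Set.union_eq_left.mpr
  rintro p' ⟨p, hp, hpq, -⟩
  exact absurd hpq (h' p hp)

theorem finrank_propSpan_cons_le {N : ℕ} (g : Gate N) (gs : List (Gate N)) (o : Fin N) :
    Module.finrank (ZMod 2) (propSpan gs o) ≤ Module.finrank (ZMod 2) (propSpan (g :: gs) o) := by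
  by_cases hg : g.isPhase = false
  · rw [propSpan_cons g hg]
    exact (LinearEquiv.finrank_map_eq g.actLin _).ge
  · cases g with
    | phase q θ => exact Submodule.finrank_mono (Submodule.span_mono Set.subset_union_left)
    | _ => simp [Gate.isPhase] at hg

/-- Propagation starts at the end of the list, so suffixes of the circuit are the intermediate
stages. Their ranks never exceed the final one, and hence all intermediate tables of the algorithm
fit into `2^b` rows. -/
theorem finrank_propSpan_append_le {N : ℕ} (gs gs' : List (Gate N)) (o : Fin N) :
    Module.finrank (ZMod 2) (propSpan gs' o) ≤
      Module.finrank (ZMod 2) (propSpan (gs ++ gs') o) := by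
  induction gs with
  | nil => exact le_rfl
  | cons g gs ih => exact ih.trans (finrank_propSpan_cons_le g _ o)

theorem finrank_propSpan_le {N : ℕ} (gs : List (Gate N)) (o : Fin N) :
    Module.finrank (ZMod 2) (propSpan gs o) ≤ gs.countP Gate.isPhase + 1 := by
  induction gs with
  | nil =>
    simp only [propSpan, propagated, List.foldr_nil, List.countP_nil, zero_add]
    exact (finrank_span_le_card _).trans (by simp)
  | cons g gs ih =>
    by_cases hg : g.isPhase = false
    · rw [propSpan_cons g hg, List.countP_cons_of_neg (by simp [hg])]
      exact (LinearEquiv.finrank_map_eq g.actLin _).le.trans ih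
    · rw [List.countP_cons_of_pos (by simpa using hg)]
      cases g with
      | phase q θ =>
        by_cases h : ∃ p ∈ propSpan gs o, p.1 q = 1
        · rw [propSpan_phase_pos q θ gs o h]
          calc _ ≤ _ := Submodule.finrank_add_le_finrank_add_finrank _ _
            _ ≤ _ := Nat.add_le_add ih ((finrank_span_le_card _).trans (by simp))
        · rw [propSpan_phase_neg q θ gs o h]
          omega
      | _ => simp [Gate.isPhase] at hg

end QCSAT

/-! ### Algebras generated by independent Paulis, and the small Hamiltonian -/

namespace QCSAT

open Matrix

/-! ### Products of independent Paulis -/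

/-- The product of the Paulis `B k`, `k ∈ S`, up to phase. -/
def subsetSum {r N : ℕ} (B : Fin r → Pauli N) (S : Finset (Fin r)) : Pauli N := ∑ k ∈ S, B k

theorem exists_pauliProd_eq {r N : ℕ} (B : Fin r → Pauli N) (S : Finset (Fin r)) :
    ∃ ζ : ℂ, ζ ≠ 0 ∧ pauliProd B S = ζ • (subsetSum B S).toOp := by
  have key : ∀ l : List (Fin r), ∃ ζ : ℂ, ζ ≠ 0 ∧
      (l.map fun k => if k ∈ S then (B k).toOp else 1).prod =
        ζ • Pauli.toOp (l.map fun k => if k ∈ S then B k else 0).sum := by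
    intro l
    induction l with
    | nil => exact ⟨1, one_ne_zero, by simp [Pauli.toOp_zero]⟩
    | cons k l ih =>
      obtain ⟨ζ, h0, h⟩ := ih
      by_cases hk : k ∈ S
      · rw [List.map_cons, List.prod_cons, h, List.map_cons, List.sum_cons, if_pos hk, if_pos hk,
          Matrix.mul_smul, Pauli.toOp_mul, smul_smul]
        exact ⟨_, mul_ne_zero h0 (pow_ne_zero _ Complex.I_ne_zero), rfl⟩
      · refine ⟨ζ, h0, ?_⟩
        rw [List.map_cons, List.prod_cons, h, List.map_cons, List.sum_cons, if_neg hk, if_neg hk,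
          one_mul, zero_add]
  obtain ⟨ζ, h0, h⟩ := key (List.finRange r)
  refine ⟨ζ, h0, ?_⟩
  rw [pauliProd, h]
  congr 2
  have h1 := (Fin.sum_univ_def fun k => if k ∈ S then B k else 0).symm
  rw [h1, subsetSum, Finset.sum_ite_mem, Finset.univ_inter]

theorem subsetSum_eq {r N : ℕ} (B : Fin r → Pauli N) (S : Finset (Fin r)) :
    subsetSum B S = ∑ k, (if k ∈ S then (1 : ZMod 2) else 0) • B k := by
  simp [subsetSum]

theorem subsetSum_injective {r N : ℕ} {B : Fin r → Pauli N} (hB : LinearIndependent (ZMod 2) B) :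
    Function.Injective (subsetSum B) := by
  intro S S' h
  rw [subsetSum_eq, subsetSum_eq] at h
  have h1 := Fintype.linearIndependent_iff.mp hB
    (fun k => (if k ∈ S then (1 : ZMod 2) else 0) - if k ∈ S' then (1 : ZMod 2) else 0)
    (by simp only [sub_smul, Finset.sum_sub_distrib, h, sub_self])
  ext k
  have h2 := h1 k
  by_cases hk : k ∈ S <;> by_cases hk' : k ∈ S' <;> simp_all

theorem exists_subsetSum_eq {r N : ℕ} {B : Fin r → Pauli N} {p : Pauli N}
    (hp : p ∈ Submodule.span (ZMod 2) (Set.range B)) : ∃ S, subsetSum B S = p := by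
  obtain ⟨c, hc⟩ := (Submodule.mem_span_range_iff_exists_fun _).mp hp
  refine ⟨Finset.univ.filter fun k => c k = 1, ?_⟩
  rw [subsetSum_eq, ← hc]
  refine Finset.sum_congr rfl fun k _ => ?_
  congr 1
  rcases zmod_two_cases (c k) with h | h <;> simp [h]

/-- Independence makes the map from subsets to Paulis injective, and its image contains the support
of `a`. Each coefficient is carried over after division by the phase that separates the ordered
product from the Pauli. -/
theorem pauliSum_eq_sum_pauliProd {r N : ℕ} {B : Fin r → Pauli N}
    (hB : LinearIndependent (ZMod 2) B) {a : Pauli N → ℝ}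
    (ha : ∀ p, a p ≠ 0 → p ∈ Submodule.span (ZMod 2) (Set.range B)) :
    ∃ α : Finset (Fin r) → ℂ, {S | α S ≠ 0}.ncard ≤ {p | a p ≠ 0}.ncard ∧
      pauliSum a = ∑ S, α S • pauliProd B S := by
  choose ζ h0 hζ using exists_pauliProd_eq B
  refine ⟨fun S => (a (subsetSum B S) : ℂ) * (ζ S)⁻¹, ?_, ?_⟩
  · refine Set.ncard_le_ncard_of_injOn (subsetSum B) ?_ (subsetSum_injective hB).injOn
      (Set.toFinite _)
    intro S hS
    simpa using left_ne_zero_of_mul hS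
  · symm
    rw [pauliSum]
    refine Fintype.sum_of_injective (subsetSum B) (subsetSum_injective hB) _ _ ?_ ?_
    · intro p hp
      have : a p = 0 := by
        by_contra h
        exact hp (exists_subsetSum_eq (ha p h))
      simp [this]
    · intro S
      simp only [hζ, smul_smul, mul_assoc, inv_mul_cancel₀ (h0 S), mul_one]

theorem linearIndependent_pauliProd {r N : ℕ} {B : Fin r → Pauli N}
    (hB : LinearIndependent (ZMod 2) B) : LinearIndependent ℂ (pauliProd B) := by
  choose ζ h0 hζ using exists_pauliProd_eq B
  have h1 := (Pauli.linearIndependent_toOp (N := N)).comp _ (subsetSum_injective hB)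
  have h2 := h1.units_smul fun S => Units.mk0 (ζ S) (h0 S)
  have h3 : pauliProd B = (fun S => Units.mk0 (ζ S) (h0 S)) •
      ((fun p : Pauli N => p.toOp) ∘ subsetSum B) := by
    funext S
    rw [hζ]
    rfl
  rw [h3]
  exact h2

theorem exists_basis_of_submodule {N : ℕ} (V : Submodule (ZMod 2) (Pauli N)) :
    ∃ B : Fin (Module.finrank (ZMod 2) V) → Pauli N, LinearIndependent (ZMod 2) B ∧
      Submodule.span (ZMod 2) (Set.range B) = V := by
  let β := Module.finBasis (ZMod 2) V
  refine ⟨fun k => β k, ?_, ?_⟩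
  · exact β.linearIndependent.map' V.subtype V.ker_subtype
  · have h := congrArg (Submodule.map V.subtype) β.span_eq
    rw [Submodule.map_span, Submodule.map_top, Submodule.range_subtype, ← Set.range_comp] at h
    exact h

/-! ### Operators with prescribed commutation relations -/

/-- The sign that arises when `Q_k` is moved into the product over the list `l` of the factors
in `S`. -/
noncomputable def pushSign {r : ℕ} (ω : Fin r → Fin r → ℂ) (k : Fin r) (S : Finset (Fin r)) :
    List (Fin r) → ℂ
  | [] => 1
  | h :: t => if h = k then 1 else (if h ∈ S then ω k h else 1) * pushSign ω k S t

/-- `Q k` moves to the right past the factors that precede position `k` and collects their signs. At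
its own position it cancels or inserts a factor, because it squares to one. If `k` does not occur in
the list, it comes out at the right end, which is the last factor of the conclusion and makes the
induction work. The sign depends on `ω` only, not on the operators. -/
theorem push_mul {r : ℕ} {A : Type*} [Ring A] [Algebra ℂ A] {ω : Fin r → Fin r → ℂ}
    {Q : Fin r → A} (hω : ∀ i j, i ≠ j → Q i * Q j = ω i j • (Q j * Q i)) (hQ : ∀ i, Q i * Q i = 1)
    (k : Fin r) (S : Finset (Fin r)) (l : List (Fin r)) (hl : l.Nodup) :
    Q k * (l.map fun j => if j ∈ S then Q j else 1).prod =
      pushSign ω k S l • ((l.map fun j => if j ∈ symmDiff S {k} then Q j else 1).prod *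
        if k ∈ l then 1 else Q k) := by
  induction l with
  | nil => simp [pushSign]
  | cons h t ih =>
    rw [List.nodup_cons] at hl
    have ih := ih hl.2
    rw [List.map_cons, List.prod_cons, List.map_cons, List.prod_cons, pushSign]
    by_cases hk : h = k
    · subst hk
      have ht : (t.map fun j => if j ∈ symmDiff S {h} then Q j else 1) =
          t.map fun j => if j ∈ S then Q j else 1 := by
        refine List.map_congr_left fun j hj => ?_
        have : j ≠ h := fun e => hl.1 (e ▸ hj)
        simp [Finset.mem_symmDiff, this]
      rw [ht]
      by_cases hS : h ∈ S
      · simp [hS, Finset.mem_symmDiff, ← mul_assoc, hQ]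
      · simp [hS, Finset.mem_symmDiff]
    · have hm : (h ∈ symmDiff S {k}) ↔ h ∈ S := by simp [Finset.mem_symmDiff, hk]
      have hm' : (k ∈ h :: t) ↔ k ∈ t := by simp [Ne.symm hk]
      simp only [hm, hm', if_neg hk]
      by_cases hS : h ∈ S
      · simp only [if_pos hS]
        rw [← mul_assoc, hω k h (Ne.symm hk), smul_mul_assoc, mul_assoc, ih, mul_smul_comm,
          smul_smul, mul_assoc]
      · simp only [if_neg hS, one_mul]
        exact ih

/-- The operators `Q_k` of a family acting from the left on the coefficient vectors with respect
to the products of the family. -/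
noncomputable def pushLin {r : ℕ} (ω : Fin r → Fin r → ℂ) (k : Fin r) :
    Module.End ℂ (Finset (Fin r) → ℂ) where
  toFun γ S := pushSign ω k (symmDiff S {k}) (List.finRange r) * γ (symmDiff S {k})
  map_add' γ γ' := by funext S; simp [mul_add]
  map_smul' c γ := by funext S; simp [mul_left_comm]

/-- The linear combination of the products of Paulis with given coefficients. -/
noncomputable def prodSum {r N : ℕ} (P : Fin r → Pauli N) (γ : Finset (Fin r) → ℂ) : Op N :=
  ∑ S, γ S • pauliProd P S

/-- On coefficient vectors, left multiplication by a generator is a linear map built from the signs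
alone. It is therefore the same map for every family of Paulis with these commutation relations. -/
theorem prodSum_pushLin {r N : ℕ} (P : Fin r → Pauli N) {ω : Fin r → Fin r → ℂ}
    (hω : ∀ i j, bitSign ((P i).symp (P j)) = ω i j) (k : Fin r) (γ : Finset (Fin r) → ℂ) :
    prodSum P (pushLin ω k γ) = (P k).toOp * prodSum P γ := by
  have h1 : ∀ S, (P k).toOp * pauliProd P S =
      pushSign ω k S (List.finRange r) • pauliProd P (symmDiff S {k}) := by
    intro S
    have := push_mul (Q := fun i => (P i).toOp) (ω := ω)
      (fun i j _ => by rw [← hω]; exact Pauli.toOp_mul_comm _ _)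
      (fun i => Pauli.toOp_mul_self _) k S (List.finRange r) (List.nodup_finRange r)
    simpa [pauliProd] using this
  have h2 : ∀ S : Finset (Fin r), symmDiff (symmDiff S {k}) {k} = S := fun S =>
    symmDiff_symmDiff_cancel_right _ _
  have hinv : Function.Involutive fun S : Finset (Fin r) => symmDiff S {k} := h2
  -- Multiplication by generator `k` toggles the membership of `k`, an involution on the subsets,
  -- along which the sum is reindexed.
  rw [prodSum, prodSum, Finset.mul_sum, ← Equiv.sum_comp hinv.toPerm]
  refine Finset.sum_congr rfl fun S _ => ?_
  rw [Function.Involutive.coe_toPerm, Matrix.mul_smul, h1, smul_smul, mul_comm (γ S)]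
  simp only [pushLin, LinearMap.coe_mk, AddHom.coe_mk, h2]

/-- The products of left multiplications. -/
noncomputable def pushProd {r : ℕ} (ω : Fin r → Fin r → ℂ) (S : Finset (Fin r))
    (l : List (Fin r)) : Module.End ℂ (Finset (Fin r) → ℂ) :=
  (l.map fun k => if k ∈ S then pushLin ω k else 1).prod

theorem prodSum_pushProd {r N : ℕ} (P : Fin r → Pauli N) {ω : Fin r → Fin r → ℂ}
    (hω : ∀ i j, bitSign ((P i).symp (P j)) = ω i j) (S : Finset (Fin r)) (l : List (Fin r))
    (γ : Finset (Fin r) → ℂ) :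
    prodSum P (pushProd ω S l γ) =
      (l.map fun k => if k ∈ S then (P k).toOp else 1).prod * prodSum P γ := by
  induction l with
  | nil => simp [pushProd]
  | cons k l ih =>
    rw [List.map_cons, List.prod_cons, Matrix.mul_assoc, ← ih, pushProd, List.map_cons,
      List.prod_cons, Module.End.mul_apply]
    by_cases hk : k ∈ S
    · rw [if_pos hk, if_pos hk, prodSum_pushLin P hω]
      rfl
    · rw [if_neg hk, if_neg hk, Matrix.one_mul]
      rfl

/-- Left multiplication by the linear combination with coefficients `β`. -/
noncomputable def leftMul {r : ℕ} (ω : Fin r → Fin r → ℂ) (β : Finset (Fin r) → ℂ) :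
    Module.End ℂ (Finset (Fin r) → ℂ) :=
  ∑ S, β S • pushProd ω S (List.finRange r)

/-- `prodSum` as a linear map. -/
noncomputable def prodSumLin {r N : ℕ} (P : Fin r → Pauli N) :
    (Finset (Fin r) → ℂ) →ₗ[ℂ] Op N where
  toFun := prodSum P
  map_add' γ γ' := by simp [prodSum, add_smul, Finset.sum_add_distrib]
  map_smul' c γ := by simp [prodSum, mul_smul, Finset.smul_sum]

theorem prodSum_leftMul {r N : ℕ} (P : Fin r → Pauli N) {ω : Fin r → Fin r → ℂ}
    (hω : ∀ i j, bitSign ((P i).symp (P j)) = ω i j) (β γ : Finset (Fin r) → ℂ) :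
    prodSum P (leftMul ω β γ) = prodSum P β * prodSum P γ := by
  change prodSumLin P (leftMul ω β γ) = _
  rw [leftMul, LinearMap.sum_apply, map_sum, prodSum, Finset.sum_mul]
  refine Finset.sum_congr rfl fun S _ => ?_
  rw [LinearMap.smul_apply, map_smul, smul_mul_assoc]
  congr 1
  exact prodSum_pushProd P hω S _ γ

/-- The coefficients of the identity. -/
def unitCoeff {r : ℕ} : Finset (Fin r) → ℂ := Pi.single ∅ 1

theorem prodSum_unitCoeff {r N : ℕ} (P : Fin r → Pauli N) : prodSum P unitCoeff = 1 := by
  rw [prodSum, Finset.sum_eq_single ∅]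
  · simp [unitCoeff, pauliProd]
  · intro S _ hS; simp [unitCoeff, hS]
  · simp

/-- For `γ = unitCoeff` this gives the coefficients of a polynomial in `prodSum P β` as a vector in
which `P` does not occur. It transfers polynomial identities between families with equal signs. -/
theorem prodSum_aeval {r N : ℕ} (P : Fin r → Pauli N) {ω : Fin r → Fin r → ℂ}
    (hω : ∀ i j, bitSign ((P i).symp (P j)) = ω i j) (β γ : Finset (Fin r) → ℂ)
    (f : Polynomial ℂ) :
    prodSum P (Polynomial.aeval (leftMul ω β) f γ) =
      Polynomial.aeval (prodSum P β) f * prodSum P γ := by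
  have hpow : ∀ i : ℕ, prodSum P ((leftMul ω β ^ i) γ) = prodSum P β ^ i * prodSum P γ := by
    intro i
    induction i with
    | zero => simp
    | succ i ih =>
      rw [pow_succ', Module.End.mul_apply, prodSum_leftMul P hω, ih, pow_succ', Matrix.mul_assoc]
  change prodSumLin P _ = _
  rw [Polynomial.aeval_eq_sum_range, Polynomial.aeval_eq_sum_range, LinearMap.sum_apply, map_sum,
    Finset.sum_mul]
  refine Finset.sum_congr rfl fun i _ => ?_
  rw [LinearMap.smul_apply, map_smul, smul_mul_assoc]
  congr 1
  exact hpow i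

theorem prodSum_injective {r N : ℕ} {P : Fin r → Pauli N} (hP : LinearIndependent (ZMod 2) P) :
    Function.Injective (prodSum P) := by
  have h := Fintype.linearIndependent_iff.mp (linearIndependent_pauliProd hP)
  intro γ γ' hγ
  funext S
  have := h (fun S => γ S - γ' S) (by
    simp only [sub_smul, Finset.sum_sub_distrib]
    exact sub_eq_zero.mpr hγ) S
  exact sub_eq_zero.mp this

/-- A polynomial maps eigenvalues of `M` to eigenvalues of its value at `M`. Conversely, the minimal
polynomial is an annihilating polynomial whose roots are eigenvalues. The criterion refers only to
annihilating polynomials and so compares matrices of different sizes. -/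
theorem mem_spectrum_iff_eval {ι : Type*} [Fintype ι] [DecidableEq ι] (M : Matrix ι ι ℂ) (μ : ℂ) :
    μ ∈ spectrum ℂ M ↔ ∀ f : Polynomial ℂ, Polynomial.aeval M f = 0 → f.eval μ = 0 := by
  constructor
  · intro h f hf
    have h1 := spectrum.subset_polynomial_aeval M f ⟨μ, h, rfl⟩
    rw [hf] at h1
    by_contra h0
    refine h1 (spectrum.mem_resolventSet_iff.mpr ?_)
    rw [sub_zero]
    exact (IsUnit.mk0 _ h0).map (algebraMap ℂ _)
  · intro h
    have h1 := h (minpoly ℂ M) (minpoly.aeval ℂ M)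
    rw [← Matrix.minpoly_toLin'] at h1
    have h2 := Module.End.hasEigenvalue_iff_isRoot.mpr h1
    rw [← Matrix.spectrum_toLin']
    exact h2.mem_spectrum

/-- A polynomial in either operator has the same coefficient vector with respect to the ordered
products. As these products are independent in both families, it vanishes for one operator exactly
when it vanishes for the other. Multiplicities are not preserved, only the set of eigenvalues. -/
theorem spectrum_prodSum_eq {r N N' : ℕ} {P : Fin r → Pauli N} {A : Fin r → Pauli N'}
    (hP : LinearIndependent (ZMod 2) P) (hA : LinearIndependent (ZMod 2) A)
    (hPA : ∀ i j, (A i).symp (A j) = (P i).symp (P j)) (β : Finset (Fin r) → ℂ) :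
    spectrum ℂ (prodSum A β) = spectrum ℂ (prodSum P β) := by
  have key : ∀ f : Polynomial ℂ, Polynomial.aeval (prodSum A β) f = 0 ↔
      Polynomial.aeval (prodSum P β) f = 0 := by
    intro f
    set ω : Fin r → Fin r → ℂ := fun i j => bitSign ((P i).symp (P j)) with hω
    have h1 := prodSum_aeval P (ω := ω) (fun _ _ => rfl) β unitCoeff f
    have h2 := prodSum_aeval A (ω := ω) (fun i j => by rw [hPA]) β unitCoeff f
    rw [prodSum_unitCoeff, Matrix.mul_one] at h1 h2
    rw [← h1, ← h2]
    have hz : ∀ {N : ℕ} (P : Fin r → Pauli N), prodSum P 0 = 0 := fun P => by simp [prodSum]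
    constructor
    · intro h
      rw [prodSum_injective hA (h.trans (hz A).symm), hz]
    · intro h
      rw [prodSum_injective hP (h.trans (hz P).symm), hz]
  ext μ
  rw [mem_spectrum_iff_eval, mem_spectrum_iff_eval]
  simp only [key]

/-- The adjoint conjugates the coefficients and reverses the ordered products, and reordering them
produces signs that depend on `ω` only. Hermiticity is thus an identity between coefficient vectors,
read off for `P` by independence and then valid for `A`. -/
theorem isHermitian_prodSum {r N N' : ℕ} {P : Fin r → Pauli N} {A : Fin r → Pauli N'}
    (hP : LinearIndependent (ZMod 2) P)
    (hPA : ∀ i j, (A i).symp (A j) = (P i).symp (P j)) (β : Finset (Fin r) → ℂ)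
    (h : (prodSum P β).IsHermitian) : (prodSum A β).IsHermitian := by
  set ω : Fin r → Fin r → ℂ := fun i j => bitSign ((P i).symp (P j)) with hω
  have key : ∀ {N : ℕ} (P : Fin r → Pauli N), (∀ i j, bitSign ((P i).symp (P j)) = ω i j) →
      (prodSum P β)ᴴ = prodSum P (∑ S, star (β S) •
        pushProd ω S (List.finRange r).reverse unitCoeff) := by
    intro N P hP
    change _ = prodSumLin P _
    rw [map_sum, prodSum, conjTranspose_sum]
    refine Finset.sum_congr rfl fun S _ => ?_
    rw [conjTranspose_smul, map_smul]
    congr 1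
    change _ = prodSum P _
    rw [prodSum_pushProd P hP, prodSum_unitCoeff, Matrix.mul_one, pauliProd,
      Matrix.conjTranspose_list_prod, List.map_map, List.map_reverse]
    congr 3
    funext k
    by_cases hk : k ∈ S <;> simp [hk, Pauli.toOp_conjTranspose]
  have h1 := key P fun _ _ => rfl
  rw [h.eq] at h1
  rw [Matrix.IsHermitian, key A fun i j => by rw [hPA], ← prodSum_injective hP h1]

/-! ### Paulis with prescribed commutation relations -/

/-- Paulis `X_i ∏ Z_j`, the product over the `j < i` such that `P_i`, `P_j` anticommute. -/
def modelPauli {r N b : ℕ} (h : r ≤ b) (P : Fin r → Pauli N) (i : Fin r) : Pauli b :=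
  (Pi.single (Fin.castLE h i) 1,
    fun l => if hl : (l : ℕ) < i then (P i).symp (P ⟨l, hl.trans i.2⟩) else 0)

theorem Pauli.symp_comm {N : ℕ} (p q : Pauli N) : p.symp q = q.symp p := by
  unfold symp
  exact Finset.sum_congr rfl fun j _ => by ring

theorem Pauli.symp_self {N : ℕ} (p : Pauli N) : p.symp p = 0 := by
  have h : ∀ x z : ZMod 2, x * z + z * x = 0 := by decide
  exact Finset.sum_eq_zero fun j _ => h _ _

/-- String `i` has its only `X` at position `i` and `Z` factors only before it. Of the two cross
terms, only the `X` of the smaller index against the `Z` factors of the larger one can be nonzero,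
and that entry was chosen to be the wanted value. -/
theorem symp_modelPauli {r N b : ℕ} (h : r ≤ b) (P : Fin r → Pauli N) (i j : Fin r) :
    (modelPauli h P i).symp (modelPauli h P j) = (P i).symp (P j) := by
  have h1 : ∀ i j : Fin r, ∑ l, (modelPauli h P i).1 l * (modelPauli h P j).2 l =
      if (i : ℕ) < j then (P i).symp (P j) else 0 := by
    intro i j
    rw [Finset.sum_eq_single (Fin.castLE h i)]
    · simp only [modelPauli, Pi.single_eq_same, one_mul, Fin.val_castLE]
      split_ifs
      · exact Pauli.symp_comm _ _
      · rfl
    · intro l _ hl; simp [modelPauli, hl]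
    · simp
  rw [Pauli.symp, Finset.sum_add_distrib, h1]
  simp only [mul_comm ((modelPauli h P i).2 _)]
  rw [h1]
  rcases lt_trichotomy (i : ℕ) j with hij | hij | hij
  · rw [if_pos hij, if_neg hij.not_gt, add_zero]
  · have : i = j := Fin.ext hij
    subst this
    simp [Pauli.symp_self]
  · rw [if_pos hij, if_neg hij.not_gt, zero_add, Pauli.symp_comm]

theorem linearIndependent_modelPauli {r N b : ℕ} (h : r ≤ b) (P : Fin r → Pauli N) :
    LinearIndependent (ZMod 2) (modelPauli h P) := by
  rw [Fintype.linearIndependent_iff]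
  intro g hg i
  have h1 := congrArg (fun p : Pauli b => p.1 (Fin.castLE h i)) hg
  simp only [Prod.fst_sum, Finset.sum_apply, Prod.smul_fst, Pi.smul_apply, modelPauli] at h1
  rw [Finset.sum_eq_single i] at h1
  · simpa using h1
  · intro j _ hj
    have : Fin.castLE h i ≠ Fin.castLE h j := fun e => hj (Fin.castLE_injective h e).symm
    simp [this]
  · simp

end QCSAT

/-! ### The witness observable, its group, and its least eigenvalue -/

namespace QCSAT

open Matrix

/-! ### Restriction to the witness qubits -/

/-- The part of a Pauli on the first `n` qubits. -/
def Pauli.restrict {n m : ℕ} : Pauli (n + m) →ₗ[ZMod 2] Pauli n where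
  toFun p := (fun i => p.1 (Fin.castAdd m i), fun i => p.2 (Fin.castAdd m i))
  map_add' _ _ := rfl
  map_smul' _ _ := rfl

/-- The `X` part of a Pauli on the last `m` qubits. -/
def Pauli.ancX {n m : ℕ} : Pauli (n + m) →ₗ[ZMod 2] (Fin m → ZMod 2) where
  toFun p j := p.1 (Fin.natAdd n j)
  map_add' _ _ := rfl
  map_smul' _ _ := rfl

/-- Basis state `u` of the first qubits, and `0` on the others. -/
def padBits {n m : ℕ} (u : Bits n) : Bits (n + m) := Fin.append u fun _ => 0

/-- On each ancilla the factor is the entry at `(0, 0)` of a one-qubit Pauli, which is `1` for `𝕀`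
and `Z` and `0` for `X` and `Y`. -/
theorem Pauli.toOp_submatrix {n m : ℕ} (p : Pauli (n + m)) :
    p.toOp.submatrix padBits padBits =
      if Pauli.ancX p = 0 then (Pauli.restrict p).toOp else 0 := by
  have h1 : ∀ x z : ZMod 2, pauliOne x z 0 0 = if x = 0 then 1 else 0 := by
    intro x z
    rcases zmod_two_cases x with rfl | rfl <;> simp [pauliOne]
  ext u w
  simp only [Matrix.submatrix_apply, Pauli.toOp, Matrix.of_apply, Fin.prod_univ_add, padBits,
    Fin.append_left, Fin.append_right, h1, Finset.prod_ite_zero, Finset.prod_const_one,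
    Finset.mem_univ, true_imp_iff]
  have h2 : (∀ i : Fin m, p.1 (Fin.natAdd n i) = 0) ↔ Pauli.ancX p = 0 := by
    rw [funext_iff]; rfl
  by_cases h : Pauli.ancX p = 0
  · rw [if_pos (h2.mpr h), if_pos h, mul_one]; rfl
  · rw [if_neg (fun h' => h (h2.mp h')), if_neg h, mul_zero]; rfl

namespace Instance

/-- The Pauli coefficients of the observable. -/
noncomputable def obsCoeffs (I : Instance) : Pauli (I.n + I.m) → ℝ := coeffs I.gates I.out

/-- The Pauli coefficients of the witness observable. -/
noncomputable def witCoeffs (I : Instance) (p : Pauli I.n) : ℝ :=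
  ∑ p' : Pauli (I.n + I.m),
    if Pauli.ancX p' = 0 ∧ Pauli.restrict p' = p then I.obsCoeffs p' else 0

theorem observable_eq (I : Instance) : I.observable = pauliSum I.obsCoeffs :=
  circuitOp_conj_Z _ _

theorem witnessObservable_eq (I : Instance) : I.witnessObservable = pauliSum I.witCoeffs := by
  have h1 : I.witnessObservable =
      ∑ p, ((I.obsCoeffs p : ℝ) : ℂ) • p.toOp.submatrix padBits padBits := by
    rw [witnessObservable, observable_eq, pauliSum]
    ext u w
    simp [Matrix.sum_apply, padBits]
  rw [h1, pauliSum]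
  simp only [Pauli.toOp_submatrix, witCoeffs, Complex.ofReal_sum, Finset.sum_smul]
  rw [Finset.sum_comm]
  refine Finset.sum_congr rfl fun p' _ => ?_
  by_cases h : Pauli.ancX p' = 0
  · rw [if_pos h, Finset.sum_eq_single (Pauli.restrict p')]
    · simp [h]
    · intro p _ hp; simp [Ne.symm hp]
    · simp
  · simp [h]

/-- The group generated by the Paulis of the witness observable. -/
def witSpan (I : Instance) : Submodule (ZMod 2) (Pauli I.n) :=
  (propSpan I.gates I.out ⊓ LinearMap.ker Pauli.ancX).map Pauli.restrict

theorem obsCoeffs_support (I : Instance) (p : Pauli (I.n + I.m)) (h : I.obsCoeffs p ≠ 0) :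
    p ∈ I.paulis := coeffs_support _ _ _ h

theorem exists_of_witCoeffs_ne_zero (I : Instance) (p : Pauli I.n) (h : I.witCoeffs p ≠ 0) :
    ∃ p' ∈ I.paulis, Pauli.ancX p' = 0 ∧ Pauli.restrict p' = p := by
  obtain ⟨p', -, hp'⟩ := Finset.exists_ne_zero_of_sum_ne_zero h
  split_ifs at hp' with h1
  · exact ⟨p', I.obsCoeffs_support p' hp', h1⟩
  · exact absurd rfl hp'

theorem witCoeffs_support (I : Instance) (p : Pauli I.n) (h : I.witCoeffs p ≠ 0) :
    p ∈ I.witSpan := by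
  obtain ⟨p', h1, h2, h3⟩ := I.exists_of_witCoeffs_ne_zero p h
  exact ⟨p', ⟨Submodule.subset_span h1, h2⟩, h3⟩

theorem ncard_witCoeffs_le (I : Instance) : {p | I.witCoeffs p ≠ 0}.ncard ≤ 2 ^ I.t := by
  have h : {p | I.witCoeffs p ≠ 0} ⊆ Pauli.restrict '' I.paulis := by
    intro p hp
    obtain ⟨p', h1, -, h3⟩ := I.exists_of_witCoeffs_ne_zero p hp
    exact ⟨p', h1, h3⟩
  exact (Set.ncard_le_ncard h (Set.toFinite _)).trans
    ((Set.ncard_image_le).trans (ncard_propagated_le _ _))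

theorem ncard_obsCoeffs_le (I : Instance) : {p | I.obsCoeffs p ≠ 0}.ncard ≤ 2 ^ I.t :=
  (Set.ncard_le_ncard I.obsCoeffs_support (Set.toFinite _)).trans (ncard_propagated_le _ _)

theorem b_eq (I : Instance) : I.b = Module.finrank (ZMod 2) (propSpan I.gates I.out) := rfl

theorem b_le (I : Instance) : I.b ≤ I.t + 1 := finrank_propSpan_le _ _

theorem finrank_witSpan_le (I : Instance) : Module.finrank (ZMod 2) I.witSpan ≤ I.b :=
  (Submodule.finrank_map_le _ _).trans (Submodule.finrank_mono inf_le_left)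

end Instance

theorem isHermitian_pauliSum {N : ℕ} (a : Pauli N → ℝ) : (pauliSum a).IsHermitian := by
  simp [Matrix.IsHermitian, pauliSum, Matrix.conjTranspose_sum, Pauli.toOp_conjTranspose]

/-! ### Least eigenvalue and maximal acceptance probability -/

theorem Pauli.toOp_Z {N : ℕ} (q : Fin N) :
    (Pauli.Z q).toOp = Matrix.diagonal fun v : Bits N => if v q = 1 then -1 else 1 := by
  have h : (Pauli.Z q).toOp = tensAt q (diagOne (-1)) := by
    rw [Pauli.toOp_eq_tens, tensAt]
    congr 1
    funext j
    by_cases hj : j = q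
    · subst hj
      ext a b
      rcases zmod_two_cases a with rfl | rfl <;> rcases zmod_two_cases b with rfl | rfl <;>
      simp [Pauli.Z, pauliOne, diagOne, ZMod.val_one]
    · simp [Pauli.Z, hj, pauliOne_zero]
  rw [h, tensAt_diagOne]

namespace Instance

theorem withAncillas_padBits (I : Instance) (ψ : EuclideanSpace ℂ (Bits I.n)) (u : Bits I.n) :
    I.withAncillas ψ (padBits u) = ψ u := by
  simp [withAncillas, padBits]

theorem padBits_injective {n m : ℕ} : Function.Injective (padBits : Bits n → Bits (n + m)) := by
  intro u w h
  funext i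
  have := congrFun h (Fin.castAdd m i)
  simpa [padBits] using this

theorem withAncillas_eq_zero (I : Instance) (ψ : EuclideanSpace ℂ (Bits I.n))
    (v : Bits (I.n + I.m)) (hv : v ∉ Set.range (padBits : Bits I.n → Bits (I.n + I.m))) :
    I.withAncillas ψ v = 0 := by
  rw [withAncillas, if_neg]
  intro h
  apply hv
  refine ⟨fun i => v (Fin.castAdd I.m i), ?_⟩
  funext j
  refine Fin.addCases (fun i => ?_) (fun i => ?_) j
  · simp [padBits]
  · simp [padBits, h]

theorem sum_withAncillas (I : Instance) (ψ : EuclideanSpace ℂ (Bits I.n))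
    (f : Bits (I.n + I.m) → ℂ) :
    ∑ v, f v * I.withAncillas ψ v = ∑ u, f (padBits u) * ψ u := by
  symm
  refine Fintype.sum_of_injective padBits padBits_injective _ _ ?_ ?_
  · intro v hv
    rw [I.withAncillas_eq_zero ψ v hv, mul_zero]
  · intro u
    rw [I.withAncillas_padBits]

theorem quadForm_withAncillas (I : Instance) (ψ : EuclideanSpace ℂ (Bits I.n))
    (M : Op (I.n + I.m)) :
    star (I.withAncillas ψ) ⬝ᵥ M *ᵥ I.withAncillas ψ =
      star (ψ : Bits I.n → ℂ) ⬝ᵥ M.submatrix padBits padBits *ᵥ (ψ : Bits I.n → ℂ) := by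
  have h1 : M *ᵥ I.withAncillas ψ = fun v => ∑ u, M v (padBits u) * ψ u := by
    funext v
    exact I.sum_withAncillas ψ _
  rw [h1]
  simp only [dotProduct, Pi.star_apply]
  have h2 := congrArg star (I.sum_withAncillas ψ fun v => star (∑ u, M v (padBits u) * ψ u))
  simp only [star_sum, star_mul', star_star] at h2
  simp only [mul_comm (star (I.withAncillas ψ _))]
  rw [h2]
  refine Finset.sum_congr rfl fun u _ => ?_
  rw [mul_comm]
  rfl

/-- With `y = U (ψ ⊗ 0)`, the expectation of `Z_out` is the squared norm of `y` minus twice the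
weight where the output bit is `1`; the norm is one because `U` is an isometry. -/
theorem acceptProb_eq (I : Instance) (ψ : EuclideanSpace ℂ (Bits I.n)) (hψ : ‖ψ‖ = 1) :
    ((1 - 2 * I.acceptProb ψ : ℝ) : ℂ) =
      star (ψ : Bits I.n → ℂ) ⬝ᵥ I.witnessObservable *ᵥ (ψ : Bits I.n → ℂ) := by
  set φ := I.withAncillas ψ with hφ
  set y := circuitOp I.gates *ᵥ φ with hy
  have hsq : ∀ z : ℂ, ((‖z‖ ^ 2 : ℝ) : ℂ) = star z * z := by
    intro z
    rw [Complex.star_def, ← Complex.normSq_eq_conj_mul_self, Complex.normSq_eq_norm_sq]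
  have hnorm : ((∑ v, ‖y v‖ ^ 2 : ℝ) : ℂ) = 1 := by
    have h1 : ((∑ v, ‖y v‖ ^ 2 : ℝ) : ℂ) = star y ⬝ᵥ y := by
      rw [Complex.ofReal_sum]
      exact Finset.sum_congr rfl fun v _ => hsq _
    have h2 : star y ⬝ᵥ y = star φ ⬝ᵥ (1 : Op (I.n + I.m)) *ᵥ φ := by
      rw [hy, star_mulVec, ← dotProduct_mulVec, mulVec_mulVec, circuitOp_conj_self]
    rw [h1, h2, quadForm_withAncillas, Matrix.submatrix_one _ padBits_injective, one_mulVec]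
    have h3 : star (ψ : Bits I.n → ℂ) ⬝ᵥ (ψ : Bits I.n → ℂ) = ((‖ψ‖ ^ 2 : ℝ) : ℂ) := by
      rw [EuclideanSpace.norm_sq_eq, Complex.ofReal_sum]
      exact (Finset.sum_congr rfl fun v _ => hsq _).symm
    rw [h3, hψ]
    simp
  have hobs : star (ψ : Bits I.n → ℂ) ⬝ᵥ I.witnessObservable *ᵥ (ψ : Bits I.n → ℂ) =
      star y ⬝ᵥ (Pauli.Z I.out).toOp *ᵥ y := by
    rw [witnessObservable]
    change _ ⬝ᵥ I.observable.submatrix padBits padBits *ᵥ _ = _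
    rw [← quadForm_withAncillas, observable, ← hφ, ← mulVec_mulVec, ← mulVec_mulVec, ← hy,
      dotProduct_mulVec, ← star_mulVec]
  have h4 : star y ⬝ᵥ (Pauli.Z I.out).toOp *ᵥ y =
      ((∑ v, ‖y v‖ ^ 2 : ℝ) : ℂ) - 2 * (I.acceptProb ψ : ℂ) := by
    rw [Pauli.toOp_Z, acceptProb, Complex.ofReal_sum, Complex.ofReal_sum, Finset.mul_sum,
      ← Finset.sum_sub_distrib, dotProduct]
    refine Finset.sum_congr rfl fun v _ => ?_
    rw [mulVec_diagonal, Pi.star_apply]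
    change _ = _ - 2 * ((if v I.out = 1 then ‖y v‖ ^ 2 else 0 : ℝ) : ℂ)
    split_ifs
    · rw [hsq]; ring
    · rw [hsq]; push_cast; ring
  rw [hobs, h4, hnorm]
  push_cast
  ring

theorem isHermitian_witnessObservable (I : Instance) : I.witnessObservable.IsHermitian := by
  rw [witnessObservable_eq]
  exact isHermitian_pauliSum _

-- `Val` is `(1 - λ)/2` for the least eigenvalue `λ`: the operator minus `λ` is positive
-- semidefinite, which bounds every acceptance probability, and an eigenvector for `λ` attains the
-- bound.
open scoped ComplexOrder in
theorem isLeast_spectrum (I : Instance) :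
    IsLeast {x : ℝ | (x : ℂ) ∈ spectrum ℂ I.witnessObservable} (1 - 2 * I.Val) := by
  have hW := I.isHermitian_witnessObservable
  obtain ⟨i₀, hi₀⟩ := Finite.exists_min hW.eigenvalues
  have hspec : ∀ z : ℂ, z ∈ spectrum ℂ I.witnessObservable ↔
      ∃ i, ((hW.eigenvalues i : ℝ) : ℂ) = z := by
    intro z
    rw [hW.spectrum_eq_image_range]
    simp
  have hpsd : (I.witnessObservable -
      algebraMap ℂ (Op I.n) ((hW.eigenvalues i₀ : ℝ) : ℂ)).PosSemidef := by
    rw [posSemidef_iff_isHermitian_and_spectrum_nonneg]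
    constructor
    · refine hW.sub ?_
      rw [Matrix.IsHermitian, Matrix.algebraMap_eq_diagonal, Matrix.diagonal_conjTranspose]
      congr 1
      funext v
      simp
    · rw [← spectrum.sub_singleton_eq]
      rintro _ ⟨z, hz, _, rfl, rfl⟩
      obtain ⟨i, rfl⟩ := (hspec z).mp hz
      change (0 : ℂ) ≤ ((hW.eigenvalues i : ℝ) : ℂ) - ((hW.eigenvalues i₀ : ℝ) : ℂ)
      rw [← Complex.ofReal_sub]
      exact_mod_cast sub_nonneg.mpr (hi₀ i)
  -- The maximum is attained, so the supremum in `Val` is a true maximum and not the default value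
  -- of `sSup`.
  have hgreat : IsGreatest {p : ℝ | ∃ ψ : EuclideanSpace ℂ (Bits I.n), ‖ψ‖ = 1 ∧
      p = I.acceptProb ψ} ((1 - hW.eigenvalues i₀) / 2) := by
    constructor
    · refine ⟨hW.eigenvectorBasis i₀, hW.eigenvectorBasis.orthonormal.1 i₀, ?_⟩
      have h1 := hW.eigenvalues_eq i₀
      rw [← acceptProb_eq I _ (hW.eigenvectorBasis.orthonormal.1 i₀)] at h1
      have h2 : hW.eigenvalues i₀ = 1 - 2 * I.acceptProb (hW.eigenvectorBasis i₀) := h1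
      rw [h2]
      ring
    · rintro p ⟨ψ, hψ, rfl⟩
      have h1 := hpsd.dotProduct_mulVec_nonneg (ψ : Bits I.n → ℂ)
      have h3 : star (ψ : Bits I.n → ℂ) ⬝ᵥ (ψ : Bits I.n → ℂ) = 1 := by
        have := EuclideanSpace.inner_eq_star_dotProduct (𝕜 := ℂ) ψ ψ
        rw [inner_self_eq_norm_sq_to_K, hψ, dotProduct_comm] at this
        simpa using this.symm
      rw [sub_mulVec, dotProduct_sub, ← acceptProb_eq I ψ hψ, Algebra.algebraMap_eq_smul_one,
        smul_mulVec, one_mulVec, dotProduct_smul, h3, smul_eq_mul, mul_one,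
        ← Complex.ofReal_sub] at h1
      have h2 : 0 ≤ 1 - 2 * I.acceptProb ψ - hW.eigenvalues i₀ := by exact_mod_cast h1
      linarith
  have hVal : 1 - 2 * I.Val = hW.eigenvalues i₀ := by
    rw [Val, hgreat.csSup_eq]
    ring
  rw [hVal]
  constructor
  · exact (hspec _).mpr ⟨i₀, rfl⟩
  · intro x hx
    obtain ⟨i, hi⟩ := (hspec _).mp hx
    rw [← Complex.ofReal_inj.mp hi]
    exact hi₀ i

/-- A basis of the group generated by the propagated Paulis for the observable. -/
theorem exists_observable_expansion (I : Instance) :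
    ∃ (B : Fin I.b → Pauli (I.n + I.m)) (α : Finset (Fin I.b) → ℂ),
      LinearIndependent (ZMod 2) B ∧
      Submodule.span (ZMod 2) (Set.range B) = Submodule.span (ZMod 2) I.paulis ∧
      {S | α S ≠ 0}.ncard ≤ 2 ^ I.t ∧
      I.observable = ∑ S : Finset (Fin I.b), α S • pauliProd B S := by
  obtain ⟨B, hB, hspan⟩ := exists_basis_of_submodule (propSpan I.gates I.out)
  obtain ⟨α, h1, h2⟩ := pauliSum_eq_sum_pauliProd hB (a := I.obsCoeffs) (by
    intro p hp
    rw [hspan]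
    exact Submodule.subset_span (I.obsCoeffs_support p hp))
  exact ⟨B, α, hB, hspan, h1.trans I.ncard_obsCoeffs_le, I.observable_eq.trans h2⟩

/-- The small Hamiltonian with the spectrum of the witness observable. -/
theorem exists_hamiltonian (I : Instance) :
    ∃ (r : ℕ) (P : Fin r → Pauli I.n) (A : Fin r → Pauli I.b)
      (β : Finset (Fin r) → ℂ) (H' : Op I.b),
      r ≤ I.b ∧
      LinearIndependent (ZMod 2) P ∧ LinearIndependent (ZMod 2) A ∧
      (∀ i j, Commute (A i).toOp (A j).toOp ↔ Commute (P i).toOp (P j).toOp) ∧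
      {S | β S ≠ 0}.ncard ≤ 2 ^ I.t ∧
      I.witnessObservable = ∑ S : Finset (Fin r), β S • pauliProd P S ∧
      H' = ∑ S : Finset (Fin r), β S • pauliProd A S ∧
      H'.IsHermitian ∧
      spectrum ℂ H' = spectrum ℂ I.witnessObservable ∧
      IsLeast {x : ℝ | (x : ℂ) ∈ spectrum ℂ H'} (1 - 2 * I.Val) := by
  obtain ⟨P, hP, hspan⟩ := exists_basis_of_submodule I.witSpan
  obtain ⟨β, h1, h2⟩ := pauliSum_eq_sum_pauliProd hP (a := I.witCoeffs) (by
    intro p hp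
    rw [hspan]
    exact I.witCoeffs_support p hp)
  have hr := I.finrank_witSpan_le
  have hA := linearIndependent_modelPauli hr P
  have hPA := symp_modelPauli hr P
  have hW : I.witnessObservable = prodSum P β := I.witnessObservable_eq.trans h2
  have hspec : spectrum ℂ (prodSum (modelPauli hr P) β) = spectrum ℂ I.witnessObservable := by
    rw [hW]
    exact spectrum_prodSum_eq hP hA hPA β
  refine ⟨_, P, modelPauli hr P, β, prodSum (modelPauli hr P) β, hr, hP, hA, ?_,
    h1.trans I.ncard_witCoeffs_le, hW, rfl, ?_, hspec, ?_⟩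
  · intro i j
    rw [Pauli.commute_iff, Pauli.commute_iff, hPA]
  · apply isHermitian_prodSum hP hPA
    rw [← hW]
    exact I.isHermitian_witnessObservable
  · rw [hspec]
    exact I.isLeast_spectrum

end Instance

end QCSAT

/-! ### A loop language compiled to the random access machine -/

namespace QCSAT

/-! ### A small imperative language

The state has sizes, natural scalars, arrays of naturals and arrays of reals. Only sizes bound
loops, and a command does not change them. -/

/-- Expressions for natural numbers. -/
inductive NE : Type
  | const (c : ℕ)
  | var (v : ℕ)
  | size (k : ℕ)
  | add (e f : NE)
  | sub (e f : NE)
  | arr (a : Fin 8) (e : NE)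
  | inp (e : NE)
  | sum (v k : ℕ) (e : NE)
  | ite (e f g h : NE)

/-- Expressions for real numbers. -/
inductive RE : Type
  | const (c : ℕ)
  | add (r s : RE)
  | sub (r s : RE)
  | mul (r s : RE)
  | div (r s : RE)
  | arr (a : Fin 8) (e : NE)
  | inp (e : NE)
  | sum (v k : ℕ) (r : RE)
  | ite (e f : NE) (r s : RE)

/-- Commands. `tabN` and `tabR` assign to several array entries simultaneously. -/
inductive Cmd : Type
  | setv (v : ℕ) (e : NE)
  | tabN (a : Fin 8) (v k : ℕ) (idx e : NE)
  | tabR (a : Fin 8) (v k : ℕ) (idx : NE) (r : RE)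
  | cmp (v : ℕ) (r s : RE)
  | seq (c d : Cmd)
  | ite (e f : NE) (c d : Cmd)
  | loop (v k : ℕ) (c : Cmd)

/-- States of the language. -/
structure St where
  sz : ℕ → ℕ
  nv : ℕ → ℕ
  na : Fin 8 → ℕ → ℕ
  ra : Fin 8 → ℕ → ℝ

namespace St

def setv (st : St) (v x : ℕ) : St := { st with nv := Function.update st.nv v x }
def setN (st : St) (a : Fin 8) (f : ℕ → ℕ) : St := { st with na := Function.update st.na a f }
def setR (st : St) (a : Fin 8) (f : ℕ → ℝ) : St := { st with ra := Function.update st.ra a f }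

end St

/-- The value of an expression. -/
def NE.eval (inp : Memory) : NE → St → ℕ
  | .const c, _ => c
  | .var v, st => st.nv v
  | .size k, st => st.sz k
  | .add e f, st => e.eval inp st + f.eval inp st
  | .sub e f, st => e.eval inp st - f.eval inp st
  | .arr a e, st => st.na a (e.eval inp st)
  | .inp e, st => inp.nat (e.eval inp st)
  | .sum v k e, st => ∑ i ∈ Finset.range (st.sz k), e.eval inp (st.setv v i)
  | .ite e f g h, st => if e.eval inp st < f.eval inp st then g.eval inp st else h.eval inp st

/-- The value of an expression. -/
noncomputable def RE.eval (inp : Memory) : RE → St → ℝ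
  | .const c, _ => c
  | .add r s, st => r.eval inp st + s.eval inp st
  | .sub r s, st => r.eval inp st - s.eval inp st
  | .mul r s, st => r.eval inp st * s.eval inp st
  | .div r s, st => r.eval inp st / s.eval inp st
  | .arr a e, st => st.ra a (e.eval inp st)
  | .inp e, st => inp.real (e.eval inp st)
  | .sum v k r, st => ∑ i ∈ Finset.range (st.sz k), r.eval inp (st.setv v i)
  | .ite e f r s, st => if e.eval inp st < f.eval inp st then r.eval inp st else s.eval inp st

/-- The function `f` after the assignments `idx i ↦ val i`, `i < n`. -/
def updMany {α : Type*} (f : ℕ → α) (idx : ℕ → ℕ) (val : ℕ → α) : ℕ → ℕ → α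
  | 0 => f
  | n + 1 => Function.update (updMany f idx val n) (idx n) (val n)

/-- The effect of a command. -/
noncomputable def Cmd.exec (inp : Memory) : Cmd → St → St
  | .setv v e, st => st.setv v (e.eval inp st)
  | .tabN a v k idx e, st => st.setN a (updMany (st.na a) (fun i => idx.eval inp (st.setv v i))
      (fun i => e.eval inp (st.setv v i)) (st.sz k))
  | .tabR a v k idx r, st => st.setR a (updMany (st.ra a) (fun i => idx.eval inp (st.setv v i))
      (fun i => r.eval inp (st.setv v i)) (st.sz k))
  | .cmp v r s, st =>
      open scoped Classical in st.setv v (if r.eval inp st < s.eval inp st then 1 else 0)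
  | .seq c d, st => d.exec inp (c.exec inp st)
  | .ite e f c d, st =>
      if e.eval inp st < f.eval inp st then c.exec inp st else d.exec inp st
  | .loop v k c, st =>
      (Nat.rec st (fun i st' => c.exec inp (st'.setv v i)) (st.sz k) : St).setv v (st.nv v)

/-! ### Compilation -/

/-- The address of temporary register `d`. -/
def tmp (d : ℕ) : ℕ := 16 * d

/-- The address of scalar `v`. -/
def adv (v : ℕ) : ℕ := 16 * v + 1

/-- The address of size `k`. -/
def ads (k : ℕ) : ℕ := 16 * k + 2

namespace Program

/-- Copy natural register `a` to `d`, with the help of `z`. -/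
def mov (d a z : ℕ) : Program := .seq (.nat (.const z 0)) (.nat (.add d a z))

/-- Replace the content `x` of register `d` by `16 * x + c`, with the help of `z`. -/
def addr (d c z : ℕ) : Program :=
  .seq (.nat (.add d d d)) (.seq (.nat (.add d d d)) (.seq (.nat (.add d d d))
    (.seq (.nat (.add d d d)) (.seq (.nat (.const z c)) (.nat (.add d d z))))))

/-- Run `body` with scalar `v` equal to `0, …, size k - 1`, and restore `v`. Temporaries
`d`, `d + 1`, `d + 2` are used. -/
def count (v k d : ℕ) (body : Program) : Program :=
  .seq (mov (tmp d) (adv v) (tmp (d + 2))) <| .seq (.nat (.const (tmp (d + 1)) 0)) <|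
  .seq (.loop (.natLt (tmp (d + 1)) (ads k))
    (.seq (mov (adv v) (tmp (d + 1)) (tmp (d + 2))) <| .seq body <|
      .seq (.nat (.const (tmp (d + 2)) 1)) (.nat (.add (tmp (d + 1)) (tmp (d + 1)) (tmp (d + 2))))))
  (mov (adv v) (tmp d) (tmp (d + 2)))

end Program

open Program

/-- Code that puts the value of an expression into temporary `d`. -/
def NE.compile : NE → ℕ → Program
  | .const c, d => .nat (.const (tmp d) c)
  | .var v, d => mov (tmp d) (adv v) (tmp (d + 1))
  | .size k, d => mov (tmp d) (ads k) (tmp (d + 1))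
  | .add e f, d => .seq (e.compile d) (.seq (f.compile (d + 1))
      (.nat (.add (tmp d) (tmp d) (tmp (d + 1)))))
  | .sub e f, d => .seq (e.compile d) (.seq (f.compile (d + 1))
      (.nat (.sub (tmp d) (tmp d) (tmp (d + 1)))))
  | .arr a e, d => .seq (e.compile d) (.seq (addr (tmp d) (a + 5) (tmp (d + 1)))
      (.nat (.load (tmp d) (tmp d))))
  | .inp e, d => .seq (e.compile d) (.nat (.read (tmp d) (tmp d)))
  | .sum v k e, d => .seq (.nat (.const (tmp d) 0)) (count v k (d + 1)
      (.seq (e.compile (d + 4)) (.nat (.add (tmp d) (tmp d) (tmp (d + 4))))))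
  | .ite e f g h, d => .seq (e.compile d) (.seq (f.compile (d + 1))
      (.branch (.natLt (tmp d) (tmp (d + 1))) (g.compile d) (h.compile d)))

/-- Code that puts the value of an expression into real temporary `t`. -/
def RE.compile : RE → ℕ → ℕ → Program
  | .const c, _, t => .real (.const (tmp t) c)
  | .add r s, d, t => .seq (r.compile d t) (.seq (s.compile d (t + 1))
      (.real (.add (tmp t) (tmp t) (tmp (t + 1)))))
  | .sub r s, d, t => .seq (r.compile d t) (.seq (s.compile d (t + 1))
      (.real (.sub (tmp t) (tmp t) (tmp (t + 1)))))
  | .mul r s, d, t => .seq (r.compile d t) (.seq (s.compile d (t + 1))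
      (.real (.mul (tmp t) (tmp t) (tmp (t + 1)))))
  | .div r s, d, t => .seq (r.compile d t) (.seq (s.compile d (t + 1))
      (.real (.div (tmp t) (tmp t) (tmp (t + 1)))))
  | .arr a e, d, t => .seq (e.compile d) (.seq (addr (tmp d) (a + 5) (tmp (d + 1)))
      (.real (.load (tmp t) (tmp d))))
  | .inp e, d, t => .seq (e.compile d) (.real (.read (tmp t) (tmp d)))
  | .sum v k r, d, t => .seq (.real (.const (tmp t) 0)) (count v k d
      (.seq (r.compile (d + 3) (t + 1)) (.real (.add (tmp t) (tmp t) (tmp (t + 1))))))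
  | .ite e f r s, d, t => .seq (e.compile d) (.seq (f.compile (d + 1))
      (.branch (.natLt (tmp d) (tmp (d + 1))) (r.compile d t) (s.compile d t)))

/-- Code that puts the address of entry `nv v` of the buffer into temporary `d`. -/
def bufAddr (v d : ℕ) : Program :=
  .seq (mov (tmp d) (adv v) (tmp (d + 1))) (addr (tmp d) 3 (tmp (d + 1)))

/-- Code that moves the natural temporaries `d`, `d + 1` to entry `nv v` of the buffer. -/
def bufStore (v d : ℕ) : Program :=
  .seq (bufAddr v (d + 2)) <| .seq (.nat (.store (tmp (d + 2)) (tmp d))) <|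
  .seq (.nat (.const (tmp (d + 3)) 1)) <|
  .seq (.nat (.add (tmp (d + 2)) (tmp (d + 2)) (tmp (d + 3)))) <|
  .nat (.store (tmp (d + 2)) (tmp (d + 1)))

/-- Code that moves entry `nv v` of the buffer to the natural temporaries `d`, `d + 1`. -/
def bufLoad (v d : ℕ) : Program :=
  .seq (bufAddr v (d + 2)) <| .seq (.nat (.load (tmp d) (tmp (d + 2)))) <|
  .seq (.nat (.const (tmp (d + 3)) 1)) <|
  .seq (.nat (.add (tmp (d + 2)) (tmp (d + 2)) (tmp (d + 3)))) <|
  .nat (.load (tmp (d + 1)) (tmp (d + 2)))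

/-- Code for a command that uses only natural temporaries from `d` on. -/
def Cmd.compile : Cmd → ℕ → Program
  | .setv v e, d => .seq (e.compile d) (mov (adv v) (tmp d) (tmp (d + 1)))
  | .tabN a v k idx e, d => .seq
      (count v k d (.seq (idx.compile (d + 3)) (.seq (e.compile (d + 4)) (bufStore v (d + 3)))))
      (count v k d (.seq (bufLoad v (d + 3)) (.seq (addr (tmp (d + 3)) (a + 5) (tmp (d + 5)))
        (.nat (.store (tmp (d + 3)) (tmp (d + 4)))))))
  | .tabR a v k idx r, d => .seq
      (count v k d (.seq (idx.compile (d + 3)) (.seq (r.compile (d + 4) 0)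
        (.seq (bufStore v (d + 3)) (.real (.store (tmp (d + 5)) (tmp 0)))))))
      (count v k d (.seq (bufLoad v (d + 3)) (.seq (.real (.load (tmp 0) (tmp (d + 5))))
        (.seq (addr (tmp (d + 3)) (a + 5) (tmp (d + 5))) (.real (.store (tmp (d + 3)) (tmp 0)))))))
  | .cmp v r s, d => .seq (r.compile d 0) (.seq (s.compile d 1)
      (.branch (.realLt (tmp 0) (tmp 1)) (.nat (.const (adv v) 1)) (.nat (.const (adv v) 0))))
  | .seq c e, d => .seq (c.compile d) (e.compile d)
  | .ite e f c c', d => .seq (e.compile d) (.seq (f.compile (d + 1))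
      (.branch (.natLt (tmp d) (tmp (d + 1))) (c.compile d) (c'.compile d)))
  | .loop v k c, d => count v k d (c.compile (d + 3))

/-- A bound for the number of steps of `count`, for `C` steps of the body. -/
def countCost (n C : ℕ) : ℕ := n * (C + 5) + 6

/-- A bound for the number of steps for the evaluation of an expression. -/
def NE.cost (sz : ℕ → ℕ) : NE → ℕ
  | .const _ => 1
  | .var _ => 2
  | .size _ => 2
  | .add e f => e.cost sz + f.cost sz + 1
  | .sub e f => e.cost sz + f.cost sz + 1
  | .arr _ e => e.cost sz + 7
  | .inp e => e.cost sz + 1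
  | .sum _ k e => countCost (sz k) (e.cost sz + 1) + 1
  | .ite e f g h => e.cost sz + f.cost sz + (g.cost sz + h.cost sz) + 1

/-- A bound for the number of steps for the evaluation of an expression. -/
def RE.cost (sz : ℕ → ℕ) : RE → ℕ
  | .const _ => 1
  | .add r s => r.cost sz + s.cost sz + 1
  | .sub r s => r.cost sz + s.cost sz + 1
  | .mul r s => r.cost sz + s.cost sz + 1
  | .div r s => r.cost sz + s.cost sz + 1
  | .arr _ e => e.cost sz + 7
  | .inp e => e.cost sz + 1
  | .sum _ k r => countCost (sz k) (r.cost sz + 1) + 1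
  | .ite e f r s => e.cost sz + f.cost sz + (r.cost sz + s.cost sz) + 1

/-- A bound for the number of steps of a command. -/
def Cmd.cost (sz : ℕ → ℕ) : Cmd → ℕ
  | .setv _ e => e.cost sz + 2
  | .tabN _ _ k idx e => countCost (sz k) (idx.cost sz + e.cost sz + 12) + countCost (sz k) 19
  | .tabR _ _ k idx r => countCost (sz k) (idx.cost sz + r.cost sz + 13) + countCost (sz k) 20
  | .cmp _ r s => r.cost sz + s.cost sz + 2
  | .seq c d => c.cost sz + d.cost sz
  | .ite e f c d => e.cost sz + f.cost sz + (c.cost sz + d.cost sz) + 1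
  | .loop _ k c => countCost (sz k) (c.cost sz)

/-! ### Correctness of the compilation -/

/-- From memory `σ`, the program halts after at most `C` steps in a memory that satisfies `Q`. -/
def Ends (inp : Memory) (p : Program) (σ : Memory) (C : ℕ) (Q : Memory → Prop) : Prop :=
  ∃ σ' T, T ≤ C ∧ Runs inp p σ σ' T ∧ Q σ'

theorem Ends.seq {inp : Memory} {p q : Program} {σ : Memory} {C C' : ℕ} {Q Q' : Memory → Prop}
    (h : Ends inp p σ C Q) (h' : ∀ σ', Q σ' → Ends inp q σ' C' Q') :
    Ends inp (.seq p q) σ (C + C') Q' := by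
  obtain ⟨σ', T, hT, hr, hq⟩ := h
  obtain ⟨σ'', T', hT', hr', hq'⟩ := h' σ' hq
  exact ⟨σ'', T + T', Nat.add_le_add hT hT', hr.seq hr', hq'⟩

theorem Ends.mono {inp : Memory} {p : Program} {σ : Memory} {C C' : ℕ} {Q Q' : Memory → Prop}
    (h : Ends inp p σ C Q) (hC : C ≤ C') (hQ : ∀ σ', Q σ' → Q' σ') : Ends inp p σ C' Q' := by
  obtain ⟨σ', T, hT, hr, hq⟩ := h
  exact ⟨σ', T, hT.trans hC, hr, hQ σ' hq⟩

theorem Ends.nat {inp : Memory} {i : NatInstr} {σ : Memory} {Q : Memory → Prop}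
    (h : Q ⟨i.exec inp.nat σ.nat, σ.real⟩) : Ends inp (.nat i) σ 1 Q :=
  ⟨_, 1, le_rfl, .nat i σ, h⟩

theorem Ends.real {inp : Memory} {i : RealInstr} {σ : Memory} {Q : Memory → Prop}
    (h : Q ⟨σ.nat, i.exec inp.real σ⟩) : Ends inp (.real i) σ 1 Q :=
  ⟨_, 1, le_rfl, .real i σ, h⟩

theorem Ends.branch {inp : Memory} {c : Test} {p q : Program} {σ : Memory} {C : ℕ}
    {Q : Memory → Prop} (h1 : c.Holds σ → Ends inp p σ C Q)
    (h2 : ¬ c.Holds σ → Ends inp q σ C Q) : Ends inp (.branch c p q) σ (C + 1) Q := by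
  by_cases hc : c.Holds σ
  · obtain ⟨σ', T, hT, hr, hq⟩ := h1 hc
    exact ⟨σ', T + 1, Nat.add_le_add_right hT 1, .branch_true hc hr, hq⟩
  · obtain ⟨σ', T, hT, hr, hq⟩ := h2 hc
    exact ⟨σ', T + 1, Nat.add_le_add_right hT 1, .branch_false hc hr, hq⟩

/-- The invariant is indexed by the number of rounds still to come, so that termination is part of
it. Each round pays one step for its test, and the failing test pays the last one. -/
theorem Ends.loop {inp : Memory} {c : Test} {p : Program} {C : ℕ} (Inv : ℕ → Memory → Prop)
    (h : ∀ i σ, Inv (i + 1) σ → c.Holds σ ∧ Ends inp p σ C (Inv i))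
    (h0 : ∀ σ, Inv 0 σ → ¬ c.Holds σ) (n : ℕ) {σ : Memory} (hσ : Inv n σ) :
    Ends inp (.loop c p) σ (n * (C + 1) + 1) (Inv 0) := by
  induction n generalizing σ with
  | zero => exact ⟨σ, 1, by omega, .loop_false (h0 σ hσ), hσ⟩
  | succ n ih =>
    obtain ⟨hc, σ', T, hT, hr, hq⟩ := h n σ hσ
    obtain ⟨σ'', T', hT', hr', hq'⟩ := ih hq
    refine ⟨σ'', T + T' + 1, ?_, .loop_true hc hr hr', hq'⟩
    rw [Nat.add_mul]
    omega

/-- The memory represents a state. -/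
structure Rep (st : St) (σ : Memory) : Prop where
  nv : ∀ v, σ.nat (16 * v + 1) = st.nv v
  sz : ∀ k, σ.nat (16 * k + 2) = st.sz k
  na : ∀ (a : Fin 8) x, σ.nat (16 * x + (a + 5)) = st.na a x
  ra : ∀ (a : Fin 8) x, σ.real (16 * x + (a + 5)) = st.ra a x

/-- The natural temporaries from `d` on, the real temporaries from `t` on, and the entries that
represent the state are the only ones in which the memories may differ. -/
structure Frame (d t : ℕ) (σ σ' : Memory) : Prop where
  nat : ∀ a, a % 16 = 0 ∧ a < 16 * d ∨ a % 16 = 3 ∨ a % 16 = 4 → σ'.nat a = σ.nat a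
  real : ∀ a, a % 16 = 0 ∧ a < 16 * t ∨ a % 16 = 4 → σ'.real a = σ.real a

theorem Frame.refl (d t : ℕ) (σ : Memory) : Frame d t σ σ := ⟨fun _ _ => rfl, fun _ _ => rfl⟩

theorem Frame.trans {d t d' t' : ℕ} {σ σ' σ'' : Memory} (h : Frame d t σ σ')
    (h' : Frame d' t' σ' σ'') (hd : d ≤ d') (ht : t ≤ t') : Frame d t σ σ'' :=
  ⟨fun a ha => (h'.nat a (by omega)).trans (h.nat a ha),
    fun a ha => (h'.real a (by omega)).trans (h.real a ha)⟩

theorem Frame.tmp_eq {d t : ℕ} {σ σ' : Memory} (h : Frame d t σ σ') {i : ℕ} (hi : i < d) :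
    σ'.nat (tmp i) = σ.nat (tmp i) := h.nat _ (by unfold tmp; omega)

theorem Frame.tmpR_eq {d t : ℕ} {σ σ' : Memory} (h : Frame d t σ σ') {i : ℕ} (hi : i < t) :
    σ'.real (tmp i) = σ.real (tmp i) := h.real _ (by unfold tmp; omega)

/-- A write to a natural address. -/
def Memory.setNat (σ : Memory) (a x : ℕ) : Memory := ⟨Function.update σ.nat a x, σ.real⟩

/-- A write to a real address. -/
def Memory.setReal (σ : Memory) (a : ℕ) (x : ℝ) : Memory := ⟨σ.nat, Function.update σ.real a x⟩

theorem Memory.setNat_self (σ : Memory) (a x : ℕ) : (σ.setNat a x).nat a = x :=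
  Function.update_self _ _ _

theorem Memory.setNat_ne (σ : Memory) {a b : ℕ} (h : b ≠ a) (x : ℕ) :
    (σ.setNat a x).nat b = σ.nat b := Function.update_of_ne h _ _

theorem Memory.setReal_self (σ : Memory) (a : ℕ) (x : ℝ) : (σ.setReal a x).real a = x :=
  Function.update_self _ _ _

theorem Memory.setReal_ne (σ : Memory) {a b : ℕ} (h : b ≠ a) (x : ℝ) :
    (σ.setReal a x).real b = σ.real b := Function.update_of_ne h _ _

theorem Memory.setNat_setNat (σ : Memory) (a x y : ℕ) :
    (σ.setNat a x).setNat a y = σ.setNat a y := by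
  simp [setNat]

theorem Memory.setNat_comm (σ : Memory) {a b : ℕ} (h : a ≠ b) (x y : ℕ) :
    (σ.setNat a x).setNat b y = (σ.setNat b y).setNat a x := by
  simp [setNat, Function.update_comm h]

/-- A write to an address that does not represent any part of the state. -/
theorem Rep.setNat {st : St} {σ : Memory} (h : Rep st σ) {a : ℕ}
    (ha : a % 16 = 0 ∨ a % 16 = 3 ∨ a % 16 = 4) (x : ℕ) : Rep st (σ.setNat a x) := by
  constructor
  · intro v; rw [← h.nv, σ.setNat_ne (by omega)]
  · intro k; rw [← h.sz, σ.setNat_ne (by omega)]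
  · intro b k; rw [← h.na, σ.setNat_ne (by omega)]
  · exact h.ra

theorem Rep.setReal {st : St} {σ : Memory} (h : Rep st σ) {a : ℕ}
    (ha : a % 16 = 0 ∨ a % 16 = 4) (x : ℝ) : Rep st (σ.setReal a x) :=
  ⟨h.nv, h.sz, h.na, fun b k => by rw [← h.ra, σ.setReal_ne (by omega)]⟩

theorem tmp_mod (d : ℕ) : tmp d % 16 = 0 := by unfold tmp; omega

theorem Rep.setTmp {st : St} {σ : Memory} (h : Rep st σ) (d x : ℕ) :
    Rep st (σ.setNat (tmp d) x) := h.setNat (Or.inl (tmp_mod d)) x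

theorem Rep.setTmpR {st : St} {σ : Memory} (h : Rep st σ) (t : ℕ) (x : ℝ) :
    Rep st (σ.setReal (tmp t) x) := h.setReal (Or.inl (tmp_mod t)) x

theorem Rep.setv {st : St} {σ : Memory} (h : Rep st σ) (v x : ℕ) :
    Rep (st.setv v x) (σ.setNat (adv v) x) := by
  unfold adv St.setv
  constructor
  · intro w
    by_cases hw : w = v
    · subst hw; simp [Memory.setNat_self]
    · simp only [Function.update_of_ne hw]
      rw [← h.nv, σ.setNat_ne (by omega)]
  · intro k; rw [← h.sz, σ.setNat_ne (by omega)]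
  · intro a k; rw [← h.na, σ.setNat_ne (by omega)]
  · exact h.ra

theorem Rep.setN {st : St} {σ : Memory} (h : Rep st σ) (a : Fin 8) (i x : ℕ) :
    Rep (st.setN a (Function.update (st.na a) i x)) (σ.setNat (16 * i + (a + 5)) x) := by
  unfold St.setN
  constructor
  · intro v; rw [← h.nv, σ.setNat_ne (by omega)]
  · intro k; rw [← h.sz, σ.setNat_ne (by omega)]
  · intro b k
    by_cases hb : b = a
    · subst hb
      by_cases hk : k = i
      · subst hk; simp [Memory.setNat_self]
      · rw [σ.setNat_ne (by omega), h.na]; simp [hk]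
    · have : (b : ℕ) ≠ a := fun e => hb (Fin.ext e)
      rw [σ.setNat_ne (by omega), h.na]; simp [hb]
  · exact h.ra

theorem Rep.setR {st : St} {σ : Memory} (h : Rep st σ) (a : Fin 8) (i : ℕ) (x : ℝ) :
    Rep (st.setR a (Function.update (st.ra a) i x)) (σ.setReal (16 * i + (a + 5)) x) := by
  refine ⟨h.nv, h.sz, h.na, fun b k => ?_⟩
  simp only [St.setR]
  by_cases hb : b = a
  · subst hb
    by_cases hk : k = i
    · subst hk; simp [Memory.setReal_self]
    · rw [σ.setReal_ne (by omega), h.ra]; simp [hk]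
  · have : (b : ℕ) ≠ a := fun e => hb (Fin.ext e)
    rw [σ.setReal_ne (by omega), h.ra]; simp [hb]

theorem Frame.setTmp (d t : ℕ) (σ : Memory) {d' : ℕ} (hd : d ≤ d') (x : ℕ) :
    Frame d t σ (σ.setNat (tmp d') x) := by
  unfold tmp
  exact ⟨fun i hi => σ.setNat_ne (by omega) _, fun _ _ => rfl⟩

theorem Frame.setTmpR (d t : ℕ) (σ : Memory) {t' : ℕ} (ht : t ≤ t') (x : ℝ) :
    Frame d t σ (σ.setReal (tmp t') x) := by
  unfold tmp
  exact ⟨fun _ _ => rfl, fun i hi => σ.setReal_ne (by omega) _⟩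

theorem tmp_inj {d d' : ℕ} : tmp d = tmp d' ↔ d = d' := by unfold tmp; omega

theorem Ends.mov {inp : Memory} {σ : Memory} {d a z : ℕ} (h : a ≠ z) :
    Ends inp (mov d a z) σ 2 fun σ' => σ' = (σ.setNat z 0).setNat d (σ.nat a) := by
  refine ⟨_, _, le_rfl, (Runs.nat _ _).seq (Runs.nat _ _), ?_⟩
  simp [Memory.setNat, NatInstr.exec, h]

theorem Ends.addr {inp : Memory} {σ : Memory} {d c z : ℕ} (h : d ≠ z) :
    Ends inp (addr d c z) σ 6 fun σ' => σ' = (σ.setNat z c).setNat d (16 * σ.nat d + c) := by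
  refine ⟨_, _, le_rfl, (Runs.nat _ _).seq ((Runs.nat _ _).seq ((Runs.nat _ _).seq
    ((Runs.nat _ _).seq ((Runs.nat _ _).seq (Runs.nat _ _))))), ?_⟩
  simp only [Memory.setNat, NatInstr.exec, Memory.mk.injEq, and_true, Function.update_self,
    Function.update_of_ne h]
  funext x
  by_cases hx : x = d
  · subst hx
    simp only [Function.update_self]
    omega
  · by_cases hz : x = z
    · subst hz
      simp [hx]
    · simp [hx, hz]

/-- The specification of counted loops. The states `S i` are those before the rounds; `J` is what
is known in addition, which must not depend on the scalar `v` and on the temporaries `d`, `d + 1`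
and `d + 2`. -/
theorem Ends.count {inp : Memory} {v k d n C : ℕ} {body : Program} (S : ℕ → St)
    (J : ℕ → Memory → Prop) (hS : ∀ i, (S i).sz k = n)
    (hJ : ∀ i σ a x, a = tmp d ∨ a = tmp (d + 1) ∨ a = tmp (d + 2) ∨ a = adv v → J i σ →
      J i (σ.setNat a x))
    (hbody : ∀ i < n, ∀ σ, Rep ((S i).setv v i) σ → J i σ → Ends inp body σ C fun σ' =>
      Rep (S (i + 1)) σ' ∧ J (i + 1) σ' ∧ σ'.nat (tmp d) = σ.nat (tmp d) ∧
        σ'.nat (tmp (d + 1)) = σ.nat (tmp (d + 1)))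
    {σ : Memory} (h0 : Rep (S 0) σ) (hJ0 : J 0 σ) :
    Ends inp (count v k d body) σ (countCost n C) fun σ' =>
      Rep ((S n).setv v ((S 0).nv v)) σ' ∧ J n σ' := by
  have t1 : tmp d ≠ tmp (d + 2) := fun h => by rw [tmp_inj] at h; omega
  have t2 : tmp (d + 1) ≠ tmp (d + 2) := fun h => by rw [tmp_inj] at h; omega
  have t3 : tmp d ≠ tmp (d + 1) := fun h => by rw [tmp_inj] at h; omega
  have a1 : ∀ i, adv v ≠ tmp i := fun i => by unfold adv tmp; omega
  have hloop : ∀ σ, Rep (S 0) σ ∧ J 0 σ ∧ σ.nat (tmp d) = (S 0).nv v ∧ σ.nat (tmp (d + 1)) = 0 →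
      Ends inp (.loop (.natLt (tmp (d + 1)) (ads k))
        (.seq (Program.mov (adv v) (tmp (d + 1)) (tmp (d + 2))) <| .seq body <|
          .seq (.nat (.const (tmp (d + 2)) 1))
            (.nat (.add (tmp (d + 1)) (tmp (d + 1)) (tmp (d + 2))))))
        σ (n * ((2 + (C + (1 + 1))) + 1) + 1)
        fun σ' => Rep (S n) σ' ∧ J n σ' ∧ σ'.nat (tmp d) = (S 0).nv v := by
    intro σ hσ
    refine (Ends.loop (fun j σ => j ≤ n ∧ Rep (S (n - j)) σ ∧ J (n - j) σ ∧
      σ.nat (tmp d) = (S 0).nv v ∧ σ.nat (tmp (d + 1)) = n - j) ?_ ?_ n ?_).mono le_rfl ?_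
    · rintro j σ ⟨hj, hr, hJ', hd, hi⟩
      obtain ⟨i, hi'⟩ : ∃ i, i = n - (j + 1) := ⟨_, rfl⟩
      rw [← hi'] at hr hJ' hi
      have hi2 : n - j = i + 1 := by omega
      refine ⟨?_, ?_⟩
      · change σ.nat (tmp (d + 1)) < σ.nat (ads k)
        have := hr.sz k
        rw [hS] at this
        rw [hi, ads, this]
        omega
      · refine (Ends.mov t2).seq ?_
        rintro _ rfl
        rw [hi]
        refine (hbody i (by omega) _ ((hr.setTmp _ _).setv v i)
          (hJ _ _ _ _ (by simp) (hJ _ _ _ _ (by simp) hJ'))).seq ?_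
        rintro σ' ⟨hr', hJ'', hd', hi''⟩
        rw [Memory.setNat_ne _ (a1 d).symm, Memory.setNat_ne _ t1, hd] at hd'
        rw [Memory.setNat_ne _ (a1 _).symm, Memory.setNat_ne _ t2, hi] at hi''
        refine (Ends.nat (Q := fun τ => τ = σ'.setNat (tmp (d + 2)) 1) rfl).seq ?_
        rintro _ rfl
        refine Ends.nat ?_
        change j ≤ n ∧ Rep _ ((σ'.setNat (tmp (d + 2)) 1).setNat (tmp (d + 1)) _) ∧
          J _ ((σ'.setNat (tmp (d + 2)) 1).setNat (tmp (d + 1)) _) ∧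
          ((σ'.setNat (tmp (d + 2)) 1).setNat (tmp (d + 1)) _).nat (tmp d) = _ ∧
          ((σ'.setNat (tmp (d + 2)) 1).setNat (tmp (d + 1)) _).nat (tmp (d + 1)) = _
        rw [hi2]
        refine ⟨by omega, (hr'.setTmp _ _).setTmp _ _,
          hJ _ _ _ _ (by simp) (hJ _ _ _ _ (by simp) hJ''), ?_, ?_⟩
        · rw [Memory.setNat_ne _ t3, Memory.setNat_ne _ t1, hd']
        · rw [Memory.setNat_self, Memory.setNat_self, Memory.setNat_ne _ t2, hi'']
    · rintro σ ⟨-, hr, -, -, hi⟩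
      change ¬ σ.nat (tmp (d + 1)) < σ.nat (ads k)
      have := hr.sz k
      rw [hS] at this
      rw [hi, ads, this]
      omega
    · simpa using hσ
    · rintro σ' ⟨-, h1, h2, h3, -⟩
      exact ⟨h1, h2, h3⟩
  -- Saving the scalar costs 2, clearing the counter 1, and restoring the scalar 2. A round consists
  -- of a copy of the counter (2), the body, the increment (2) and the test (1). The total is `n *
  -- (C + 5) + 6`.
  refine Ends.mono (C := 2 + (1 + ((n * ((2 + (C + (1 + 1))) + 1) + 1) + 2))) ?_
    (by unfold countCost; ring_nf; omega) (fun _ h => h)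
  refine (Ends.mov (a1 _)).seq ?_
  rintro _ rfl
  refine (Ends.nat (Q := fun τ => τ = ((σ.setNat (tmp (d + 2)) 0).setNat (tmp d)
    (σ.nat (adv v))).setNat (tmp (d + 1)) 0) rfl).seq ?_
  rintro _ rfl
  refine (hloop _ ⟨((h0.setTmp _ _).setTmp _ _).setTmp _ _, hJ _ _ _ _ (by simp)
    (hJ _ _ _ _ (by simp) (hJ _ _ _ _ (by simp) hJ0)), ?_, ?_⟩).seq ?_
  · rw [Memory.setNat_ne _ t3, Memory.setNat_self]
    exact h0.nv v
  · rw [Memory.setNat_self]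
  · rintro σ' ⟨hr, hJ', hd⟩
    refine (Ends.mov t1).mono le_rfl ?_
    rintro _ rfl
    rw [hd]
    exact ⟨(hr.setTmp _ _).setv v _, hJ _ _ _ _ (by simp) (hJ _ _ _ _ (by simp) hJ')⟩

/-- What holds after the evaluation of an expression into natural temporary `d`. -/
structure NatDone (st : St) (d : ℕ) (σ : Memory) (x : ℕ) (σ' : Memory) : Prop where
  rep : Rep st σ'
  frame : ∀ t, Frame d t σ σ'
  val : σ'.nat (tmp d) = x

theorem Ends.nat_setNat {inp : Memory} {i : NatInstr} {σ : Memory} {a x : ℕ}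
    {Q : Memory → Prop} (h : i.exec inp.nat σ.nat = Function.update σ.nat a x)
    (hQ : Q (σ.setNat a x)) : Ends inp (.nat i) σ 1 Q := by
  refine Ends.nat ?_
  rw [h]
  exact hQ

theorem Ends.real_setReal {inp : Memory} {i : RealInstr} {σ : Memory} {a : ℕ} {x : ℝ}
    {Q : Memory → Prop} (h : i.exec inp.real σ = Function.update σ.real a x)
    (hQ : Q (σ.setReal a x)) : Ends inp (.real i) σ 1 Q := by
  refine Ends.real ?_
  rw [h]
  exact hQ

theorem NatDone.trans {st : St} {d x y : ℕ} {σ σ' σ'' : Memory}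
    (h : NatDone st d σ x σ') (h' : NatDone st (d + 1) σ' y σ'') :
    Rep st σ'' ∧ (∀ t, Frame d t σ σ'') ∧ σ''.nat (tmp d) = x ∧ σ''.nat (tmp (d + 1)) = y :=
  ⟨h'.rep, fun t => (h.frame t).trans (h'.frame t) (Nat.le_succ d) le_rfl,
    ((h'.frame 0).tmp_eq (Nat.lt_succ_self d)).trans h.val, h'.val⟩

theorem NatDone.setTmp {st : St} {d : ℕ} {σ σ' : Memory} (hr : Rep st σ')
    (hf : ∀ t, Frame d t σ σ') (x : ℕ) : NatDone st d σ x (σ'.setNat (tmp d) x) :=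
  ⟨hr.setTmp _ _, fun t => (hf t).trans (Frame.setTmp d t _ le_rfl _) le_rfl le_rfl,
    Memory.setNat_self _ _ _⟩

theorem St.setv_setv (st : St) (v x y : ℕ) : (st.setv v x).setv v y = st.setv v y := by
  simp [setv]

theorem St.setv_self (st : St) (v : ℕ) : st.setv v (st.nv v) = st := by
  simp [setv]

theorem St.setv_nv_self (st : St) (v x : ℕ) : (st.setv v x).nv v = x := by
  simp [setv]

/-- The specification of counted loops whose bodies leave the loop variable alone. -/
theorem Ends.count_frame {inp : Memory} {v k d n C : ℕ} {body : Program} (S : ℕ → St)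
    (J : ℕ → Memory → Prop) (hS : ∀ i, (S i).sz k = n) (hv : ∀ i, (S i).nv v = (S 0).nv v)
    (hJ : ∀ i σ a x, a = tmp d ∨ a = tmp (d + 1) ∨ a = tmp (d + 2) ∨ a = adv v → J i σ →
      J i (σ.setNat a x))
    (hbody : ∀ i < n, ∀ σ, Rep ((S i).setv v i) σ → J i σ → Ends inp body σ C fun σ' =>
      Rep ((S (i + 1)).setv v i) σ' ∧ J (i + 1) σ' ∧ σ'.nat (tmp d) = σ.nat (tmp d) ∧
        σ'.nat (tmp (d + 1)) = σ.nat (tmp (d + 1)))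
    {σ : Memory} (h0 : Rep (S 0) σ) (hJ0 : J 0 σ) :
    Ends inp (Program.count v k d body) σ (countCost n C) fun σ' => Rep (S n) σ' ∧ J n σ' := by
  -- After a round the scalar still holds the index of that round, so before round `i > 0` it
  -- contains `i - 1`; only before round `0` is it the original value. The final restoration removes
  -- the difference.
  have := Ends.count (inp := inp) (v := v) (k := k) (d := d) (n := n) (C := C) (body := body)
    (fun i => if i = 0 then S 0 else (S i).setv v (i - 1)) J
    (by intro i; split_ifs; exacts [hS 0, hS i]) hJ
    (by
      intro i hi σ hr hJi
      have e : (if i = 0 then S 0 else (S i).setv v (i - 1)).setv v i = (S i).setv v i := by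
        split_ifs with h
        · rw [h]
        · rw [St.setv_setv]
      rw [e] at hr
      simpa using hbody i hi σ hr hJi)
    (σ := σ) (by simpa using h0) hJ0
  refine this.mono le_rfl ?_
  rintro σ' ⟨hr, h⟩
  refine ⟨?_, h⟩
  have e : (if n = 0 then S 0 else (S n).setv v (n - 1)).setv v
      ((if (0 : ℕ) = 0 then S 0 else (S 0).setv v (0 - 1)).nv v) = S n := by
    rw [if_pos rfl]
    split_ifs with h
    · rw [h, St.setv_self]
    · rw [St.setv_setv, ← hv n, St.setv_self]
  rw [← e]
  exact hr

/-- Temporaries are used as a stack: code for level `d` leaves all lower natural temporaries and the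
buffers alone. That frame condition, carried through the induction, protects the values of the
operands evaluated earlier. -/
theorem NE.ends {inp : Memory} (e : NE) (st : St) (d : ℕ) {σ : Memory} (h : Rep st σ) :
    Ends inp (e.compile d) σ (e.cost st.sz) (NatDone st d σ (e.eval inp st)) := by
  induction e generalizing st d σ with
  | const c => exact Ends.nat_setNat rfl (NatDone.setTmp h (fun t => Frame.refl d t σ) c)
  | var v =>
    refine (Ends.mov (by unfold adv tmp; omega)).mono le_rfl ?_
    rintro _ rfl
    rw [adv, h.nv]
    exact NatDone.setTmp (h.setTmp _ _) (fun t => Frame.setTmp d t σ (Nat.le_succ d) _) _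
  | size k =>
    refine (Ends.mov (by unfold ads tmp; omega)).mono le_rfl ?_
    rintro _ rfl
    rw [ads, h.sz]
    exact NatDone.setTmp (h.setTmp _ _) (fun t => Frame.setTmp d t σ (Nat.le_succ d) _) _
  | add e f he hf =>
    refine ((he st d h).seq fun σ1 h1 => (hf st (d + 1) h1.rep).seq fun σ2 h2 =>
      Ends.nat_setNat rfl ?_).mono (by rw [cost]; omega) fun _ h => h
    obtain ⟨h3, h4, h5, h6⟩ := h1.trans h2
    rw [h5, h6]
    exact NatDone.setTmp h3 h4 _
  | sub e f he hf =>
    refine ((he st d h).seq fun σ1 h1 => (hf st (d + 1) h1.rep).seq fun σ2 h2 =>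
      Ends.nat_setNat rfl ?_).mono (by rw [cost]; omega) fun _ h => h
    obtain ⟨h3, h4, h5, h6⟩ := h1.trans h2
    rw [h5, h6]
    exact NatDone.setTmp h3 h4 _
  | arr a e he =>
    refine (he st d h).seq fun σ1 h1 => (Ends.mono (C := 6 + 1)
      ((Ends.addr (by rw [ne_eq, tmp_inj]; omega)).seq ?_) le_rfl fun _ h => h)
    rintro _ rfl
    refine Ends.nat_setNat rfl ?_
    have hr := (h1.rep.setTmp (d + 1) (a + 5)).setTmp d (16 * σ1.nat (tmp d) + (a + 5))
    rw [Memory.setNat_self, hr.na, h1.val]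
    refine NatDone.setTmp (by rw [h1.val] at hr; exact hr) (fun t => ?_) _
    exact ((h1.frame t).trans (Frame.setTmp d t _ (Nat.le_succ d) _) le_rfl le_rfl).trans
      (Frame.setTmp d t _ le_rfl _) le_rfl le_rfl
  | inp e he =>
    refine (he st d h).seq fun σ1 h1 => Ends.nat_setNat rfl ?_
    rw [h1.val]
    exact NatDone.setTmp h1.rep h1.frame _
  | sum v k e he =>
    refine ((Ends.nat_setNat (Q := fun τ => τ = σ.setNat (tmp d) 0) rfl rfl).seq ?_).mono
      (C' := (NE.sum v k e).cost st.sz) (by rw [cost, add_comm]) fun _ h => h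
    rintro _ rfl
    -- The partial sum lives in temporary `d`, the loop control in `d + 1`, `d + 2`, `d + 3`, and
    -- the summand is evaluated from `d + 4` on.
    refine (Ends.count_frame (fun _ => st) (fun i τ => (∀ t, Frame d t σ τ) ∧
      τ.nat (tmp d) = ∑ j ∈ Finset.range i, e.eval inp (st.setv v j)) (fun _ => rfl) (fun _ => rfl) ?_ ?_
      (h.setTmp _ _) ?_).mono
      le_rfl ?_
    · rintro i τ a x ha ⟨h1, h2⟩
      have hne : tmp d ≠ a := by unfold tmp adv at *; omega
      refine ⟨fun t => (h1 t).trans (d' := d) (t' := t) ⟨fun b hb => ?_, fun _ _ => rfl⟩ le_rfl le_rfl, ?_⟩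
      · refine Memory.setNat_ne _ ?_ _
        unfold tmp adv at *
        omega
      · rw [Memory.setNat_ne _ hne, h2]
    · rintro i hi τ hr ⟨h1, h2⟩
      refine (he (st.setv v i) (d + 4) hr).seq fun σ1 h3 => Ends.nat_setNat rfl ?_
      have hne : ∀ j, j ≠ 0 → tmp (d + j) ≠ tmp d := fun j hj => by rw [ne_eq, tmp_inj]; omega
      rw [h3.val, (h3.frame 0).tmp_eq (by omega), h2]
      refine ⟨h3.rep.setTmp _ _, ⟨fun t => ?_, ?_⟩, ?_, ?_⟩
      · exact ((h1 t).trans (h3.frame t) (by omega) le_rfl).trans (Frame.setTmp d t _ le_rfl _)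
          le_rfl le_rfl
      · rw [Memory.setNat_self, Finset.sum_range_succ]
      · rw [Memory.setNat_ne _ (hne 1 one_ne_zero), (h3.frame 0).tmp_eq (by omega)]
      · rw [Memory.setNat_ne _ (hne 2 two_ne_zero), (h3.frame 0).tmp_eq (by omega)]
    · exact ⟨fun t => Frame.setTmp d t σ le_rfl _, by simp [Memory.setNat_self]⟩
    · rintro σ' ⟨hr, hf, hv⟩
      exact ⟨hr, hf, hv⟩
  | ite e f g g' he hf hg hg' =>
    refine ((he st d h).seq fun σ1 h1 => (hf st (d + 1) h1.rep).seq
      (C' := (g.cost st.sz + g'.cost st.sz) + 1) fun σ2 h2 => Ends.branch ?_ ?_).mono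
      (by rw [cost]; omega) fun _ h => h
    · intro hc
      obtain ⟨h3, h4, h5, h6⟩ := h1.trans h2
      have hc' : e.eval inp st < f.eval inp st := by rw [← h5, ← h6]; exact hc
      refine (hg st d h3).mono (by omega) fun σ' h' => ?_
      rw [eval, if_pos hc']
      exact ⟨h'.rep, fun t => (h4 t).trans (h'.frame t) le_rfl le_rfl, h'.val⟩
    · intro hc
      obtain ⟨h3, h4, h5, h6⟩ := h1.trans h2
      have hc' : ¬ e.eval inp st < f.eval inp st := by rw [← h5, ← h6]; exact hc
      refine (hg' st d h3).mono (by omega) fun σ' h' => ?_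
      rw [eval, if_neg hc']
      exact ⟨h'.rep, fun t => (h4 t).trans (h'.frame t) le_rfl le_rfl, h'.val⟩

/-- What holds after the evaluation of an expression into real temporary `t`. -/
structure RealDone (st : St) (d t : ℕ) (σ : Memory) (x : ℝ) (σ' : Memory) : Prop where
  rep : Rep st σ'
  frame : Frame d t σ σ'
  val : σ'.real (tmp t) = x

theorem RealDone.trans {st : St} {d t : ℕ} {x y : ℝ} {σ σ' σ'' : Memory}
    (h : RealDone st d t σ x σ') (h' : RealDone st d (t + 1) σ' y σ'') :
    Rep st σ'' ∧ Frame d t σ σ'' ∧ σ''.real (tmp t) = x ∧ σ''.real (tmp (t + 1)) = y :=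
  ⟨h'.rep, h.frame.trans h'.frame le_rfl (Nat.le_succ t),
    (h'.frame.tmpR_eq (Nat.lt_succ_self t)).trans h.val, h'.val⟩

theorem RealDone.setTmpR {st : St} {d t : ℕ} {σ σ' : Memory} (hr : Rep st σ')
    (hf : Frame d t σ σ') (x : ℝ) : RealDone st d t σ x (σ'.setReal (tmp t) x) :=
  ⟨hr.setTmpR _ _, hf.trans (Frame.setTmpR d t _ le_rfl _) le_rfl le_rfl,
    Memory.setReal_self _ _ _⟩

theorem RE.ends_binary {inp : Memory} {r s : RE} {st : St} {d t : ℕ} {σ : Memory}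
    {i : RealInstr} {f : ℝ → ℝ → ℝ}
    (hi : ∀ σ, i.exec inp.real σ =
      Function.update σ.real (tmp t) (f (σ.real (tmp t)) (σ.real (tmp (t + 1)))))
    (hr : Ends inp (r.compile d t) σ (r.cost st.sz) (RealDone st d t σ (r.eval inp st)))
    (hs : ∀ σ, Rep st σ → Ends inp (s.compile d (t + 1)) σ (s.cost st.sz)
      (RealDone st d (t + 1) σ (s.eval inp st))) :
    Ends inp (.seq (r.compile d t) (.seq (s.compile d (t + 1)) (.real i))) σ
      (r.cost st.sz + s.cost st.sz + 1)
      (RealDone st d t σ (f (r.eval inp st) (s.eval inp st))) := by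
  refine (hr.seq fun σ1 h1 => (hs σ1 h1.rep).seq fun σ2 h2 =>
    Ends.real_setReal (hi σ2) ?_).mono (by omega) fun _ h => h
  obtain ⟨h3, h4, h5, h6⟩ := h1.trans h2
  rw [h5, h6]
  exact RealDone.setTmpR h3 h4 _

theorem RE.ends {inp : Memory} (r : RE) (st : St) (d t : ℕ) {σ : Memory} (h : Rep st σ) :
    Ends inp (r.compile d t) σ (r.cost st.sz) (RealDone st d t σ (r.eval inp st)) := by
  induction r generalizing st d t σ with
  | const c => exact Ends.real_setReal rfl (RealDone.setTmpR h (Frame.refl d t σ) c)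
  | add r s hr hs => exact RE.ends_binary (fun _ => rfl) (hr st d t h) fun _ h => hs st d (t + 1) h
  | sub r s hr hs => exact RE.ends_binary (fun _ => rfl) (hr st d t h) fun _ h => hs st d (t + 1) h
  | mul r s hr hs => exact RE.ends_binary (fun _ => rfl) (hr st d t h) fun _ h => hs st d (t + 1) h
  | div r s hr hs => exact RE.ends_binary (fun _ => rfl) (hr st d t h) fun _ h => hs st d (t + 1) h
  | arr a e =>
    refine (e.ends st d h).seq fun σ1 h1 => (Ends.mono (C := 6 + 1)
      ((Ends.addr (by rw [ne_eq, tmp_inj]; omega)).seq ?_) le_rfl fun _ h => h)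
    rintro _ rfl
    refine Ends.real_setReal rfl ?_
    have hr := (h1.rep.setTmp (d + 1) (a + 5)).setTmp d (16 * σ1.nat (tmp d) + (a + 5))
    rw [Memory.setNat_self, hr.ra, h1.val]
    refine RealDone.setTmpR (by rw [h1.val] at hr; exact hr) ?_ _
    exact ((h1.frame t).trans (Frame.setTmp d t _ (Nat.le_succ d) _) le_rfl le_rfl).trans
      (Frame.setTmp d t _ le_rfl _) le_rfl le_rfl
  | inp e =>
    refine (e.ends st d h).seq fun σ1 h1 => Ends.real_setReal rfl ?_
    rw [h1.val]
    exact RealDone.setTmpR h1.rep (h1.frame t) _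
  | sum v k r hr =>
    refine ((Ends.real_setReal (Q := fun τ => τ = σ.setReal (tmp t) 0)
      (by simp only [RealInstr.exec, Nat.cast_zero]) rfl).seq ?_).mono
      (C' := (RE.sum v k r).cost st.sz) (by rw [cost, add_comm]) fun _ h => h
    rintro _ rfl
    refine (Ends.count_frame (fun _ => st) (fun i τ => Frame d t σ τ ∧
      τ.real (tmp t) = ∑ j ∈ Finset.range i, r.eval inp (st.setv v j)) (fun _ => rfl) (fun _ => rfl) ?_ ?_
      (h.setTmpR _ _) ?_).mono
      le_rfl ?_
    · rintro i τ a x ha ⟨h1, h2⟩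
      refine ⟨h1.trans (d' := d) (t' := t) ⟨fun b hb => ?_, fun _ _ => rfl⟩ le_rfl le_rfl, h2⟩
      refine Memory.setNat_ne _ ?_ _
      unfold tmp adv at *
      omega
    · rintro i hi τ hrep ⟨h1, h2⟩
      refine (hr (st.setv v i) (d + 3) (t + 1) hrep).seq fun σ1 h3 => Ends.real_setReal rfl ?_
      rw [h3.val, h3.frame.tmpR_eq (by omega), h2]
      refine ⟨h3.rep.setTmpR _ _, ⟨?_, ?_⟩, h3.frame.tmp_eq (by omega), h3.frame.tmp_eq (by omega)⟩
      · exact (h1.trans h3.frame (by omega) (by omega)).trans (Frame.setTmpR d t _ le_rfl _)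
          le_rfl le_rfl
      · rw [Memory.setReal_self, Finset.sum_range_succ]
    · exact ⟨Frame.setTmpR d t σ le_rfl _, by simp [Memory.setReal_self]⟩
    · rintro σ' ⟨hr, hf, hv⟩
      exact ⟨hr, hf, hv⟩
  | ite e f g g' hg hg' =>
    refine ((e.ends st d h).seq fun σ1 h1 => (f.ends st (d + 1) h1.rep).seq
      (C' := (g.cost st.sz + g'.cost st.sz) + 1) fun σ2 h2 => Ends.branch ?_ ?_).mono
      (by rw [cost]; omega) fun _ h => h
    · intro hc
      obtain ⟨h3, h4, h5, h6⟩ := h1.trans h2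
      have hc' : e.eval inp st < f.eval inp st := by rw [← h5, ← h6]; exact hc
      refine (hg st d t h3).mono (by omega) fun σ' h' => ?_
      rw [eval, if_pos hc']
      exact ⟨h'.rep, (h4 t).trans h'.frame le_rfl le_rfl, h'.val⟩
    · intro hc
      obtain ⟨h3, h4, h5, h6⟩ := h1.trans h2
      have hc' : ¬ e.eval inp st < f.eval inp st := by rw [← h5, ← h6]; exact hc
      refine (hg' st d t h3).mono (by omega) fun σ' h' => ?_
      rw [eval, if_neg hc']
      exact ⟨h'.rep, (h4 t).trans h'.frame le_rfl le_rfl, h'.val⟩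

theorem Ends.bufAddr {inp : Memory} {v i d : ℕ} {σ : Memory} (h : σ.nat (adv v) = i) :
    Ends inp (bufAddr v d) σ 8 fun σ' =>
      σ' = (σ.setNat (tmp (d + 1)) 3).setNat (tmp d) (16 * i + 3) := by
  have hne : tmp d ≠ tmp (d + 1) := by rw [ne_eq, tmp_inj]; omega
  refine (Ends.mov (by unfold adv tmp; omega)).seq (C' := 6) ?_
  rintro _ rfl
  refine (Ends.addr hne).mono le_rfl ?_
  rintro _ rfl
  rw [Memory.setNat_self, h, Memory.setNat_comm _ hne, Memory.setNat_setNat, Memory.setNat_setNat]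

/-- The conclusion also records the address left in temporary `d + 2`: real assignments reuse it to
put their value at the same address of the real memory. -/
theorem Ends.bufStore {inp : Memory} {v i d : ℕ} {st : St} {σ : Memory}
    (h : Rep (st.setv v i) σ) :
    Ends inp (bufStore v d) σ 12 fun σ' => Rep (st.setv v i) σ' ∧ σ'.real = σ.real ∧
      σ'.nat (16 * i + 3) = σ.nat (tmp d) ∧ σ'.nat (16 * i + 4) = σ.nat (tmp (d + 1)) ∧
      σ'.nat (tmp (d + 2)) = 16 * i + 4 ∧
      ∀ a, a ≠ 16 * i + 3 → a ≠ 16 * i + 4 → (a % 16 = 0 → a < 16 * (d + 2)) →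
        σ'.nat a = σ.nat a := by
  have hi : σ.nat (adv v) = i := (h.nv v).trans (St.setv_nv_self _ _ _)
  have n1 : tmp (d + 2 + 1) ≠ tmp (d + 2) := by rw [ne_eq, tmp_inj]; omega
  have n2 : tmp d ≠ tmp (d + 2) := by rw [ne_eq, tmp_inj]; omega
  have n3 : tmp d ≠ tmp (d + 2 + 1) := by rw [ne_eq, tmp_inj]; omega
  have n4 : tmp (d + 1) ≠ tmp (d + 2) := by rw [ne_eq, tmp_inj]; omega
  have n5 : tmp (d + 1) ≠ tmp (d + 2 + 1) := by rw [ne_eq, tmp_inj]; omega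
  have n6 : ∀ j r, r = 3 ∨ r = 4 → tmp j ≠ 16 * i + r := by unfold tmp; omega
  have h1 := (h.setTmp (d + 2 + 1) 3).setTmp (d + 2) (16 * i + 3)
  refine (Ends.bufAddr hi).seq (C' := 4) ?_
  rintro _ rfl
  have e1 : ((σ.setNat (tmp (d + 2 + 1)) 3).setNat (tmp (d + 2)) (16 * i + 3)).nat (tmp (d + 2)) =
    16 * i + 3 := Memory.setNat_self _ _ _
  have e2 : ∀ a, a ≠ tmp (d + 2) → a ≠ tmp (d + 2 + 1) → ((σ.setNat (tmp (d + 2 + 1)) 3).setNat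
      (tmp (d + 2)) (16 * i + 3)).nat a = σ.nat a := fun a ha ha' => by
    rw [Memory.setNat_ne _ ha, Memory.setNat_ne _ ha']
  have e3 : ((σ.setNat (tmp (d + 2 + 1)) 3).setNat (tmp (d + 2)) (16 * i + 3)).real = σ.real := rfl
  generalize (σ.setNat (tmp (d + 2 + 1)) 3).setNat (tmp (d + 2)) (16 * i + 3) = σ1 at *
  refine (Ends.nat_setNat (a := 16 * i + 3) (x := σ.nat (tmp d))
    (Q := fun τ => τ = σ1.setNat (16 * i + 3) (σ.nat (tmp d)))
    (by rw [NatInstr.exec, e1, e2 _ n2 n3]) rfl).seq (C' := 3) ?_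
  rintro _ rfl
  refine (Ends.nat_setNat (Q := fun τ => τ = _) rfl rfl).seq (C' := 2) ?_
  rintro _ rfl
  refine (Ends.nat_setNat (a := tmp (d + 2)) (x := 16 * i + 4) (Q := fun τ => τ = _) ?_ rfl).seq
    (C' := 1) ?_
  · rw [NatInstr.exec, Memory.setNat_self, Memory.setNat_ne _ n1.symm,
      Memory.setNat_ne _ (n6 _ 3 (by simp)), e1]
  rintro _ rfl
  refine Ends.nat_setNat (a := 16 * i + 4) (x := σ.nat (tmp (d + 1))) ?_ ⟨?_, e3, ?_⟩
  · rw [NatInstr.exec, Memory.setNat_self, Memory.setNat_ne _ n4, Memory.setNat_ne _ n5,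
      Memory.setNat_ne _ (n6 _ 3 (by simp)), e2 _ n4 n5]
  · exact Rep.setNat (Rep.setTmp (Rep.setTmp (Rep.setNat h1 (by omega) _) _ _) _ _) (by omega) _
  · refine ⟨?_, Memory.setNat_self _ _ _, ?_, ?_⟩
    · rw [Memory.setNat_ne _ (by omega), Memory.setNat_ne _ (n6 _ 3 (by simp)).symm,
        Memory.setNat_ne _ (n6 _ 3 (by simp)).symm, Memory.setNat_self]
    · rw [Memory.setNat_ne _ (n6 _ 4 (by simp)), Memory.setNat_self]
    · intro a h2 h3 h4
      have n7 : a ≠ tmp (d + 2) := by unfold tmp; omega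
      have n8 : a ≠ tmp (d + 2 + 1) := by unfold tmp; omega
      rw [Memory.setNat_ne _ h3, Memory.setNat_ne _ n7, Memory.setNat_ne _ n8,
        Memory.setNat_ne _ h2, e2 _ n7 n8]

theorem Ends.bufLoad {inp : Memory} {v i d : ℕ} {st : St} {σ : Memory}
    (h : Rep (st.setv v i) σ) :
    Ends inp (bufLoad v d) σ 12 fun σ' => Rep (st.setv v i) σ' ∧ σ'.real = σ.real ∧
      σ'.nat (tmp d) = σ.nat (16 * i + 3) ∧ σ'.nat (tmp (d + 1)) = σ.nat (16 * i + 4) ∧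
      σ'.nat (tmp (d + 2)) = 16 * i + 4 ∧
      ∀ a, (a % 16 = 0 → a < 16 * d) → σ'.nat a = σ.nat a := by
  have hi : σ.nat (adv v) = i := (h.nv v).trans (St.setv_nv_self _ _ _)
  have n1 : tmp (d + 2 + 1) ≠ tmp (d + 2) := by rw [ne_eq, tmp_inj]; omega
  have n2 : tmp d ≠ tmp (d + 2) := by rw [ne_eq, tmp_inj]; omega
  have n3 : tmp d ≠ tmp (d + 2 + 1) := by rw [ne_eq, tmp_inj]; omega
  have n4 : tmp (d + 1) ≠ tmp (d + 2) := by rw [ne_eq, tmp_inj]; omega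
  have n5 : tmp (d + 1) ≠ tmp (d + 2 + 1) := by rw [ne_eq, tmp_inj]; omega
  have n6 : ∀ j r, r = 3 ∨ r = 4 → tmp j ≠ 16 * i + r := by unfold tmp; omega
  have n9 : tmp d ≠ tmp (d + 1) := by rw [ne_eq, tmp_inj]; omega
  have h1 := (h.setTmp (d + 2 + 1) 3).setTmp (d + 2) (16 * i + 3)
  refine (Ends.bufAddr hi).seq (C' := 4) ?_
  rintro _ rfl
  have e1 : ((σ.setNat (tmp (d + 2 + 1)) 3).setNat (tmp (d + 2)) (16 * i + 3)).nat (tmp (d + 2)) =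
    16 * i + 3 := Memory.setNat_self _ _ _
  have e2 : ∀ a, a ≠ tmp (d + 2) → a ≠ tmp (d + 2 + 1) → ((σ.setNat (tmp (d + 2 + 1)) 3).setNat
      (tmp (d + 2)) (16 * i + 3)).nat a = σ.nat a := fun a ha ha' => by
    rw [Memory.setNat_ne _ ha, Memory.setNat_ne _ ha']
  have e3 : ((σ.setNat (tmp (d + 2 + 1)) 3).setNat (tmp (d + 2)) (16 * i + 3)).real = σ.real := rfl
  have n6' : ∀ j r, r = 3 ∨ r = 4 → 16 * i + r ≠ tmp j := fun j r hr => (n6 j r hr).symm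
  generalize (σ.setNat (tmp (d + 2 + 1)) 3).setNat (tmp (d + 2)) (16 * i + 3) = σ1 at *
  refine (Ends.nat_setNat (a := tmp d) (x := σ.nat (16 * i + 3))
    (Q := fun τ => τ = σ1.setNat (tmp d) (σ.nat (16 * i + 3)))
    (by rw [NatInstr.exec, e1, e2 _ (n6' _ 3 (by simp)) (n6' _ 3 (by simp))]) rfl).seq (C' := 3) ?_
  rintro _ rfl
  refine (Ends.nat_setNat (Q := fun τ => τ = _) rfl rfl).seq (C' := 2) ?_
  rintro _ rfl
  refine (Ends.nat_setNat (a := tmp (d + 2)) (x := 16 * i + 4) (Q := fun τ => τ = _) ?_ rfl).seq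
    (C' := 1) ?_
  · rw [NatInstr.exec, Memory.setNat_self, Memory.setNat_ne _ n1.symm,
      Memory.setNat_ne _ n2.symm, e1]
  rintro _ rfl
  refine Ends.nat_setNat (a := tmp (d + 1)) (x := σ.nat (16 * i + 4)) ?_ ⟨?_, e3, ?_⟩
  · rw [NatInstr.exec, Memory.setNat_self, Memory.setNat_ne _ (n6' _ 4 (by simp)),
      Memory.setNat_ne _ (n6' _ 4 (by simp)), Memory.setNat_ne _ (n6' _ 4 (by simp)),
      e2 _ (n6' _ 4 (by simp)) (n6' _ 4 (by simp))]
  · exact Rep.setTmp (Rep.setTmp (Rep.setTmp (Rep.setTmp h1 _ _) _ _) _ _) _ _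
  · refine ⟨?_, Memory.setNat_self _ _ _, ?_, ?_⟩
    · rw [Memory.setNat_ne _ n9, Memory.setNat_ne _ n2, Memory.setNat_ne _ n3, Memory.setNat_self]
    · rw [Memory.setNat_ne _ n4.symm, Memory.setNat_self]
    · intro a h2
      have n7 : a ≠ tmp (d + 2) := by unfold tmp; omega
      have n8 : a ≠ tmp (d + 2 + 1) := by unfold tmp; omega
      rw [Memory.setNat_ne _ (by unfold tmp; omega), Memory.setNat_ne _ n7, Memory.setNat_ne _ n8,
        Memory.setNat_ne _ (by unfold tmp; omega), e2 _ n7 n8]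

/-- What holds after a command. -/
structure CmdDone (st : St) (d : ℕ) (σ σ' : Memory) : Prop where
  rep : Rep st σ'
  low : ∀ i < d, σ'.nat (tmp i) = σ.nat (tmp i)

theorem CmdDone.trans {st st' : St} {d : ℕ} {σ σ' σ'' : Memory} (h : CmdDone st d σ σ')
    (h' : CmdDone st' d σ' σ'') : CmdDone st' d σ σ'' :=
  ⟨h'.rep, fun i hi => (h'.low i hi).trans (h.low i hi)⟩

/-- Costs depend on the state only through the sizes, so invariance of the sizes allows the cost of
a sequence or a loop to be evaluated at its initial state. -/
theorem Cmd.exec_sz (inp : Memory) (c : Cmd) (st : St) : (c.exec inp st).sz = st.sz := by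
  induction c generalizing st with
  | seq c d hc hd => rw [exec, hd, hc]
  | ite e f c d hc hd => rw [exec]; split_ifs; exacts [hc st, hd st]
  | loop v k c hc =>
    rw [exec]
    change (Nat.rec st (fun i st' => c.exec inp (st'.setv v i)) (st.sz k) : St).sz = st.sz
    generalize st.sz k = n
    induction n with
    | zero => rfl
    | succ n ih => exact (hc _).trans ih
  | _ => rfl

theorem tmp_ne_loop {d v i a : ℕ} (hi : i < d)
    (ha : a = tmp d ∨ a = tmp (d + 1) ∨ a = tmp (d + 2) ∨ a = adv v) : tmp i ≠ a := by
  unfold tmp adv at *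
  omega

/-- Array assignments are simultaneous, so they take two passes: all addresses and values are
evaluated into the buffer while the state is unchanged, and then they are copied. The addresses
modulo 16 keep temporaries, scalars, sizes, buffer and the eight arrays apart, so the checks that a
write disturbs nothing else are linear arithmetic. -/
theorem Cmd.ends {inp : Memory} (c : Cmd) (st : St) (d : ℕ) {σ : Memory} (h : Rep st σ) :
    Ends inp (c.compile d) σ (c.cost st.sz) (CmdDone (c.exec inp st) d σ) := by
  induction c generalizing st d σ with
  | setv v e =>
    refine (e.ends st d h).seq fun σ1 h1 => (Ends.mov (by rw [ne_eq, tmp_inj]; omega)).mono le_rfl ?_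
    rintro _ rfl
    rw [h1.val]
    refine ⟨(h1.rep.setTmp _ _).setv v _, fun i hi => ?_⟩
    rw [Memory.setNat_ne _ (by unfold tmp adv; omega), Memory.setNat_ne _
      (by rw [ne_eq, tmp_inj]; omega), (h1.frame 0).tmp_eq hi]
  | tabN a v k idx e =>
    refine (Ends.count_frame (fun _ => st) (fun i τ => (∀ j < i,
      τ.nat (16 * j + 3) = idx.eval inp (st.setv v j) ∧
      τ.nat (16 * j + 4) = e.eval inp (st.setv v j)) ∧ ∀ j < d, τ.nat (tmp j) = σ.nat (tmp j))
      (fun _ => rfl) (fun _ => rfl) ?_ ?_ h ⟨fun j hj => absurd hj (Nat.not_lt_zero j),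
      fun _ _ => rfl⟩).seq ?_
    · rintro i τ b x hb ⟨h1, h2⟩
      refine ⟨fun j hj => ?_, fun j hj => ?_⟩
      · rw [Memory.setNat_ne _ (by unfold tmp adv at hb; omega),
          Memory.setNat_ne _ (by unfold tmp adv at hb; omega)]
        exact h1 j hj
      · rw [Memory.setNat_ne _ (tmp_ne_loop hj hb), h2 j hj]
    · rintro i hi τ hr ⟨h1, h2⟩
      refine ((idx.ends _ (d + 3) hr).seq fun σ1 h3 => (e.ends _ (d + 4) h3.rep).seq
        fun σ2 h4 => (Ends.bufStore (d := d + 3) h4.rep).mono le_rfl ?_).mono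
        (by simp only [St.setv]; omega) fun _ h => h
      rintro σ3 ⟨h5, -, h6, h7, -, h8⟩
      obtain ⟨-, h9, h10, h11⟩ := h3.trans h4
      have hlow : ∀ j < d + 3, σ3.nat (tmp j) = τ.nat (tmp j) := by
        intro j hj
        rw [h8 _ (by unfold tmp; omega) (by unfold tmp; omega) (by unfold tmp; omega),
          (h9 0).tmp_eq hj]
      refine ⟨h5, ⟨fun j hj => ?_, fun j hj => ?_⟩, hlow _ (by omega), hlow _ (by omega)⟩
      · rcases Nat.lt_succ_iff_lt_or_eq.mp hj with hj | rfl
        · rw [h8 _ (by omega) (by omega) (by omega), h8 _ (by omega) (by omega) (by omega),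
            (h9 0).nat _ (by omega), (h9 0).nat _ (by omega)]
          exact h1 j hj
        · exact ⟨h6.trans h10, h7.trans h11⟩
      · rw [hlow j (by omega), h2 j hj]
    · rintro σ1 ⟨hr, h1, h2⟩
      -- In the second pass the state after `i` rounds contains the first `i` assignments. The
      -- buffer still holds the addresses and values computed in the original state.
      refine (Ends.count_frame (fun i => st.setN a (updMany (st.na a)
        (fun i => idx.eval inp (st.setv v i)) (fun i => e.eval inp (st.setv v i)) i))
        (fun i τ => (∀ j < st.sz k,
        τ.nat (16 * j + 3) = idx.eval inp (st.setv v j) ∧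
        τ.nat (16 * j + 4) = e.eval inp (st.setv v j)) ∧ ∀ j < d, τ.nat (tmp j) = σ.nat (tmp j))
        (fun _ => rfl) (fun _ => rfl) ?_ ?_ ?_ ⟨h1, h2⟩).mono le_rfl ?_
      · rintro i τ b x hb ⟨h1, h2⟩
        refine ⟨fun j hj => ?_, fun j hj => ?_⟩
        · rw [Memory.setNat_ne _ (by unfold tmp adv at hb; omega),
            Memory.setNat_ne _ (by unfold tmp adv at hb; omega)]
          exact h1 j hj
        · rw [Memory.setNat_ne _ (tmp_ne_loop hj hb), h2 j hj]
      · rintro i hi τ hr ⟨h1, h2⟩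
        refine ((Ends.bufLoad (d := d + 3) hr).seq (C' := 7) ?_)
        rintro σ2 ⟨h3, -, h4, h5, -, h6⟩
        refine (Ends.addr (by rw [ne_eq, tmp_inj]; omega)).seq (C' := 1) ?_
        rintro _ rfl
        have ha := a.2
        have e1 : (tmp (d + 3 + 1)) ≠ tmp (d + 3) := by rw [ne_eq, tmp_inj]; omega
        have e2 : (tmp (d + 3 + 1)) ≠ tmp (d + 5) := by rw [ne_eq, tmp_inj]; omega
        refine Ends.nat_setNat rfl ?_
        rw [Memory.setNat_self, Memory.setNat_ne _ e1, Memory.setNat_ne _ e2, h4, h5,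
          (h1 i hi).1, (h1 i hi).2]
        have hlow : ∀ j < d + 3, ∀ x y z, (((σ2.setNat (tmp (d + 5)) x).setNat (tmp (d + 3))
            y).setNat (16 * idx.eval inp (st.setv v i) + (a + 5)) z).nat (tmp j) =
            τ.nat (tmp j) := by
          intro j hj x y z
          rw [Memory.setNat_ne _ (by unfold tmp; omega), Memory.setNat_ne _
            (by rw [ne_eq, tmp_inj]; omega), Memory.setNat_ne _ (by rw [ne_eq, tmp_inj]; omega),
            h6 _ (by unfold tmp; omega)]
        refine ⟨?_, ⟨fun j hj => ?_, fun j hj => ?_⟩, hlow _ (by omega) _ _ _,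
          hlow _ (by omega) _ _ _⟩
        · have := Rep.setN ((h3.setTmp (d + 5) (a + 5)).setTmp (d + 3)
            (16 * idx.eval inp (st.setv v i) + (a + 5))) a (idx.eval inp (st.setv v i))
            (e.eval inp (st.setv v i))
          simpa [St.setN, St.setv, updMany] using this
        · have e3 : ∀ x y z r, r = 3 ∨ r = 4 → (((σ2.setNat (tmp (d + 5)) x).setNat (tmp (d + 3))
              y).setNat (16 * idx.eval inp (st.setv v i) + (a + 5)) z).nat (16 * j + r) =
              τ.nat (16 * j + r) := by
            intro x y z r hr
            rw [Memory.setNat_ne _ (by omega), Memory.setNat_ne _ (by unfold tmp; omega),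
              Memory.setNat_ne _ (by unfold tmp; omega), h6 _ (by omega)]
          rw [e3 _ _ _ 3 (by simp), e3 _ _ _ 4 (by simp)]
          exact h1 j hj
        · rw [hlow _ (by omega), h2 j hj]
      · simpa [St.setN, updMany] using hr
      · rintro σ' ⟨hr, -, h4⟩
        exact ⟨hr, h4⟩
  | tabR a v k idx r =>
    refine (Ends.count_frame (fun _ => st) (fun i τ => (∀ j < i,
      τ.nat (16 * j + 3) = idx.eval inp (st.setv v j) ∧
      τ.real (16 * j + 4) = r.eval inp (st.setv v j)) ∧ ∀ j < d, τ.nat (tmp j) = σ.nat (tmp j))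
      (fun _ => rfl) (fun _ => rfl) ?_ ?_ h ⟨fun j hj => absurd hj (Nat.not_lt_zero j),
      fun _ _ => rfl⟩).seq ?_
    · rintro i τ b x hb ⟨h1, h2⟩
      refine ⟨fun j hj => ?_, fun j hj => ?_⟩
      · rw [Memory.setNat_ne _ (by unfold tmp adv at hb; omega)]
        exact h1 j hj
      · rw [Memory.setNat_ne _ (tmp_ne_loop hj hb), h2 j hj]
    · rintro i hi τ hr ⟨h1, h2⟩
      refine ((idx.ends _ (d + 3) hr).seq fun σ1 h3 => (r.ends _ (d + 4) 0 h3.rep).seq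
        fun σ2 h4 => (Ends.bufStore (d := d + 3) h4.rep).seq (C' := 1) ?_).mono
        (by simp only [St.setv]; omega) fun _ h => h
      rintro σ3 ⟨h5, h5', h6, -, h7, h8⟩
      refine Ends.real_setReal rfl ?_
      have e0 : σ3.nat (tmp (d + 5)) = 16 * i + 4 := h7
      rw [e0, h5', h4.val]
      have h9 : Frame (d + 3) 0 τ σ2 := (h3.frame 0).trans h4.frame (by omega) le_rfl
      have h10 : σ2.nat (tmp (d + 3)) = idx.eval inp (st.setv v i) := by
        rw [h4.frame.tmp_eq (by omega), h3.val]
      have hlow : ∀ j < d + 3, σ3.nat (tmp j) = τ.nat (tmp j) := by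
        intro j hj
        rw [h8 _ (by unfold tmp; omega) (by unfold tmp; omega) (by unfold tmp; omega),
          h9.tmp_eq hj]
      refine ⟨h5.setReal (by omega) _, ⟨fun j hj => ?_, fun j hj => ?_⟩, hlow _ (by omega),
        hlow _ (by omega)⟩
      · rcases Nat.lt_succ_iff_lt_or_eq.mp hj with hj | rfl
        · rw [Memory.setReal_ne _ (by omega), h5', h9.real _ (by omega)]
          change σ3.nat _ = _ ∧ _
          rw [h8 _ (by omega) (by omega) (by omega), h9.nat _ (by omega)]
          exact h1 j hj
        · exact ⟨h6.trans h10, Memory.setReal_self _ _ _⟩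
      · exact (hlow j (by omega)).trans (h2 j hj)
    · rintro σ1 ⟨hr, h1, h2⟩
      refine (Ends.count_frame (fun i => st.setR a (updMany (st.ra a)
        (fun i => idx.eval inp (st.setv v i)) (fun i => r.eval inp (st.setv v i)) i))
        (fun i τ => (∀ j < st.sz k,
        τ.nat (16 * j + 3) = idx.eval inp (st.setv v j) ∧
        τ.real (16 * j + 4) = r.eval inp (st.setv v j)) ∧ ∀ j < d, τ.nat (tmp j) = σ.nat (tmp j))
        (fun _ => rfl) (fun _ => rfl) ?_ ?_ ?_ ⟨h1, h2⟩).mono le_rfl ?_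
      · rintro i τ b x hb ⟨h1, h2⟩
        refine ⟨fun j hj => ?_, fun j hj => ?_⟩
        · rw [Memory.setNat_ne _ (by unfold tmp adv at hb; omega)]
          exact h1 j hj
        · rw [Memory.setNat_ne _ (tmp_ne_loop hj hb), h2 j hj]
      · rintro i hi τ hr ⟨h1, h2⟩
        refine ((Ends.bufLoad (d := d + 3) hr).seq (C' := 8) ?_)
        rintro σ2 ⟨h3, h3', h4, -, h5, h6⟩
        refine (Ends.real_setReal (Q := fun τ => τ = _) rfl rfl).seq (C' := 7) ?_
        rintro _ rfl
        refine (Ends.addr (by rw [ne_eq, tmp_inj]; omega)).seq (C' := 1) ?_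
        rintro _ rfl
        have ha := a.2
        have e0 : σ2.nat (tmp (d + 5)) = 16 * i + 4 := h5
        refine Ends.real_setReal rfl ?_
        rw [Memory.setNat_self, e0]
        have e1 : σ2.real (16 * i + 4) = r.eval inp (st.setv v i) := by rw [h3', (h1 i hi).2]
        have e4 : (σ2.setReal (tmp 0) (σ2.real (16 * i + 4))).nat (tmp (d + 3)) =
            idx.eval inp (st.setv v i) := h4.trans (h1 i hi).1
        have e5 : ∀ x y z w, (((σ2.setReal x y).setNat z w).setNat (tmp (d + 3))
          (16 * idx.eval inp (st.setv v i) + (a + 5))).real = (σ2.setReal x y).real :=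
          fun _ _ _ _ => rfl
        rw [e4, e5, Memory.setReal_self, e1]
        have hlow : ∀ j < d + 3, ∀ x y z w q u, ((((σ2.setReal x y).setNat (tmp (d + 5)) z).setNat
            (tmp (d + 3)) w).setReal q u).nat (tmp j) = τ.nat (tmp j) := by
          intro j hj x y z w q u
          change (((σ2.setReal x y).setNat (tmp (d + 5)) z).setNat (tmp (d + 3)) w).nat _ = _
          rw [Memory.setNat_ne _
            (by rw [ne_eq, tmp_inj]; omega), Memory.setNat_ne _ (by rw [ne_eq, tmp_inj]; omega)]
          exact h6 _ (by unfold tmp; omega)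
        refine ⟨?_, ⟨fun j hj => ⟨?_, ?_⟩, fun j hj => ?_⟩, hlow _ (by omega) _ _ _ _ _ _,
          hlow _ (by omega) _ _ _ _ _ _⟩
        · have := Rep.setR (((h3.setTmpR 0 (r.eval inp (st.setv v i))).setTmp (d + 5)
            (a + 5)).setTmp (d + 3) (16 * idx.eval inp (st.setv v i) + (a + 5))) a
            (idx.eval inp (st.setv v i)) (r.eval inp (st.setv v i))
          simpa [St.setR, St.setv, updMany] using this
        · change (((σ2.setReal _ _).setNat (tmp (d + 5)) _).setNat (tmp (d + 3)) _).nat _ = _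
          rw [Memory.setNat_ne _ (by unfold tmp; omega),
            Memory.setNat_ne _ (by unfold tmp; omega)]
          exact (h6 _ (by omega)).trans (h1 j hj).1
        · rw [Memory.setReal_ne _ (by omega)]
          rw [e5, Memory.setReal_ne _ (by unfold tmp; omega), h3']
          exact (h1 j hj).2
        · rw [hlow _ (by omega), h2 j hj]
      · simpa [St.setR, updMany] using hr
      · rintro σ' ⟨hr, -, h4⟩
        exact ⟨hr, h4⟩
  | cmp v r s =>
    refine ((r.ends st d 0 h).seq fun σ1 h1 => (s.ends st d 1 h1.rep).seq (C' := 1 + 1)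
      fun σ2 h2 => Ends.branch ?_ ?_).mono (by rw [cost]; omega) fun _ h => h
    · intro hc
      obtain ⟨h3, h4, h5, h6⟩ := h1.trans h2
      have hc' : r.eval inp st < s.eval inp st := by rw [← h5, ← h6]; exact hc
      refine Ends.nat_setNat rfl ?_
      rw [exec, if_pos hc']
      refine ⟨h3.setv v 1, fun i hi => ?_⟩
      rw [Memory.setNat_ne _ (by unfold tmp adv; omega), h4.tmp_eq hi]
    · intro hc
      obtain ⟨h3, h4, h5, h6⟩ := h1.trans h2
      have hc' : ¬ r.eval inp st < s.eval inp st := by rw [← h5, ← h6]; exact hc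
      refine Ends.nat_setNat rfl ?_
      rw [exec, if_neg hc']
      refine ⟨h3.setv v 0, fun i hi => ?_⟩
      rw [Memory.setNat_ne _ (by unfold tmp adv; omega), h4.tmp_eq hi]
  | seq c e hc he =>
    refine (hc st d h).seq fun σ1 h1 => ?_
    have := he (c.exec inp st) d h1.rep
    rw [Cmd.exec_sz] at this
    exact this.mono le_rfl fun σ2 h2 => h1.trans h2
  | ite e f c c' hc hc' =>
    refine ((e.ends st d h).seq fun σ1 h1 => (f.ends st (d + 1) h1.rep).seq
      (C' := (c.cost st.sz + c'.cost st.sz) + 1) fun σ2 h2 => Ends.branch ?_ ?_).mono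
      (by rw [cost]; omega) fun _ h => h
    · intro hlt
      obtain ⟨h3, h4, h5, h6⟩ := h1.trans h2
      have hlt' : e.eval inp st < f.eval inp st := by rw [← h5, ← h6]; exact hlt
      refine (hc st d h3).mono (by omega) fun σ' h' => ?_
      rw [exec, if_pos hlt']
      exact ⟨h'.rep, fun i hi => (h'.low i hi).trans ((h4 0).tmp_eq hi)⟩
    · intro hlt
      obtain ⟨h3, h4, h5, h6⟩ := h1.trans h2
      have hlt' : ¬ e.eval inp st < f.eval inp st := by rw [← h5, ← h6]; exact hlt
      refine (hc' st d h3).mono (by omega) fun σ' h' => ?_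
      rw [exec, if_neg hlt']
      exact ⟨h'.rep, fun i hi => (h'.low i hi).trans ((h4 0).tmp_eq hi)⟩
  | loop v k c hc =>
    have hsz : ∀ i, (Nat.rec st (fun i st' => c.exec inp (st'.setv v i)) i : St).sz = st.sz := by
      intro i
      induction i with
      | zero => rfl
      | succ i ih => exact (Cmd.exec_sz inp c _).trans ih
    refine (Ends.count (fun i => (Nat.rec st (fun i st' => c.exec inp (st'.setv v i)) i : St))
      (fun _ τ => ∀ j < d, τ.nat (tmp j) = σ.nat (tmp j)) (fun i => by rw [hsz]) ?_ ?_ h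
      fun _ _ => rfl).mono le_rfl ?_
    · intro i τ a x ha h1 j hj
      rw [Memory.setNat_ne _ (tmp_ne_loop hj ha), h1 j hj]
    · intro i hi τ hr h1
      have := hc _ (d + 3) hr
      have e1 : ((Nat.rec st (fun i st' => c.exec inp (st'.setv v i)) i : St).setv v i).sz = st.sz :=
        hsz i
      rw [e1] at this
      refine this.mono le_rfl fun σ' h2 => ⟨h2.rep, fun j hj => ?_, h2.low _ (by omega),
        h2.low _ (by omega)⟩
      rw [h2.low j (by omega), h1 j hj]
    · rintro σ' ⟨hr, h1⟩
      exact ⟨hr, h1⟩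

end QCSAT

/-! ### Symbolic running times, and addressing of tables -/

namespace QCSAT

open Program

/-! ### Growth of the costs -/

/-- The bound `k * L ^ l * D ^ d`. -/
structure Deg where
  k : ℕ
  l : ℕ
  d : ℕ

namespace Deg

def val (x : Deg) (L D : ℕ) : ℕ := x.k * L ^ x.l * D ^ x.d

def const (c : ℕ) : Deg := ⟨c, 0, 0⟩

def add (x y : Deg) : Deg := ⟨x.k + y.k, max x.l y.l, max x.d y.d⟩

/-- The bound for a loop over `size k`, for the bound `x` of the body. -/
def loop (k : ℕ) (x : Deg) : Deg :=
  if k < 8 then ⟨x.k + 11, x.l + 1, x.d⟩ else ⟨x.k + 11, x.l, x.d + 1⟩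

theorem le_const {L D : ℕ} (c : ℕ) : c ≤ (const c).val L D := by simp [const, val]

theorem add_le {L D : ℕ} (hL : 1 ≤ L) (hD : 1 ≤ D) {x y : ℕ} {X Y : Deg} (hx : x ≤ X.val L D)
    (hy : y ≤ Y.val L D) : x + y ≤ (X.add Y).val L D := by
  have h1 : X.val L D ≤ X.k * L ^ max X.l Y.l * D ^ max X.d Y.d := by
    unfold val
    gcongr
    · exact le_max_left _ _
    · exact le_max_left _ _
  have h2 : Y.val L D ≤ Y.k * L ^ max X.l Y.l * D ^ max X.d Y.d := by
    unfold val
    gcongr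
    · exact le_max_right _ _
    · exact le_max_right _ _
  calc x + y ≤ _ := Nat.add_le_add (hx.trans h1) (hy.trans h2)
    _ = _ := by unfold add val; ring

/-- The constants 5 and 6 of `countCost` are absorbed into the coefficient, whence the 11, because
the monomial is at least one. Sizes below 8 are bounded by `L` and the others by `D`, so the index
of the size decides which exponent grows. -/
theorem loop_le {L D : ℕ} (hL : 1 ≤ L) (hD : 1 ≤ D) {sz : ℕ → ℕ}
    (hsz : ∀ k, sz k ≤ if k < 8 then L else D) {k x : ℕ} {X : Deg} (hx : x ≤ X.val L D) :
    countCost (sz k) x ≤ (X.loop k).val L D := by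
  have h1 : 1 ≤ L ^ X.l * D ^ X.d := Nat.mul_pos (pow_pos hL _) (pow_pos hD _)
  have h2 := hsz k
  unfold val at hx
  rw [mul_assoc] at hx
  unfold countCost loop val
  generalize hw : L ^ X.l * D ^ X.d = w at *
  split_ifs at h2 ⊢ with hk
  · calc sz k * (x + 5) + 6 ≤ L * (X.k * w + 5) + 6 := by gcongr
      _ ≤ L * (X.k * w + 5 * w) + 6 * (L * w) := by
        have : 1 ≤ L * w := Nat.mul_pos hL h1
        gcongr <;> omega
      _ = (X.k + 11) * (L * w) := by ring
      _ = _ := by rw [← hw, pow_succ]; ring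
  · calc sz k * (x + 5) + 6 ≤ D * (X.k * w + 5) + 6 := by gcongr
      _ ≤ D * (X.k * w + 5 * w) + 6 * (D * w) := by
        have : 1 ≤ D * w := Nat.mul_pos hD h1
        gcongr <;> omega
      _ = (X.k + 11) * (D * w) := by ring
      _ = _ := by rw [← hw, pow_succ]; ring

end Deg

def NE.deg : NE → Deg
  | .const _ => .const 1
  | .var _ => .const 2
  | .size _ => .const 2
  | .add e f => (e.deg.add f.deg).add (.const 1)
  | .sub e f => (e.deg.add f.deg).add (.const 1)
  | .arr _ e => e.deg.add (.const 7)
  | .inp e => e.deg.add (.const 1)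
  | .sum _ k e => (Deg.loop k (e.deg.add (.const 1))).add (.const 1)
  | .ite e f g h => ((e.deg.add f.deg).add (g.deg.add h.deg)).add (.const 1)

def RE.deg : RE → Deg
  | .const _ => .const 1
  | .add r s => (r.deg.add s.deg).add (.const 1)
  | .sub r s => (r.deg.add s.deg).add (.const 1)
  | .mul r s => (r.deg.add s.deg).add (.const 1)
  | .div r s => (r.deg.add s.deg).add (.const 1)
  | .arr _ e => e.deg.add (.const 7)
  | .inp e => e.deg.add (.const 1)
  | .sum _ k r => (Deg.loop k (r.deg.add (.const 1))).add (.const 1)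
  | .ite e f r s => ((e.deg.add f.deg).add (r.deg.add s.deg)).add (.const 1)

def Cmd.deg : Cmd → Deg
  | .setv _ e => e.deg.add (.const 2)
  | .tabN _ _ k idx e =>
      (Deg.loop k ((idx.deg.add e.deg).add (.const 12))).add (Deg.loop k (.const 19))
  | .tabR _ _ k idx r =>
      (Deg.loop k ((idx.deg.add r.deg).add (.const 13))).add (Deg.loop k (.const 20))
  | .cmp _ r s => (r.deg.add s.deg).add (.const 2)
  | .seq c d => c.deg.add d.deg
  | .ite e f c d => ((e.deg.add f.deg).add (c.deg.add d.deg)).add (.const 1)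
  | .loop _ k c => Deg.loop k c.deg

section
variable {L D : ℕ} (hL : 1 ≤ L) (hD : 1 ≤ D) {sz : ℕ → ℕ}
  (hsz : ∀ k, sz k ≤ if k < 8 then L else D)
include hL hD hsz

theorem NE.cost_le (e : NE) : e.cost sz ≤ e.deg.val L D := by
  induction e with
  | const c => exact Deg.le_const _
  | var v => exact Deg.le_const _
  | size k => exact Deg.le_const _
  | add e f he hf => exact Deg.add_le hL hD (Deg.add_le hL hD he hf) (Deg.le_const _)
  | sub e f he hf => exact Deg.add_le hL hD (Deg.add_le hL hD he hf) (Deg.le_const _)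
  | arr a e he => exact Deg.add_le hL hD he (Deg.le_const _)
  | inp e he => exact Deg.add_le hL hD he (Deg.le_const _)
  | sum v k e he =>
    exact Deg.add_le hL hD (Deg.loop_le hL hD hsz (Deg.add_le hL hD he (Deg.le_const _)))
      (Deg.le_const _)
  | ite e f g h he hf hg hh =>
    exact Deg.add_le hL hD (Deg.add_le hL hD (Deg.add_le hL hD he hf) (Deg.add_le hL hD hg hh))
      (Deg.le_const _)

theorem RE.cost_le (r : RE) : r.cost sz ≤ r.deg.val L D := by
  induction r with
  | const c => exact Deg.le_const _
  | add e f he hf => exact Deg.add_le hL hD (Deg.add_le hL hD he hf) (Deg.le_const _)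
  | sub e f he hf => exact Deg.add_le hL hD (Deg.add_le hL hD he hf) (Deg.le_const _)
  | mul e f he hf => exact Deg.add_le hL hD (Deg.add_le hL hD he hf) (Deg.le_const _)
  | div e f he hf => exact Deg.add_le hL hD (Deg.add_le hL hD he hf) (Deg.le_const _)
  | arr a e => exact Deg.add_le hL hD (e.cost_le hL hD hsz) (Deg.le_const _)
  | inp e => exact Deg.add_le hL hD (e.cost_le hL hD hsz) (Deg.le_const _)
  | sum v k e he =>
    exact Deg.add_le hL hD (Deg.loop_le hL hD hsz (Deg.add_le hL hD he (Deg.le_const _)))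
      (Deg.le_const _)
  | ite e f g h hg hh =>
    exact Deg.add_le hL hD (Deg.add_le hL hD (Deg.add_le hL hD (e.cost_le hL hD hsz)
      (f.cost_le hL hD hsz)) (Deg.add_le hL hD hg hh)) (Deg.le_const _)

theorem Cmd.cost_le (c : Cmd) : c.cost sz ≤ c.deg.val L D := by
  induction c with
  | setv v e => exact Deg.add_le hL hD (e.cost_le hL hD hsz) (Deg.le_const _)
  | tabN a v k idx e =>
    exact Deg.add_le hL hD (Deg.loop_le hL hD hsz (Deg.add_le hL hD (Deg.add_le hL hD
      (idx.cost_le hL hD hsz) (e.cost_le hL hD hsz)) (Deg.le_const _)))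
      (Deg.loop_le hL hD hsz (Deg.le_const _))
  | tabR a v k idx r =>
    exact Deg.add_le hL hD (Deg.loop_le hL hD hsz (Deg.add_le hL hD (Deg.add_le hL hD
      (idx.cost_le hL hD hsz) (r.cost_le hL hD hsz)) (Deg.le_const _)))
      (Deg.loop_le hL hD hsz (Deg.le_const _))
  | cmp v r s =>
    exact Deg.add_le hL hD (Deg.add_le hL hD (r.cost_le hL hD hsz) (s.cost_le hL hD hsz))
      (Deg.le_const _)
  | seq c d hc hd => exact Deg.add_le hL hD hc hd
  | ite e f c d hc hd =>
    exact Deg.add_le hL hD (Deg.add_le hL hD (Deg.add_le hL hD (e.cost_le hL hD hsz)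
      (f.cost_le hL hD hsz)) (Deg.add_le hL hD hc hd)) (Deg.le_const _)
  | loop v k c hc => exact Deg.loop_le hL hD hsz hc

end

/-! ### Programs without real numbers -/

/-- The command does not use real numbers. -/
def Cmd.NoReal : Cmd → Prop
  | .setv _ _ => True
  | .tabN _ _ _ _ _ => True
  | .tabR _ _ _ _ _ => False
  | .cmp _ _ _ => False
  | .seq c d => c.NoReal ∧ d.NoReal
  | .ite _ _ c d => c.NoReal ∧ d.NoReal
  | .loop _ _ c => c.NoReal

theorem isDiscrete_count {v k d : ℕ} {p : Program} (h : p.IsDiscrete) :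
    (count v k d p).IsDiscrete := by
  simp [count, Program.IsDiscrete, mov, h]

theorem NE.isDiscrete_compile (e : NE) (d : ℕ) : (e.compile d).IsDiscrete := by
  induction e generalizing d with
  | sum v k e he =>
    exact ⟨trivial, isDiscrete_count ⟨he _, trivial⟩⟩
  | _ => simp_all [compile, Program.IsDiscrete, mov, addr]

theorem Cmd.isDiscrete_compile (c : Cmd) (hc : c.NoReal) (d : ℕ) : (c.compile d).IsDiscrete := by
  induction c generalizing d with
  | setv v e => exact ⟨e.isDiscrete_compile d, trivial, trivial⟩
  | tabN a v k idx e =>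
    refine ⟨isDiscrete_count ⟨idx.isDiscrete_compile _, e.isDiscrete_compile _, ?_⟩,
      isDiscrete_count ?_⟩ <;>
    simp [bufStore, bufLoad, bufAddr, Program.IsDiscrete, mov, addr]
  | tabR a v k idx r => exact hc.elim
  | cmp v r s => exact hc.elim
  | seq c d h1 h2 => exact ⟨h1 hc.1 _, h2 hc.2 _⟩
  | ite e f c d h1 h2 =>
    exact ⟨e.isDiscrete_compile _, f.isDiscrete_compile _, h1 hc.1 _, h2 hc.2 _⟩
  | loop v k c h1 => exact isDiscrete_count (h1 hc _)

/-! ### Top level code -/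

/-- Code that sets a size. -/
def setSize (k : ℕ) (e : NE) : Program := .seq (e.compile 0) (mov (ads k) (tmp 0) (tmp 1))

/-- The state after a size has been set. -/
def St.setsz (st : St) (k x : ℕ) : St := { st with sz := Function.update st.sz k x }

theorem Rep.setsz {st : St} {σ : Memory} (h : Rep st σ) (k x : ℕ) :
    Rep (st.setsz k x) (σ.setNat (ads k) x) := by
  unfold ads St.setsz
  constructor
  · intro v; rw [← h.nv, σ.setNat_ne (by omega)]
  · intro w
    by_cases hw : w = k
    · subst hw; simp [Memory.setNat_self]
    · simp only [Function.update_of_ne hw]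
      rw [← h.sz, σ.setNat_ne (by omega)]
  · intro a k; rw [← h.na, σ.setNat_ne (by omega)]
  · exact h.ra

theorem Ends.setSize {inp : Memory} {st : St} {σ : Memory} (k : ℕ) (e : NE) (h : Rep st σ) :
    Ends inp (setSize k e) σ (e.cost st.sz + 2) (Rep (st.setsz k (e.eval inp st))) := by
  refine (e.ends st 0 h).seq fun σ1 h1 => ?_
  have h2 : tmp 0 ≠ tmp 1 := by unfold tmp; omega
  refine (Ends.mov h2).mono le_rfl ?_
  rintro _ rfl
  rw [h1.val]
  exact (h1.rep.setTmp _ _).setsz k _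

theorem Ends.cmd {inp : Memory} {st : St} {σ : Memory} (c : Cmd) (h : Rep st σ) :
    Ends inp (c.compile 0) σ (c.cost st.sz) (Rep (c.exec inp st)) :=
  (c.ends st 0 h).mono le_rfl fun _ h => h.rep

/-! ### Simultaneous assignments -/

-- When the value is a function of the address, repeated addresses receive equal values and the
-- order of the assignments is irrelevant. This matters because the list of columns contains
-- repetitions.
open scoped Classical in
theorem updMany_eq {α : Type*} (f : ℕ → α) (idx : ℕ → ℕ) (val : ℕ → α) (F : ℕ → α) (n : ℕ)
    (h : ∀ i < n, val i = F (idx i)) (k : ℕ) :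
    updMany f idx val n k = if ∃ i < n, idx i = k then F k else f k := by
  induction n with
  | zero => simp [updMany]
  | succ n ih =>
    have ih := ih (fun i hi => h i (by omega))
    rw [updMany]
    by_cases hk : k = idx n
    · rw [hk, Function.update_self, if_pos ⟨n, by omega, rfl⟩, h n (by omega)]
    · rw [Function.update_of_ne hk, ih]
      congr 1
      rw [eq_iff_iff]
      constructor
      · rintro ⟨i, hi, rfl⟩
        exact ⟨i, by omega, rfl⟩
      · rintro ⟨i, hi, rfl⟩
        refine ⟨i, ?_, rfl⟩
        rcases Nat.lt_succ_iff_lt_or_eq.mp hi with hi | rfl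
        · exact hi
        · exact absurd rfl hk

theorem mul_add_eq_iff {W : ℕ} {i c i' c' : ℕ} (hc : c < W) (hc' : c' < W) :
    i * W + c = i' * W + c' ↔ i = i' ∧ c = c' := by
  constructor
  · intro h
    have h1 : (i * W + c) / W = (i' * W + c') / W := by rw [h]
    rw [mul_comm i, mul_comm i', Nat.mul_add_div (by omega), Nat.mul_add_div (by omega),
      Nat.div_eq_of_lt hc, Nat.div_eq_of_lt hc'] at h1
    have h2 : i = i' := by simpa using h1
    subst h2
    exact ⟨rfl, by omega⟩
  · rintro ⟨rfl, rfl⟩; rfl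

/-- Assignment to a column of a table with rows of length `W`. -/
theorem updMany_col {α : Type*} (f : ℕ → α) {idx : ℕ → ℕ} {val : ℕ → α} {W n c₀ : ℕ}
    (hidx : ∀ i < n, idx i = i * W + c₀) (hc₀ : c₀ < W) {g c : ℕ} (hg : g < n) (hc : c < W) :
    updMany f idx val n (g * W + c) = if c = c₀ then val g else f (g * W + c) := by
  classical
  rw [updMany_eq f idx val (fun k => val (k / W)) n (fun i hi => by
    rw [hidx i hi, mul_comm, Nat.mul_add_div (by omega), Nat.div_eq_of_lt hc₀, add_zero])]
  have h1 : (∃ i < n, idx i = g * W + c) ↔ c = c₀ := by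
    constructor
    · rintro ⟨i, hi, h⟩
      rw [hidx i hi] at h
      exact ((mul_add_eq_iff hc₀ hc).mp h).2.symm
    · rintro rfl
      exact ⟨g, hg, hidx g hg⟩
  by_cases h : c = c₀
  · rw [if_pos (h1.mpr h), if_pos h, mul_comm, Nat.mul_add_div (by omega), Nat.div_eq_of_lt hc,
      add_zero]
  · rw [if_neg (fun h' => h (h1.mp h')), if_neg h]

/-- Assignment to entries of row `r` of a table with rows of length `W`. -/
theorem updMany_row {α : Type*} (f : ℕ → α) {idx : ℕ → ℕ} {val : ℕ → α} {W n r : ℕ} {col : ℕ → ℕ}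
    (F : ℕ → α) (hidx : ∀ j < n, idx j = r * W + col j) (hcol : ∀ j < n, col j < W)
    (hval : ∀ j < n, val j = F (col j)) {g c : ℕ} (hc : c < W)
    [Decidable (g = r ∧ ∃ j < n, col j = c)] :
    updMany f idx val n (g * W + c) = if g = r ∧ ∃ j < n, col j = c then F c else f (g * W + c) := by
  classical
  rw [updMany_eq f idx val (fun k => F (k % W)) n (fun i hi => by
    rw [hval i hi, hidx i hi, mul_comm, Nat.mul_add_mod, Nat.mod_eq_of_lt (hcol i hi)])]
  have h1 : (∃ j < n, idx j = g * W + c) ↔ (g = r ∧ ∃ j < n, col j = c) := by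
    constructor
    · rintro ⟨j, hj, h⟩
      rw [hidx j hj] at h
      have := (mul_add_eq_iff (hcol j hj) hc).mp h
      exact ⟨this.1.symm, j, hj, this.2⟩
    · rintro ⟨rfl, j, hj, rfl⟩
      exact ⟨j, hj, hidx j hj⟩
  by_cases h : g = r ∧ ∃ j < n, col j = c
  · rw [if_pos (h1.mpr h), if_pos h, mul_comm, Nat.mul_add_mod, Nat.mod_eq_of_lt hc]
  · rw [if_neg (fun h' => h (h1.mp h')), if_neg h]

/-- Assignment to the entries `0, …, n - 1`. -/
theorem updMany_id {α : Type*} (f : ℕ → α) {idx : ℕ → ℕ} {val : ℕ → α} {n : ℕ}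
    (hidx : ∀ i < n, idx i = i) (k : ℕ) :
    updMany f idx val n k = if k < n then val k else f k := by
  classical
  rw [updMany_eq f idx val val n (fun i hi => by rw [hidx i hi])]
  congr 1
  rw [eq_iff_iff]
  constructor
  · rintro ⟨i, hi, rfl⟩; rwa [hidx i hi]
  · intro hk; exact ⟨k, hk, hidx k hk⟩

theorem sum_range_ite_lt (n i w : ℕ) (h : i ≤ n) :
    ∑ j ∈ Finset.range n, (if j < i then w else 0) = i * w := by
  rw [← Finset.sum_filter, Finset.sum_const, smul_eq_mul]
  congr 1
  have : (Finset.range n).filter (fun j => j < i) = Finset.range i := by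
    ext j; simp; omega
  rw [this, Finset.card_range]

/-! ### Bits of Paulis -/

/-- The bits of a Pauli, first those of the `X` part and then those of the `Z` part. -/
def Pauli.bit {N : ℕ} (p : Pauli N) (c : ℕ) : ZMod 2 :=
  if h : c < N then p.1 ⟨c, h⟩ else if h : c - N < N then p.2 ⟨c - N, h⟩ else 0

theorem Pauli.bit_fst {N : ℕ} (p : Pauli N) (q : Fin N) : p.bit q = p.1 q := by
  simp [bit]

theorem Pauli.bit_snd {N : ℕ} (p : Pauli N) (q : Fin N) : p.bit (N + q) = p.2 q := by
  simp [bit]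

theorem Pauli.bit_add {N : ℕ} (p p' : Pauli N) (c : ℕ) : (p + p').bit c = p.bit c + p'.bit c := by
  unfold bit
  split_ifs <;> simp

theorem Pauli.bit_zero {N : ℕ} (c : ℕ) : (0 : Pauli N).bit c = 0 := by
  unfold bit
  split_ifs <;> simp

theorem Pauli.bit_smul {N : ℕ} (a : ZMod 2) (p : Pauli N) (c : ℕ) :
    (a • p).bit c = a * p.bit c := by
  unfold bit
  split_ifs <;> simp

theorem Pauli.ext_bit {N : ℕ} {p p' : Pauli N} (h : ∀ c < 2 * N, p.bit c = p'.bit c) : p = p' := by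
  ext q
  · rw [← bit_fst, ← bit_fst, h _ (by omega)]
  · rw [← bit_snd, ← bit_snd, h _ (by omega)]

theorem Pauli.bit_Z {N : ℕ} (q : Fin N) (c : ℕ) :
    (Pauli.Z q).bit c = if c = N + q then 1 else 0 := by
  have hq := q.2
  unfold bit Z
  split_ifs with h1 h2 h3 h4
  · omega
  · rfl
  · obtain rfl : c = N + q := by assumption
    simp
  · apply Pi.single_eq_of_ne
    intro h
    apply h4
    rw [← h]
    simp only
    omega
  · omega
  · rfl

theorem Gate.bit_act_H {N : ℕ} (q : Fin N) (p : Pauli N) (c : ℕ) :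
    ((Gate.H q).act p).bit c =
      if c = N + q then p.bit q else if c = q then p.bit (N + q) else p.bit c := by
  have hq := q.2
  rw [Pauli.bit_fst, Pauli.bit_snd]
  unfold Pauli.bit act
  simp only [Function.update_apply, Fin.ext_iff]
  by_cases h1 : c < N
  · simp only [h1, dif_pos]
    split_ifs <;> first | rfl | omega
  · simp only [h1, dif_neg, not_false_eq_true]
    by_cases h2 : c - N < N
    · simp only [h2, dif_pos]
      split_ifs <;> first | rfl | omega
    · simp only [h2, dif_neg, not_false_eq_true]
      split_ifs <;> first | rfl | omega

theorem Gate.bit_act_S {N : ℕ} (q : Fin N) (p : Pauli N) (c : ℕ) :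
    ((Gate.S q).act p).bit c = if c = N + q then p.bit (N + q) + p.bit q else p.bit c := by
  have hq := q.2
  rw [Pauli.bit_fst, Pauli.bit_snd]
  unfold Pauli.bit act
  simp only [Function.update_apply, Fin.ext_iff]
  by_cases h1 : c < N
  · simp only [h1, dif_pos]
    split_ifs <;> first | rfl | omega
  · simp only [h1, dif_neg, not_false_eq_true]
    by_cases h2 : c - N < N
    · simp only [h2, dif_pos]
      split_ifs <;> first | rfl | omega
    · simp only [h2, dif_neg, not_false_eq_true]
      split_ifs <;> first | rfl | omega

theorem Gate.bit_act_CNOT {N : ℕ} (a b : Fin N) (hab : a ≠ b) (p : Pauli N) (c : ℕ) :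
    ((Gate.CNOT a b hab).act p).bit c =
      if c = N + a then p.bit (N + a) + p.bit (N + b)
      else if c = b then p.bit b + p.bit a else p.bit c := by
  have ha := a.2
  have hb := b.2
  rw [Pauli.bit_fst, Pauli.bit_snd, Pauli.bit_fst, Pauli.bit_snd]
  unfold Pauli.bit act
  simp only [Function.update_apply, Fin.ext_iff]
  by_cases h1 : c < N
  · simp only [h1, dif_pos]
    split_ifs <;> first | rfl | omega
  · simp only [h1, dif_neg, not_false_eq_true]
    by_cases h2 : c - N < N
    · simp only [h2, dif_pos]
      split_ifs <;> first | rfl | omega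
    · simp only [h2, dif_neg, not_false_eq_true]
      split_ifs <;> first | rfl | omega

end QCSAT

/-! ### Pauli tables in memory, and reading the circuit -/

namespace QCSAT

/-! ### States -/

section
variable (st : St) (v x k : ℕ) (a : Fin 8) (f : ℕ → ℕ) (r : ℕ → ℝ)

@[simp] theorem St.setv_sz : (st.setv v x).sz = st.sz := rfl
@[simp] theorem St.setv_na : (st.setv v x).na = st.na := rfl
@[simp] theorem St.setv_ra : (st.setv v x).ra = st.ra := rfl
@[simp] theorem St.setv_nv (w : ℕ) : (st.setv v x).nv w = if w = v then x else st.nv w := by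
  simp [St.setv, Function.update_apply]
@[simp] theorem St.setN_sz : (st.setN a f).sz = st.sz := rfl
@[simp] theorem St.setN_nv : (st.setN a f).nv = st.nv := rfl
@[simp] theorem St.setN_ra : (st.setN a f).ra = st.ra := rfl
@[simp] theorem St.setN_na (b : Fin 8) :
    (st.setN a f).na b = if b = a then f else st.na b := by
  simp [St.setN, Function.update_apply]
@[simp] theorem St.setR_sz : (st.setR a r).sz = st.sz := rfl
@[simp] theorem St.setR_nv : (st.setR a r).nv = st.nv := rfl
@[simp] theorem St.setR_na : (st.setR a r).na = st.na := rfl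
@[simp] theorem St.setR_ra (b : Fin 8) :
    (st.setR a r).ra b = if b = a then r else st.ra b := by
  simp [St.setR, Function.update_apply]
@[simp] theorem St.setsz_na : (st.setsz k x).na = st.na := rfl
@[simp] theorem St.setsz_sz (w : ℕ) : (st.setsz k x).sz w = if w = k then x else st.sz w := by
  simp [St.setsz, Function.update_apply]

theorem St.setN_setN (f' : ℕ → ℕ) : (st.setN a f).setN a f' = st.setN a f' := by
  simp [St.setN]

theorem St.setR_setR (r' : ℕ → ℝ) : (st.setR a r).setR a r' = st.setR a r' := by
  simp [St.setR]

theorem St.setN_self : st.setN a (st.na a) = st := by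
  simp [St.setN]

theorem St.setR_self : st.setR a (st.ra a) = st := by
  simp [St.setR]

theorem St.setN_setv : (st.setN a f).setv v x = (st.setv v x).setN a f := rfl

theorem St.setR_setv : (st.setR a r).setv v x = (st.setv v x).setR a r := rfl

end

theorem Cmd.loop_induction {inp : Memory} {v k : ℕ} {c : Cmd} {st : St} (Inv : ℕ → St → Prop)
    (h0 : Inv 0 st)
    (hs : ∀ i < st.sz k, ∀ st', Inv i st' → Inv (i + 1) (c.exec inp (st'.setv v i)))
    {Q : St → Prop} (hQ : ∀ st', Inv (st.sz k) st' → Q (st'.setv v (st.nv v))) :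
    Q ((Cmd.loop v k c).exec inp st) := by
  have h : ∀ n ≤ st.sz k,
      Inv n (Nat.rec st (fun i st' => c.exec inp (st'.setv v i)) n : St) := by
    intro n hn
    induction n with
    | zero => exact h0
    | succ n ih => exact hs n (by omega) _ (ih (by omega))
  exact hQ _ (h _ le_rfl)

/-! ### Tables of bits -/

/-- The Pauli with given bits. -/
def Pauli.ofBits (N : ℕ) (f : ℕ → ZMod 2) : Pauli N := (fun q => f q, fun q => f (N + q))

theorem Pauli.bit_ofBits {N : ℕ} (f : ℕ → ZMod 2) {c : ℕ} (hc : c < 2 * N) :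
    (Pauli.ofBits N f).bit c = f c := by
  unfold bit ofBits
  split_ifs with h1 h2
  · rfl
  · simp only
    congr 1
    omega
  · omega

/-- Bit `d` is replaced by the sum of the bits `d` and `s`. -/
def Pauli.xorBit {N : ℕ} (d s : ℕ) (p : Pauli N) : Pauli N :=
  Pauli.ofBits N fun c => if c = d then p.bit d + p.bit s else p.bit c

theorem Pauli.bit_xorBit {N : ℕ} (d s : ℕ) (p : Pauli N) {c : ℕ} (hc : c < 2 * N) :
    (p.xorBit d s).bit c = if c = d then p.bit d + p.bit s else p.bit c :=
  bit_ofBits _ hc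

/-- `H` exchanges the `X` and the `Z` bit of its qubit, and an exchange is three additions modulo
two. All Clifford gates are thus compiled to the single operation of adding one column to another.
-/
theorem Gate.act_H_eq {N : ℕ} (q : Fin N) (p : Pauli N) :
    ((p.xorBit q (N + q)).xorBit (N + q) q).xorBit q (N + q) = (Gate.H q).act p := by
  have hq := q.2
  apply Pauli.ext_bit
  intro c hc
  have h1 : ((q : ℕ) = N + q) = False := by simp; omega
  have h2 : (N + (q : ℕ) = q) = False := by simp; omega
  have h3 : ∀ x y : ZMod 2, y + (x + y) = x := by decide
  have h4 : ∀ x y : ZMod 2, x + y + x = y := by decide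
  have b1 : ∀ (d s : ℕ) (p : Pauli N), (p.xorBit d s).bit q =
      if (q : ℕ) = d then p.bit d + p.bit s else p.bit q :=
    fun d s p => Pauli.bit_xorBit _ _ _ (by omega)
  have b2 : ∀ (d s : ℕ) (p : Pauli N), (p.xorBit d s).bit (N + q) =
      if N + (q : ℕ) = d then p.bit d + p.bit s else p.bit (N + q) :=
    fun d s p => Pauli.bit_xorBit _ _ _ (by omega)
  rw [Gate.bit_act_H]
  simp only [Pauli.bit_xorBit _ _ _ hc, b1, b2, h1, h2, if_true, if_false, h3, h4]
  split_ifs <;> first | rfl | omega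

theorem Gate.act_S_eq {N : ℕ} (q : Fin N) (p : Pauli N) :
    p.xorBit (N + q) q = (Gate.S q).act p := by
  apply Pauli.ext_bit
  intro c hc
  rw [Gate.bit_act_S, Pauli.bit_xorBit _ _ _ hc]

theorem Gate.act_CNOT_eq {N : ℕ} (a b : Fin N) (h : a ≠ b) (p : Pauli N) :
    (p.xorBit b a).xorBit (N + a) (N + b) = (Gate.CNOT a b h).act p := by
  have ha := a.2
  have hb := b.2
  apply Pauli.ext_bit
  intro c hc
  have h1 : (N + (a : ℕ) = b) = False := by simp; omega
  have h2 : (N + (b : ℕ) = b) = False := by simp; omega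
  rw [Gate.bit_act_CNOT, Pauli.bit_xorBit _ _ _ hc, Pauli.bit_xorBit _ _ _ (by omega),
    Pauli.bit_xorBit _ _ _ (by omega), Pauli.bit_xorBit _ _ _ hc]
  simp only [h1, h2, if_false]

/-- `R` contains the bits of `rows g`, `g < n`. -/
def IsTab (N : ℕ) (R : ℕ → ℕ) (rows : ℕ → Pauli N) (n : ℕ) : Prop :=
  ∀ g < n, ∀ c < 2 * N, R (g * (2 * N) + c) = ((rows g).bit c).val

/-- The Paulis whose nonzero bits are among `col j`, `j < w`. -/
def colSupp (N : ℕ) (col : ℕ → ℕ) (w : ℕ) : Submodule (ZMod 2) (Pauli N) where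
  carrier := {p | ∀ c < 2 * N, (∀ j < w, col j ≠ c) → p.bit c = 0}
  add_mem' := by
    intro p p' hp hp' c hc hj
    rw [Pauli.bit_add, hp c hc hj, hp' c hc hj, add_zero]
  zero_mem' := fun c _ _ => Pauli.bit_zero c
  smul_mem' := by
    intro a p hp c hc hj
    rw [Pauli.bit_smul, hp c hc hj, mul_zero]

theorem Pauli.Z_mem_colSupp {N : ℕ} {col : ℕ → ℕ} {w : ℕ} (q : Fin N)
    (h : ∃ j < w, col j = N + q) : Pauli.Z q ∈ colSupp N col w := by
  intro c _ hj
  rw [Pauli.bit_Z, if_neg]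
  rintro rfl
  obtain ⟨j, hjw, hjc⟩ := h
  exact hj j hjw hjc

theorem Pauli.xorBit_mem_colSupp {N : ℕ} {col : ℕ → ℕ} {w d s : ℕ} (h : ∃ j < w, col j = d)
    {p : Pauli N} (hp : p ∈ colSupp N col w) : p.xorBit d s ∈ colSupp N col w := by
  intro c hc hj
  rw [bit_xorBit _ _ _ hc, if_neg, hp c hc hj]
  rintro rfl
  obtain ⟨j, hjw, hjc⟩ := h
  exact hj j hjw hjc

/-- The data on which the code for tables with `n` rows relies: pointers to the rows, and the
columns in use. -/
structure Layout (N : ℕ) (inp : Memory) (st : St) (n : ℕ) : Prop where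
  num : inp.nat 0 + inp.nat 1 = N
  ptr : ∀ g < n, st.na 2 g = g * (2 * N)
  col : ∀ j < st.sz 2, st.na 1 j < 2 * N

theorem Layout.setv {N : ℕ} {inp : Memory} {st : St} {n : ℕ} (h : Layout N inp st n) (v x : ℕ) :
    Layout N inp (st.setv v x) n := ⟨h.num, h.ptr, h.col⟩

theorem Layout.setN {N : ℕ} {inp : Memory} {st : St} {n : ℕ} (h : Layout N inp st n) {a : Fin 8}
    (h1 : a ≠ 1) (h2 : a ≠ 2) (f : ℕ → ℕ) : Layout N inp (st.setN a f) n := by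
  refine ⟨h.num, fun g hg => ?_, fun j hj => ?_⟩
  · rw [St.setN_na, if_neg h2.symm, h.ptr g hg]
  · rw [St.setN_na, if_neg h1.symm]
    exact h.col j hj

theorem Layout.setR {N : ℕ} {inp : Memory} {st : St} {n : ℕ} (h : Layout N inp st n) (a : Fin 8)
    (f : ℕ → ℝ) : Layout N inp (st.setR a f) n := ⟨h.num, h.ptr, h.col⟩

/-- Bit `c` of row `g` in the table `a`. -/
def NE.bit (a : Fin 8) (g c : NE) : NE := .arr a (.add (.arr 2 g) c)

theorem NE.eval_bit {N : ℕ} {inp : Memory} {st : St} {n : ℕ} (h : Layout N inp st n) {a : Fin 8}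
    {rows : ℕ → Pauli N} (hT : IsTab N (st.na a) rows n) {g c : NE} {γ κ : ℕ}
    (hg : g.eval inp st = γ) (hc : c.eval inp st = κ) (hγ : γ < n) (hκ : κ < 2 * N) :
    (NE.bit a g c).eval inp st = ((rows γ).bit κ).val := by
  simp only [NE.bit, NE.eval, hg, hc, h.ptr γ hγ, hT γ hγ κ hκ]

/-- The number of qubits. -/
def NE.numQubits : NE := .add (.inp (.const 0)) (.inp (.const 1))

theorem NE.eval_numQubits {N : ℕ} {inp : Memory} {st : St} {n : ℕ} (h : Layout N inp st n) :
    NE.numQubits.eval inp st = N := h.num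

def NE.xor (e f : NE) : NE := .ite (.add e f) (.const 2) (.add e f) (.const 0)

theorem NE.eval_xor {inp : Memory} {st : St} {e f : NE} {x y : ZMod 2}
    (he : e.eval inp st = x.val) (hf : f.eval inp st = y.val) :
    (NE.xor e f).eval inp st = (x + y).val := by
  have h : ∀ x y : ZMod 2,
      (if x.val + y.val < 2 then x.val + y.val else 0) = (x + y).val := by decide
  simp only [NE.xor, NE.eval, he, hf, h]

/-- Add column `s` to column `d`. -/
def Cmd.xorCol (a : Fin 8) (k : ℕ) (d s : NE) : Cmd :=
  .tabN a 9 k (.add (.arr 2 (.var 9)) d) (.xor (.bit a (.var 9) d) (.bit a (.var 9) s))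

theorem Cmd.exec_xorCol {N : ℕ} {inp : Memory} {st : St} {k n : ℕ} (h : Layout N inp st n)
    (hk : st.sz k = n) {a : Fin 8} {rows : ℕ → Pauli N} (hT : IsTab N (st.na a) rows n) {d s : NE}
    {δ σ : ℕ} (hd : ∀ i, d.eval inp (st.setv 9 i) = δ) (hs : ∀ i, s.eval inp (st.setv 9 i) = σ)
    (hδ : δ < 2 * N) (hσ : σ < 2 * N) :
    ∃ R, (Cmd.xorCol a k d s).exec inp st = st.setN a R ∧
      IsTab N R (fun g => (rows g).xorBit δ σ) n := by
  refine ⟨_, rfl, fun g hg c hc => ?_⟩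
  rw [hk, updMany_col (W := 2 * N) (c₀ := δ) _ _ hδ hg hc, Pauli.bit_xorBit _ _ _ hc]
  · have hv : (NE.var 9).eval inp (st.setv 9 g) = g := by simp [NE.eval]
    have e1 := NE.eval_bit (h.setv 9 g) hT hv (hd g) hg hδ
    have e2 := NE.eval_bit (h.setv 9 g) hT hv (hs g) hg hσ
    simp only [NE.eval_xor e1 e2]
    split_ifs with hcd
    · rfl
    · rw [hT g hg c hc]
  · intro i hi
    simp [NE.eval, hd i, h.ptr i hi]

/-- Set the entries of row `r` in the columns `nv 10`. -/
def Cmd.setRow (a : Fin 8) (r e : NE) : Cmd :=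
  .tabN a 10 2 (.add (.arr 2 r) (.arr 1 (.var 10))) e

/-- Only the columns in use are written. In all other columns both the old row and `p` vanish, so
the whole row becomes `p` although its length `2N` does not enter the cost. -/
theorem Cmd.exec_setRow {N : ℕ} {inp : Memory} {st : St} {n : ℕ} (h : Layout N inp st n)
    {a : Fin 8} {rows : ℕ → Pauli N} (hT : IsTab N (st.na a) rows n) {r e : NE} {ρ : ℕ}
    (hr : ∀ j, r.eval inp (st.setv 10 j) = ρ) (hρ : ρ < n) {p : Pauli N}
    (hp : p ∈ colSupp N (st.na 1) (st.sz 2)) (hρs : rows ρ ∈ colSupp N (st.na 1) (st.sz 2))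
    (he : ∀ j < st.sz 2, e.eval inp (st.setv 10 j) = (p.bit (st.na 1 j)).val) :
    ∃ R, (Cmd.setRow a r e).exec inp st = st.setN a R ∧
      IsTab N R (Function.update rows ρ p) n := by
  classical
  refine ⟨_, rfl, fun g hg c hc => ?_⟩
  rw [updMany_row (W := 2 * N) (r := ρ) (col := st.na 1) _ (fun c => (p.bit c).val) _ h.col he hc,
    hT g hg c hc]
  · by_cases hgρ : g = ρ
    · subst hgρ
      rw [Function.update_self]
      split_ifs with h1
      · rfl
      · have h2 : ∀ j < st.sz 2, st.na 1 j ≠ c := fun j hj hjc => h1 ⟨rfl, j, hj, hjc⟩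
        rw [hp c hc h2, hρs c hc h2]
    · rw [if_neg (fun h => hgρ h.1), Function.update_of_ne hgρ]
  · intro j hj
    simp [NE.eval, hr j, h.ptr ρ hρ]

/-! ### Clifford gates -/

def Cmd.skip : Cmd := .setv 9 (.var 9)

@[simp] theorem Cmd.exec_skip (inp : Memory) (st : St) : Cmd.skip.exec inp st = st :=
  St.setv_self st 9

/-- Apply the Clifford gate described by the scalars 2, 3, 4 to the rows. -/
def Cmd.gateRows (a : Fin 8) (k : ℕ) : Cmd :=
  .ite (.var 2) (.const 1)
    (.seq (.xorCol a k (.var 3) (.add .numQubits (.var 3)))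
      (.seq (.xorCol a k (.add .numQubits (.var 3)) (.var 3))
        (.xorCol a k (.var 3) (.add .numQubits (.var 3))))) <|
  .ite (.var 2) (.const 2) (.xorCol a k (.add .numQubits (.var 3)) (.var 3)) <|
  .ite (.var 2) (.const 3)
    (.seq (.xorCol a k (.var 4) (.var 3))
      (.xorCol a k (.add .numQubits (.var 3)) (.add .numQubits (.var 4))))
    .skip

/-- The scalars 2, 3, 4 describe a gate. -/
def IsGate {N : ℕ} (st : St) (g : Gate N) : Prop := g.natCode = [st.nv 2, st.nv 3, st.nv 4]

theorem Cmd.exec_gateRows {N : ℕ} {inp : Memory} {st : St} {k n : ℕ} (h : Layout N inp st n)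
    (hk : st.sz k = n) {a : Fin 8} (h1 : a ≠ 1) (h2 : a ≠ 2) {rows : ℕ → Pauli N}
    (hT : IsTab N (st.na a) rows n) {g : Gate N} (hg : IsGate st g) :
    ∃ R, (Cmd.gateRows a k).exec inp st = st.setN a R ∧
      IsTab N R (fun i => if g.isPhase then rows i else g.act (rows i)) n := by
  have hvar : ∀ (R : ℕ → ℕ) (w : ℕ), w ≠ 9 → ∀ i,
      (NE.var w).eval inp ((st.setN a R).setv 9 i) = st.nv w := by
    intro R w hw i
    simp [NE.eval, hw]
  have hadd : ∀ (R : ℕ → ℕ) (w : ℕ), w ≠ 9 → ∀ i,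
      (NE.add .numQubits (.var w)).eval inp ((st.setN a R).setv 9 i) = N + st.nv w := by
    intro R w hw i
    show NE.numQubits.eval inp _ + _ = _
    rw [NE.eval_numQubits ((h.setN h1 h2 R).setv 9 i), hvar R w hw i]
  have hx : ∀ (R : ℕ → ℕ) (rows : ℕ → Pauli N), IsTab N R rows n → ∀ (d s : NE) (δ σ : ℕ),
      (∀ i, d.eval inp ((st.setN a R).setv 9 i) = δ) →
      (∀ i, s.eval inp ((st.setN a R).setv 9 i) = σ) → δ < 2 * N → σ < 2 * N →
      ∃ R', (Cmd.xorCol a k d s).exec inp (st.setN a R) = st.setN a R' ∧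
        IsTab N R' (fun g => (rows g).xorBit δ σ) n := by
    intro R rows hR d s δ σ hd hs hδ hσ
    obtain ⟨R', e1, e2⟩ := Cmd.exec_xorCol (h.setN h1 h2 R) hk (a := a) (rows := rows)
      (by simpa using hR) hd hs hδ hσ
    exact ⟨R', by rw [e1, St.setN_setN], e2⟩
  have hst : st = st.setN a (st.na a) := (St.setN_self st a).symm
  unfold IsGate at hg
  cases g with
  | H q =>
    simp only [Gate.natCode, List.cons.injEq] at hg
    obtain ⟨c0, c1, -⟩ := hg
    have hq := q.2
    have a1 := fun R i => (hvar R 3 (by decide) i).trans c1.symm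
    have a2 := fun R i => (hadd R 3 (by decide) i).trans (by rw [← c1])
    obtain ⟨R1, e1, t1⟩ := hx _ rows hT _ _ q (N + q) (a1 _) (a2 _) (by omega) (by omega)
    obtain ⟨R2, e2, t2⟩ := hx _ _ t1 _ _ (N + q) q (a2 _) (a1 _) (by omega) (by omega)
    obtain ⟨R3, e3, t3⟩ := hx _ _ t2 _ _ q (N + q) (a1 _) (a2 _) (by omega) (by omega)
    refine ⟨R3, ?_, ?_⟩
    · simp only [Cmd.gateRows, Cmd.exec, NE.eval, ← c0]
      rw [if_pos (by decide)]
      rw [hst, e1, e2, e3, ← hst]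
    · simpa [Gate.isPhase, Gate.act_H_eq] using t3
  | S q =>
    simp only [Gate.natCode, List.cons.injEq] at hg
    obtain ⟨c0, c1, -⟩ := hg
    have hq := q.2
    have a1 := fun R i => (hvar R 3 (by decide) i).trans c1.symm
    have a2 := fun R i => (hadd R 3 (by decide) i).trans (by rw [← c1])
    obtain ⟨R1, e1, t1⟩ := hx _ rows hT _ _ (N + q) q (a2 _) (a1 _) (by omega) (by omega)
    refine ⟨R1, ?_, ?_⟩
    · simp only [Cmd.gateRows, Cmd.exec, NE.eval, ← c0]
      rw [if_neg (by decide), if_pos (by decide)]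
      rw [hst, e1, ← hst]
    · simpa [Gate.isPhase, Gate.act_S_eq] using t1
  | CNOT x y hxy =>
    simp only [Gate.natCode, List.cons.injEq] at hg
    obtain ⟨c0, c1, c2, -⟩ := hg
    have hx' := x.2
    have hy' := y.2
    have a1 := fun R i => (hvar R 3 (by decide) i).trans c1.symm
    have a2 := fun R i => (hadd R 3 (by decide) i).trans (by rw [← c1])
    have b1 := fun R i => (hvar R 4 (by decide) i).trans c2.symm
    have b2 := fun R i => (hadd R 4 (by decide) i).trans (by rw [← c2])
    obtain ⟨R1, e1, t1⟩ := hx _ rows hT _ _ y x (b1 _) (a1 _) (by omega) (by omega)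
    obtain ⟨R2, e2, t2⟩ := hx _ _ t1 _ _ (N + x) (N + y) (a2 _) (b2 _) (by omega) (by omega)
    refine ⟨R2, ?_, ?_⟩
    · simp only [Cmd.gateRows, Cmd.exec, NE.eval, ← c0]
      rw [if_neg (by decide), if_neg (by decide), if_pos (by decide)]
      rw [hst, e1, e2, ← hst]
    · simpa [Gate.isPhase, Gate.act_CNOT_eq x y hxy] using t2
  | phase q θ =>
    simp only [Gate.natCode, List.cons.injEq] at hg
    obtain ⟨c0, -⟩ := hg
    refine ⟨st.na a, ?_, ?_⟩
    · simp only [Cmd.gateRows, Cmd.exec, NE.eval, ← c0]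
      rw [if_neg (by decide), if_neg (by decide), if_neg (by decide), Cmd.exec_skip, ← hst]
    · simpa [Gate.isPhase] using hT

end QCSAT

namespace QCSAT

/-! ### The input -/

theorem getD_flatMap {α β : Type*} {f : α → List β} {k : ℕ} (hf : ∀ x, (f x).length = k)
    (l : List α) (d : β) {i r : ℕ} (hi : i < l.length) (hr : r < k) :
    (l.flatMap f).getD (k * i + r) d = (f l[i]).getD r d := by
  induction l generalizing i with
  | nil => simp at hi
  | cons x l ih =>
    rw [List.flatMap_cons]
    cases i with
    | zero =>
      rw [mul_zero, zero_add, List.getD_append _ _ _ _ (by rw [hf]; exact hr)]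
      rfl
    | succ i =>
      rw [List.getD_append_right _ _ _ _ (by rw [hf, mul_add]; omega), hf,
        show k * (i + 1) + r - k = k * i + r by rw [mul_add]; omega, ih (by simpa using hi)]
      rfl

theorem Gate.length_natCode {N : ℕ} (g : Gate N) : g.natCode.length = 3 := by cases g <;> rfl

theorem Gate.length_realCode {N : ℕ} (g : Gate N) : g.realCode.length = 2 := by cases g <;> rfl

theorem Instance.natInput_gate (I : Instance) {i r : ℕ} (hi : i < I.gates.length) (hr : r < 3) :
    I.natInput (4 + (3 * i + r)) = (I.gates[i]).natCode.getD r 0 := by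
  unfold Instance.natInput
  rw [List.getD_append_right _ _ _ _ (by simp)]
  simp only [List.length_cons, List.length_nil, Nat.add_sub_cancel_left]
  exact getD_flatMap Gate.length_natCode _ _ hi hr

theorem Instance.realInput_gate (I : Instance) (c δ : ℝ) {i r : ℕ} (hi : i < I.gates.length)
    (hr : r < 2) :
    I.realInput c δ (2 + (2 * i + r)) = (I.gates[i]).realCode.getD r 0 := by
  unfold Instance.realInput
  rw [List.getD_append_right _ _ _ _ (by simp)]
  simp only [List.length_cons, List.length_nil, Nat.add_sub_cancel_left]
  exact getD_flatMap Gate.length_realCode _ _ hi hr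

theorem Gate.natCode_getD_lt {N : ℕ} (g : Gate N) (hN : 0 < N) {r : ℕ} (hr : 0 < r) :
    g.natCode.getD r 0 < N := by
  rcases r with - | - | - | r
  · omega
  · cases g <;> simp [natCode]
  · cases g <;> simp [natCode, hN]
  · cases g <;> simp [natCode, hN]

/-! ### Columns and pointers -/

def NE.triple (e : NE) : NE := .add e (.add e e)

/-- Entry `r` of the code of gate `e`. -/
def NE.gateCode (r : ℕ) (e : NE) : NE := .inp (.add (.const (4 + r)) (.triple e))

theorem NE.eval_gateCode {I : Instance} {inp : Memory} (hinp : inp.nat = I.natInput) {st : St}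
    {r i : ℕ} {e : NE} (he : e.eval inp st = i) (hi : i < I.gates.length) (hr : r < 3) :
    (NE.gateCode r e).eval inp st = (I.gates[i]).natCode.getD r 0 := by
  simp only [gateCode, triple, NE.eval, he, hinp]
  rw [← I.natInput_gate hi hr]
  congr 1
  ring

/-- The sizes used for an instance. -/
structure HasSizes (I : Instance) (st : St) : Prop where
  sz0 : st.sz 0 = I.s
  sz1 : st.sz 1 = I.s + 1
  sz2 : st.sz 2 = 4 * I.s + 2
  sz3 : st.sz 3 = I.n
  sz4 : st.sz 4 = 2 * I.n + 2

/-- Expression for the columns in use. -/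
def NE.column : NE :=
  let s : NE := .size 0
  let j : NE := .var 9
  .ite j s (.gateCode 1 j) <|
  .ite j (.add s s) (.add .numQubits (.gateCode 1 (.sub j s))) <|
  .ite j (.triple s) (.gateCode 2 (.sub j (.add s s))) <|
  .ite j (.add s (.triple s)) (.add .numQubits (.gateCode 2 (.sub j (.triple s)))) <|
  .ite j (.add (.const 1) (.add s (.triple s))) (.inp (.const 3)) <|
  .add .numQubits (.inp (.const 3))

def Cmd.columns : Cmd := .tabN 1 9 2 (.var 9) .column

/-- The machine cannot multiply natural numbers, so the address `g * 2N` of row `g` is the sum of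
`2N` over the indices below `g`. -/
def Cmd.pointers (k : ℕ) : Cmd :=
  .tabN 2 9 k (.var 9) (.sum 10 k (.ite (.var 10) (.var 9) (.add .numQubits .numQubits) (.const 0)))

/-- The qubits of the gate are among the columns, for their `X` and their `Z` part. -/
def Touches {N : ℕ} (col : ℕ → ℕ) (w : ℕ) (g : Gate N) : Prop :=
  ∀ r, r = 1 ∨ r = 2 →
    (∃ j < w, col j = g.natCode.getD r 0) ∧ ∃ j < w, col j = N + g.natCode.getD r 0

/-- The columns of an instance. -/
structure HasColumns (I : Instance) (st : St) : Prop where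
  lt : ∀ j < st.sz 2, st.na 1 j < 2 * (I.n + I.m)
  gate : ∀ g ∈ I.gates, Touches (st.na 1) (st.sz 2) g
  out : ∃ j < st.sz 2, st.na 1 j = I.n + I.m + I.out

/-- The list has `4s + 2` entries: for each gate the `X` and the `Z` columns of both coded qubits,
and the two columns of the output. Its length does not depend on the number of ancillas. Gates on
one qubit are coded with a second qubit `0`, which is a valid column since the output qubit shows `N
> 0`. -/
theorem Cmd.exec_columns {I : Instance} {inp : Memory} (hinp : inp.nat = I.natInput) {st : St}
    (hs : HasSizes I st) :
    ∃ R, Cmd.columns.exec inp st = st.setN 1 R ∧ HasColumns I (st.setN 1 R) := by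
  have hN : 0 < I.n + I.m := I.out.pos
  have hI : I.s = I.gates.length := rfl
  have hnum : inp.nat 0 + inp.nat 1 = I.n + I.m := by rw [hinp]; rfl
  have hout : inp.nat 3 = I.out := by rw [hinp]; rfl
  have h9 : ∀ j, (NE.var 9).eval inp (st.setv 9 j) = j := by intro j; simp [NE.eval]
  refine ⟨_, rfl, ?_⟩
  rw [hs.sz2]
  generalize hv : (fun j => NE.column.eval inp (st.setv 9 j)) = v
  have hcol : ∀ j, v j = if j < I.s then (NE.gateCode 1 (.var 9)).eval inp (st.setv 9 j)
      else if j < I.s + I.s then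
        I.n + I.m + (NE.gateCode 1 (.sub (.var 9) (.size 0))).eval inp (st.setv 9 j)
      else if j < I.s + (I.s + I.s) then
        (NE.gateCode 2 (.sub (.var 9) (.add (.size 0) (.size 0)))).eval inp (st.setv 9 j)
      else if j < I.s + (I.s + (I.s + I.s)) then
        I.n + I.m + (NE.gateCode 2 (.sub (.var 9) (.triple (.size 0)))).eval inp (st.setv 9 j)
      else if j < 1 + (I.s + (I.s + (I.s + I.s))) then (I.out : ℕ) else I.n + I.m + I.out := by
    intro j
    rw [← hv]
    simp [NE.column, NE.eval, NE.triple, NE.numQubits, hs.sz0, hnum, hout]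
  have g1 : ∀ i (hi : i < I.gates.length), v i = I.gates[i].natCode.getD 1 0 := by
    intro i hi
    rw [hcol, if_pos (by omega), NE.eval_gateCode hinp (h9 i) hi (by omega)]
  have g2 : ∀ i (hi : i < I.gates.length),
      v (I.s + i) = I.n + I.m + I.gates[i].natCode.getD 1 0 := by
    intro i hi
    rw [hcol, if_neg (by omega), if_pos (by omega), NE.eval_gateCode (i := i) hinp _ hi (by omega)]
    simp [NE.eval, hs.sz0]
  have g3 : ∀ i (hi : i < I.gates.length),
      v (I.s + I.s + i) = I.gates[i].natCode.getD 2 0 := by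
    intro i hi
    rw [hcol, if_neg (by omega), if_neg (by omega), if_pos (by omega),
      NE.eval_gateCode (i := i) hinp _ hi (by omega)]
    simp [NE.eval, hs.sz0]
  have g4 : ∀ i (hi : i < I.gates.length),
      v (I.s + (I.s + I.s) + i) = I.n + I.m + I.gates[i].natCode.getD 2 0 := by
    intro i hi
    rw [hcol, if_neg (by omega), if_neg (by omega), if_neg (by omega), if_pos (by omega),
      NE.eval_gateCode (i := i) hinp _ hi (by omega)]
    simp [NE.eval, hs.sz0, NE.triple]
  have g5 : v (I.s + (I.s + (I.s + I.s))) = I.out := by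
    rw [hcol, if_neg (by omega), if_neg (by omega), if_neg (by omega), if_neg (by omega),
      if_pos (by omega)]
  have g6 : v (1 + (I.s + (I.s + (I.s + I.s)))) = I.n + I.m + I.out := by
    rw [hcol, if_neg (by omega), if_neg (by omega), if_neg (by omega), if_neg (by omega),
      if_neg (by omega)]
  have hR : ∀ j < 4 * I.s + 2, updMany (st.na 1) (fun i => (NE.var 9).eval inp (st.setv 9 i))
      v (4 * I.s + 2) j = v j := by
    intro j hj
    rw [updMany_id _ (fun i _ => h9 i), if_pos hj]
  generalize updMany (st.na 1) (fun i => (NE.var 9).eval inp (st.setv 9 i)) v (4 * I.s + 2) = R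
    at hR
  have hlt : ∀ (i r : ℕ) (hi : i < I.gates.length), 0 < r →
      I.gates[i].natCode.getD r 0 < I.n + I.m := fun i r hi hr => Gate.natCode_getD_lt _ hN hr
  have hout' := I.out.2
  constructor
  · simp only [St.setN_sz, St.setN_na, if_true, hs.sz2]
    intro j hj
    rw [hR j hj]
    by_cases h1 : j < I.s
    · rw [g1 j h1]; have := hlt j 1 h1 (by omega); omega
    by_cases h2 : j < I.s + I.s
    · obtain ⟨i, rfl⟩ := Nat.exists_eq_add_of_le (not_lt.mp h1)
      have hi : i < I.gates.length := by omega
      rw [g2 i hi]; have := hlt i 1 hi (by omega); omega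
    by_cases h3 : j < I.s + (I.s + I.s)
    · obtain ⟨i, rfl⟩ := Nat.exists_eq_add_of_le (not_lt.mp h2)
      have hi : i < I.gates.length := by omega
      rw [g3 i hi]; have := hlt i 2 hi (by omega); omega
    by_cases h4 : j < I.s + (I.s + (I.s + I.s))
    · obtain ⟨i, rfl⟩ := Nat.exists_eq_add_of_le (not_lt.mp h3)
      have hi : i < I.gates.length := by omega
      rw [g4 i hi]; have := hlt i 2 hi (by omega); omega
    by_cases h5 : j < 1 + (I.s + (I.s + (I.s + I.s)))
    · obtain rfl : j = I.s + (I.s + (I.s + I.s)) := by omega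
      rw [g5]; omega
    · obtain rfl : j = 1 + (I.s + (I.s + (I.s + I.s))) := by omega
      rw [g6]; omega
  · simp only [St.setN_sz, St.setN_na, if_true, hs.sz2]
    intro g hg r hr
    obtain ⟨i, hi, rfl⟩ := List.getElem_of_mem hg
    rcases hr with rfl | rfl
    · exact ⟨⟨i, by omega, by rw [hR _ (by omega), g1 i hi]⟩,
        ⟨I.s + i, by omega, by rw [hR _ (by omega), g2 i hi]⟩⟩
    · exact ⟨⟨I.s + I.s + i, by omega, by rw [hR _ (by omega), g3 i hi]⟩,
        ⟨I.s + (I.s + I.s) + i, by omega, by rw [hR _ (by omega), g4 i hi]⟩⟩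
  · simp only [St.setN_sz, St.setN_na, if_true, hs.sz2]
    exact ⟨1 + (I.s + (I.s + (I.s + I.s))), by omega, by rw [hR _ (by omega), g6]⟩

theorem Cmd.exec_pointers {I : Instance} {inp : Memory} (hinp : inp.nat = I.natInput) {st : St}
    (hc : HasColumns I st) (k : ℕ) :
    ∃ R, (Cmd.pointers k).exec inp st = st.setN 2 R ∧
      Layout (I.n + I.m) inp (st.setN 2 R) (st.sz k) := by
  have hnum : inp.nat 0 + inp.nat 1 = I.n + I.m := by rw [hinp]; rfl
  refine ⟨_, rfl, hnum, ?_, ?_⟩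
  · intro g hg
    rw [St.setN_na, if_pos rfl, updMany_id _ (fun i _ => by simp [NE.eval]), if_pos hg]
    simp only [NE.eval, NE.numQubits, St.setv_sz, St.setv_nv, hnum]
    rw [two_mul, ← sum_range_ite_lt _ g _ hg.le]
    simp
  · simpa using hc.lt

theorem HasColumns.congr {I : Instance} {st st' : St} (h : HasColumns I st) (h1 : st'.sz = st.sz)
    (h2 : st'.na 1 = st.na 1) : HasColumns I st' := by
  constructor
  · rw [h1, h2]; exact h.lt
  · rw [h1, h2]; exact h.gate
  · rw [h1, h2]; exact h.out

theorem HasSizes.congr {I : Instance} {st st' : St} (h : HasSizes I st) (h1 : st'.sz = st.sz) :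
    HasSizes I st' := by
  constructor <;> rw [h1]
  exacts [h.sz0, h.sz1, h.sz2, h.sz3, h.sz4]

theorem Layout.congr {N : ℕ} {inp : Memory} {st st' : St} {n : ℕ} (h : Layout N inp st n)
    (h1 : st'.sz = st.sz) (h2 : st'.na 1 = st.na 1) (h3 : st'.na 2 = st.na 2) :
    Layout N inp st' n := by
  constructor
  · exact h.num
  · rw [h3]; exact h.ptr
  · rw [h1, h2]; exact h.col

theorem Gate.act_mem_colSupp {N : ℕ} {col : ℕ → ℕ} {w : ℕ} {g : Gate N} (hg : Touches col w g)
    {p : Pauli N} (hp : p ∈ colSupp N col w) : g.act p ∈ colSupp N col w := by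
  have h1 := hg 1 (Or.inl rfl)
  have h2 := hg 2 (Or.inr rfl)
  cases g with
  | H q =>
    rw [← Gate.act_H_eq]
    exact Pauli.xorBit_mem_colSupp h1.1 (Pauli.xorBit_mem_colSupp h1.2
      (Pauli.xorBit_mem_colSupp h1.1 hp))
  | S q =>
    rw [← Gate.act_S_eq]
    exact Pauli.xorBit_mem_colSupp h1.2 hp
  | CNOT a b h =>
    rw [← Gate.act_CNOT_eq]
    exact Pauli.xorBit_mem_colSupp h1.2 (Pauli.xorBit_mem_colSupp h2.1 hp)
  | phase q θ => exact hp

theorem Touches.Z_mem {N : ℕ} {col : ℕ → ℕ} {w : ℕ} {q : Fin N} {θ : ℝ}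
    (hg : Touches col w (Gate.phase q θ)) : Pauli.Z q ∈ colSupp N col w :=
  Pauli.Z_mem_colSupp q (hg 1 (Or.inl rfl)).2

/-! ### Reading a gate -/

/-- The index of the gate for step `nv 1`, counted from the last gate. -/
def NE.gateIdx : NE := .sub (.size 0) (.add (.var 1) (.const 1))

def Cmd.loadGate : Cmd :=
  .seq (.setv 2 (.gateCode 0 .gateIdx)) <| .seq (.setv 3 (.gateCode 1 .gateIdx)) <|
    .setv 4 (.gateCode 2 .gateIdx)

theorem Cmd.exec_loadGate {I : Instance} {inp : Memory} (hinp : inp.nat = I.natInput) {st : St}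
    (hs : st.sz 0 = I.s) {i : ℕ} (hi : I.s - (i + 1) < I.gates.length) (h1 : st.nv 1 = i) :
    ∃ x y z, Cmd.loadGate.exec inp st = ((st.setv 2 x).setv 3 y).setv 4 z ∧
      IsGate (((st.setv 2 x).setv 3 y).setv 4 z) I.gates[I.s - (i + 1)] := by
  refine ⟨_, _, _, rfl, ?_⟩
  have hidx : ∀ st' : St, st'.sz 0 = I.s → st'.nv 1 = i →
      NE.gateIdx.eval inp st' = I.s - (i + 1) := by
    intro st' h h'
    simp [NE.gateIdx, NE.eval, h, h']
  unfold IsGate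
  rw [NE.eval_gateCode hinp (hidx _ (by simpa [Cmd.exec] using hs) (by simpa [Cmd.exec] using h1)) hi (by omega),
    NE.eval_gateCode hinp (hidx _ (by simpa [Cmd.exec] using hs) (by simpa [Cmd.exec] using h1)) hi (by omega),
    NE.eval_gateCode hinp (hidx _ (by simpa [Cmd.exec] using hs) (by simpa [Cmd.exec] using h1)) hi (by omega)]
  generalize I.gates[I.s - (i + 1)] = g
  cases g <;> rfl

theorem Instance.drop_gates (I : Instance) {i : ℕ} (hi : i < I.s) :
    I.gates.drop (I.s - (i + 1)) = I.gates[I.s - (i + 1)]'(by unfold Instance.s at *; omega) ::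
      I.gates.drop (I.s - i) := by
  rw [List.drop_eq_getElem_cons (by unfold Instance.s at *; omega)]
  congr 2
  omega

theorem IsGate.phase_iff {N : ℕ} {st : St} {g : Gate N} (h : IsGate st g) :
    g.isPhase = true ↔ ¬ st.nv 2 < 3 := by
  cases g <;> simp only [IsGate, Gate.natCode, List.cons.injEq] at h <;>
    simp [← h.1, Gate.isPhase]

theorem IsGate.phase_eq {N : ℕ} {st : St} {q : Fin N} {θ : ℝ} (h : IsGate st (Gate.phase q θ)) :
    st.nv 3 = q := by
  simp only [IsGate, Gate.natCode, List.cons.injEq] at h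
  exact h.2.1.symm

/-- Count the rows with a nonzero `X` part in qubit `nv 3`. -/
def Cmd.countX (a : Fin 8) (k : ℕ) : Cmd := .setv 5 (.sum 9 k (.bit a (.var 9) (.var 3)))

theorem Cmd.exec_countX {N : ℕ} {inp : Memory} {st : St} {k n : ℕ} (h : Layout N inp st n)
    (hk : st.sz k = n) {a : Fin 8} {rows : ℕ → Pauli N} (hT : IsTab N (st.na a) rows n)
    {q : Fin N} (hq : st.nv 3 = q) :
    ∃ x, (Cmd.countX a k).exec inp st = st.setv 5 x ∧
      (0 < x ↔ ∃ g < n, (rows g).1 q = 1) := by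
  refine ⟨_, rfl, ?_⟩
  have h1 : ∀ i ∈ Finset.range n, (NE.bit a (.var 9) (.var 3)).eval inp (st.setv 9 i) =
      ((rows i).1 q).val := by
    intro i hi
    rw [NE.eval_bit (h.setv 9 i) hT (γ := i) (κ := q) (by simp [NE.eval])
      (by simp [NE.eval, hq]) (Finset.mem_range.mp hi) (by omega), Pauli.bit_fst]
  rw [NE.eval, hk, Finset.sum_congr rfl h1, Finset.sum_pos_iff]
  simp only [Finset.mem_range]
  have h2 : ∀ x : ZMod 2, 0 < x.val ↔ x = 1 := by decide
  simp only [h2]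

def NE.eq (e f : NE) : NE := .ite e f (.const 0) (.ite f e (.const 0) (.const 1))

theorem NE.eval_eq (e f : NE) (inp : Memory) (st : St) :
    (NE.eq e f).eval inp st = if e.eval inp st = f.eval inp st then 1 else 0 := by
  simp only [NE.eq, NE.eval]
  split_ifs <;> first | rfl | omega

end QCSAT

/-! ### Generators of the group, and the computation of `b` -/

namespace QCSAT

/-! ### Generators of the group of propagated Paulis -/

theorem span_range_update {N : ℕ} {rows : ℕ → Pauli N} {i : ℕ} (h : rows i = 0) (p : Pauli N) :
    Submodule.span (ZMod 2) (Set.range (Function.update rows i p)) =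
      Submodule.span (ZMod 2) (Set.range rows) ⊔ Submodule.span (ZMod 2) {p} := by
  apply le_antisymm
  · rw [Submodule.span_le]
    rintro _ ⟨g, rfl⟩
    by_cases hg : g = i
    · subst hg
      rw [Function.update_self]
      exact Submodule.mem_sup_right (Submodule.subset_span rfl)
    · rw [Function.update_of_ne hg]
      exact Submodule.mem_sup_left (Submodule.subset_span ⟨g, rfl⟩)
  · apply sup_le
    · rw [Submodule.span_le]
      rintro _ ⟨g, rfl⟩
      by_cases hg : g = i
      · subst hg
        rw [h]
        exact Submodule.zero_mem _
      · exact Submodule.subset_span ⟨g, Function.update_of_ne hg _ _⟩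
    · rw [Submodule.span_singleton_le_iff_mem]
      exact Submodule.subset_span ⟨i, Function.update_self _ _ _⟩

theorem span_range_act {N : ℕ} (g : Gate N) (hg : g.isPhase = false) (gs : List (Gate N))
    (o : Fin N) {rows : ℕ → Pauli N}
    (h : Submodule.span (ZMod 2) (Set.range rows) = propSpan gs o) :
    Submodule.span (ZMod 2) (Set.range fun i => g.act (rows i)) = propSpan (g :: gs) o := by
  rw [propSpan_cons g hg, ← h, Submodule.map_span, ← Set.range_comp]
  rfl

/-- One step of the computation of generators. -/
def Cmd.gateStep : Cmd :=
  .seq .loadGate <| .seq (.gateRows 0 1) <| .ite (.var 2) (.const 3) .skip <|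
  .seq (.countX 0 1) <| .ite (.const 0) (.var 5)
    (.setRow 0 (.add (.var 1) (.const 1)) (.eq (.arr 1 (.var 10)) (.add .numQubits (.var 3))))
    .skip

/-- The states agree apart from the table `0` and the scalars other than `0`. -/
structure Agree (st st' : St) : Prop where
  sz : st'.sz = st.sz
  na : ∀ b ≠ 0, st'.na b = st.na b
  ra : st'.ra = st.ra
  nv : st'.nv 0 = st.nv 0

/-- The rows of table `0` generate the group for the last `i` gates. -/
structure GateInv (I : Instance) (st : St) (i : ℕ) (st' : St) (rows : ℕ → Pauli (I.n + I.m)) :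
    Prop where
  agree : Agree st st'
  tab : IsTab (I.n + I.m) (st'.na 0) rows (I.s + 1)
  supp : ∀ g, rows g ∈ colSupp (I.n + I.m) (st.na 1) (st.sz 2)
  zero : ∀ g, i < g → rows g = 0
  span : Submodule.span (ZMod 2) (Set.range rows) = propSpan (I.gates.drop (I.s - i)) I.out

theorem NE.eval_eq_Z {N : ℕ} {inp : Memory} {st : St} {n : ℕ} (h : Layout N inp st n) {q : Fin N}
    (hq : st.nv 3 = q) (j : ℕ) :
    (NE.eq (.arr 1 (.var 10)) (.add .numQubits (.var 3))).eval inp (st.setv 10 j) =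
      ((Pauli.Z q).bit (st.na 1 j)).val := by
  rw [NE.eval_eq, Pauli.bit_Z]
  have h1 : (NE.add .numQubits (.var 3)).eval inp (st.setv 10 j) = N + q := by
    rw [NE.eval, NE.eval_numQubits (h.setv 10 j)]
    simp [NE.eval, hq]
  have h2 : (NE.arr 1 (.var 10)).eval inp (st.setv 10 j) = st.na 1 j := by simp [NE.eval]
  rw [h1, h2]
  split_ifs <;> rfl

/-- A Clifford gate maps generators to generators. A phase gate adds the generator `Z_q` if some row
has an `X` bit at `q`, and otherwise changes nothing. After `i` gates the rows above `i` are still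
zero, so row `i + 1` is free; hence `s + 1` rows suffice, without any test for redundancy. -/
theorem Cmd.exec_gateStep {I : Instance} {inp : Memory} (hinp : inp.nat = I.natInput) {st : St}
    (hs : HasSizes I st) (hc : HasColumns I st) (hl : Layout (I.n + I.m) inp st (I.s + 1))
    {i : ℕ} (hi : i < I.s) {st' : St} {rows : ℕ → Pauli (I.n + I.m)}
    (h : GateInv I st i st' rows) :
    ∃ rows', GateInv I st (i + 1) (Cmd.gateStep.exec inp (st'.setv 1 i)) rows' := by
  have hlen : I.s - (i + 1) < I.gates.length := by unfold Instance.s at *; omega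
  have hs' := hs.congr h.agree.sz
  have hl' := hl.congr h.agree.sz (h.agree.na 1 (by decide)) (h.agree.na 2 (by decide))
  obtain ⟨x, y, z, e1, hg⟩ := Cmd.exec_loadGate (st := st'.setv 1 i) hinp hs'.sz0 hlen (by simp)
  generalize hst1 : (((st'.setv 1 i).setv 2 x).setv 3 y).setv 4 z = st1 at e1 hg
  have hl1 : Layout (I.n + I.m) inp st1 (I.s + 1) := by
    rw [← hst1]; exact (((hl'.setv _ _).setv _ _).setv _ _).setv _ _
  have a1 : Agree st st1 := by
    rw [← hst1]
    exact ⟨h.agree.sz, h.agree.na, h.agree.ra, by simpa using h.agree.nv⟩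
  have hi1 : st1.nv 1 = i := by simp [← hst1]
  have hz1 : st1.sz 1 = I.s + 1 := by rw [a1.sz, hs.sz1]
  have ht1 : IsTab (I.n + I.m) (st1.na 0) rows (I.s + 1) := by rw [← hst1]; exact h.tab
  obtain ⟨R2, e2, t2⟩ := Cmd.exec_gateRows hl1 hz1 (a := 0) (by decide) (by decide) ht1 hg
  have hl2 := hl1.setN (a := 0) (by decide) (by decide) R2
  have a2 : Agree st (st1.setN 0 R2) :=
    ⟨a1.sz, fun b hb => by rw [St.setN_na, if_neg hb, a1.na b hb], a1.ra, a1.nv⟩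
  have hmem : I.gates[I.s - (i + 1)] ∈ I.gates := List.getElem_mem hlen
  have htouch := hc.gate _ hmem
  have hdrop := I.drop_gates hi
  unfold Cmd.gateStep
  simp only [Cmd.exec, e1, e2]
  generalize I.gates[I.s - (i + 1)] = g at *
  by_cases hph : g.isPhase = true
  · have hnot := hg.phase_iff.mp hph
    cases g with
    | phase q θ =>
      have hq := hg.phase_eq
      have t2' : IsTab (I.n + I.m) ((st1.setN 0 R2).na 0) rows (I.s + 1) := by
        simpa [Gate.isPhase] using t2
      rw [if_neg (by simpa [NE.eval] using hnot)]
      obtain ⟨x, e3, hx⟩ := Cmd.exec_countX hl2 (by simpa using hz1) t2' (q := q)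
        (by simpa using hq)
      rw [e3]
      -- The count over the generators decides the question for the whole group, by linearity of the
      -- `X` bit.
      have hiff : 0 < x ↔ ∃ p ∈ propSpan (I.gates.drop (I.s - i)) I.out, p.1 q = 1 := by
        rw [hx, ← h.span, exists_fst_ne_zero_iff]
        constructor
        · rintro ⟨g, -, hg⟩; exact ⟨_, ⟨g, rfl⟩, hg⟩
        · rintro ⟨_, ⟨g, rfl⟩, hg⟩
          refine ⟨g, ?_, hg⟩
          by_contra hlt
          rw [h.zero g (by omega)] at hg
          exact zero_ne_one hg
      have a3 : Agree st ((st1.setN 0 R2).setv 5 x) :=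
        ⟨a2.sz, a2.na, a2.ra, by simpa using a2.nv⟩
      by_cases hx0 : 0 < x
      · rw [if_pos (by simpa [NE.eval] using hx0)]
        have hcol : ((st1.setN 0 R2).setv 5 x).na 1 = st.na 1 := a3.na 1 (by decide)
        obtain ⟨R4, e4, t4⟩ := Cmd.exec_setRow (hl2.setv 5 x) (a := 0) t2'
          (r := .add (.var 1) (.const 1)) (ρ := i + 1)
          (e := .eq (.arr 1 (.var 10)) (.add .numQubits (.var 3)))
          (by intro j; simp [NE.eval, hi1]) (by omega) (p := Pauli.Z q)
          (by rw [hcol, a3.sz]; exact htouch.Z_mem)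
          (by rw [hcol, a3.sz]; exact h.supp _)
          (fun j _ => NE.eval_eq_Z (hl2.setv 5 x) (by simpa using hq) j)
        rw [e4]
        refine ⟨_, ⟨a3.sz, fun b hb => ?_, a3.ra, a3.nv⟩, by simpa using t4, ?_, ?_, ?_⟩
        · rw [St.setN_na, if_neg hb, a3.na b hb]
        · intro g
          by_cases hg : g = i + 1
          · rw [hg, Function.update_self]; exact htouch.Z_mem
          · rw [Function.update_of_ne hg]; exact h.supp g
        · intro g hg
          rw [Function.update_of_ne (by omega), h.zero g (by omega)]
        · rw [span_range_update (h.zero _ (by omega)), h.span, hdrop,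
            propSpan_phase_pos _ _ _ _ (hiff.mp hx0)]
      · rw [if_neg (by simpa [NE.eval] using hx0), Cmd.exec_skip]
        refine ⟨rows, a3, t2', h.supp, fun g hg => h.zero g (by omega), ?_⟩
        rw [h.span, hdrop, propSpan_phase_neg _ _ _ _ (fun h' => hx0 (hiff.mpr h'))]
    | _ => simp [Gate.isPhase] at hph
  · have hph' : g.isPhase = false := by simpa using hph
    have hlt : st1.nv 2 < 3 := by
      by_contra h'
      exact hph (hg.phase_iff.mpr h')
    rw [if_pos (by simpa [NE.eval] using hlt), Cmd.exec_skip]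
    refine ⟨fun i => g.act (rows i), a2, by simpa [hph'] using t2,
      fun g' => Gate.act_mem_colSupp htouch (h.supp g'), fun g' hg' => ?_, ?_⟩
    · simp only [h.zero g' (by omega)]
      exact g.actLin.map_zero
    · rw [span_range_act g hph' _ _ h.span, hdrop]

/-- Compute generators of the group of propagated Paulis. -/
def Cmd.generators : Cmd :=
  .seq .columns <| .seq (.pointers 1) <| .seq (.setv 3 (.inp (.const 3))) <|
  .seq (.setRow 0 (.const 0) (.eq (.arr 1 (.var 10)) (.add .numQubits (.var 3)))) <|
  .loop 1 0 .gateStep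

theorem isTab_zero {N : ℕ} {R : ℕ → ℕ} (hR : R = fun _ => 0) (n : ℕ) :
    IsTab N R (fun _ => 0) n := by
  intro g _ c _
  rw [hR, Pauli.bit_zero]
  rfl

theorem Cmd.exec_generators {I : Instance} {inp : Memory} (hinp : inp.nat = I.natInput) {st : St}
    (hs : HasSizes I st) (h0 : st.na 0 = fun _ => 0) (hv : st.nv 0 = 0) :
    let st' := Cmd.generators.exec inp st
    st'.sz = st.sz ∧ HasColumns I st' ∧ Layout (I.n + I.m) inp st' (I.s + 1) ∧
      (∀ b, b ≠ 0 → b ≠ 1 → b ≠ 2 → st'.na b = st.na b) ∧ st'.ra = st.ra ∧ st'.nv 0 = 0 ∧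
      ∃ rows, IsTab (I.n + I.m) (st'.na 0) rows (I.s + 1) ∧
        (∀ g, rows g ∈ colSupp (I.n + I.m) (st'.na 1) (st'.sz 2)) ∧
        (∀ g, I.s < g → rows g = 0) ∧
        Submodule.span (ZMod 2) (Set.range rows) = propSpan I.gates I.out := by
  obtain ⟨R1, e1, hc1⟩ := Cmd.exec_columns hinp hs
  obtain ⟨R2, e2, hl2⟩ := Cmd.exec_pointers hinp hc1 1
  have hout : inp.nat 3 = I.out := by rw [hinp]; rfl
  have hc2 : HasColumns I ((st.setN 1 R1).setN 2 R2) := hc1.congr rfl (by simp)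
  generalize hst2 : (st.setN 1 R1).setN 2 R2 = st2 at e2 hl2 hc2
  have hsz2 : st2.sz = st.sz := by rw [← hst2]; rfl
  have hz : (st.setN 1 R1).sz 1 = I.s + 1 := hs.sz1
  rw [hz] at hl2
  have ht2 : IsTab (I.n + I.m) ((st2.setv 3 I.out).na 0) (fun _ => 0) (I.s + 1) :=
    isTab_zero (by rw [← hst2]; simpa using h0) _
  obtain ⟨R3, e3, t3⟩ := Cmd.exec_setRow (hl2.setv 3 I.out) (a := 0) ht2
    (r := .const 0) (ρ := 0) (e := .eq (.arr 1 (.var 10)) (.add .numQubits (.var 3)))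
    (by intro j; rfl) (by omega) (p := Pauli.Z I.out) (Pauli.Z_mem_colSupp _ hc2.out)
    (Submodule.zero_mem _) (fun j _ => NE.eval_eq_Z (hl2.setv 3 I.out) (by simp) j)
  generalize hst3 : (st2.setv 3 I.out).setN 0 R3 = st3 at e3
  have hc3 : HasColumns I st3 := hc2.congr (by rw [← hst3]; rfl) (by rw [← hst3]; simp)
  have hs3 : HasSizes I st3 := hs.congr (by rw [← hst3]; exact hsz2)
  have hl3 : Layout (I.n + I.m) inp st3 (I.s + 1) := by
    rw [← hst3]; exact (hl2.setv _ _).setN (by decide) (by decide) _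
  have hinit : GateInv I st3 0 st3 (Function.update (fun _ => 0) 0 (Pauli.Z I.out)) := by
    refine ⟨⟨rfl, fun _ _ => rfl, rfl, rfl⟩, by rw [← hst3]; simpa using t3, ?_, ?_, ?_⟩
    · intro g
      by_cases hg : g = 0
      · subst hg; rw [Function.update_self]; exact Pauli.Z_mem_colSupp _ hc3.out
      · rw [Function.update_of_ne hg]; exact Submodule.zero_mem _
    · intro g hg
      rw [Function.update_of_ne (by omega)]
    · rw [span_range_update rfl, Nat.sub_zero, Instance.s, List.drop_length]
      simp [propSpan, propagated]
  have hexec : Cmd.generators.exec inp st = (Cmd.loop 1 0 .gateStep).exec inp st3 := by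
    have e4 : (NE.inp (.const 3)).eval inp st2 = I.out := hout
    simp only [Cmd.generators, Cmd.exec, e1, e2, e4, e3]
  intro st'
  have hst' : st' = (Cmd.loop 1 0 .gateStep).exec inp st3 := hexec
  clear_value st'
  have hfin : ∃ st'' rows, GateInv I st3 I.s st'' rows ∧ st' = st''.setv 1 (st3.nv 1) := by
    rw [hst', ← hs3.sz0]
    refine Cmd.loop_induction (Q := fun st' => ∃ st'' rows, GateInv I st3 (st3.sz 0) st'' rows ∧
      st' = st''.setv 1 (st3.nv 1)) (fun i st' => ∃ rows, GateInv I st3 i st' rows)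
      ⟨_, hinit⟩ ?_ ?_
    · rintro i hi st4 ⟨rows, h⟩
      exact Cmd.exec_gateStep hinp hs3 hc3 hl3 (by rwa [hs3.sz0] at hi) h
    · rintro st4 ⟨rows, h⟩
      exact ⟨st4, rows, h, rfl⟩
  obtain ⟨st4, rows, h, rfl⟩ := hfin
  have hszz : st4.sz = st.sz := by rw [h.agree.sz, ← hst3]; exact hsz2
  have hna1 : st4.na 1 = st3.na 1 := h.agree.na 1 (by decide)
  refine ⟨hszz, hc3.congr h.agree.sz hna1,
    hl3.congr h.agree.sz hna1 (h.agree.na 2 (by decide)), ?_, ?_, ?_, rows, h.tab, ?_, h.zero, ?_⟩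
  · intro b h0 h1 h2
    rw [St.setv_na, h.agree.na b h0, ← hst3, ← hst2]
    simp [h0, h1, h2]
  · rw [St.setv_ra, h.agree.ra, ← hst3, ← hst2]; rfl
  · rw [St.setv_nv, if_neg (by decide), h.agree.nv, ← hst3, ← hst2]
    simpa using hv
  · simpa [hna1, h.agree.sz] using h.supp
  · rw [h.span, Nat.sub_self, List.drop_zero]

end QCSAT

namespace QCSAT

/-! ### Elimination over the field with two elements -/

/-- After the elimination all later rows vanish in column `c`, where row `i` does not. So row `i`
lies outside their span, and together with them it spans what the old rows spanned. -/
theorem finrank_elimination {N : ℕ} {rows rows' : ℕ → Pauli N} {i n c : ℕ} (hi : i < n)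
    (hc : (rows i).bit c = 1)
    (h : ∀ g, i < g → rows' g = if (rows g).bit c = 1 then rows g + rows i else rows g) :
    Module.finrank (ZMod 2) (Submodule.span (ZMod 2) (rows '' Set.Ico i n)) =
      Module.finrank (ZMod 2) (Submodule.span (ZMod 2) (rows' '' Set.Ico (i + 1) n)) + 1 := by
  have hbit : ∀ p ∈ Submodule.span (ZMod 2) (rows' '' Set.Ico (i + 1) n), p.bit c = 0 := by
    intro p hp
    induction hp using Submodule.span_induction with
    | mem x hx =>
      obtain ⟨g, hg, rfl⟩ := hx
      rw [h g hg.1]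
      split_ifs with h1
      · rw [Pauli.bit_add, h1, hc]; rfl
      · exact (zmod_two_cases _).resolve_right h1
    | zero => exact Pauli.bit_zero c
    | add x y _ _ hx hy => rw [Pauli.bit_add, hx, hy, add_zero]
    | smul a x _ hx => rw [Pauli.bit_smul, hx, mul_zero]
  have hnot : rows i ∉ Submodule.span (ZMod 2) (rows' '' Set.Ico (i + 1) n) := fun hp => by
    rw [hbit _ hp] at hc
    exact zero_ne_one hc
  rw [← Submodule.finrank_sup_span_singleton hnot]
  refine congrArg (fun W : Submodule (ZMod 2) (Pauli N) => Module.finrank (ZMod 2) W) ?_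
  have hself : rows i ∈ Submodule.span (ZMod 2) (rows '' Set.Ico i n) :=
    Submodule.subset_span ⟨i, ⟨le_rfl, hi⟩, rfl⟩
  apply le_antisymm
  · rw [Submodule.span_le]
    rintro _ ⟨g, ⟨hg1, hg2⟩, rfl⟩
    rcases hg1.eq_or_lt with rfl | hg1
    · exact Submodule.mem_sup_right (Submodule.subset_span rfl)
    · have h1 : rows' g ∈ Submodule.span (ZMod 2) (rows' '' Set.Ico (i + 1) n) :=
        Submodule.subset_span ⟨g, ⟨hg1, hg2⟩, rfl⟩
      rw [h g hg1] at h1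
      split_ifs at h1 with h2
      · have h3 := Submodule.add_mem_sup h1 (Submodule.mem_span_singleton_self (R := ZMod 2)
          (rows i))
        rwa [add_assoc, Pauli.add_self, add_zero] at h3
      · exact Submodule.mem_sup_left h1
  · apply sup_le
    · rw [Submodule.span_le]
      rintro _ ⟨g, ⟨hg1, hg2⟩, rfl⟩
      have h1 : rows g ∈ Submodule.span (ZMod 2) (rows '' Set.Ico i n) :=
        Submodule.subset_span ⟨g, ⟨by omega, hg2⟩, rfl⟩
      rw [h g hg1]
      split_ifs
      · exact Submodule.add_mem _ h1 hself
      · exact h1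
    · rwa [Submodule.span_singleton_le_iff_mem]

theorem finrank_elimination_zero {N : ℕ} {rows : ℕ → Pauli N} {i n : ℕ} (hc : rows i = 0) :
    Module.finrank (ZMod 2) (Submodule.span (ZMod 2) (rows '' Set.Ico i n)) =
      Module.finrank (ZMod 2) (Submodule.span (ZMod 2) (rows '' Set.Ico (i + 1) n)) := by
  refine congrArg (fun W : Submodule (ZMod 2) (Pauli N) => Module.finrank (ZMod 2) W) ?_
  apply le_antisymm
  · rw [Submodule.span_le]
    rintro _ ⟨g, ⟨hg1, hg2⟩, rfl⟩
    rcases hg1.eq_or_lt with rfl | hg1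
    · rw [hc]; exact Submodule.zero_mem _
    · exact Submodule.subset_span ⟨g, ⟨hg1, hg2⟩, rfl⟩
  · exact Submodule.span_mono (Set.image_mono (Set.Ico_subset_Ico_left (by omega)))

/-- The states agree apart from the scalars in `A`. -/
structure SameBut (A : Finset ℕ) (st st' : St) : Prop where
  sz : st'.sz = st.sz
  na : st'.na = st.na
  ra : st'.ra = st.ra
  nv : ∀ v ∉ A, st'.nv v = st.nv v

/-- Look for a column `nv 6` in which row `nv 1` is nonzero, and put `nv 5 = 1` if there is one. -/
def Cmd.pivot : Cmd :=
  .seq (.setv 5 (.const 0)) <| .loop 9 2 <| .ite (.const 0) (.bit 0 (.var 1) (.arr 1 (.var 9)))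
    (.seq (.setv 6 (.arr 1 (.var 9))) (.setv 5 (.const 1))) .skip

/-- The loop does not stop at a hit but keeps the last one, and any pivot will do. Without a hit the
row is zero, because it has no bits outside the listed columns. -/
theorem Cmd.exec_pivot {N : ℕ} {inp : Memory} {st : St} {n : ℕ} (h : Layout N inp st n)
    {rows : ℕ → Pauli N} (hT : IsTab N (st.na 0) rows n) {i : ℕ} (hi : i < n) (h1 : st.nv 1 = i)
    (hsupp : rows i ∈ colSupp N (st.na 1) (st.sz 2)) :
    let st' := Cmd.pivot.exec inp st
    SameBut {5, 6} st st' ∧ (st'.nv 5 = 0 ∧ rows i = 0 ∨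
      st'.nv 5 = 1 ∧ st'.nv 6 < 2 * N ∧ (rows i).bit (st'.nv 6) = 1) := by
  show SameBut {5, 6} st ((Cmd.loop 9 2 _).exec inp (st.setv 5 0)) ∧ _
  refine Cmd.loop_induction (st := st.setv 5 0) (Q := fun st' => SameBut {5, 6} st st' ∧
    (st'.nv 5 = 0 ∧ rows i = 0 ∨ st'.nv 5 = 1 ∧ st'.nv 6 < 2 * N ∧ (rows i).bit (st'.nv 6) = 1))
    (fun j st' => SameBut {5, 6, 9} st st' ∧
      (st'.nv 5 = 0 ∧ (∀ j' < j, (rows i).bit (st.na 1 j') = 0) ∨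
        st'.nv 5 = 1 ∧ st'.nv 6 < 2 * N ∧ (rows i).bit (st'.nv 6) = 1)) ?_ ?_ ?_
  · refine ⟨⟨rfl, rfl, rfl, fun v hv => ?_⟩, Or.inl ⟨by simp, by simp⟩⟩
    simp only [Finset.mem_insert, Finset.mem_singleton, not_or] at hv
    simp [hv.1]
  · rintro j hj st' ⟨hsame, hinv⟩
    have hj : j < st.sz 2 := hj
    have hl : Layout N inp (st'.setv 9 j) n :=
      h.congr hsame.sz (by rw [St.setv_na, hsame.na]) (by rw [St.setv_na, hsame.na])
    have hbit : (NE.bit 0 (.var 1) (.arr 1 (.var 9))).eval inp (st'.setv 9 j) =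
        ((rows i).bit (st.na 1 j)).val := by
      refine NE.eval_bit hl (a := 0) (by rw [St.setv_na, hsame.na]; exact hT) ?_ ?_ hi (h.col j hj)
      · simp [NE.eval, hsame.nv 1 (by decide), h1]
      · simp [NE.eval, hsame.na]
    have hz : ∀ x : ZMod 2, 0 < x.val ↔ x = 1 := by decide
    rw [Cmd.exec, hbit]
    simp only [NE.eval, hz]
    split_ifs with hone
    · refine ⟨⟨hsame.sz, hsame.na, hsame.ra, fun v hv => ?_⟩, Or.inr ?_⟩
      · have := hsame.nv v hv
        simp only [Finset.mem_insert, Finset.mem_singleton, not_or] at hv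
        simp [Cmd.exec, hv, this]
      · simp [Cmd.exec, NE.eval, hsame.na, hone, h.col j hj]
    · rw [Cmd.exec_skip]
      refine ⟨⟨hsame.sz, hsame.na, hsame.ra, fun v hv => ?_⟩, ?_⟩
      · have := hsame.nv v hv
        simp only [Finset.mem_insert, Finset.mem_singleton, not_or] at hv
        simp [hv, this]
      · simp only [St.setv_nv]
        rcases hinv with ⟨h5, hb⟩ | hinv
        · refine Or.inl ⟨by simpa using h5, fun j' hj' => ?_⟩
          rcases Nat.lt_succ_iff_lt_or_eq.mp hj' with hj' | rfl
          · exact hb j' hj'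
          · exact (zmod_two_cases _).resolve_right hone
        · exact Or.inr (by simpa using hinv)
  · rintro st' ⟨hsame, hinv⟩
    refine ⟨⟨hsame.sz, hsame.na, hsame.ra, fun v hv => ?_⟩, ?_⟩
    · simp only [Finset.mem_insert, Finset.mem_singleton, not_or] at hv
      by_cases h9 : v = 9
      · simp [h9]
      · simpa [h9] using hsame.nv v (by simp [hv, h9])
    · rcases hinv with ⟨h5, hb⟩ | hinv
      · refine Or.inl ⟨by simpa using h5, Pauli.ext_bit fun c hc => ?_⟩
        rw [Pauli.bit_zero]
        by_cases hex : ∃ j < st.sz 2, st.na 1 j = c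
        · obtain ⟨j, hj, rfl⟩ := hex
          exact hb j hj
        · exact hsupp c hc fun j hj hjc => hex ⟨j, hj, hjc⟩
      · exact Or.inr (by simpa using hinv)

/-- Add row `nv 1` to the later rows that are nonzero in column `nv 6`. -/
def Cmd.clearColumn : Cmd :=
  .loop 9 1 <| .ite (.var 1) (.var 9)
    (.ite (.const 0) (.bit 0 (.var 9) (.var 6))
      (.setRow 0 (.var 9)
        (.xor (.bit 0 (.var 9) (.arr 1 (.var 10))) (.bit 0 (.var 1) (.arr 1 (.var 10)))))
      .skip) .skip

theorem Cmd.exec_clearColumn {N : ℕ} {inp : Memory} {st : St} {n : ℕ} (h : Layout N inp st n)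
    (hk : st.sz 1 = n) {rows : ℕ → Pauli N} (hT : IsTab N (st.na 0) rows n) {i c : ℕ} (hi : i < n)
    (h1 : st.nv 1 = i) (hc : c < 2 * N) (h6 : st.nv 6 = c)
    (hsupp : ∀ g, rows g ∈ colSupp N (st.na 1) (st.sz 2)) :
    ∃ R, Cmd.clearColumn.exec inp st = st.setN 0 R ∧ IsTab N R
      (fun g => if i < g ∧ g < n ∧ (rows g).bit c = 1 then rows g + rows i else rows g) n := by
  have hz : ∀ x : ZMod 2, 0 < x.val ↔ x = 1 := by decide
  refine Cmd.loop_induction (Q := fun st' => ∃ R, st' = st.setN 0 R ∧ IsTab N R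
      (fun g => if i < g ∧ g < n ∧ (rows g).bit c = 1 then rows g + rows i else rows g) n)
    (fun l st' => ∃ R z, st' = (st.setv 9 z).setN 0 R ∧ IsTab N R
      (fun g => if i < g ∧ g < l ∧ (rows g).bit c = 1 then rows g + rows i else rows g) n) ?_ ?_ ?_
  · exact ⟨st.na 0, st.nv 9, by rw [St.setv_self, St.setN_self], by simpa using hT⟩
  · rintro l hl st' ⟨R, z, rfl, hR⟩
    rw [hk] at hl
    rw [St.setN_setv, St.setv_setv]
    generalize hrows : (fun g => if i < g ∧ g < l ∧ (rows g).bit c = 1 then rows g + rows i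
      else rows g) = rows1 at hR
    have hst : Layout N inp ((st.setv 9 l).setN 0 R) n :=
      (h.setv 9 l).setN (by decide) (by decide) R
    have hR' : IsTab N (((st.setv 9 l).setN 0 R).na 0) rows1 n := by simpa using hR
    have hrl : rows1 l = rows l := by rw [← hrows]; simp
    have hri : rows1 i = rows i := by rw [← hrows]; simp
    have hs1 : ∀ g, rows1 g ∈ colSupp N (st.na 1) (st.sz 2) := by
      intro g
      rw [← hrows]
      dsimp only
      split_ifs
      · exact Submodule.add_mem _ (hsupp g) (hsupp i)
      · exact hsupp g
    have hbit : (NE.bit 0 (.var 9) (.var 6)).eval inp ((st.setv 9 l).setN 0 R) =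
        ((rows l).bit c).val := by
      rw [NE.eval_bit hst hR' (γ := l) (κ := c) (by simp [NE.eval]) (by simp [NE.eval, h6]) hl hc,
        hrl]
    simp only [Cmd.exec]
    rw [hbit]
    simp only [NE.eval, hz, St.setN_nv, St.setv_nv]
    simp only [show ((1 : ℕ) = 9) = False by simp, if_false, if_true, h1]
    by_cases hil : i < l
    · rw [if_pos hil]
      by_cases hone : (rows l).bit c = 1
      · rw [if_pos hone]
        obtain ⟨R', e', t'⟩ := Cmd.exec_setRow hst hR' (r := .var 9) (ρ := l) (p := rows l + rows i)
          (e := .xor (.bit 0 (.var 9) (.arr 1 (.var 10))) (.bit 0 (.var 1) (.arr 1 (.var 10))))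
          (by intro j; simp [NE.eval]) hl
          (by simpa using Submodule.add_mem _ (hsupp l) (hsupp i)) (by simpa using hs1 l)
          (by
            intro j hj
            have hj' : st.na 1 j < 2 * N := h.col j hj
            have b1 := NE.eval_bit (hst.setv 10 j) (a := 0) hR' (g := .var 9) (c := .arr 1 (.var 10))
              (γ := l) (κ := st.na 1 j) (by simp [NE.eval]) (by simp [NE.eval]) hl hj'
            have b2 := NE.eval_bit (hst.setv 10 j) (a := 0) hR' (g := .var 1) (c := .arr 1 (.var 10))
              (γ := i) (κ := st.na 1 j) (by simp [NE.eval, h1]) (by simp [NE.eval]) hi hj'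
            rw [NE.eval_xor b1 b2, hrl, hri, Pauli.bit_add]
            simp)
        refine ⟨R', l, by rw [e', St.setN_setN], ?_⟩
        convert t' using 1
        funext g
        by_cases hg : g = l
        · subst hg; simp [hil, hone]
        · rw [Function.update_of_ne hg, ← hrows]
          have : g < l + 1 ↔ g < l := by omega
          simp only [this]
      · rw [if_neg hone, Cmd.exec_skip]
        refine ⟨R, l, rfl, ?_⟩
        convert hR using 1
        rw [← hrows]
        funext g
        by_cases hg : g = l
        · subst hg; simp [hone]
        · have : g < l + 1 ↔ g < l := by omega
          simp only [this]
    · rw [if_neg hil, Cmd.exec_skip]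
      refine ⟨R, l, rfl, ?_⟩
      convert hR using 1
      rw [← hrows]
      funext g
      by_cases hg : g = l
      · subst hg; simp [hil]
      · have : g < l + 1 ↔ g < l := by omega
        simp only [this]
  · rintro st' ⟨R, z, rfl, hR⟩
    refine ⟨R, ?_, by rwa [hk] at hR⟩
    rw [St.setN_setv, St.setv_setv, St.setv_self]

/-- Put the dimension of the span of the rows of table `0` into scalar `0`. -/
def Cmd.rank : Cmd :=
  .loop 1 1 <| .seq .pivot <| .ite (.const 0) (.var 5)
    (.seq (.setv 0 (.add (.var 0) (.const 1))) .clearColumn) .skip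

/-- The invariant is that the counter plus the dimension of the span of the rows from `i` on is the
dimension sought. Each round drops row `i`: a zero row changes neither summand, and a pivot row
moves one unit to the counter. -/
theorem Cmd.exec_rank {N : ℕ} {inp : Memory} {st : St} {n : ℕ} (h : Layout N inp st n)
    (hk : st.sz 1 = n) {rows : ℕ → Pauli N} (hT : IsTab N (st.na 0) rows n) (h0 : st.nv 0 = 0)
    (hsupp : ∀ g, rows g ∈ colSupp N (st.na 1) (st.sz 2)) :
    let st' := Cmd.rank.exec inp st
    st'.sz = st.sz ∧ (∀ b ≠ 0, st'.na b = st.na b) ∧ st'.ra = st.ra ∧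
      st'.nv 0 = Module.finrank (ZMod 2) (Submodule.span (ZMod 2) (rows '' Set.Iio n)) := by
  have h0I : Set.Iio n = Set.Ico 0 n := by ext; simp
  rw [h0I]
  refine Cmd.loop_induction (Q := fun st' => st'.sz = st.sz ∧ (∀ b ≠ 0, st'.na b = st.na b) ∧
      st'.ra = st.ra ∧
      st'.nv 0 = Module.finrank (ZMod 2) (Submodule.span (ZMod 2) (rows '' Set.Ico 0 n)))
    (fun i st' => st'.sz = st.sz ∧ (∀ b ≠ 0, st'.na b = st.na b) ∧ st'.ra = st.ra ∧
      ∃ rows', IsTab N (st'.na 0) rows' n ∧ (∀ g, rows' g ∈ colSupp N (st.na 1) (st.sz 2)) ∧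
        st'.nv 0 + Module.finrank (ZMod 2) (Submodule.span (ZMod 2) (rows' '' Set.Ico i n)) =
          Module.finrank (ZMod 2) (Submodule.span (ZMod 2) (rows '' Set.Ico 0 n))) ?_ ?_ ?_
  · exact ⟨rfl, fun _ _ => rfl, rfl, rows, hT, hsupp, by rw [h0, zero_add]⟩
  · rintro i hi st' ⟨hsz, hna, hra, rows', hT', hs', hrank⟩
    rw [hk] at hi
    have hl : Layout N inp (st'.setv 1 i) n :=
      (h.congr hsz (hna 1 (by decide)) (hna 2 (by decide))).setv 1 i
    have hs1 : ∀ g, rows' g ∈ colSupp N ((st'.setv 1 i).na 1) ((st'.setv 1 i).sz 2) := by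
      intro g
      rw [St.setv_na, hna 1 (by decide), St.setv_sz, hsz]
      exact hs' g
    obtain ⟨hp1, hp2⟩ := Cmd.exec_pivot hl (rows := rows') hT' hi (by simp) (hs1 i)
    simp only [Cmd.exec]
    generalize Cmd.pivot.exec inp (st'.setv 1 i) = st2 at hp1 hp2
    have hn0 : st2.nv 0 = st'.nv 0 := by simp [hp1.nv 0 (by decide)]
    rcases hp2 with ⟨h5, hzero⟩ | ⟨h5, hlt, hone⟩
    · rw [if_neg (by simp [NE.eval, h5]), Cmd.exec_skip]
      refine ⟨by rw [hp1.sz]; exact hsz, fun b hb => by rw [hp1.na]; exact hna b hb,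
        by rw [hp1.ra]; exact hra, rows', by rw [hp1.na]; exact hT', hs', ?_⟩
      rw [hn0, ← hrank, finrank_elimination_zero hzero]
    · rw [if_pos (by simp [NE.eval, h5])]
      have hl2 : Layout N inp (st2.setv 0 (st2.nv 0 + 1)) n :=
        (hl.congr hp1.sz (by rw [hp1.na]) (by rw [hp1.na])).setv _ _
      obtain ⟨R, e, t⟩ := Cmd.exec_clearColumn (st := st2.setv 0 (st2.nv 0 + 1)) hl2
        (by rw [St.setv_sz, hp1.sz, St.setv_sz, hsz, hk])
        (rows := rows') (by rw [St.setv_na, hp1.na]; exact hT') hi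
        (by rw [St.setv_nv, if_neg (by decide), hp1.nv 1 (by decide)]; simp) hlt (by simp)
        (by rw [St.setv_na, hp1.na, St.setv_sz, hp1.sz]; exact hs1)
      have e0 : (NE.add (.var 0) (.const 1)).eval inp st2 = st2.nv 0 + 1 := rfl
      rw [e0, e]
      refine ⟨by rw [St.setN_sz, St.setv_sz, hp1.sz]; exact hsz, fun b hb => ?_,
        by rw [St.setN_ra, St.setv_ra, hp1.ra]; exact hra, _, by simpa using t, ?_, ?_⟩
      · rw [St.setN_na, if_neg hb, St.setv_na, hp1.na]; exact hna b hb
      · intro g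
        split_ifs
        · exact Submodule.add_mem _ (hs' g) (hs' i)
        · exact hs' g
      · rw [St.setN_nv, St.setv_nv, if_pos rfl, hn0, ← hrank]
        rw [finrank_elimination (rows := rows') (rows' := fun g =>
          if (rows' g).bit (st2.nv 6) = 1 then rows' g + rows' i else rows' g) hi hone
          (fun g hg => rfl)]
        have : (fun g => if i < g ∧ g < n ∧ (rows' g).bit (st2.nv 6) = 1 then rows' g + rows' i
            else rows' g) '' Set.Ico (i + 1) n = (fun g => if (rows' g).bit (st2.nv 6) = 1 then
            rows' g + rows' i else rows' g) '' Set.Ico (i + 1) n := by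
          apply Set.image_congr
          rintro g ⟨hg1, hg2⟩
          have : i < g := hg1
          simp [this, hg2]
        rw [this]
        omega
  · rintro st' ⟨hsz, hna, hra, rows', hT', hs', hrank⟩
    refine ⟨hsz, hna, hra, ?_⟩
    rw [hk, Set.Ico_self, Set.image_empty, Submodule.span_empty, finrank_bot, add_zero] at hrank
    simpa using hrank

end QCSAT

namespace QCSAT

open Program

/-! ### The dimension of the group of propagated Paulis -/

/-- Put the dimension of the group of propagated Paulis into scalar `0`. -/
def Cmd.dim : Cmd := .seq .generators .rank

theorem Cmd.exec_dim {I : Instance} {inp : Memory} (hinp : inp.nat = I.natInput) {st : St}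
    (hs : HasSizes I st) (h0 : st.na 0 = fun _ => 0) (hv : st.nv 0 = 0) :
    let st' := Cmd.dim.exec inp st
    st'.sz = st.sz ∧ HasColumns I st' ∧ (∀ b, b ≠ 0 → b ≠ 1 → b ≠ 2 → st'.na b = st.na b) ∧
      st'.ra = st.ra ∧ st'.nv 0 = I.b := by
  obtain ⟨hsz, hc, hl, hna, hra, hnv, rows, hT, hsupp, hzero, hspan⟩ :=
    Cmd.exec_generators hinp hs h0 hv
  have h1 := Cmd.exec_rank hl (by rw [hsz]; exact hs.sz1) hT hnv hsupp
  simp only [Cmd.dim, Cmd.exec] at h1 ⊢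
  obtain ⟨hsz', hna', hra', hnv'⟩ := h1
  refine ⟨hsz'.trans hsz, hc.congr hsz' (hna' 1 (by decide)),
    fun b h0 h1 h2 => (hna' b h0).trans (hna b h0 h1 h2), hra'.trans hra, ?_⟩
  rw [hnv', I.b_eq, ← hspan]
  refine congrArg (fun W : Submodule (ZMod 2) (Pauli _) => Module.finrank (ZMod 2) W) ?_
  apply le_antisymm
  · exact Submodule.span_mono (Set.image_subset_range _ _)
  · rw [Submodule.span_le]
    rintro _ ⟨g, rfl⟩
    by_cases hg : g < I.s + 1
    · exact Submodule.subset_span ⟨g, hg, rfl⟩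
    · rw [hzero g (by omega)]
      exact Submodule.zero_mem _

def NE.numGates : NE := .inp (.const 2)

/-- Set the sizes for an instance. -/
def setSizes : Program :=
  .seq (setSize 0 .numGates) <| .seq (setSize 1 (.add .numGates (.const 1))) <|
  .seq (setSize 2 (.add (.add .numGates (.triple .numGates)) (.const 2))) <|
  .seq (setSize 3 (.inp (.const 0))) <|
  setSize 4 (.add (.add (.inp (.const 0)) (.inp (.const 0))) (.const 2))

/-- The initial state. -/
def St.init : St := ⟨fun _ => 0, fun _ => 0, fun _ _ => 0, fun _ _ => 0⟩

theorem Rep.init : Rep St.init ⟨fun _ => 0, fun _ => 0⟩ := ⟨by simp [St.init], by simp [St.init],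
  by simp [St.init], by simp [St.init]⟩

/-- The state after the sizes have been set. -/
structure Started (I : Instance) (st : St) : Prop where
  sizes : HasSizes I st
  le : ∀ k, st.sz k ≤ 4 * (I.n + I.s + 1)
  zero : ∀ k, 8 ≤ k → st.sz k = 0
  nv : st.nv = fun _ => 0
  na : st.na = fun _ _ => 0

theorem ends_setSizes {I : Instance} {inp : Memory} (hinp : inp.nat = I.natInput) :
    Ends inp setSizes ⟨fun _ => 0, fun _ => 0⟩ 100 (fun σ => ∃ st, Started I st ∧ Rep st σ) := by
  have h2 : inp.nat 2 = I.s := by rw [hinp]; rfl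
  have h0 : inp.nat 0 = I.n := by rw [hinp]; rfl
  unfold setSizes
  refine ((Ends.setSize 0 _ Rep.init).seq fun σ1 h1 => (Ends.setSize 1 _ h1).seq fun σ2 h2 =>
    (Ends.setSize 2 _ h2).seq fun σ3 h3 => (Ends.setSize 3 _ h3).seq fun σ4 h4 =>
    Ends.setSize 4 _ h4).mono ?_ ?_
  · simp [NE.cost, NE.numGates, NE.triple]
  · intro σ h
    refine ⟨_, ?_, h⟩
    simp only [NE.eval, NE.numGates, NE.triple, h0, h2]
    refine ⟨⟨?_, ?_, ?_, ?_, ?_⟩, ?_, ?_, rfl, rfl⟩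
    · simp
    · simp
    · simp; omega
    · simp
    · simp; omega
    · intro k
      simp only [St.setsz_sz, St.init]
      split_ifs <;> omega
    · intro k hk
      simp only [St.setsz_sz, St.init]
      split_ifs <;> omega

/-- The program that computes the dimension. -/
def routineProgram : Program :=
  .seq setSizes <| .seq (Cmd.dim.compile 0) (mov (tmp 0) (adv 0) (tmp 1))

theorem isDiscrete_routineProgram : routineProgram.IsDiscrete := by
  have h : ∀ k e, (setSize k e).IsDiscrete := fun k e => ⟨e.isDiscrete_compile 0, trivial, trivial⟩
  refine ⟨⟨h _ _, h _ _, h _ _, h _ _, h _ _⟩, Cmd.isDiscrete_compile _ ?_ _, trivial, trivial⟩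
  simp [Cmd.dim, Cmd.generators, Cmd.rank, Cmd.columns, Cmd.pointers, Cmd.setRow, Cmd.gateStep,
    Cmd.loadGate, Cmd.gateRows, Cmd.xorCol, Cmd.skip, Cmd.countX, Cmd.pivot, Cmd.clearColumn,
    Cmd.NoReal]

theorem Ends.haltsWith {inp : Memory} {p : Program} {C y : ℕ}
    (h : Ends inp p ⟨fun _ => 0, fun _ => 0⟩ C (fun σ => σ.nat 0 = y)) :
    ∃ T ≤ C, p.HaltsWith inp T y := by
  obtain ⟨σ, T, hT, hr, hy⟩ := h
  exact ⟨T, hT, σ, hr, hy⟩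

theorem Ends.output {inp : Memory} {st : St} {σ : Memory} {v : ℕ} (h : Rep st σ) :
    Ends inp (Program.mov (tmp 0) (adv v) (tmp 1)) σ 2 (fun σ' => σ'.nat 0 = st.nv v) := by
  refine (Ends.mov (by unfold tmp adv; omega)).mono le_rfl ?_
  rintro _ rfl
  rw [← h.nv v]
  exact Memory.setNat_self σ _ _

/-- As long as size 8 has not been set, all sizes counted by `D` are zero, so any `D` is admissible.
With `D = 1` the cost of a command is a polynomial in `n + s`. -/
theorem Started.size_le {I : Instance} {st : St} (h : Started I st) {D : ℕ} (k : ℕ) :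
    st.sz k ≤ if k < 8 then 4 * (I.n + I.s + 1) else D := by
  split_ifs with hk
  · exact h.le k
  · rw [h.zero k (by omega)]
    exact Nat.zero_le _

theorem ends_routineProgram {I : Instance} {inp : Memory} (hinp : inp.nat = I.natInput) :
    Ends inp routineProgram ⟨fun _ => 0, fun _ => 0⟩
      (100 + (Cmd.dim.deg.val (4 * (I.n + I.s + 1)) 1 + 2)) (fun σ => σ.nat 0 = I.b) := by
  refine (ends_setSizes hinp).seq fun σ1 ⟨st, hst, h1⟩ => ((Ends.cmd Cmd.dim h1).mono
    (Cmd.cost_le (by omega) le_rfl hst.size_le _) fun _ h => h).seq fun σ2 h2 => ?_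
  obtain ⟨-, -, -, -, h⟩ := Cmd.exec_dim hinp hst.sizes (by rw [hst.na]) (by rw [hst.nv])
  rw [← h]
  exact Ends.output h2

theorem Deg.val_le (x : Deg) (w D : ℕ) :
    x.val (4 * w) D ≤ x.k * 4 ^ x.l * w ^ x.l * D ^ x.d := by
  unfold Deg.val
  rw [mul_pow, mul_assoc, mul_assoc, mul_assoc, mul_assoc]

theorem exists_routine : ∃ (routine : Program) (K k : ℕ), routine.IsDiscrete ∧
    ∀ I : Instance, ∃ T : ℕ, T ≤ K * (I.n + I.s + 1) ^ k ∧
      routine.HaltsWith ⟨I.natInput, fun _ => 0⟩ T I.b := by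
  refine ⟨routineProgram, Cmd.dim.deg.k * 4 ^ Cmd.dim.deg.l + 102, Cmd.dim.deg.l,
    isDiscrete_routineProgram, fun I => ?_⟩
  obtain ⟨T, hT, h⟩ := (ends_routineProgram (I := I) (inp := ⟨I.natInput, fun _ => 0⟩) rfl).haltsWith
  refine ⟨T, hT.trans ?_, h⟩
  have h1 := Cmd.dim.deg.val_le (I.n + I.s + 1) 1
  rw [one_pow, mul_one] at h1
  have h2 : 1 ≤ (I.n + I.s + 1) ^ Cmd.dim.deg.l := Nat.one_le_pow _ _ (by omega)
  rw [add_mul]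
  omega

end QCSAT

/-! ### The decision problem as positivity of a real quadratic form -/

namespace QCSAT

open Matrix

/-! ### Positivity on the algebra generated by the witness observable -/

/-- The real part of the phase of the product of two Paulis. -/
noncomputable def pairSign {N : ℕ} (p q : Pauli N) : ℝ :=
  (Complex.I ^ (∑ j, phaseExp (p.1 j) (p.2 j) (q.1 j) (q.2 j))).re

/-- The span of the Pauli operators in `G`. -/
def opSpan {N : ℕ} (G : Submodule (ZMod 2) (Pauli N)) : Submodule ℂ (Op N) :=
  Submodule.span ℂ (Pauli.toOp '' (G : Set (Pauli N)))

theorem toOp_mem_opSpan {N : ℕ} {G : Submodule (ZMod 2) (Pauli N)} {p : Pauli N} (hp : p ∈ G) :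
    p.toOp ∈ opSpan G := Submodule.subset_span ⟨p, hp, rfl⟩

theorem toOp_mul_mem_opSpan {N : ℕ} {G : Submodule (ZMod 2) (Pauli N)} {p : Pauli N} (hp : p ∈ G)
    {A : Op N} (hA : A ∈ opSpan G) : p.toOp * A ∈ opSpan G := by
  induction hA using Submodule.span_induction with
  | mem x hx =>
    obtain ⟨q, hq, rfl⟩ := hx
    rw [Pauli.toOp_mul]
    exact Submodule.smul_mem _ _ (toOp_mem_opSpan (G.add_mem hp hq))
  | zero => rw [Matrix.mul_zero]; exact Submodule.zero_mem _
  | add x y _ _ hx hy => rw [Matrix.mul_add]; exact Submodule.add_mem _ hx hy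
  | smul a x _ hx => rw [Matrix.mul_smul]; exact Submodule.smul_mem _ _ hx

theorem pauliSum_mul_mem_opSpan {N : ℕ} {G : Submodule (ZMod 2) (Pauli N)} {a : Pauli N → ℝ}
    (ha : ∀ p, a p ≠ 0 → p ∈ G) {A : Op N} (hA : A ∈ opSpan G) : pauliSum a * A ∈ opSpan G := by
  rw [pauliSum, Finset.sum_mul]
  refine Submodule.sum_mem _ fun p _ => ?_
  rw [Matrix.smul_mul]
  by_cases hp : a p = 0
  · rw [hp, Complex.ofReal_zero, zero_smul]; exact Submodule.zero_mem _
  · exact Submodule.smul_mem _ _ (toOp_mul_mem_opSpan (ha p hp) hA)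

/-- `G` contains the trivial Pauli and is closed under products up to phase, so the span of its
operators is stable under multiplication by `pauliSum a` and contains all its powers. -/
theorem aeval_mem_opSpan {N : ℕ} {G : Submodule (ZMod 2) (Pauli N)} {a : Pauli N → ℝ}
    (ha : ∀ p, a p ≠ 0 → p ∈ G) (f : Polynomial ℝ) :
    Polynomial.aeval (pauliSum a) f ∈ opSpan G := by
  have hpow : ∀ k : ℕ, pauliSum a ^ k ∈ opSpan G := by
    intro k
    induction k with
    | zero => rw [pow_zero, ← Pauli.toOp_zero]; exact toOp_mem_opSpan G.zero_mem
    | succ k ih => rw [pow_succ']; exact pauliSum_mul_mem_opSpan ha ih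
  induction f using Polynomial.induction_on' with
  | add f g hf hg => rw [map_add]; exact Submodule.add_mem _ hf hg
  | monomial k x =>
    rw [Polynomial.aeval_monomial, ← Algebra.smul_def]
    have : x • pauliSum a ^ k = (x : ℂ) • pauliSum a ^ k := by
      ext i j; simp
    rw [this]
    exact Submodule.smul_mem _ _ (hpow k)

theorem isHermitian_aeval {N : ℕ} {A : Op N} (hA : A.IsHermitian) (f : Polynomial ℝ) :
    (Polynomial.aeval A f).IsHermitian := by
  induction f using Polynomial.induction_on' with
  | add f g hf hg => rw [map_add]; exact hf.add hg
  | monomial k x =>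
    rw [Polynomial.aeval_monomial, ← Algebra.smul_def]
    have h := hA.pow k
    unfold Matrix.IsHermitian at *
    rw [Matrix.conjTranspose_smul, h]
    simp

/-- Paulis are Hermitian and linearly independent, so equating `A` with its adjoint forces each
coefficient to equal its conjugate. -/
theorem exists_real_coeffs {N : ℕ} {G : Submodule (ZMod 2) (Pauli N)} {A : Op N}
    (hA : A ∈ opSpan G) (hH : A.IsHermitian) :
    ∃ z : Pauli N → ℝ, (∀ p ∉ G, z p = 0) ∧ A = pauliSum z := by
  have h1 : ∃ z : Pauli N → ℂ, (∀ p ∉ G, z p = 0) ∧ A = ∑ p, z p • p.toOp := by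
    clear hH
    classical
    induction hA using Submodule.span_induction with
    | mem x hx =>
      obtain ⟨q, hq, rfl⟩ := hx
      have hne : ∀ p ∉ G, p ≠ q := fun p hp h => hp (by rw [h]; exact hq)
      refine ⟨Pi.single q 1, fun p hp => Pi.single_eq_of_ne (hne p hp) _, ?_⟩
      simp [Pi.single_apply]
    | zero => exact ⟨0, fun _ _ => rfl, by simp⟩
    | add x y _ _ hx hy =>
      obtain ⟨z, h1, rfl⟩ := hx
      obtain ⟨z', h2, rfl⟩ := hy
      exact ⟨z + z', fun p hp => by simp [h1 p hp, h2 p hp],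
        by simp [add_smul, Finset.sum_add_distrib]⟩
    | smul a x _ hx =>
      obtain ⟨z, h1, rfl⟩ := hx
      exact ⟨a • z, fun p hp => by simp [h1 p hp], by simp [Finset.smul_sum, smul_smul]⟩
  obtain ⟨z, hz, rfl⟩ := h1
  have h2 : ∑ p, (star (z p) - z p) • (Pauli.toOp p : Op N) = 0 := by
    simp only [sub_smul, Finset.sum_sub_distrib]
    rw [sub_eq_zero]
    conv_rhs => rw [← hH.eq]
    simp [Matrix.conjTranspose_sum, Matrix.conjTranspose_smul, Pauli.toOp_conjTranspose]
  have h3 := Fintype.linearIndependent_iff.mp (Pauli.linearIndependent_toOp (N := N)) _ h2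
  have h4 : ∀ p, ((z p).re : ℂ) = z p := fun p => Complex.conj_eq_iff_re.mp (sub_eq_zero.mp (h3 p))
  refine ⟨fun p => (z p).re, fun p hp => by simp [hz p hp], ?_⟩
  simp [pauliSum, h4]

theorem trace_triple {N : ℕ} (v h w : Pauli N) :
    (v.toOp * h.toOp * w.toOp).trace.re = if h = v + w then 2 ^ N * pairSign w v else 0 := by
  rw [Matrix.trace_mul_comm, ← Matrix.mul_assoc, Pauli.toOp_mul, Matrix.smul_mul,
    Matrix.trace_smul, Pauli.trace_toOp_mul, pairSign, add_comm v w]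
  by_cases hh : w + v = h
  · rw [if_pos hh, if_pos hh.symm, smul_eq_mul, mul_comm]
    have : (2 : ℂ) ^ N = ((2 ^ N : ℝ) : ℂ) := by push_cast; rfl
    rw [this, Complex.re_ofReal_mul]
  · rw [if_neg hh, if_neg (fun h' => hh h'.symm)]
    simp

/-- The entries of the matrix for the quadratic form `Y ↦ tr (Y (O - c) Y)`, up to a factor, for
the operator `O` with Pauli coefficients `a`. -/
noncomputable def formEntry {N : ℕ} (a : Pauli N → ℝ) (c : ℝ) (v w : Pauli N) : ℝ :=
  a (v + w) * pairSign w v - if v = w then c else 0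

/-- In the trace against `v` and `w` only the term of `pauliSum a` with label `v + w` survives. A
matrix entry therefore requires a single coefficient of the operator and one phase. -/
theorem trace_formEntry {N : ℕ} (a : Pauli N → ℝ) (c : ℝ) (v w : Pauli N) :
    (v.toOp * (pauliSum a - (c : ℂ) • 1) * w.toOp).trace.re = 2 ^ N * formEntry a c v w := by
  have h1 : (v.toOp * pauliSum a * w.toOp).trace.re = 2 ^ N * (a (v + w) * pairSign w v) := by
    simp only [pauliSum, Finset.mul_sum, Finset.sum_mul, Matrix.trace_sum, Complex.re_sum,
      Matrix.mul_smul, Matrix.smul_mul, Matrix.trace_smul, smul_eq_mul, Complex.re_ofReal_mul,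
      trace_triple]
    rw [Finset.sum_eq_single (v + w)]
    · rw [if_pos rfl]; ring
    · intro h _ hh; rw [if_neg hh, mul_zero]
    · simp
  rw [Matrix.mul_sub, Matrix.sub_mul, Matrix.trace_sub, Complex.sub_re, h1, Matrix.mul_smul,
    Matrix.mul_one, Matrix.smul_mul, Matrix.trace_smul, Pauli.trace_toOp_mul, formEntry, mul_sub]
  congr 1
  by_cases hvw : v = w
  · rw [if_pos hvw, if_pos hvw, smul_eq_mul, Complex.re_ofReal_mul]
    have : (2 : ℂ) ^ N = ((2 ^ N : ℝ) : ℂ) := by push_cast; rfl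
    rw [this, Complex.ofReal_re, mul_comm]
  · simp [hvw]

theorem quadForm_formEntry {N D : ℕ} (a : Pauli N → ℝ) (c : ℝ) (R : ℕ → Pauli N) (y : ℕ → ℝ) :
    ((∑ v ∈ Finset.range D, (y v : ℂ) • (R v).toOp) * (pauliSum a - (c : ℂ) • 1) *
      (∑ w ∈ Finset.range D, (y w : ℂ) • (R w).toOp)).trace.re =
    2 ^ N * ∑ v ∈ Finset.range D, ∑ w ∈ Finset.range D, y v * y w * formEntry a c (R v) (R w) := by
  simp only [Finset.sum_mul, Finset.mul_sum, Matrix.trace_sum, Complex.re_sum, Matrix.smul_mul,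
    Matrix.mul_smul, Matrix.trace_smul, smul_eq_mul, Complex.re_ofReal_mul, trace_formEntry]
  rw [Finset.sum_comm]
  refine Finset.sum_congr rfl fun v _ => Finset.sum_congr rfl fun w _ => ?_
  ring

/-- The polynomial `f` is the real minimal polynomial with the root `x` divided out. Having smaller
degree, it does not annihilate `A`, whereas `(X - x) f` does. For Hermitian `A` the value `f(A)`
stands in for an eigenvector and stays inside the algebra generated by `A`. -/
theorem exists_minimal_factor {N : ℕ} (A : Op N) {x : ℝ} (hx : (x : ℂ) ∈ spectrum ℂ A) :
    ∃ f : Polynomial ℝ, Polynomial.aeval A f ≠ 0 ∧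
      A * Polynomial.aeval A f = (x : ℂ) • Polynomial.aeval A f := by
  have hx' : x ∈ spectrum ℝ A := (spectrum.algebraMap_mem_iff ℂ).mp hx
  have hint : IsIntegral ℝ A := Algebra.IsIntegral.isIntegral A
  have hroot : (minpoly ℝ A).IsRoot x := by
    by_contra h0
    have h1 : (Polynomial.eval x (minpoly ℝ A)) ∈ spectrum ℝ (Polynomial.aeval A (minpoly ℝ A)) :=
      spectrum.subset_polynomial_aeval A _ ⟨x, hx', rfl⟩
    rw [minpoly.aeval] at h1
    refine h1 (spectrum.mem_resolventSet_iff.mpr ?_)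
    rw [sub_zero]
    exact (IsUnit.mk0 _ h0).map (algebraMap ℝ _)
  have hfac := Polynomial.mul_divByMonic_eq_iff_isRoot.mpr hroot
  set f := minpoly ℝ A /ₘ (Polynomial.X - Polynomial.C x) with hf
  have hne : minpoly ℝ A ≠ 0 := minpoly.ne_zero hint
  refine ⟨f, fun h0 => ?_, ?_⟩
  · have hf0 : f ≠ 0 := by
      rintro hf0
      rw [hf0, mul_zero] at hfac
      exact hne hfac.symm
    have hd := minpoly.degree_le_of_ne_zero ℝ A hf0 h0
    rw [← hfac, Polynomial.degree_mul, Polynomial.degree_X_sub_C,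
      Polynomial.degree_eq_natDegree hf0] at hd
    have : 1 + f.natDegree ≤ f.natDegree := by exact_mod_cast hd
    omega
  · have h1 := congrArg (Polynomial.aeval A) hfac
    rw [map_mul, minpoly.aeval, map_sub, Polynomial.aeval_X, Polynomial.aeval_C, sub_mul,
      sub_eq_zero, ← Algebra.smul_def] at h1
    rw [h1]
    ext i j
    simp

-- If `W - (1 - 2c)` is positive semidefinite, so is `Y (W - (1 - 2c)) Y` for every Hermitian `Y`,
-- and its trace is nonnegative. Conversely it suffices to evaluate the form at `f(W)` for the
-- polynomial `f` of `exists_minimal_factor`, which is a real combination of Paulis in `witSpan`.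
-- The family `R` only has to cover `witSpan`; repetitions and further Paulis do no harm.
open scoped ComplexOrder in
theorem formEntry_nonneg_iff (I : Instance) (c : ℝ) {D : ℕ} {R : ℕ → Pauli I.n}
    (hR : ∀ p ∈ I.witSpan, ∃ v < D, R v = p) :
    (∀ y : ℕ → ℝ, 0 ≤ ∑ v ∈ Finset.range D, ∑ w ∈ Finset.range D,
      y v * y w * formEntry I.witCoeffs (1 - 2 * c) (R v) (R w)) ↔ I.Val ≤ c := by
  obtain ⟨hmem, hleast⟩ := I.isLeast_spectrum
  have hW : (pauliSum I.witCoeffs).IsHermitian := isHermitian_pauliSum _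
  rw [I.witnessObservable_eq] at hmem hleast
  set W := pauliSum I.witCoeffs with hWdef
  have hpos : (0 : ℝ) < 2 ^ I.n := by positivity
  have hYH : ∀ y : ℕ → ℝ, (∑ v ∈ Finset.range D, (y v : ℂ) • (R v).toOp).IsHermitian := by
    intro y
    simp [Matrix.IsHermitian, Matrix.conjTranspose_sum, Pauli.toOp_conjTranspose]
  constructor
  · intro hq
    obtain ⟨f, hf0, hf⟩ := exists_minimal_factor W hmem
    obtain ⟨z, hz, hfz⟩ := exists_real_coeffs (aeval_mem_opSpan I.witCoeffs_support f)
      (isHermitian_aeval hW f)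
    have hspan : Polynomial.aeval W f ∈
        Submodule.span ℝ (Set.range fun v : Fin D => (R v).toOp) := by
      rw [hfz, pauliSum]
      refine Submodule.sum_mem _ fun p _ => ?_
      by_cases hp : p ∈ I.witSpan
      · obtain ⟨v, hv, rfl⟩ := hR p hp
        have : ((z (R v) : ℝ) : ℂ) • (R v).toOp = z (R v) • (R v).toOp := by ext i j; simp
        rw [this]
        exact Submodule.smul_mem _ _ (Submodule.subset_span ⟨⟨v, hv⟩, rfl⟩)
      · rw [hz p hp, Complex.ofReal_zero, zero_smul]
        exact Submodule.zero_mem _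
    obtain ⟨y, hy⟩ := (Submodule.mem_span_range_iff_exists_fun ℝ).mp hspan
    set y' : ℕ → ℝ := fun v => if h : v < D then y ⟨v, h⟩ else 0
    have hY : Polynomial.aeval W f = ∑ v ∈ Finset.range D, (y' v : ℂ) • (R v).toOp := by
      rw [← hy, Finset.sum_range]
      refine Finset.sum_congr rfl fun v _ => ?_
      ext i j
      simp [y']
    have h1 := hq y'
    have h2 := quadForm_formEntry (D := D) I.witCoeffs (1 - 2 * c) R y'
    rw [← hY, ← hWdef] at h2
    -- Since `W` acts on `f(W)` as its least eigenvalue `1 - 2 Val`, the form there is `2 (c - Val)`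
    -- times the trace of `f(W)† f(W)`, which is positive.
    have h3 : (Polynomial.aeval W f * (W - ((1 - 2 * c : ℝ) : ℂ) • 1) * Polynomial.aeval W f) =
        (((1 - 2 * I.Val) - (1 - 2 * c) : ℝ) : ℂ) •
          ((Polynomial.aeval W f)ᴴ * Polynomial.aeval W f) := by
      rw [(isHermitian_aeval hW f).eq, Matrix.mul_assoc, Matrix.sub_mul, hf, Matrix.smul_mul,
        Matrix.one_mul, ← sub_smul, Matrix.mul_smul]
      congr 1
      push_cast
      rfl
    rw [h3, Matrix.trace_smul, smul_eq_mul, Complex.re_ofReal_mul] at h2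
    have h4 := (Matrix.posSemidef_conjTranspose_mul_self (Polynomial.aeval W f)).trace_nonneg
    have h5 : ((Polynomial.aeval W f)ᴴ * Polynomial.aeval W f).trace ≠ 0 := fun h =>
      hf0 (Matrix.trace_conjTranspose_mul_self_eq_zero_iff.mp h)
    have h6 : 0 < ((Polynomial.aeval W f)ᴴ * Polynomial.aeval W f).trace.re :=
      (Complex.pos_iff.mp (lt_of_le_of_ne h4 h5.symm)).1
    have h7 := mul_nonneg hpos.le h1
    rw [← h2] at h7
    have h8 := nonneg_of_mul_nonneg_left h7 h6
    linarith
  · intro hV y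
    have hA : (W - ((1 - 2 * c : ℝ) : ℂ) • 1).PosSemidef := by
      rw [Matrix.posSemidef_iff_isHermitian_and_spectrum_nonneg]
      refine ⟨?_, ?_⟩
      · refine hW.sub ?_
        simp [Matrix.IsHermitian]
      · intro μ hμ
        have h1 : μ + ((1 - 2 * c : ℝ) : ℂ) ∈ spectrum ℂ W := by
          have h2 := (spectrum.add_mem_add_iff (r := μ) (s := ((1 - 2 * c : ℝ) : ℂ))).mpr hμ
          simpa [Algebra.algebraMap_eq_smul_one, add_comm] using h2
        have h2 : (μ + ((1 - 2 * c : ℝ) : ℂ)) ∈ Set.range fun i => ((hW.eigenvalues i : ℝ) : ℂ) := by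
          rw [hW.spectrum_eq_image_range] at h1
          obtain ⟨_, ⟨i, rfl⟩, hi⟩ := h1
          exact ⟨i, hi⟩
        obtain ⟨i, hi⟩ := h2
        rw [← hi] at h1
        have h3 := hleast h1
        have h4 : μ = ((hW.eigenvalues i - (1 - 2 * c) : ℝ) : ℂ) := by
          rw [Complex.ofReal_sub]
          exact eq_sub_of_add_eq hi.symm
        rw [h4]
        show (0 : ℂ) ≤ _
        exact Complex.zero_le_real.mpr (by linarith)
    have h1 := quadForm_formEntry (D := D) I.witCoeffs (1 - 2 * c) R y
    have h2 := (hA.conjTranspose_mul_mul_same (∑ v ∈ Finset.range D, (y v : ℂ) • (R v).toOp)).trace_nonneg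
    rw [(hYH y).eq] at h2
    have h3 := (Complex.nonneg_iff.mp h2).1
    rw [← hWdef] at h1
    rw [h1] at h3
    exact nonneg_of_mul_nonneg_right h3 hpos

end QCSAT

namespace QCSAT

/-! ### Elimination for quadratic forms -/

/-- The quadratic form of the part of `M` with indices from `i` on. -/
noncomputable def quadFrom (D i : ℕ) (M : ℕ → ℕ → ℝ) (y : ℕ → ℝ) : ℝ :=
  ∑ j ∈ Finset.Ico i D, ∑ k ∈ Finset.Ico i D, y j * y k * M j k

/-- One step of symmetric Gaussian elimination. -/
noncomputable def eliminate (i : ℕ) (M : ℕ → ℕ → ℝ) (j k : ℕ) : ℝ :=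
  if i < j then M j k - M j i * M i k / M i i else M j k

/-- The sum of the squares of the entries to the right of entry `i` of the diagonal. -/
noncomputable def rowSquares (D i : ℕ) (M : ℕ → ℕ → ℝ) : ℝ :=
  ∑ k ∈ Finset.range D, if i < k then M i k * M i k else 0

theorem rowSquares_eq (D i : ℕ) (M : ℕ → ℕ → ℝ) :
    rowSquares D i M = ∑ k ∈ Finset.Ico (i + 1) D, M i k * M i k := by
  rw [rowSquares, ← Finset.sum_filter]
  congr 1
  ext k
  simp
  omega

theorem quadFrom_succ {D i : ℕ} {M : ℕ → ℕ → ℝ} (hi : i < D)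
    (hM : ∀ k, i < k → k < D → M k i = M i k) (y : ℕ → ℝ) :
    quadFrom D i M y = M i i * (y i * y i) +
      2 * y i * ∑ k ∈ Finset.Ico (i + 1) D, y k * M i k + quadFrom D (i + 1) M y := by
  have h1 : ∑ j ∈ Finset.Ico (i + 1) D, y j * y i * M j i =
      y i * ∑ k ∈ Finset.Ico (i + 1) D, y k * M i k := by
    rw [Finset.mul_sum]
    refine Finset.sum_congr rfl fun k hk => ?_
    rw [Finset.mem_Ico] at hk
    rw [hM k hk.1 hk.2]
    ring
  have h2 : ∑ k ∈ Finset.Ico (i + 1) D, y i * y k * M i k =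
      y i * ∑ k ∈ Finset.Ico (i + 1) D, y k * M i k := by
    rw [Finset.mul_sum]
    exact Finset.sum_congr rfl fun k _ => by ring
  rw [quadFrom, Finset.sum_eq_sum_Ico_succ_bot hi, Finset.sum_eq_sum_Ico_succ_bot hi, h2]
  have h3 : ∀ j ∈ Finset.Ico (i + 1) D, ∑ k ∈ Finset.Ico i D, y j * y k * M j k =
      y j * y i * M j i + ∑ k ∈ Finset.Ico (i + 1) D, y j * y k * M j k := fun j _ => by
    rw [Finset.sum_eq_sum_Ico_succ_bot hi]
  rw [Finset.sum_congr rfl h3, Finset.sum_add_distrib, h1, quadFrom]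
  ring

theorem quadFrom_eliminate {D i : ℕ} {M : ℕ → ℕ → ℝ}
    (hM : ∀ k, i < k → k < D → M k i = M i k) (y : ℕ → ℝ) :
    quadFrom D (i + 1) (eliminate i M) y = quadFrom D (i + 1) M y -
      (∑ k ∈ Finset.Ico (i + 1) D, y k * M i k) * (∑ k ∈ Finset.Ico (i + 1) D, y k * M i k) /
        M i i := by
  rw [Finset.sum_mul_sum, Finset.sum_div, quadFrom, quadFrom, ← Finset.sum_sub_distrib]
  refine Finset.sum_congr rfl fun j hj => ?_
  rw [Finset.sum_div, ← Finset.sum_sub_distrib]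
  refine Finset.sum_congr rfl fun k hk => ?_
  rw [Finset.mem_Ico] at hj
  rw [eliminate, if_pos (show i < j from hj.1), hM j hj.1 hj.2]
  ring

theorem quadFrom_congr {D i : ℕ} {M : ℕ → ℕ → ℝ} {y y' : ℕ → ℝ} (h : ∀ k, i ≤ k → y k = y' k) :
    quadFrom D i M y = quadFrom D i M y' := by
  refine Finset.sum_congr rfl fun j hj => Finset.sum_congr rfl fun k hk => ?_
  rw [Finset.mem_Ico] at hj hk
  rw [h j hj.1, h k hk.1]

/-- The form fails at step `i` exactly if the pivot is negative, or is zero while the rest of its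
row is not. Both cases are covered by the one condition that the pivot is at most zero and the sum
of squares exceeds it. Otherwise completing the square reduces the question to the Schur complement.
-/
theorem quadFrom_nonneg_iff {D i : ℕ} {M : ℕ → ℕ → ℝ} (hi : i < D)
    (hM : ∀ k, i < k → k < D → M k i = M i k) :
    (∀ y, 0 ≤ quadFrom D i M y) ↔ ¬ (M i i ≤ 0 ∧ 0 < rowSquares D i M - M i i) ∧
      ∀ y, 0 ≤ quadFrom D (i + 1) (eliminate i M) y := by
  have hS : 0 ≤ rowSquares D i M := by
    rw [rowSquares_eq]
    exact Finset.sum_nonneg fun k _ => mul_self_nonneg _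
  have hupd : ∀ (t : ℝ) (y : ℕ → ℝ), quadFrom D i M (Function.update y i t) = M i i * (t * t) +
      2 * t * ∑ k ∈ Finset.Ico (i + 1) D, y k * M i k + quadFrom D (i + 1) M y := by
    intro t y
    have h1 : ∀ k, i + 1 ≤ k → Function.update y i t k = y k := fun k hk =>
      Function.update_of_ne (by omega) _ _
    rw [quadFrom_succ hi hM, Function.update_self, quadFrom_congr h1]
    congr 3
    refine Finset.sum_congr rfl fun k hk => ?_
    rw [h1 k (Finset.mem_Ico.mp hk).1]
  rcases lt_trichotomy (M i i) 0 with hp | hp | hp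
  · refine iff_of_false (fun h => ?_) (fun h => h.1 ⟨hp.le, by linarith⟩)
    have h1 := h (Function.update 0 i 1)
    rw [hupd] at h1
    simp only [Pi.zero_apply, zero_mul, Finset.sum_const_zero, quadFrom] at h1
    linarith
  · rcases hS.eq_or_lt with hS0 | hS0
    -- Zero pivot and zero row: the elimination divides by zero, which yields zero, so it leaves the
    -- form unchanged, as it should.
    · have h0 : ∀ k ∈ Finset.Ico (i + 1) D, M i k = 0 := by
        rw [rowSquares_eq] at hS0
        intro k hk
        have := (Finset.sum_eq_zero_iff_of_nonneg (fun k _ => mul_self_nonneg (M i k))).mp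
          hS0.symm k hk
        exact mul_self_eq_zero.mp this
      have hL : ∀ y : ℕ → ℝ, ∑ k ∈ Finset.Ico (i + 1) D, y k * M i k = 0 := fun y =>
        Finset.sum_eq_zero fun k hk => by rw [h0 k hk, mul_zero]
      have h1 : ¬ (M i i ≤ 0 ∧ 0 < rowSquares D i M - M i i) := by
        rw [← hS0, hp]; simp
      simp only [h1, not_false_eq_true, true_and]
      refine forall_congr' fun y => ?_
      rw [quadFrom_succ hi hM, quadFrom_eliminate hM, hL, hp]
      simp
    · refine iff_of_false (fun h => ?_) (fun h => h.1 ⟨hp.le, by linarith⟩)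
      -- With the row itself as the vector and `t` in position `i`, the form is `2 t S + Q`, where
      -- `S` is the sum of squares and `Q` the remaining form. The chosen `t` makes this `-1`.
      have h1 := h (Function.update (M i) i
        (-(quadFrom D (i + 1) M (M i) + 1) / (2 * rowSquares D i M)))
      rw [hupd, ← rowSquares_eq, hp] at h1
      have h2 : 2 * (-(quadFrom D (i + 1) M (M i) + 1) / (2 * rowSquares D i M)) *
          rowSquares D i M = -(quadFrom D (i + 1) M (M i) + 1) := by
        field_simp
      rw [h2] at h1
      linarith
  · have h1 : ¬ (M i i ≤ 0 ∧ 0 < rowSquares D i M - M i i) := fun h => absurd hp (not_lt.mpr h.1)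
    simp only [h1, not_false_eq_true, true_and]
    -- Completing the square in coordinate `i`; a suitable `t` makes the square vanish and leaves
    -- the form of the eliminated matrix.
    have key : ∀ (t : ℝ) (y : ℕ → ℝ), quadFrom D i M (Function.update y i t) =
        M i i * (t + (∑ k ∈ Finset.Ico (i + 1) D, y k * M i k) / M i i) ^ 2 +
          quadFrom D (i + 1) (eliminate i M) y := by
      intro t y
      rw [hupd, quadFrom_eliminate hM]
      field_simp
      ring
    constructor
    · intro h y
      have h2 := h (Function.update y i (-((∑ k ∈ Finset.Ico (i + 1) D, y k * M i k) / M i i)))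
      rw [key] at h2
      simpa using h2
    · intro h y
      rw [← Function.update_eq_self i y, key]
      have := h y
      positivity

theorem eliminate_symm {D i : ℕ} {M : ℕ → ℕ → ℝ}
    (hM : ∀ j k, i ≤ j → j < D → i ≤ k → k < D → M j k = M k j) :
    ∀ j k, i + 1 ≤ j → j < D → i + 1 ≤ k → k < D → eliminate i M j k = eliminate i M k j := by
  intro j k hj hjD hk hkD
  rw [eliminate, eliminate, if_pos (by omega), if_pos (by omega),
    hM j k (by omega) hjD (by omega) hkD, hM j i (by omega) hjD le_rfl (by omega),
    hM k i (by omega) hkD le_rfl (by omega)]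
  ring

end QCSAT

/-! ### Enumeration of the group with the coefficients of the observable -/

namespace QCSAT

/-! ### Tables of coefficients -/

/-- The rows `g < d` are the elements of `V`, and `a` contains the coefficients `A` of the rows. -/
structure TableOf {N : ℕ} (rows : ℕ → Pauli N) (a : ℕ → ℝ) (d D : ℕ)
    (V : Submodule (ZMod 2) (Pauli N)) (A : Pauli N → ℝ) : Prop where
  mem : ∀ g < d, rows g ∈ V
  surj : ∀ p ∈ V, ∃ g < d, rows g = p
  inj : ∀ g < d, ∀ h < d, rows g = rows h → g = h
  zero : ∀ g, d ≤ g → rows g = 0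
  coeff : ∀ g < d, a g = A (rows g)
  coeff_zero : ∀ g, d ≤ g → g < D → a g = 0
  supp : ∀ p, A p ≠ 0 → p ∈ V
  card : d = 2 ^ Module.finrank (ZMod 2) V
  le : d ≤ D

namespace TableOf

variable {N : ℕ} {rows : ℕ → Pauli N} {a : ℕ → ℝ} {d D : ℕ} {V : Submodule (ZMod 2) (Pauli N)}
  {A : Pauli N → ℝ}

theorem congr (h : TableOf rows a d D V A) {a' : ℕ → ℝ} (ha : ∀ g < D, a' g = a g) :
    TableOf rows a' d D V A :=
  ⟨h.mem, h.surj, h.inj, h.zero, fun g hg => by rw [ha g (hg.trans_le h.le), h.coeff g hg],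
    fun g hg hgD => by rw [ha g hgD, h.coeff_zero g hg hgD], h.supp, h.card, h.le⟩

theorem mem_all (h : TableOf rows a d D V A) (g : ℕ) : rows g ∈ V := by
  by_cases hg : g < d
  · exact h.mem g hg
  · rw [h.zero g (by omega)]; exact V.zero_mem

/-- The first `d` rows list `V` without repetition, `A` vanishes outside `V`, and the stored
coefficients of the unused rows are zero. So sums can run over the full capacity `D`, a size of the
language, although `d` is not one. -/
theorem sum_eq (h : TableOf rows a d D V A) (f : Pauli N → ℝ) :
    ∑ g ∈ Finset.range D, f (rows g) * a g = ∑ p, f p * A p := by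
  classical
  have h1 : ∑ g ∈ Finset.range D, f (rows g) * a g =
      ∑ g ∈ Finset.range d, f (rows g) * A (rows g) := by
    rw [← Finset.sum_subset (Finset.range_mono h.le)]
    · exact Finset.sum_congr rfl fun g hg => by rw [h.coeff g (Finset.mem_range.mp hg)]
    · intro g hg hg'
      rw [Finset.mem_range] at hg hg'
      rw [h.coeff_zero g (by omega) hg, mul_zero]
  have hinj : Set.InjOn rows (Finset.range d) := fun g hg k hk hgk =>
    h.inj g (by simpa using hg) k (by simpa using hk) hgk
  rw [h1, ← Finset.sum_image (f := fun p => f p * A p) hinj]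
  refine Finset.sum_subset (Finset.subset_univ _) fun p _ hp => ?_
  by_cases hA : A p = 0
  · rw [hA, mul_zero]
  · obtain ⟨g, hg, rfl⟩ := h.surj p (h.supp p hA)
    exact absurd (Finset.mem_image.mpr ⟨g, Finset.mem_range.mpr hg, rfl⟩) hp

theorem sum_ite_eq (h : TableOf rows a d D V A) (p : Pauli N) :
    ∑ g ∈ Finset.range D, (if rows g = p then a g else 0) = A p := by
  have h1 := h.sum_eq (fun p' => if p' = p then 1 else 0)
  simpa using h1

theorem act (h : TableOf rows a d D V A) (g : Gate N) (hg : g.isPhase = false) :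
    TableOf (fun i => g.act (rows i)) (fun i => realSign (g.signBit (rows i)) * a i) d D
      (V.map g.actLin.toLinearMap) (g.evolve A) := by
  constructor
  · exact fun i hi => ⟨_, h.mem i hi, rfl⟩
  · rintro _ ⟨p, hp, rfl⟩
    obtain ⟨i, hi, rfl⟩ := h.surj p hp
    exact ⟨i, hi, rfl⟩
  · exact fun i hi j hj hij => h.inj i hi j hj (g.actLin.injective hij)
  · intro i hi
    rw [h.zero i hi]
    exact g.actLin.map_zero
  · intro i hi
    rw [g.evolve_of_not_isPhase hg, g.act_act, h.coeff i hi]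
  · intro i hi hiD
    rw [h.coeff_zero i hi hiD, mul_zero]
  · intro p hp
    rw [g.evolve_of_not_isPhase hg] at hp
    exact ⟨g.act p, h.supp _ (right_ne_zero_of_mul hp), g.act_act p⟩
  · rw [h.card, LinearEquiv.finrank_map_eq g.actLin V]
  · exact h.le

/-- The new rows form the coset `V + p`, disjoint from `V`. No coefficient has to be written: `A`
vanishes on the coset, and the unused entries are already zero. -/
theorem double (h : TableOf rows a d D V A) {p : Pauli N} (hp : p ∉ V) (hD : d + d ≤ D) :
    TableOf (fun g => if d ≤ g ∧ g < d + d then rows (g - d) + p else rows g) a (d + d) D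
      (V ⊔ Submodule.span (ZMod 2) {p}) A := by
  have hadd : ∀ x y : Pauli N, x + p = y → p = x + y := by
    rintro x _ rfl
    rw [← add_assoc, Pauli.add_self, zero_add]
  constructor
  · intro g hg
    split_ifs
    · exact Submodule.add_mem_sup (h.mem_all _) (Submodule.mem_span_singleton_self p)
    · exact Submodule.mem_sup_left (h.mem_all _)
  · intro x hx
    obtain ⟨y, hy, z, hz, rfl⟩ := Submodule.mem_sup.mp hx
    obtain ⟨c, rfl⟩ := Submodule.mem_span_singleton.mp hz
    obtain ⟨g, hg, rfl⟩ := h.surj y hy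
    rcases zmod_two_cases c with rfl | rfl
    · exact ⟨g, by omega, by rw [if_neg (by omega), zero_smul, add_zero]⟩
    · exact ⟨g + d, by omega, by rw [if_pos (by omega), one_smul, Nat.add_sub_cancel]⟩
  · intro g hg k hk hgk
    split_ifs at hgk with h1 h2 h2
    · have := h.inj _ (by omega) _ (by omega) (add_right_cancel hgk)
      omega
    · exact absurd (by rw [hadd _ _ hgk]; exact V.add_mem (h.mem_all _) (h.mem_all _)) hp
    · exact absurd (by rw [hadd _ _ hgk.symm]; exact V.add_mem (h.mem_all _) (h.mem_all _)) hp
    · exact h.inj _ (by omega) _ (by omega) hgk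
  · intro g hg
    rw [if_neg (by omega), h.zero g (by omega)]
  · intro g hg
    split_ifs with h1
    · rw [h.coeff_zero g h1.1 (by omega)]
      by_contra hne
      have h2 := h.supp _ (Ne.symm hne)
      have h3 := V.add_mem (h.mem_all (g - d)) h2
      rw [← add_assoc, Pauli.add_self, zero_add] at h3
      exact hp h3
    · exact h.coeff g (by omega)
  · intro g hg hgD
    exact h.coeff_zero g (by omega) hgD
  · exact fun q hq => Submodule.mem_sup_left (h.supp q hq)
  · rw [Submodule.finrank_sup_span_singleton hp, pow_succ, ← h.card]
    omega
  · exact hD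

/-- Since `Z_q ∈ V`, the coset partner `p + Z_q` of an element of `V` lies in `V` again, so the
rotation stays within the table. The zero rows beyond `d` have no `X` bit and keep their zero
coefficients. -/
theorem rotate (h : TableOf rows a d D V A) {q : Fin N} (θ : ℝ) (hq : Pauli.Z q ∈ V) :
    TableOf rows (fun g => if (rows g).1 q = 0 then a g else
      Real.cos θ * a g + realSign ((rows g).2 q) * Real.sin θ * A (rows g + Pauli.Z q)) d D V
      ((Gate.phase q θ).evolve A) := by
  refine ⟨h.mem, h.surj, h.inj, h.zero, ?_, ?_, ?_, h.card, h.le⟩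
  · intro g hg
    dsimp only [Gate.evolve]
    rw [h.coeff g hg]
  · intro g hg hgD
    rw [h.zero g hg, if_pos (show (0 : Pauli N).1 q = 0 from rfl), h.coeff_zero g hg hgD]
  · intro p hp
    by_contra hpV
    have h1 : A p = 0 := by
      by_contra h1
      exact hpV (h.supp p h1)
    have h2 : A (p + Pauli.Z q) = 0 := by
      by_contra h2
      have h3 := V.add_mem (h.supp _ h2) hq
      rw [add_assoc, Pauli.add_self, add_zero] at h3
      exact hpV h3
    apply hp
    dsimp only [Gate.evolve]
    rw [h1, h2]
    simp

theorem phase_of_forall_eq_zero (h : TableOf rows a d D V A) {q : Fin N} (θ : ℝ)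
    (hq : ¬ ∃ p ∈ V, p.1 q = 1) : TableOf rows a d D V ((Gate.phase q θ).evolve A) := by
  have h1 : (Gate.phase q θ).evolve A = A := by
    funext p
    dsimp only [Gate.evolve]
    split_ifs with h0
    · rfl
    · have h0 : p.1 q = 1 := (zmod_two_cases _).resolve_left h0
      have h1 : ∀ p : Pauli N, p.1 q = 1 → A p = 0 := by
        intro p hp
        by_contra h1
        exact hq ⟨p, h.supp p h1, hp⟩
      rw [h1 p h0, h1 _ (by rw [Pauli.add_Z_fst]; exact h0)]
      simp
  rw [h1]
  exact h

end TableOf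

/-- This ensures that a loop of `s + 1` rounds is long enough to double `b` times. -/
theorem Instance.b_le_s (I : Instance) : I.b ≤ I.s + 1 :=
  I.b_le.trans (Nat.add_le_add_right (List.countP_le_length) 1)

theorem Instance.finrank_drop_le (I : Instance) (τ : ℕ) :
    Module.finrank (ZMod 2) (propSpan (I.gates.drop τ) I.out) ≤ I.b := by
  have h := finrank_propSpan_append_le (I.gates.take τ) (I.gates.drop τ) I.out
  rwa [List.take_append_drop] at h

theorem tableOf_init {N : ℕ} {o : Fin N} {D : ℕ} (hD : 2 ≤ D) :
    TableOf (Function.update (fun _ => 0) 1 (Pauli.Z o)) (fun g => if g = 1 then 1 else 0) 2 D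
      (propSpan [] o) (coeffs [] o) := by
  have hZ : (Pauli.Z o : Pauli N) ≠ 0 := by
    intro h
    have := congrFun (congrArg Prod.snd h) o
    simp [Pauli.Z] at this
  have hspan : propSpan ([] : List (Gate N)) o = Submodule.span (ZMod 2) {Pauli.Z o} := rfl
  constructor
  · intro g hg
    by_cases h1 : g = 1
    · rw [h1, Function.update_self]; exact Submodule.mem_span_singleton_self _
    · rw [Function.update_of_ne h1]; exact Submodule.zero_mem _
  · intro p hp
    rw [hspan] at hp
    obtain ⟨c, rfl⟩ := Submodule.mem_span_singleton.mp hp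
    rcases zmod_two_cases c with rfl | rfl
    · exact ⟨0, by omega, by rw [Function.update_of_ne (by omega), zero_smul]⟩
    · exact ⟨1, by omega, by rw [Function.update_self, one_smul]⟩
  · intro g hg h hh hgh
    have h1 : g = 0 ∨ g = 1 := by omega
    have h2 : h = 0 ∨ h = 1 := by omega
    rcases h1 with rfl | rfl <;> rcases h2 with rfl | rfl
    · rfl
    · rw [Function.update_self, Function.update_of_ne (by omega)] at hgh
      exact absurd hgh.symm hZ
    · rw [Function.update_self, Function.update_of_ne (by omega)] at hgh
      exact absurd hgh hZ
    · rfl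
  · intro g hg
    rw [Function.update_of_ne (by omega)]
  · intro g hg
    have h1 : g = 0 ∨ g = 1 := by omega
    rcases h1 with rfl | rfl
    · rw [Function.update_of_ne (by omega)]
      simp [coeffs, hZ.symm]
    · rw [Function.update_self]
      simp [coeffs]
  · intro g hg _
    rw [if_neg (by omega)]
  · intro p hp
    exact Submodule.subset_span (coeffs_support _ _ _ hp)
  · rw [hspan, finrank_span_singleton hZ, pow_one]
  · exact hD

end QCSAT

namespace QCSAT

/-! ### The table of all elements of the group -/

/-- The number of columns in which row `g` differs from `e`. -/
def NE.rowDiff (a : Fin 8) (g e : NE) : NE := .sum 10 2 (.xor (.bit a g (.arr 1 (.var 10))) e)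

/-- Both Paulis vanish outside the columns in use, so comparing these columns decides equality.
Repeated columns are counted repeatedly, but only the vanishing of the count is used. -/
theorem NE.eval_rowDiff {N : ℕ} {inp : Memory} {st : St} {n : ℕ} (h : Layout N inp st n)
    {a : Fin 8} {rows : ℕ → Pauli N} (hT : IsTab N (st.na a) rows n) {g e : NE} {γ : ℕ}
    {p : Pauli N} (hg : ∀ j, g.eval inp (st.setv 10 j) = γ) (hγ : γ < n)
    (he : ∀ j < st.sz 2, e.eval inp (st.setv 10 j) = (p.bit (st.na 1 j)).val)
    (hs : rows γ ∈ colSupp N (st.na 1) (st.sz 2)) (hp : p ∈ colSupp N (st.na 1) (st.sz 2)) :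
    (NE.rowDiff a g e).eval inp st < 1 ↔ rows γ = p := by
  have h1 : ∀ j ∈ Finset.range (st.sz 2),
      (NE.xor (.bit a g (.arr 1 (.var 10))) e).eval inp (st.setv 10 j) =
        ((rows γ).bit (st.na 1 j) + p.bit (st.na 1 j)).val := by
    intro j hj
    rw [Finset.mem_range] at hj
    exact NE.eval_xor (NE.eval_bit (h.setv 10 j) (a := a) hT (hg j) (by simp [NE.eval]) hγ
      (h.col j hj)) (he j hj)
  rw [NE.rowDiff, NE.eval, Finset.sum_congr rfl h1, Nat.lt_one_iff, Finset.sum_eq_zero_iff]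
  have h2 : ∀ x y : ZMod 2, (x + y).val = 0 ↔ x = y := by decide
  simp only [Finset.mem_range, h2]
  constructor
  · intro h3
    apply Pauli.ext_bit
    intro c hc
    by_cases hex : ∃ j < st.sz 2, st.na 1 j = c
    · obtain ⟨j, hj, rfl⟩ := hex
      exact h3 j hj
    · rw [hs c hc fun j hj hjc => hex ⟨j, hj, hjc⟩, hp c hc fun j hj hjc => hex ⟨j, hj, hjc⟩]
  · rintro rfl j _
    rfl

/-- The bits of `Z` on qubit `nv 3`, in the columns `nv 10`. -/
def NE.bitZ : NE := .eq (.arr 1 (.var 10)) (.add .numQubits (.var 3))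

/-- Positive if conjugation with the gate changes the sign of row `nv 9` of table `7`. -/
def NE.signCond : NE :=
  let x : NE := .bit 7 (.var 9) (.var 3)
  let z : NE := .bit 7 (.var 9) (.add .numQubits (.var 3))
  let x' : NE := .bit 7 (.var 9) (.var 4)
  let z' : NE := .bit 7 (.var 9) (.add .numQubits (.var 4))
  .ite (.var 2) (.const 1) (.sub (.add x z) (.const 1)) <|
  .ite (.var 2) (.const 2) (.sub x z) <|
  .ite (.var 2) (.const 3) (.ite (.const 1) (.add x z') (.eq x' z) (.const 0)) (.const 0)

theorem NE.eval_signCond {N : ℕ} {inp : Memory} {st : St} {n : ℕ} (h : Layout N inp st n)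
    {rows : ℕ → Pauli N} (hT : IsTab N (st.na 7) rows n) {g : Gate N} (hg : IsGate st g) {i : ℕ}
    (hi : i < n) : 0 < NE.signCond.eval inp (st.setv 9 i) ↔ g.signBit (rows i) = 1 := by
  have hl := h.setv 9 i
  have h9 : (NE.var 9).eval inp (st.setv 9 i) = i := by simp [NE.eval]
  have hv : ∀ w, w ≠ 9 → (NE.var w).eval inp (st.setv 9 i) = st.nv w := by
    intro w hw; simp [NE.eval, hw]
  have hx : ∀ (w : ℕ) (q : Fin N), w ≠ 9 → st.nv w = q →
      (NE.bit 7 (.var 9) (.var w)).eval inp (st.setv 9 i) = ((rows i).1 q).val := by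
    intro w q hw hq
    rw [NE.eval_bit hl (a := 7) hT h9 ((hv w hw).trans hq) hi (by omega), Pauli.bit_fst]
  have hz : ∀ (w : ℕ) (q : Fin N), w ≠ 9 → st.nv w = q →
      (NE.bit 7 (.var 9) (.add .numQubits (.var w))).eval inp (st.setv 9 i) =
        ((rows i).2 q).val := by
    intro w q hw hq
    rw [NE.eval_bit hl (a := 7) hT h9 (κ := N + q)
      (by rw [NE.eval, NE.eval_numQubits hl, hv w hw, hq]) hi (by omega), Pauli.bit_snd]
  unfold NE.signCond
  unfold IsGate at hg
  cases g with
  | H q =>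
    simp only [Gate.natCode, List.cons.injEq] at hg
    obtain ⟨c0, c1, -⟩ := hg
    simp only [NE.eval.eq_9, NE.eval.eq_5, NE.eval.eq_4, hv 2 (by decide), ← c0,
      hx 3 q (by decide) c1.symm, hz 3 q (by decide) c1.symm, NE.eval.eq_1, Gate.signBit]
    rw [if_pos (by decide)]
    generalize (rows i).1 q = x
    generalize (rows i).2 q = z
    revert x z
    decide
  | S q =>
    simp only [Gate.natCode, List.cons.injEq] at hg
    obtain ⟨c0, c1, -⟩ := hg
    simp only [NE.eval.eq_9, NE.eval.eq_5, NE.eval.eq_4, hv 2 (by decide), ← c0,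
      hx 3 q (by decide) c1.symm, hz 3 q (by decide) c1.symm, NE.eval.eq_1, Gate.signBit]
    rw [if_neg (by decide), if_pos (by decide)]
    generalize (rows i).1 q = x
    generalize (rows i).2 q = z
    revert x z
    decide
  | CNOT a b hab =>
    simp only [Gate.natCode, List.cons.injEq] at hg
    obtain ⟨c0, c1, c2, -⟩ := hg
    simp only [NE.eval.eq_9, NE.eval.eq_5, NE.eval.eq_4, NE.eval_eq, hv 2 (by decide), ← c0,
      hx 3 a (by decide) c1.symm, hz 3 a (by decide) c1.symm, hx 4 b (by decide) c2.symm,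
      hz 4 b (by decide) c2.symm, NE.eval.eq_1, Gate.signBit]
    generalize (rows i).1 a = x
    generalize (rows i).2 a = z
    generalize (rows i).1 b = x'
    generalize (rows i).2 b = z'
    revert x z x' z'
    decide
  | phase q θ =>
    simp only [Gate.natCode, List.cons.injEq] at hg
    obtain ⟨c0, -⟩ := hg
    simp only [NE.eval.eq_9, hv 2 (by decide), ← c0, NE.eval.eq_1, Gate.signBit]
    rw [if_neg (by decide), if_neg (by decide), if_neg (by decide)]
    decide

/-- Change the signs of the coefficients. -/
def Cmd.signs : Cmd :=
  .tabR 0 9 8 (.var 9) (.ite (.const 0) .signCond (.sub (.const 0) (.arr 0 (.var 9)))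
    (.arr 0 (.var 9)))

theorem Cmd.exec_signs {N : ℕ} {inp : Memory} {st : St} {n : ℕ} (h : Layout N inp st n)
    (hk : st.sz 8 = n) {rows : ℕ → Pauli N} (hT : IsTab N (st.na 7) rows n) {g : Gate N}
    (hg : IsGate st g) :
    ∃ r, Cmd.signs.exec inp st = st.setR 0 r ∧
      ∀ i < n, r i = realSign (g.signBit (rows i)) * st.ra 0 i := by
  refine ⟨_, rfl, fun i hi => ?_⟩
  rw [updMany_id _ (fun i _ => by simp [NE.eval]), hk, if_pos hi]
  have h1 := NE.eval_signCond h hT hg hi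
  simp only [RE.eval, NE.eval.eq_1, NE.eval.eq_2, h1, St.setv_ra, St.setv_nv, if_true]
  rcases zmod_two_cases (g.signBit (rows i)) with h2 | h2
  · rw [h2, if_neg (by decide)]; simp [realSign]
  · rw [h2, if_pos rfl]; simp [realSign]

/-- Count the rows that are equal to `Z` on qubit `nv 3`. -/
def Cmd.member : Cmd :=
  .setv 6 (.sum 9 8 (.ite (.rowDiff 7 (.var 9) .bitZ) (.const 1) (.const 1) (.const 0)))

theorem Cmd.exec_member {N : ℕ} {inp : Memory} {st : St} {n : ℕ} (h : Layout N inp st n)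
    (hk : st.sz 8 = n) {rows : ℕ → Pauli N} (hT : IsTab N (st.na 7) rows n)
    (hs : ∀ g, rows g ∈ colSupp N (st.na 1) (st.sz 2)) {q : Fin N} (hq : st.nv 3 = q)
    (hZ : Pauli.Z q ∈ colSupp N (st.na 1) (st.sz 2)) :
    ∃ x, Cmd.member.exec inp st = st.setv 6 x ∧ (0 < x ↔ ∃ g < n, rows g = Pauli.Z q) := by
  refine ⟨_, rfl, ?_⟩
  have h1 : ∀ i ∈ Finset.range n,
      (NE.ite (.rowDiff 7 (.var 9) .bitZ) (.const 1) (.const 1) (.const 0)).eval inp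
        (st.setv 9 i) = if rows i = Pauli.Z q then 1 else 0 := by
    intro i hi
    rw [Finset.mem_range] at hi
    have h2 := NE.eval_rowDiff (h.setv 9 i) (a := 7) hT (g := .var 9) (e := .bitZ) (γ := i)
      (by intro j; simp [NE.eval]) hi (fun j _ => NE.eval_eq_Z (h.setv 9 i) (by simpa using hq) j)
      (hs i) hZ
    simp only [NE.eval.eq_9, NE.eval.eq_1, h2]
  rw [NE.eval, hk, Finset.sum_congr rfl h1, Finset.sum_pos_iff]
  simp only [Finset.mem_range]
  refine exists_congr fun g => and_congr_right fun _ => ?_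
  split_ifs with h <;> simp [h]

/-- Append the products of the rows with `Z` on qubit `nv 3`. -/
def Cmd.double : Cmd :=
  .seq (.loop 9 8 (.ite (.var 9) (.var 15) (.setRow 7 (.add (.var 9) (.var 15))
    (.xor (.bit 7 (.var 9) (.arr 1 (.var 10))) .bitZ)) .skip))
  (.setv 15 (.add (.var 15) (.var 15)))

theorem Cmd.exec_double {N : ℕ} {inp : Memory} {st : St} {n : ℕ} (h : Layout N inp st n)
    (hk : st.sz 8 = n) {rows : ℕ → Pauli N} (hT : IsTab N (st.na 7) rows n)
    (hs : ∀ g, rows g ∈ colSupp N (st.na 1) (st.sz 2)) {q : Fin N} (hq : st.nv 3 = q)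
    (hZ : Pauli.Z q ∈ colSupp N (st.na 1) (st.sz 2)) {d : ℕ} (hd : st.nv 15 = d)
    (hdn : d + d ≤ n) :
    ∃ R, Cmd.double.exec inp st = (st.setN 7 R).setv 15 (d + d) ∧ IsTab N R
      (fun g => if d ≤ g ∧ g < d + d then rows (g - d) + Pauli.Z q else rows g) n := by
  have hloop : ∃ R, (Cmd.loop 9 8 (.ite (.var 9) (.var 15) (.setRow 7 (.add (.var 9) (.var 15))
      (.xor (.bit 7 (.var 9) (.arr 1 (.var 10))) .bitZ)) .skip)).exec inp st = st.setN 7 R ∧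
      IsTab N R (fun g => if d ≤ g ∧ g < d + d then rows (g - d) + Pauli.Z q else rows g) n := by
    -- The loop runs through all rows of the table but acts only while `l < d`; the minimum in the
    -- invariant accounts for the idle rounds.
    refine Cmd.loop_induction (Q := fun st' => ∃ R, st' = st.setN 7 R ∧ IsTab N R
        (fun g => if d ≤ g ∧ g < d + d then rows (g - d) + Pauli.Z q else rows g) n)
      (fun l st' => ∃ R z, st' = (st.setv 9 z).setN 7 R ∧ IsTab N R
        (fun g => if d ≤ g ∧ g < d + min l d then rows (g - d) + Pauli.Z q else rows g) n) ?_ ?_ ?_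
    · refine ⟨st.na 7, st.nv 9, by rw [St.setv_self, St.setN_self], ?_⟩
      have h0 : ∀ g, ¬ (d ≤ g ∧ g < d + min 0 d) := by intro g; omega
      simpa only [h0, if_false] using hT
    · rintro l hl st' ⟨R, z, rfl, hR⟩
      rw [hk] at hl
      rw [St.setN_setv, St.setv_setv]
      have hst : Layout N inp ((st.setv 9 l).setN 7 R) n :=
        (h.setv 9 l).setN (by decide) (by decide) R
      rw [Cmd.exec]
      simp only [NE.eval, St.setN_nv, St.setv_nv, show ((15 : ℕ) = 9) = False by simp, if_false,
        if_true, hd]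
      by_cases hld : l < d
      · rw [if_pos hld]
        generalize hrows : (fun g => if d ≤ g ∧ g < d + min l d then rows (g - d) + Pauli.Z q
          else rows g) = rows1 at hR
        have hR' : IsTab N (((st.setv 9 l).setN 7 R).na 7) rows1 n := by simpa using hR
        have hrl : rows1 l = rows l := by rw [← hrows]; simp only; rw [if_neg (by omega)]
        have hrd : rows1 (l + d) = rows (l + d) := by
          rw [← hrows]; simp only; rw [if_neg (by omega)]
        obtain ⟨R', e', t'⟩ := Cmd.exec_setRow hst hR' (r := .add (.var 9) (.var 15)) (ρ := l + d)
          (p := rows l + Pauli.Z q)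
          (e := .xor (.bit 7 (.var 9) (.arr 1 (.var 10))) .bitZ)
          (by intro j; simp [NE.eval, hd]) (by omega)
          (by simpa using Submodule.add_mem _ (hs l) hZ) (by rw [hrd]; simpa using hs _)
          (by
            intro j hj
            have hj' : st.na 1 j < 2 * N := h.col j hj
            have b1 := NE.eval_bit (hst.setv 10 j) (a := 7) hR' (g := .var 9) (c := .arr 1 (.var 10))
              (γ := l) (κ := st.na 1 j) (by simp [NE.eval]) (by simp [NE.eval]) (by omega) hj'
            have b2 := NE.eval_eq_Z hst (q := q) (by simpa using hq) j
            rw [NE.bitZ, NE.eval_xor b1 b2, hrl, Pauli.bit_add]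
            simp)
        refine ⟨R', l, by rw [e', St.setN_setN], ?_⟩
        convert t' using 1
        funext g
        by_cases hg : g = l + d
        · subst hg
          rw [Function.update_self, if_pos (by omega), Nat.add_sub_cancel]
        · rw [Function.update_of_ne hg, ← hrows]
          have : (d ≤ g ∧ g < d + min (l + 1) d) ↔ (d ≤ g ∧ g < d + min l d) := by omega
          simp only [this]
      · rw [if_neg hld, Cmd.exec_skip]
        refine ⟨R, l, rfl, ?_⟩
        have : min (l + 1) d = min l d := by omega
        rwa [this]
    · rintro st' ⟨R, z, rfl, hR⟩
      refine ⟨R, by rw [St.setN_setv, St.setv_setv, St.setv_self], ?_⟩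
      rwa [hk, show min n d = d by omega] at hR
  obtain ⟨R, e, t⟩ := hloop
  refine ⟨R, ?_, t⟩
  rw [Cmd.double, Cmd.exec, e, Cmd.exec]
  simp [NE.eval, hd]

end QCSAT

namespace QCSAT

/-- The coefficient of the product of row `nv 9` with `Z` on qubit `nv 3`. -/
def RE.partner : RE :=
  .sum 11 8 (.ite (.rowDiff 7 (.var 11) (.xor (.bit 7 (.var 9) (.arr 1 (.var 10))) .bitZ))
    (.const 1) (.arr 0 (.var 11)) (.const 0))

/-- Entry `r` of the real code of the current gate. -/
def RE.gateReal (r : ℕ) : RE := .inp (.add (.const (2 + r)) (.add .gateIdx .gateIdx))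

/-- The coefficients after conjugation with a phase gate. -/
def Cmd.rotate : Cmd :=
  .tabR 0 9 8 (.var 9) <| .ite (.const 0) (.bit 7 (.var 9) (.var 3))
    (.ite (.bit 7 (.var 9) (.add .numQubits (.var 3))) (.const 1)
      (.add (.mul (.gateReal 0) (.arr 0 (.var 9))) (.mul (.gateReal 1) .partner))
      (.sub (.mul (.gateReal 0) (.arr 0 (.var 9))) (.mul (.gateReal 1) .partner)))
    (.arr 0 (.var 9))

/-- The partner is found by linear search through the table. This makes the rotation quadratic in
the number of rows, still below the cubic cost of the elimination. -/
theorem RE.eval_partner {N : ℕ} {inp : Memory} {st : St} {n d : ℕ} (h : Layout N inp st n)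
    (hk : st.sz 8 = n) {rows : ℕ → Pauli N} (hT : IsTab N (st.na 7) rows n)
    (hs : ∀ g, rows g ∈ colSupp N (st.na 1) (st.sz 2)) {q : Fin N} (hq : st.nv 3 = q)
    (hZ : Pauli.Z q ∈ colSupp N (st.na 1) (st.sz 2)) {V : Submodule (ZMod 2) (Pauli N)}
    {A : Pauli N → ℝ} (hA : TableOf rows (st.ra 0) d n V A) {i : ℕ} (hi : i < n)
    (h9 : st.nv 9 = i) : RE.partner.eval inp st = A (rows i + Pauli.Z q) := by
  rw [← hA.sum_ite_eq, RE.partner, RE.eval, hk]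
  refine Finset.sum_congr rfl fun g hg => ?_
  rw [Finset.mem_range] at hg
  have hl := h.setv 11 g
  have h2 := NE.eval_rowDiff hl (a := 7) hT (g := .var 11)
    (e := .xor (.bit 7 (.var 9) (.arr 1 (.var 10))) .bitZ) (γ := g) (p := rows i + Pauli.Z q)
    (by intro j; simp [NE.eval]) hg
    (by
      intro j hj
      have b1 := NE.eval_bit (hl.setv 10 j) (a := 7) hT (g := .var 9) (c := .arr 1 (.var 10))
        (γ := i) (κ := st.na 1 j) (by simp [NE.eval, h9]) (by simp [NE.eval]) hi (h.col j hj)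
      have b2 := NE.eval_eq_Z hl (q := q) (by simpa using hq) j
      rw [NE.bitZ, NE.eval_xor b1 b2, Pauli.bit_add]
      simp) (hs g) (Submodule.add_mem _ (hs i) hZ)
  simp only [RE.eval, NE.eval.eq_1, h2]
  simp [NE.eval]

theorem RE.eval_gateReal {I : Instance} {inp : Memory} {c δ : ℝ} (hinp : inp.real = I.realInput c δ)
    {st : St} {i r : ℕ} (hi : NE.gateIdx.eval inp st = i) (hlt : i < I.gates.length) (hr : r < 2) :
    (RE.gateReal r).eval inp st = (I.gates[i]).realCode.getD r 0 := by
  rw [← I.realInput_gate c δ hlt hr, ← hinp]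
  simp only [RE.gateReal, RE.eval, NE.eval, hi]
  congr 1
  ring

theorem Cmd.exec_rotate {N : ℕ} {inp : Memory} {st : St} {n d : ℕ} (h : Layout N inp st n)
    (hk : st.sz 8 = n) {rows : ℕ → Pauli N} (hT : IsTab N (st.na 7) rows n)
    (hs : ∀ g, rows g ∈ colSupp N (st.na 1) (st.sz 2)) {q : Fin N} (hq : st.nv 3 = q)
    (hZ : Pauli.Z q ∈ colSupp N (st.na 1) (st.sz 2)) {V : Submodule (ZMod 2) (Pauli N)}
    {A : Pauli N → ℝ} (hA : TableOf rows (st.ra 0) d n V A) {θ : ℝ}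
    (hcos : ∀ i, (RE.gateReal 0).eval inp (st.setv 9 i) = Real.cos θ)
    (hsin : ∀ i, (RE.gateReal 1).eval inp (st.setv 9 i) = Real.sin θ) :
    ∃ r, Cmd.rotate.exec inp st = st.setR 0 r ∧ ∀ g < n, r g = if (rows g).1 q = 0 then st.ra 0 g
      else Real.cos θ * st.ra 0 g +
        realSign ((rows g).2 q) * Real.sin θ * A (rows g + Pauli.Z q) := by
  refine ⟨_, rfl, fun i hi => ?_⟩
  rw [updMany_id _ (fun i _ => by simp [NE.eval]), hk, if_pos hi]
  have hl := h.setv 9 i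
  have h9 : (NE.var 9).eval inp (st.setv 9 i) = i := by simp [NE.eval]
  have h3 : (NE.var 3).eval inp (st.setv 9 i) = q := by simp [NE.eval, hq]
  have b1 := NE.eval_bit hl (a := 7) hT h9 h3 hi (by omega)
  have b2 := NE.eval_bit hl (a := 7) hT h9 (c := .add .numQubits (.var 3)) (κ := N + q)
    (by rw [NE.eval, NE.eval_numQubits hl, h3]) hi (by omega)
  have b3 := RE.eval_partner hl hk (rows := rows) hT hs (q := q) (by simpa using hq) hZ
    (hA.congr fun _ _ => rfl) hi (by simp)
  rw [Pauli.bit_fst] at b1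
  rw [Pauli.bit_snd] at b2
  simp only [RE.eval, b1, b2, b3, hcos, hsin, NE.eval.eq_1, NE.eval.eq_2, St.setv_ra, St.setv_nv,
    if_true]
  rcases zmod_two_cases ((rows i).1 q) with h1 | h1 <;>
    rcases zmod_two_cases ((rows i).2 q) with h2 | h2 <;>
    simp [h1, h2, realSign, ZMod.val_one]
  ring

/-- One step of the computation of the table. -/
def Cmd.tableStep : Cmd :=
  .seq .loadGate <| .seq .signs <| .seq (.gateRows 7 8) <| .ite (.var 2) (.const 3) .skip <|
  .seq (.countX 7 8) <| .ite (.const 0) (.var 5)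
    (.seq .member (.seq (.ite (.const 0) (.var 6) .skip .double) .rotate)) .skip

/-- The table contains the group for the last `i` gates, with the coefficients. -/
structure TableInv (I : Instance) (st : St) (D i : ℕ) (st' : St) (rows : ℕ → Pauli (I.n + I.m)) :
    Prop where
  sz : st'.sz = st.sz
  na : ∀ b ≠ 7, st'.na b = st.na b
  ra : ∀ b ≠ 0, st'.ra b = st.ra b
  tab : IsTab (I.n + I.m) (st'.na 7) rows D
  supp : ∀ g, rows g ∈ colSupp (I.n + I.m) (st.na 1) (st.sz 2)
  table : TableOf rows (st'.ra 0) (st'.nv 15) D (propSpan (I.gates.drop (I.s - i)) I.out)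
    (coeffs (I.gates.drop (I.s - i)) I.out)

theorem TableInv.layout {I : Instance} {st st' : St} {D i : ℕ} {rows : ℕ → Pauli (I.n + I.m)}
    (h : TableInv I st D i st' rows) {inp : Memory} (hl : Layout (I.n + I.m) inp st D) :
    Layout (I.n + I.m) inp st' D :=
  hl.congr h.sz (h.na 1 (by decide)) (h.na 2 (by decide))

/-- The cases are those of the growth of the group. A Clifford gate transforms rows and signs. A
phase gate without an `X` bit at its qubit changes nothing. Otherwise the table is doubled if `Z_q`
is new, and then the coefficients are rotated in pairs. -/
theorem Cmd.exec_tableStep {I : Instance} {inp : Memory} (hinp : inp.nat = I.natInput) {c δ : ℝ}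
    (hreal : inp.real = I.realInput c δ) {st : St} (hs : HasSizes I st) (hc : HasColumns I st)
    (hk : st.sz 8 = 2 ^ I.b) (hl : Layout (I.n + I.m) inp st (2 ^ I.b)) {i : ℕ} (hi : i < I.s)
    {st' : St} {rows : ℕ → Pauli (I.n + I.m)} (h : TableInv I st (2 ^ I.b) i st' rows) :
    ∃ rows', TableInv I st (2 ^ I.b) (i + 1) (Cmd.tableStep.exec inp (st'.setv 1 i)) rows' := by
  have hlen : I.s - (i + 1) < I.gates.length := by unfold Instance.s at *; omega
  have hl' := h.layout hl
  obtain ⟨x, y, z, e1, hg⟩ := Cmd.exec_loadGate (st := st'.setv 1 i) hinp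
    (hs.congr h.sz).sz0 hlen (by simp)
  generalize hst1 : (((st'.setv 1 i).setv 2 x).setv 3 y).setv 4 z = st1 at e1 hg
  have hsz1 : st1.sz = st.sz := by rw [← hst1]; exact h.sz
  have hl1 : Layout (I.n + I.m) inp st1 (2 ^ I.b) := by
    rw [← hst1]; exact (((hl'.setv _ _).setv _ _).setv _ _).setv _ _
  have hna1 : st1.na = st'.na := by rw [← hst1]; rfl
  have hra1 : st1.ra = st'.ra := by rw [← hst1]; rfl
  have h15 : st1.nv 15 = st'.nv 15 := by rw [← hst1]; simp
  have hi1 : st1.nv 1 = i := by simp [← hst1]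
  have hk1 : st1.sz 8 = 2 ^ I.b := by rw [hsz1, hk]
  have hT1 : IsTab (I.n + I.m) (st1.na 7) rows (2 ^ I.b) := by rw [hna1]; exact h.tab
  -- The signs are computed before the rows are transformed: `evolve` evaluates the sign bit at the
  -- Pauli from which the new one arises, that is, at the old row. For a phase gate all signs are
  -- `+1`.
  obtain ⟨r2, e2, hr2⟩ := Cmd.exec_signs hl1 hk1 hT1 hg
  have hg2 : IsGate (st1.setR 0 r2) I.gates[I.s - (i + 1)] := hg
  obtain ⟨R3, e3, t3⟩ := Cmd.exec_gateRows (hl1.setR 0 r2) (k := 8) hk1 (a := 7) (by decide)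
    (by decide) (by simpa using hT1) hg2
  have hl3 := (hl1.setR 0 r2).setN (a := 7) (by decide) (by decide) R3
  have hmem : I.gates[I.s - (i + 1)] ∈ I.gates := List.getElem_mem hlen
  have htouch := hc.gate _ hmem
  have hdrop := I.drop_gates hi
  have hfin := I.finrank_drop_le (I.s - (i + 1))
  have hidx : ∀ st'' : St, st''.sz = st.sz → st''.nv 1 = i →
      NE.gateIdx.eval inp st'' = I.s - (i + 1) := by
    intro st'' h1 h2
    simp [NE.gateIdx, NE.eval, h1, h2, hs.sz0]
  have hcs : ∀ (st'' : St) (r : ℕ), st''.sz = st.sz → st''.nv 1 = i → r < 2 →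
      (RE.gateReal r).eval inp st'' = (I.gates[I.s - (i + 1)]).realCode.getD r 0 :=
    fun st'' r h1 h2 hr => RE.eval_gateReal hreal (hidx st'' h1 h2) hlen hr
  unfold Cmd.tableStep
  simp only [Cmd.exec, e1, e2, e3]
  generalize hst3 : (st1.setR 0 r2).setN 7 R3 = st3 at hl3
  have hsz3 : st3.sz = st.sz := by rw [← hst3]; exact hsz1
  have hna3 : ∀ b ≠ 7, st3.na b = st.na b := by
    intro b hb
    rw [← hst3, St.setN_na, if_neg hb, St.setR_na, hna1, h.na b hb]
  have hra3 : ∀ b ≠ 0, st3.ra b = st.ra b := by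
    intro b hb
    rw [← hst3, St.setN_ra, St.setR_ra, if_neg hb, hra1, h.ra b hb]
  have hnv3 : st3.nv = st1.nv := by rw [← hst3]; rfl
  have h73 : st3.na 7 = R3 := by rw [← hst3]; simp
  have hra30 : st3.ra 0 = r2 := by rw [← hst3]; simp
  generalize I.gates[I.s - (i + 1)] = g at *
  by_cases hph : g.isPhase = true
  · have hnot := hg.phase_iff.mp hph
    cases g with
    | phase q θ =>
      have hq : st3.nv 3 = q := by rw [hnv3]; exact hg.phase_eq
      have hZ : Pauli.Z q ∈ colSupp (I.n + I.m) (st.na 1) (st.sz 2) := htouch.Z_mem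
      have t3' : IsTab (I.n + I.m) (st3.na 7) rows (2 ^ I.b) := by
        rw [h73]; simpa [Gate.isPhase] using t3
      have htab3 : TableOf rows (st3.ra 0) (st'.nv 15) (2 ^ I.b)
          (propSpan (I.gates.drop (I.s - i)) I.out) (coeffs (I.gates.drop (I.s - i)) I.out) := by
        refine h.table.congr fun g hg => ?_
        rw [hra30, hr2 g hg, hra1]
        simp [Gate.signBit, realSign]
      rw [if_neg (by rw [NE.eval, NE.eval, hnv3]; exact hnot)]
      obtain ⟨x, e4, hx⟩ := Cmd.exec_countX hl3 (by rw [hsz3, hk]) t3' hq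
      rw [e4]
      have hiff : 0 < x ↔ ∃ p ∈ propSpan (I.gates.drop (I.s - i)) I.out, p.1 q = 1 := by
        rw [hx]
        constructor
        · rintro ⟨g, hg, h1⟩; exact ⟨_, h.table.mem_all g, h1⟩
        · rintro ⟨p, hp, h1⟩
          obtain ⟨g, hg, rfl⟩ := h.table.surj p hp
          exact ⟨g, hg.trans_le h.table.le, h1⟩
      by_cases hx0 : 0 < x
      · rw [if_pos (by simpa [NE.eval] using hx0)]
        have hV := propSpan_phase_pos q θ _ _ (hiff.mp hx0)
        have hsupp3 : ∀ g, rows g ∈ colSupp (I.n + I.m) (st3.na 1) (st3.sz 2) := by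
          intro g; rw [hna3 1 (by decide), hsz3]; exact h.supp g
        have hZ3 : Pauli.Z q ∈ colSupp (I.n + I.m) (st3.na 1) (st3.sz 2) := by
          rw [hna3 1 (by decide), hsz3]; exact hZ
        obtain ⟨w, e5, hw⟩ := Cmd.exec_member (hl3.setv 5 x) (by rw [St.setv_sz, hsz3, hk])
          t3' hsupp3 (q := q) (by simpa using hq) hZ3
        simp only [e5]
        have hwV : 0 < w ↔ Pauli.Z q ∈ propSpan (I.gates.drop (I.s - i)) I.out := by
          rw [hw]
          constructor
          · rintro ⟨g, -, h1⟩; rw [← h1]; exact h.table.mem_all g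
          · intro h1
            obtain ⟨g, hg, h2⟩ := h.table.surj _ h1
            exact ⟨g, hg.trans_le h.table.le, h2⟩
        -- Whether or not the table was doubled, it now lists the group enlarged by `Z_q`, still
        -- with the coefficients from before the gate.
        have hmid : ∃ (R4 : ℕ → ℕ) (rows4 : ℕ → Pauli (I.n + I.m)) (d4 : ℕ),
            (if (NE.const 0).eval inp ((st3.setv 5 x).setv 6 w) <
              (NE.var 6).eval inp ((st3.setv 5 x).setv 6 w) then
                Cmd.skip.exec inp ((st3.setv 5 x).setv 6 w)
              else Cmd.double.exec inp ((st3.setv 5 x).setv 6 w)) =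
              (((st3.setv 5 x).setv 6 w).setN 7 R4).setv 15 d4 ∧
            IsTab (I.n + I.m) R4 rows4 (2 ^ I.b) ∧
            (∀ g, rows4 g ∈ colSupp (I.n + I.m) (st.na 1) (st.sz 2)) ∧
            TableOf rows4 (st3.ra 0) d4 (2 ^ I.b)
              (propSpan (Gate.phase q θ :: I.gates.drop (I.s - i)) I.out)
              (coeffs (I.gates.drop (I.s - i)) I.out) := by
          by_cases hw0 : 0 < w
          · rw [if_pos (by simpa [NE.eval] using hw0), Cmd.exec_skip]
            refine ⟨st3.na 7, rows, st'.nv 15, ?_, t3', h.supp, ?_⟩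
            · have e6 : ((st3.setv 5 x).setv 6 w).nv 15 = st'.nv 15 := by
                simp [hnv3, h15]
              rw [← e6, show st3.na 7 = ((st3.setv 5 x).setv 6 w).na 7 from rfl, St.setN_self,
                St.setv_self]
            · rw [hV]
              have : propSpan (I.gates.drop (I.s - i)) I.out ⊔
                  Submodule.span (ZMod 2) {Pauli.Z q} = propSpan (I.gates.drop (I.s - i)) I.out :=
                sup_eq_left.mpr ((Submodule.span_singleton_le_iff_mem _ _).mpr (hwV.mp hw0))
              rw [this]
              exact htab3
          · rw [if_neg (by simpa [NE.eval] using hw0)]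
            have hnotV : Pauli.Z q ∉ propSpan (I.gates.drop (I.s - i)) I.out :=
              fun h1 => hw0 (hwV.mpr h1)
            -- Doubling happens only when the rank grows, and the rank at every stage is at most
            -- `b`, so the capacity is never exceeded.
            have hdd : st'.nv 15 + st'.nv 15 ≤ 2 ^ I.b := by
              rw [hdrop, hV, Submodule.finrank_sup_span_singleton hnotV] at hfin
              rw [h.table.card, ← two_mul, ← pow_succ']
              exact Nat.pow_le_pow_right (by omega) hfin
            obtain ⟨R4, e6, t4⟩ := Cmd.exec_double ((hl3.setv 5 x).setv 6 w)
              (by rw [St.setv_sz, St.setv_sz, hsz3, hk]) t3' hsupp3 (q := q) (by simpa using hq)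
              hZ3 (d := st'.nv 15) (by simp [hnv3, h15]) hdd
            refine ⟨R4, _, _, e6, t4, fun g => ?_, ?_⟩
            · split_ifs
              · exact Submodule.add_mem _ (h.supp _) hZ
              · exact h.supp _
            · rw [hV]
              exact htab3.double hnotV hdd
        obtain ⟨R4, rows4, d4, e7, t4, s4, table4⟩ := hmid
        rw [e7]
        have hZV : Pauli.Z q ∈ propSpan (Gate.phase q θ :: I.gates.drop (I.s - i)) I.out := by
          rw [hV]
          exact Submodule.mem_sup_right (Submodule.mem_span_singleton_self _)
        have hl4 : Layout (I.n + I.m) inp ((((st3.setv 5 x).setv 6 w).setN 7 R4).setv 15 d4)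
            (2 ^ I.b) :=
          (((hl3.setv 5 x).setv 6 w).setN (by decide) (by decide) R4).setv 15 d4
        obtain ⟨r5, e8, hr5⟩ := Cmd.exec_rotate hl4 (by simp [hsz3, hk]) (rows := rows4)
          (by simpa using t4) (by simpa [hna3, hsz3] using s4) (q := q) (by simpa using hq)
          (by simpa [hna3, hsz3] using hZ) (hA := table4) (θ := θ)
          (by intro j; exact hcs _ 0 (by simp [hsz3]) (by simp [hnv3, hi1]) (by omega))
          (by intro j; exact hcs _ 1 (by simp [hsz3]) (by simp [hnv3, hi1]) (by omega))
        rw [e8]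
        refine ⟨rows4, ?_, ?_, ?_, ?_, s4, ?_⟩
        · simp [hsz3]
        · intro b hb; simp [hb, hna3 b hb]
        · intro b hb; simp [hb, hra3 b hb]
        · simpa using t4
        · rw [hdrop]
          have h1 := (table4.rotate θ hZV).congr (a' := r5) hr5
          simpa [coeffs] using h1
      · rw [if_neg (by simpa [NE.eval] using hx0), Cmd.exec_skip]
        have hno : ¬ ∃ p ∈ propSpan (I.gates.drop (I.s - i)) I.out, p.1 q = 1 :=
          fun h1 => hx0 (hiff.mpr h1)
        refine ⟨rows, by simp [hsz3], fun b hb => by simp [hna3 b hb],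
          fun b hb => by simp [hra3 b hb], t3', h.supp, ?_⟩
        rw [hdrop, propSpan_phase_neg _ _ _ _ hno]
        have h1 := htab3.phase_of_forall_eq_zero θ hno
        simpa [coeffs, hnv3, h15] using h1
    | _ => simp [Gate.isPhase] at hph
  · have hph' : g.isPhase = false := by simpa using hph
    have hlt : st1.nv 2 < 3 := by
      by_contra h'
      exact hph (hg.phase_iff.mpr h')
    rw [if_pos (by rw [NE.eval, NE.eval, hnv3]; exact hlt), Cmd.exec_skip]
    refine ⟨fun i => g.act (rows i), hsz3, hna3, hra3, by rw [h73]; simpa [hph'] using t3,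
      fun g' => Gate.act_mem_colSupp htouch (h.supp g'), ?_⟩
    rw [hdrop, propSpan_cons g hph', hnv3, h15]
    have h1 := (h.table.act g hph').congr (a' := st3.ra 0) fun j hj => by
      rw [hra30, hr2 j hj, hra1]
    simpa [coeffs] using h1

end QCSAT

namespace QCSAT

/-- Compute the table of the elements of the group with their coefficients. -/
def Cmd.table : Cmd :=
  .seq (.pointers 8) <| .seq (.setv 15 (.const 2)) <| .seq (.setv 3 (.inp (.const 3))) <|
  .seq (.setRow 7 (.const 1) .bitZ) <|
  .seq (.tabR 0 9 8 (.var 9)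
    (.ite (.const 0) (.eq (.var 9) (.const 1)) (.const 1) (.const 0))) <|
  .loop 1 0 .tableStep

/-- The group contains the nontrivial element `Z_out` from the start, and its rank never decreases;
so the table has room for the two initial rows. -/
theorem Instance.two_le (I : Instance) : 2 ≤ 2 ^ I.b := by
  have h1 := (tableOf_init (o := I.out) (D := 2) le_rfl).card
  have h2 := I.finrank_drop_le I.s
  rw [Instance.s, List.drop_length] at h2
  calc 2 = _ := h1
    _ ≤ _ := Nat.pow_le_pow_right (by omega) h2

/-- The table of the elements of the group has been computed. -/
structure HasTable (I : Instance) (inp : Memory) (st : St) (rows : ℕ → Pauli (I.n + I.m)) (d : ℕ) :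
    Prop where
  layout : Layout (I.n + I.m) inp st (2 ^ I.b)
  tab : IsTab (I.n + I.m) (st.na 7) rows (2 ^ I.b)
  supp : ∀ g, rows g ∈ colSupp (I.n + I.m) (st.na 1) (st.sz 2)
  table : TableOf rows (st.ra 0) d (2 ^ I.b) (propSpan I.gates I.out) I.obsCoeffs

theorem Cmd.exec_table {I : Instance} {inp : Memory} (hinp : inp.nat = I.natInput) {c δ : ℝ}
    (hreal : inp.real = I.realInput c δ) {st : St} (hs : HasSizes I st) (hc : HasColumns I st)
    (hk : st.sz 8 = 2 ^ I.b) (h7 : st.na 7 = fun _ => 0) :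
    ∃ rows d, HasTable I inp (Cmd.table.exec inp st) rows d ∧
      (Cmd.table.exec inp st).sz = st.sz ∧ (Cmd.table.exec inp st).na 1 = st.na 1 := by
  obtain ⟨R1, e1, hl1⟩ := Cmd.exec_pointers hinp hc 8
  have hout : inp.nat 3 = I.out := by rw [hinp]; rfl
  rw [hk] at hl1
  have h2 := I.two_le
  have hl2 := (hl1.setv 15 2).setv 3 I.out
  generalize hst2 : ((st.setN 2 R1).setv 15 2).setv 3 I.out = st2 at hl2
  have hsz2 : st2.sz = st.sz := by rw [← hst2]; rfl
  have hna2 : st2.na 1 = st.na 1 := by rw [← hst2]; simp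
  have ht2 : IsTab (I.n + I.m) (st2.na 7) (fun _ => 0) (2 ^ I.b) :=
    isTab_zero (by rw [← hst2]; simpa using h7) _
  have hq2 : st2.nv 3 = I.out := by simp [← hst2]
  obtain ⟨R3, e3, t3⟩ := Cmd.exec_setRow hl2 (a := 7) ht2
    (r := .const 1) (ρ := 1) (e := .bitZ) (by intro j; rfl) (by omega) (p := Pauli.Z I.out)
    (Pauli.Z_mem_colSupp _ (by rw [hsz2, hna2]; exact hc.out)) (Submodule.zero_mem _)
    (fun j _ => NE.eval_eq_Z hl2 hq2 j)
  have hl3 := hl2.setN (a := 7) (by decide) (by decide) R3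
  have h4 : ∃ r, (Cmd.tabR 0 9 8 (.var 9) (.ite (.const 0) (.eq (.var 9) (.const 1)) (.const 1)
      (.const 0))).exec inp (st2.setN 7 R3) = (st2.setN 7 R3).setR 0 r ∧
      ∀ g < 2 ^ I.b, r g = if g = 1 then 1 else 0 := by
    refine ⟨_, rfl, fun g hg => ?_⟩
    rw [updMany_id _ (fun i _ => by simp [NE.eval]), St.setN_sz, hsz2, hk, if_pos hg]
    simp only [RE.eval, NE.eval_eq, NE.eval, St.setv_nv, if_true]
    split_ifs <;> simp_all
  obtain ⟨r, e4, hr⟩ := h4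
  have hl4 := hl3.setR 0 r
  generalize hst4 : (st2.setN 7 R3).setR 0 r = st4 at e4 hl4
  have hsz4 : st4.sz = st.sz := by rw [← hst4]; exact hsz2
  have hna4 : st4.na 1 = st.na 1 := by rw [← hst4]; simpa using hna2
  have hs4 : HasSizes I st4 := hs.congr hsz4
  have hc4 : HasColumns I st4 := hc.congr hsz4 hna4
  have hexec : Cmd.table.exec inp st = (Cmd.loop 1 0 .tableStep).exec inp st4 := by
    have e2 : (NE.inp (.const 3)).eval inp ((st.setN 2 R1).setv 15 2) = I.out := hout
    have e2' : (NE.const 2).eval inp (st.setN 2 R1) = 2 := rfl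
    rw [Cmd.table]
    simp only [Cmd.exec.eq_5]
    rw [e1, Cmd.exec.eq_1, Cmd.exec.eq_1, e2', e2, hst2, e3, e4]
  have hinit : TableInv I st4 (2 ^ I.b) 0 st4 (Function.update (fun _ => 0) 1 (Pauli.Z I.out)) := by
    refine ⟨rfl, fun _ _ => rfl, fun _ _ => rfl, by rw [← hst4]; simpa using t3, ?_, ?_⟩
    · intro g
      by_cases hg : g = 1
      · subst hg; rw [Function.update_self]; exact Pauli.Z_mem_colSupp _ hc4.out
      · rw [Function.update_of_ne hg]; exact Submodule.zero_mem _
    · have h15 : st4.nv 15 = 2 := by rw [← hst4, ← hst2]; simp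
      have hr0 : st4.ra 0 = r := by rw [← hst4]; simp
      rw [h15, hr0, Nat.sub_zero, Instance.s, List.drop_length]
      exact (tableOf_init h2).congr hr
  rw [hexec]
  refine Cmd.loop_induction (Q := fun st' => ∃ rows d, HasTable I inp st' rows d ∧
      st'.sz = st.sz ∧ st'.na 1 = st.na 1)
    (fun i st' => ∃ rows, TableInv I st4 (2 ^ I.b) i st' rows) ⟨_, hinit⟩ ?_ ?_
  · rintro i hi st' ⟨rows, h⟩
    exact Cmd.exec_tableStep hinp hreal hs4 hc4 (by rw [hsz4, hk]) hl4 (by rwa [hs4.sz0] at hi) h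
  · rintro st' ⟨rows, h⟩
    rw [hs4.sz0] at h
    have hna : st'.na 1 = st4.na 1 := h.na 1 (by decide)
    refine ⟨rows, st'.nv 15, ⟨(h.layout hl4).setv _ _, h.tab, ?_, ?_⟩, h.sz.trans hsz4,
      hna.trans hna4⟩
    · simpa [hna, h.sz] using h.supp
    · have h1 := h.table
      rwa [Nat.sub_self, List.drop_zero] at h1

/-- Put `2 ^ nv 0` into scalar `13`. -/
def Cmd.pow : Cmd :=
  .seq (.setv 13 (.const 1)) <| .loop 9 1 <| .ite (.var 9) (.var 0)
    (.setv 13 (.add (.var 13) (.var 13))) .skip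

theorem Cmd.exec_pow {inp : Memory} {st : St} {b : ℕ} (hb : st.nv 0 = b) (hle : b ≤ st.sz 1) :
    let st' := Cmd.pow.exec inp st
    st'.sz = st.sz ∧ st'.na = st.na ∧ st'.ra = st.ra ∧ st'.nv 13 = 2 ^ b := by
  show _ = _ ∧ _
  refine Cmd.loop_induction (st := st.setv 13 1) (Q := fun st' => st'.sz = st.sz ∧
    st'.na = st.na ∧ st'.ra = st.ra ∧ st'.nv 13 = 2 ^ b) (fun i st' => st'.sz = st.sz ∧
    st'.na = st.na ∧ st'.ra = st.ra ∧ st'.nv 0 = b ∧ st'.nv 13 = 2 ^ min i b) ?_ ?_ ?_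
  · exact ⟨rfl, rfl, rfl, by simpa using hb, by simp⟩
  · rintro i hi st' ⟨h1, h2, h3, h4, h5⟩
    rw [Cmd.exec]
    simp only [NE.eval, St.setv_nv, if_true, show ((0 : ℕ) = 9) = False by simp, if_false, h4]
    split_ifs with hib
    · refine ⟨h1, h2, h3, by simp [Cmd.exec, h4], ?_⟩
      simp only [Cmd.exec, NE.eval, St.setv_nv, if_true, show ((13 : ℕ) = 9) = False by simp,
        if_false, h5]
      rw [show min i b = i by omega, show min (i + 1) b = i + 1 by omega, pow_succ]
      omega
    · rw [Cmd.exec_skip]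
      refine ⟨h1, h2, h3, by simp [h4], ?_⟩
      rw [show min (i + 1) b = min i b by omega]
      simpa using h5
  · rintro st' ⟨h1, h2, h3, h4, h5⟩
    refine ⟨h1, h2, h3, ?_⟩
    rw [show min ((st.setv 13 1).sz 1) b = b by simp; omega] at h5
    simpa using h5

end QCSAT

/-! ### The matrix of the quadratic form and its elimination in memory -/

namespace QCSAT

/-! ### The matrix of the quadratic form -/

/-- The number of ancillas on which row `h` has a nonzero `X` part, counted in the columns. -/
def NE.ancCount (h : NE) : NE :=
  .sum 10 2 (.ite (.arr 1 (.var 10)) (.inp (.const 0)) (.const 0)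
    (.ite (.arr 1 (.var 10)) .numQubits (.bit 7 h (.arr 1 (.var 10))) (.const 0)))

/-- The `X` columns of ancillas are those from `n` to `n + m - 1`. Ancillas outside the list of
columns carry no bits, so the search through the list is complete and its length is independent of
`m`. -/
theorem NE.eval_ancCount {I : Instance} {inp : Memory} (hinp : inp.nat = I.natInput) {st : St}
    {rows : ℕ → Pauli (I.n + I.m)} {d : ℕ} (ht : HasTable I inp st rows d) {h : NE} {γ : ℕ}
    (hh : ∀ j, h.eval inp (st.setv 10 j) = γ) (hγ : γ < 2 ^ I.b) :
    (NE.ancCount h).eval inp st < 1 ↔ Pauli.ancX (rows γ) = 0 := by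
  have h0 : inp.nat 0 = I.n := by rw [hinp]; rfl
  have h1 : ∀ j ∈ Finset.range (st.sz 2),
      (NE.ite (.arr 1 (.var 10)) (.inp (.const 0)) (.const 0)
        (.ite (.arr 1 (.var 10)) .numQubits (.bit 7 h (.arr 1 (.var 10))) (.const 0))).eval inp
        (st.setv 10 j) = if st.na 1 j < I.n then 0 else
          if st.na 1 j < I.n + I.m then ((rows γ).bit (st.na 1 j)).val else 0 := by
    intro j hj
    rw [Finset.mem_range] at hj
    have e1 : (NE.arr 1 (.var 10)).eval inp (st.setv 10 j) = st.na 1 j := by simp [NE.eval]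
    have e2 := NE.eval_numQubits (ht.layout.setv 10 j)
    have e3 := NE.eval_bit (ht.layout.setv 10 j) (a := 7) ht.tab (hh j) e1 hγ (ht.layout.col j hj)
    have e4 : (NE.inp (.const 0)).eval inp (st.setv 10 j) = I.n := h0
    simp only [NE.eval.eq_9, e1, e2, e3, e4, NE.eval.eq_1]
  rw [NE.ancCount, NE.eval, Finset.sum_congr rfl h1, Nat.lt_one_iff, Finset.sum_eq_zero_iff]
  simp only [Finset.mem_range]
  constructor
  · intro h2
    funext k
    have hk := k.2
    show (rows γ).1 (Fin.natAdd I.n k) = 0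
    rw [← Pauli.bit_fst, Fin.val_natAdd]
    by_cases hex : ∃ j < st.sz 2, st.na 1 j = I.n + k
    · obtain ⟨j, hj, hjk⟩ := hex
      have h3 := h2 j hj
      rw [hjk, if_neg (by omega), if_pos (by omega)] at h3
      exact (ZMod.val_eq_zero _).mp h3
    · exact ht.supp γ _ (by omega) fun j hj hjk => hex ⟨j, hj, hjk⟩
  · intro h2 j hj
    split_ifs with h3 h4
    · rfl
    · have h5 := congrFun h2 ⟨st.na 1 j - I.n, by omega⟩
      have h6 : (rows γ).1 (Fin.natAdd I.n ⟨st.na 1 j - I.n, by omega⟩) = 0 := h5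
      rw [← Pauli.bit_fst] at h6
      simp only [Fin.val_natAdd] at h6
      rw [show I.n + (st.na 1 j - I.n) = st.na 1 j by omega] at h6
      rw [h6]
      rfl
    · rfl

/-- The number of bits of the witness qubits that are nonzero, for the bits `f`. -/
def NE.witCount (f : NE → NE) : NE :=
  .sum 10 3 (.add (f (.var 10)) (f (.add .numQubits (.var 10))))

theorem Pauli.restrict_fst {n m : ℕ} (p : Pauli (n + m)) (j : Fin n) :
    (Pauli.restrict p).1 j = p.bit j := by
  rw [show (j : ℕ) = (Fin.castAdd m j : Fin (n + m)) from rfl, Pauli.bit_fst]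
  rfl

theorem Pauli.restrict_snd {n m : ℕ} (p : Pauli (n + m)) (j : Fin n) :
    (Pauli.restrict p).2 j = p.bit (n + m + j) := by
  rw [show (j : ℕ) = (Fin.castAdd m j : Fin (n + m)) from rfl, Pauli.bit_snd]
  rfl

theorem NE.eval_witCount {I : Instance} {inp : Memory} {st : St} {n : ℕ}
    (hl : Layout (I.n + I.m) inp st n) (h3 : st.sz 3 = I.n) {f : NE → NE} {p : Pauli (I.n + I.m)}
    (hf : ∀ j c κ, c.eval inp (st.setv 10 j) = κ → κ < 2 * (I.n + I.m) →
      (f c).eval inp (st.setv 10 j) = (p.bit κ).val) :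
    (NE.witCount f).eval inp st < 1 ↔ Pauli.restrict p = 0 := by
  have h10 : ∀ j, (NE.var 10).eval inp (st.setv 10 j) = j := by intro j; simp [NE.eval]
  have h1 : ∀ j ∈ Finset.range I.n,
      (NE.add (f (.var 10)) (f (.add .numQubits (.var 10)))).eval inp (st.setv 10 j) =
        (p.bit j).val + (p.bit (I.n + I.m + j)).val := by
    intro j hj
    rw [Finset.mem_range] at hj
    rw [NE.eval, hf j _ j (h10 j) (by omega), hf j _ (I.n + I.m + j)
      (by rw [NE.eval, NE.eval_numQubits (hl.setv 10 j), h10]) (by omega)]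
  rw [NE.witCount, NE.eval, h3, Finset.sum_congr rfl h1, Nat.lt_one_iff, Finset.sum_eq_zero_iff]
  simp only [Finset.mem_range, Nat.add_eq_zero_iff, ZMod.val_eq_zero]
  constructor
  · intro h
    ext j
    · rw [Pauli.restrict_fst, (h j j.2).1]; rfl
    · rw [Pauli.restrict_snd, (h j j.2).2]; rfl
  · intro h j hj
    rw [← Pauli.restrict_fst p ⟨j, hj⟩, ← Pauli.restrict_snd p ⟨j, hj⟩, h]
    exact ⟨rfl, rfl⟩

def NE.and (e f : NE) : NE := .sub (.add e f) (.const 1)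

/-- The exponent of the phase of the product of the rows `nv 9` and `nv 12`. -/
def NE.phase : NE :=
  let x : NE := .bit 7 (.var 9) (.var 10)
  let z : NE := .bit 7 (.var 9) (.add .numQubits (.var 10))
  let x' : NE := .bit 7 (.var 12) (.var 10)
  let z' : NE := .bit 7 (.var 12) (.add .numQubits (.var 10))
  .sum 10 3 (.add (.add (.and x z) (.and x' z'))
    (.add (.add (.and z x') (.and z x')) (.triple (.and (.xor x x') (.xor z z')))))

theorem NE.eval_and {inp : Memory} {st : St} {e f : NE} {x y : ZMod 2}
    (he : e.eval inp st = x.val) (hf : f.eval inp st = y.val) :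
    (NE.and e f).eval inp st = x.val * y.val := by
  have h : ∀ x y : ZMod 2, x.val + y.val - 1 = x.val * y.val := by decide
  simp only [NE.and, NE.eval, he, hf, h]

theorem NE.eval_phase {I : Instance} {inp : Memory} {st : St} {rows : ℕ → Pauli (I.n + I.m)} {d : ℕ}
    (ht : HasTable I inp st rows d) (h3 : st.sz 3 = I.n) {v w : ℕ} (hv : st.nv 12 = v)
    (hw : st.nv 9 = w) (hvD : v < 2 ^ I.b) (hwD : w < 2 ^ I.b) :
    NE.phase.eval inp st = ∑ j : Fin I.n, phaseExp ((Pauli.restrict (rows w)).1 j)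
      ((Pauli.restrict (rows w)).2 j) ((Pauli.restrict (rows v)).1 j)
      ((Pauli.restrict (rows v)).2 j) := by
  rw [NE.phase, NE.eval, h3, Finset.sum_range]
  refine Finset.sum_congr rfl fun j _ => ?_
  have hj := j.2
  have hl := ht.layout.setv 10 j
  have h10 : (NE.var 10).eval inp (st.setv 10 j) = j := by simp [NE.eval]
  have hN : (NE.add .numQubits (.var 10)).eval inp (st.setv 10 j) = I.n + I.m + j := by
    rw [NE.eval, NE.eval_numQubits hl, h10]
  have h9 : (NE.var 9).eval inp (st.setv 10 j) = w := by simp [NE.eval, hw]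
  have h12 : (NE.var 12).eval inp (st.setv 10 j) = v := by simp [NE.eval, hv]
  have x := NE.eval_bit hl (a := 7) ht.tab h9 h10 hwD (by omega)
  have z := NE.eval_bit hl (a := 7) ht.tab h9 hN hwD (by omega)
  have x' := NE.eval_bit hl (a := 7) ht.tab h12 h10 hvD (by omega)
  have z' := NE.eval_bit hl (a := 7) ht.tab h12 hN hvD (by omega)
  rw [Pauli.restrict_fst, Pauli.restrict_fst, Pauli.restrict_snd, Pauli.restrict_snd, phaseExp]
  simp only [NE.triple, NE.eval.eq_4, NE.eval_and x z, NE.eval_and x' z', NE.eval_and z x',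
    NE.eval_and (NE.eval_xor x x') (NE.eval_xor z z')]
  ring

/-- The real part of `i ^ E` for the exponent `E` of the phase. -/
def RE.phaseSign : RE :=
  let four : NE := .add (.add (.var 14) (.var 14)) (.add (.var 14) (.var 14))
  let r : NE := .sub .phase (.sum 14 4 (.ite (.add (.const 3) four) .phase (.const 4) (.const 0)))
  .ite r (.const 1) (.const 1) <| .ite r (.const 2) (.const 0) <|
    .ite r (.const 3) (.sub (.const 0) (.const 1)) (.const 0)

theorem phaseExp_le (x z x' z' : ZMod 2) : phaseExp x z x' z' ≤ 7 := by
  revert x z x' z'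
  decide

theorem re_I_pow (E : ℕ) : (Complex.I ^ E).re =
    if E % 4 < 1 then 1 else if E % 4 < 2 then 0 else if E % 4 < 3 then 0 - 1 else (0 : ℝ) := by
  have h1 : Complex.I ^ E = Complex.I ^ (E % 4) := by
    conv_lhs => rw [← Nat.div_add_mod E 4, pow_add, pow_mul, Complex.I_pow_four, one_pow, one_mul]
  rw [h1]
  have h2 : E % 4 < 4 := Nat.mod_lt _ (by omega)
  generalize E % 4 = r at h2
  interval_cases r <;> simp [pow_succ]

/-- The phase is a power of `i` whose exponent is a sum over the witness qubits. Only its residue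
modulo 4 matters, and this residue is formed by counting, since the machine has no division of
natural numbers. -/
theorem RE.eval_phaseSign {I : Instance} {inp : Memory} {st : St}
    {rows : ℕ → Pauli (I.n + I.m)} {d : ℕ} (ht : HasTable I inp st rows d) (hs : HasSizes I st)
    {v w : ℕ} (hv : st.nv 12 = v) (hw : st.nv 9 = w) (hvD : v < 2 ^ I.b) (hwD : w < 2 ^ I.b) :
    RE.phaseSign.eval inp st =
      pairSign (Pauli.restrict (rows w)) (Pauli.restrict (rows v)) := by
  have h1 := NE.eval_phase ht hs.sz3 hv hw hvD hwD
  have h2 : ∀ k, NE.phase.eval inp (st.setv 14 k) = NE.phase.eval inp st := by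
    intro k
    rw [h1]
    exact NE.eval_phase ⟨ht.layout.setv 14 k, ht.tab, ht.supp, ht.table⟩ hs.sz3 (by simpa using hv)
      (by simpa using hw) hvD hwD
  rw [pairSign, ← h1, re_I_pow]
  have h3 : NE.phase.eval inp st ≤ 7 * I.n := by
    rw [h1]
    refine (Finset.sum_le_card_nsmul _ _ 7 fun j _ => phaseExp_le _ _ _ _).trans ?_
    simp [mul_comm]
  generalize hE : NE.phase.eval inp st = E at *
  -- `4k + 3 < E` means `k < E / 4`, so the sum counts the multiples of 4 to be subtracted. As `E ≤
  -- 7n`, the range of length `2n + 2` contains all such `k`.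
  have h5 : ∑ k ∈ Finset.range (2 * I.n + 2), (if 3 + (k + k + (k + k)) < E then 4 else 0) =
      E / 4 * 4 := by
    rw [← sum_range_ite_lt (2 * I.n + 2) (E / 4) 4 (by omega)]
    refine Finset.sum_congr rfl fun k _ => ?_
    congr 1
    rw [eq_iff_iff]
    omega
  have h6 : E - E / 4 * 4 = E % 4 := by omega
  simp only [RE.phaseSign, RE.eval, NE.eval.eq_9, NE.eval.eq_8, NE.eval.eq_5, NE.eval.eq_4,
    NE.eval.eq_1, NE.eval.eq_2, h2, hE, hs.sz4, St.setv_nv, if_true, h5, h6]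
  norm_num

/-- The entry of the matrix for the rows `nv 12` and `nv 9`. -/
def RE.entry : RE :=
  .sub (.mul (.sum 11 8 (.ite (.ancCount (.var 11)) (.const 1)
    (.ite (.witCount fun c => .xor (.xor (.bit 7 (.var 11) c) (.bit 7 (.var 12) c))
      (.bit 7 (.var 9) c)) (.const 1) (.arr 0 (.var 11)) (.const 0)) (.const 0))) .phaseSign)
  (.ite (.witCount fun c => .xor (.bit 7 (.var 12) c) (.bit 7 (.var 9) c)) (.const 1)
    (.sub (.const 1) (.add (.inp (.const 0)) (.inp (.const 0)))) (.const 0))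

theorem Pauli.add_eq_zero_iff {N : ℕ} (p q : Pauli N) : p + q = 0 ↔ p = q := by
  constructor
  · intro h
    have := congrArg (· + q) h
    simpa [add_assoc, Pauli.add_self] using this
  · rintro rfl
    exact Pauli.add_self p

theorem RE.eval_entry {I : Instance} {inp : Memory} (hinp : inp.nat = I.natInput) {c δ : ℝ}
    (hreal : inp.real = I.realInput c δ) {st : St} {rows : ℕ → Pauli (I.n + I.m)} {d : ℕ}
    (ht : HasTable I inp st rows d) (hs : HasSizes I st) (hk : st.sz 8 = 2 ^ I.b) {v w : ℕ}
    (hv : st.nv 12 = v) (hw : st.nv 9 = w) (hvD : v < 2 ^ I.b) (hwD : w < 2 ^ I.b) :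
    RE.entry.eval inp st = formEntry I.witCoeffs (1 - 2 * c) (Pauli.restrict (rows v))
      (Pauli.restrict (rows w)) := by
  have hc0 : inp.real 0 = c := by rw [hreal]; rfl
  have h1 := RE.eval_phaseSign ht hs hv hw hvD hwD
  have h2 := NE.eval_witCount ht.layout hs.sz3
    (f := fun c => .xor (.bit 7 (.var 12) c) (.bit 7 (.var 9) c)) (p := rows v + rows w)
    (by
      intro j c κ hc hκ
      rw [Pauli.bit_add]
      exact NE.eval_xor
        (NE.eval_bit (ht.layout.setv 10 j) (a := 7) ht.tab (by simp [NE.eval, hv]) hc hvD hκ)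
        (NE.eval_bit (ht.layout.setv 10 j) (a := 7) ht.tab (by simp [NE.eval, hw]) hc hwD hκ))
  rw [map_add, Pauli.add_eq_zero_iff] at h2
  have h3 : ∑ g ∈ Finset.range (2 ^ I.b), RE.eval inp (.ite (.ancCount (.var 11)) (.const 1)
      (.ite (.witCount fun c => .xor (.xor (.bit 7 (.var 11) c) (.bit 7 (.var 12) c))
        (.bit 7 (.var 9) c)) (.const 1) (.arr 0 (.var 11)) (.const 0)) (.const 0))
      (st.setv 11 g) = I.witCoeffs (Pauli.restrict (rows v) + Pauli.restrict (rows w)) := by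
    -- Several Paulis of the observable can restrict to the same Pauli on the witness qubits, so the
    -- coefficient is a sum over the whole table. This sum is the third factor `2^b` in the cost of
    -- the matrix.
    have h4 := ht.table.sum_eq fun p => if Pauli.ancX p = 0 ∧
      Pauli.restrict p = Pauli.restrict (rows v) + Pauli.restrict (rows w) then 1 else 0
    simp only [ite_mul, one_mul, zero_mul] at h4
    rw [Instance.witCoeffs, ← h4]
    refine Finset.sum_congr rfl fun g hg => ?_
    rw [Finset.mem_range] at hg
    have ht' : HasTable I inp (st.setv 11 g) rows d :=
      ⟨ht.layout.setv 11 g, ht.tab, ht.supp, ht.table⟩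
    have e1 := NE.eval_ancCount hinp ht' (h := .var 11) (γ := g) (by intro j; simp [NE.eval]) hg
    have e2 := NE.eval_witCount ht'.layout hs.sz3
      (f := fun c => .xor (.xor (.bit 7 (.var 11) c) (.bit 7 (.var 12) c)) (.bit 7 (.var 9) c))
      (p := rows g + rows v + rows w)
      (by
        intro j c κ hc hκ
        rw [Pauli.bit_add, Pauli.bit_add]
        exact NE.eval_xor (NE.eval_xor
          (NE.eval_bit (ht'.layout.setv 10 j) (a := 7) ht.tab (by simp [NE.eval]) hc hg hκ)
          (NE.eval_bit (ht'.layout.setv 10 j) (a := 7) ht.tab (by simp [NE.eval, hv]) hc hvD hκ))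
          (NE.eval_bit (ht'.layout.setv 10 j) (a := 7) ht.tab (by simp [NE.eval, hw]) hc hwD hκ))
    rw [map_add, map_add, add_assoc, Pauli.add_eq_zero_iff] at e2
    simp only [RE.eval, NE.eval.eq_1, NE.eval.eq_2, e1, e2, ite_and, St.setv_nv, if_true, St.setv_ra]
    simp
  rw [formEntry, ← h1, ← h3]
  simp only [RE.entry, RE.eval, NE.eval.eq_1, h2, hk, hc0]
  congr 1
  split_ifs
  · push_cast; ring
  · simp

end QCSAT

namespace QCSAT

open Matrix

/-! ### Matrices in memory -/

/-- The entries of `T` are those of the `D × D` matrix `M`, row by row. -/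
def IsMat (T : ℕ → ℝ) (M : ℕ → ℕ → ℝ) (D : ℕ) : Prop := ∀ j < D, ∀ k < D, T (j * D + k) = M j k

/-- Array `3` contains the multiples of `size 8`. -/
def HasMultiples (st : St) (D : ℕ) : Prop := st.sz 8 = D ∧ ∀ j < D, st.na 3 j = j * D

/-- Entry `(e, f)` of the matrix in array `1`. -/
def RE.mat (e f : NE) : RE := .arr 1 (.add (.arr 3 e) f)

theorem RE.eval_mat {inp : Memory} {st : St} {D : ℕ} (h : HasMultiples st D) {M : ℕ → ℕ → ℝ}
    (hM : IsMat (st.ra 1) M D) {e f : NE} {j k : ℕ} (he : e.eval inp st = j)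
    (hf : f.eval inp st = k) (hj : j < D) (hk : k < D) : (RE.mat e f).eval inp st = M j k := by
  rw [RE.mat, RE.eval, NE.eval, NE.eval, he, hf, h.2 j hj, hM j hj k hk]

/-- Fill the matrix in array `1`, row by row. -/
def Cmd.fillRows (r : RE) : Cmd := .loop 12 8 (.tabR 1 9 8 (.add (.arr 3 (.var 12)) (.var 9)) r)

/-- The matrix is replaced in place, and only the entries of one row are assigned simultaneously.
The expression for row `j` must therefore have the right value when the rows before `j` are already
the new ones. -/
theorem Cmd.exec_fillRows {inp : Memory} {st : St} {D : ℕ} (h : HasMultiples st D) {r : RE}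
    (F : ℕ → ℕ → ℝ) {M : ℕ → ℕ → ℝ} (hM : IsMat (st.ra 1) M D)
    (hr : ∀ j < D, ∀ T, IsMat T (fun g => if g < j then F g else M g) D → ∀ k < D,
      r.eval inp (((st.setR 1 T).setv 12 j).setv 9 k) = F j k) :
    ∃ T, (Cmd.fillRows r).exec inp st = st.setR 1 T ∧ IsMat T F D := by
  obtain ⟨h8, h3⟩ := h
  refine Cmd.loop_induction (Q := fun st' => ∃ T, st' = st.setR 1 T ∧ IsMat T F D)
    (fun j st' => ∃ T z, st' = (st.setR 1 T).setv 12 z ∧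
      IsMat T (fun g => if g < j then F g else M g) D)
    ⟨st.ra 1, st.nv 12, ?_, by simpa using hM⟩ ?_ ?_
  · rw [St.setR_self, St.setv_self]
  · rintro j hj st' ⟨T, z, rfl, hT⟩
    rw [h8] at hj
    rw [show ((st.setR 1 T).setv 12 z).setv 12 j = (st.setv 12 j).setR 1 T by
      rw [St.setv_setv, St.setR_setv], Cmd.exec.eq_3, St.setR_setR]
    refine ⟨_, j, rfl, fun g hg k hk => ?_⟩
    classical
    rw [updMany_row (W := D) (r := j) (col := id) _ (F j) _ _ _ hk]
    · by_cases hgj : g = j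
      · subst hgj
        rw [if_pos ⟨rfl, k, by simpa [h8] using hk, rfl⟩]
        simp
      · have h1 : g < j + 1 ↔ g < j := by omega
        rw [if_neg (fun h => hgj h.1)]
        simp only [St.setR_ra, if_true, hT g hg k hk, h1]
    · intro i _
      simp [NE.eval, h3 j hj]
    · intro i hi
      simpa [h8] using hi
    · intro i hi
      exact hr j hj T hT i (by simpa [h8] using hi)
  · rintro st' ⟨T, z, rfl, hT⟩
    rw [h8] at hT
    refine ⟨T, ?_, fun g hg k hk => (hT g hg k hk).trans (by simp [hg])⟩
    rw [St.setv_setv, St.setR_setv, St.setv_self]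

/-- Compute the multiples of `size 8`. -/
def Cmd.multiples : Cmd :=
  .tabN 3 9 8 (.var 9) (.sum 10 8 (.ite (.var 10) (.var 9) (.size 8) (.const 0)))

theorem Cmd.exec_multiples (inp : Memory) (st : St) :
    ∃ R, Cmd.multiples.exec inp st = st.setN 3 R ∧ HasMultiples (st.setN 3 R) (st.sz 8) := by
  refine ⟨_, rfl, rfl, fun j hj => ?_⟩
  rw [St.setN_na, if_pos rfl, updMany_id _ (fun i _ => by simp [NE.eval]), if_pos hj]
  simp only [NE.eval, St.setv_nv, if_true, show ((9 : ℕ) = 10) = False by simp, if_false,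
    St.setv_sz]
  exact sum_range_ite_lt _ _ _ hj.le

theorem HasTable.congr {I : Instance} {inp : Memory} {st st' : St} {rows : ℕ → Pauli (I.n + I.m)}
    {d : ℕ} (h : HasTable I inp st rows d) (h0 : st'.sz = st.sz) (h1 : st'.na 1 = st.na 1)
    (h2 : st'.na 2 = st.na 2) (h7 : st'.na 7 = st.na 7) (hr : st'.ra 0 = st.ra 0) :
    HasTable I inp st' rows d := by
  obtain ⟨⟨a1, a2, a3⟩, a4, a5, a6⟩ := h
  exact ⟨⟨a1, by rwa [h2], by rwa [h0, h1]⟩, by rwa [h7], by rwa [h0, h1], by rwa [hr]⟩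

/-- Compute the matrix of the quadratic form. -/
def Cmd.fillMatrix : Cmd := .seq .multiples (.fillRows .entry)

theorem Cmd.exec_fillMatrix {I : Instance} {inp : Memory} (hinp : inp.nat = I.natInput) {c δ : ℝ}
    (hreal : inp.real = I.realInput c δ) {st : St} {rows : ℕ → Pauli (I.n + I.m)} {d : ℕ}
    (ht : HasTable I inp st rows d) (hs : HasSizes I st) (hk : st.sz 8 = 2 ^ I.b) :
    ∃ st', Cmd.fillMatrix.exec inp st = st' ∧
    HasMultiples st' (2 ^ I.b) ∧ IsMat (st'.ra 1) (fun v w => formEntry I.witCoeffs (1 - 2 * c)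
      (Pauli.restrict (rows v)) (Pauli.restrict (rows w))) (2 ^ I.b) := by
  obtain ⟨R, e1, h1⟩ := Cmd.exec_multiples inp st
  rw [hk] at h1
  generalize hst1 : st.setN 3 R = st1 at e1 h1
  have hs1 : st1.sz = st.sz := by rw [← hst1]; rfl
  have ht1 : HasTable I inp st1 rows d := by
    rw [← hst1]
    exact ht.congr rfl (by simp) (by simp) (by simp) (by simp)
  generalize hD : 2 ^ I.b = D at *
  have hM : IsMat (st1.ra 1) (fun v w => st1.ra 1 (v * D + w)) D := fun _ _ _ _ => rfl
  obtain ⟨T, e2, h2⟩ := Cmd.exec_fillRows (inp := inp) h1 (r := .entry)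
    (fun v w => formEntry I.witCoeffs (1 - 2 * c) (Pauli.restrict (rows v))
      (Pauli.restrict (rows w))) hM (by
      intro v hv T _ w hw
      refine RE.eval_entry hinp hreal (d := d) (rows := rows) ?_ (hs.congr ?_) ?_ ?_ ?_
        (hv.trans_eq hD.symm) (hw.trans_eq hD.symm)
      · exact ht1.congr rfl rfl rfl rfl (by simp)
      · exact hs1
      · exact (congrFun hs1 8).trans (hk.trans hD.symm)
      · simp
      · simp)
  refine ⟨st1.setR 1 T, ?_, h1, ?_⟩
  · rw [Cmd.fillMatrix, Cmd.exec.eq_5, e1, e2]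
  · simpa using h2

/-! ### Elimination -/

/-- The entries after one step of elimination. -/
def RE.elimEntry : RE :=
  .ite (.var 1) (.var 12) (.sub (.mat (.var 12) (.var 9))
    (.div (.mul (.mat (.var 12) (.var 1)) (.mat (.var 1) (.var 9))) (.mat (.var 1) (.var 1))))
    (.mat (.var 12) (.var 9))

/-- Working in place is harmless: the new row `j` uses only the old row `j` and the pivot row `i`,
and the pivot row is not changed by the step. -/
theorem Cmd.exec_eliminate {inp : Memory} {st : St} {D i : ℕ} (h : HasMultiples st D)
    (hi : st.nv 1 = i) (hiD : i < D) {M : ℕ → ℕ → ℝ} (hM : IsMat (st.ra 1) M D) :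
    ∃ T, (Cmd.fillRows .elimEntry).exec inp st = st.setR 1 T ∧ IsMat T (eliminate i M) D := by
  refine Cmd.exec_fillRows h _ hM fun j hj T hT k hk => ?_
  generalize hst : ((st.setR 1 T).setv 12 j).setv 9 k = st'
  have h' : HasMultiples st' D := by rw [← hst]; exact h
  have hT' : IsMat (st'.ra 1) (fun g => if g < j then eliminate i M g else M g) D := by
    rw [← hst]; simpa using hT
  have h12 : (NE.var 12).eval inp st' = j := by simp [NE.eval, ← hst]
  have h9 : (NE.var 9).eval inp st' = k := by simp [NE.eval, ← hst]
  have h1 : (NE.var 1).eval inp st' = i := by simp [NE.eval, ← hst, hi]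
  -- `eliminate` alters only rows below the pivot row, so row `i` reads the same whether or not it
  -- has been rewritten.
  have hrow : ∀ l, (if i < j then eliminate i M i else M i) l = M i l := by
    intro l
    split_ifs
    · rw [eliminate, if_neg (by omega)]
    · rfl
  simp only [RE.elimEntry, RE.eval, RE.eval_mat h' hT' h12 h9 hj hk,
    RE.eval_mat h' hT' h12 h1 hj hiD, RE.eval_mat h' hT' h1 h9 hiD hk,
    RE.eval_mat h' hT' h1 h1 hiD hiD, h12, h1, lt_irrefl, if_false, hrow, eliminate]

/-- Test whether row `nv 1` shows that the form is not positive, and eliminate. -/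
def Cmd.elimStep : Cmd :=
  .seq (.cmp 6 (.const 0) (.mat (.var 1) (.var 1))) <|
  .seq (.cmp 7 (.const 0) (.sub (.sum 9 8 (.ite (.var 1) (.var 9)
    (.mul (.mat (.var 1) (.var 9)) (.mat (.var 1) (.var 9))) (.const 0)))
    (.mat (.var 1) (.var 1)))) <|
  .seq (.ite (.var 6) (.var 7) (.setv 16 (.const 1)) .skip) (.fillRows .elimEntry)

theorem Cmd.exec_elimStep {inp : Memory} {st : St} {D i : ℕ} (h : HasMultiples st D)
    (hi : st.nv 1 = i) (hiD : i < D) {M : ℕ → ℕ → ℝ} (hM : IsMat (st.ra 1) M D) :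
    let st' := Cmd.elimStep.exec inp st
    HasMultiples st' D ∧ IsMat (st'.ra 1) (eliminate i M) D ∧
      ((M i i ≤ 0 ∧ 0 < rowSquares D i M - M i i) → st'.nv 16 = 1) ∧
      (¬ (M i i ≤ 0 ∧ 0 < rowSquares D i M - M i i) → st'.nv 16 = st.nv 16) := by
  classical
  have hv : ∀ st' : St, st'.nv 1 = i → (NE.var 1).eval inp st' = i := fun _ h => h
  have e1 := RE.eval_mat h hM (hv st hi) (hv st hi) hiD hiD
  generalize ha : (if 0 < M i i then 1 else 0 : ℕ) = a
  generalize hb : (if 0 < rowSquares D i M - M i i then 1 else 0 : ℕ) = b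
  have e2 : RE.eval inp (.sub (.sum 9 8 (.ite (.var 1) (.var 9)
      (.mul (.mat (.var 1) (.var 9)) (.mat (.var 1) (.var 9))) (.const 0)))
      (.mat (.var 1) (.var 1))) (st.setv 6 a) = rowSquares D i M - M i i := by
    have h' : ∀ k, HasMultiples ((st.setv 6 a).setv 9 k) D := fun _ => h
    have hM' : ∀ k, IsMat (((st.setv 6 a).setv 9 k).ra 1) M D := fun _ => hM
    rw [RE.eval, RE.eval, RE.eval_mat (st := st.setv 6 a) h hM (hv _ (by simpa using hi))
      (hv _ (by simpa using hi)) hiD hiD, rowSquares, St.setv_sz, h.1]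
    congr 1
    refine Finset.sum_congr rfl fun k hk => ?_
    rw [Finset.mem_range] at hk
    have h1 := hv ((st.setv 6 a).setv 9 k) (by simpa using hi)
    have h9 : (NE.var 9).eval inp ((st.setv 6 a).setv 9 k) = k := by simp [NE.eval]
    rw [RE.eval.eq_9, RE.eval.eq_4, RE.eval_mat (h' k) (hM' k) h1 h9 hiD hk, h1, h9, RE.eval.eq_1,
      Nat.cast_zero]
  generalize hst2 : (Cmd.ite (.var 6) (.var 7) (.setv 16 (.const 1)) .skip).exec inp
    ((st.setv 6 a).setv 7 b) = st2
  have hst2' : st2 = if a < b then ((st.setv 6 a).setv 7 b).setv 16 1 else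
      (st.setv 6 a).setv 7 b := by
    rw [← hst2, Cmd.exec, Cmd.exec_skip]
    simp [NE.eval, Cmd.exec]
  have hm2 : HasMultiples st2 D := by rw [hst2']; split_ifs <;> exact h
  have hM2 : IsMat (st2.ra 1) M D := by rw [hst2']; split_ifs <;> exact hM
  have h12 : st2.nv 1 = i := by rw [hst2']; split_ifs <;> simpa using hi
  obtain ⟨T, e3, hT⟩ := Cmd.exec_eliminate (inp := inp) hm2 h12 hiD hM2
  intro st'
  have hst' : st' = st2.setR 1 T := by
    show Cmd.elimStep.exec inp st = _
    rw [Cmd.elimStep]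
    simp only [Cmd.exec.eq_5, Cmd.exec.eq_4, e1, RE.eval.eq_1, Nat.cast_zero, ha, e2, hb]
    rw [hst2, e3]
  -- The comparisons are stored as `0` or `1`, so `a < b` says that the first fails and the second
  -- holds.
  have hab : a < b ↔ (M i i ≤ 0 ∧ 0 < rowSquares D i M - M i i) := by
    rw [← ha, ← hb, ← not_lt]
    by_cases h1 : 0 < M i i <;> by_cases h2 : 0 < rowSquares D i M - M i i <;>
      simp only [h1, h2, if_true, if_false] <;> simp
  refine ⟨by rw [hst']; exact hm2, by rw [hst']; simpa using hT, fun hc => ?_, fun hc => ?_⟩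
  · rw [hst', hst2', if_pos (hab.mpr hc)]; simp
  · rw [hst', hst2', if_neg (hc ∘ hab.mp)]; simp

/-- Put `0` into scalar `16` if the matrix is positive semidefinite, and otherwise `1`. -/
def Cmd.psdTest : Cmd := .seq (.setv 16 (.const 0)) (.loop 1 8 .elimStep)

/-- The verdict is never reset, so after a bad pivot the elimination may go on with meaningless
entries. Until then, nonnegativity of the original form is equivalent to that of the remaining one,
which is empty at the end. -/
theorem Cmd.exec_psdTest {inp : Memory} {st : St} {D : ℕ} (h : HasMultiples st D)
    {M : ℕ → ℕ → ℝ} (hM : IsMat (st.ra 1) M D) (hsymm : ∀ j k, M j k = M k j) :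
    let st' := Cmd.psdTest.exec inp st
    st'.nv 16 ≤ 1 ∧ (st'.nv 16 = 0 ↔ ∀ y, 0 ≤ quadFrom D 0 M y) := by
  show _ ∧ _
  rw [Cmd.psdTest, Cmd.exec, Cmd.exec.eq_1, NE.eval]
  refine Cmd.loop_induction (st := st.setv 16 0) (Q := fun st' => st'.nv 16 ≤ 1 ∧
      (st'.nv 16 = 0 ↔ ∀ y, 0 ≤ quadFrom D 0 M y))
    (fun i st' => HasMultiples st' D ∧ st'.nv 16 ≤ 1 ∧ ∃ Mi, IsMat (st'.ra 1) Mi D ∧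
      (∀ j k, i ≤ j → j < D → i ≤ k → k < D → Mi j k = Mi k j) ∧
      ((∀ y, 0 ≤ quadFrom D 0 M y) ↔ st'.nv 16 = 0 ∧ ∀ y, 0 ≤ quadFrom D i Mi y))
    ⟨h, by simp, M, hM, fun j k _ _ _ _ => hsymm j k, by simp⟩ ?_ ?_
  · rintro i hi st' ⟨h1, h2, Mi, h3, h4, h5⟩
    rw [St.setv_sz, h.1] at hi
    obtain ⟨b1, b2, b3, b4⟩ := Cmd.exec_elimStep (inp := inp) (st := st'.setv 1 i) h1 (by simp) hi h3
    rw [St.setv_nv, if_neg (by decide)] at b4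
    have h6 := quadFrom_nonneg_iff hi (M := Mi) fun k hk hkD => h4 k i hk.le hkD le_rfl hi
    by_cases hc : Mi i i ≤ 0 ∧ 0 < rowSquares D i Mi - Mi i i
    · refine ⟨b1, (b3 hc).le, _, b2, eliminate_symm h4, ?_⟩
      rw [h5, h6, b3 hc]
      simp [hc]
    · refine ⟨b1, (b4 hc).trans_le h2, _, b2, eliminate_symm h4, ?_⟩
      rw [h5, h6, b4 hc]
      simp only [hc, not_false_eq_true, true_and]
  · rintro st' ⟨-, h2, Mi, -, -, h5⟩
    rw [St.setv_sz, h.1] at h5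
    rw [St.setv_nv, if_neg (by decide)]
    refine ⟨h2, ?_⟩
    rw [h5]
    simp [quadFrom]

/-- Exchanging `v` and `w` replaces the operator in `trace_formEntry` by its adjoint, which
conjugates the trace and leaves its real part unchanged. -/
theorem formEntry_comm {N : ℕ} (a : Pauli N → ℝ) (c : ℝ) (v w : Pauli N) :
    formEntry a c v w = formEntry a c w v := by
  have h : (v.toOp * (pauliSum a - (c : ℂ) • 1) * w.toOp)ᴴ =
      w.toOp * (pauliSum a - (c : ℂ) • 1) * v.toOp := by
    have h1 : (pauliSum a - (c : ℂ) • 1 : Op N)ᴴ = pauliSum a - (c : ℂ) • 1 := by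
      rw [Matrix.conjTranspose_sub, (isHermitian_pauliSum a).eq]
      simp
    rw [Matrix.conjTranspose_mul, Matrix.conjTranspose_mul, h1, Pauli.toOp_conjTranspose,
      Pauli.toOp_conjTranspose, Matrix.mul_assoc]
  have h2 := trace_formEntry a c w v
  rw [← h, Matrix.trace_conjTranspose, Complex.star_def, Complex.conj_re, trace_formEntry] at h2
  exact mul_left_cancel₀ (by positivity) h2

end QCSAT

/-! ### The decision algorithm and its running time -/

namespace QCSAT

open Program

/-! ### The decision algorithm -/

/-- Compute the dimension and the number of elements of the group. -/
def Cmd.prepare : Cmd := .seq .dim .pow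

/-- Decide whether the maximal acceptance probability exceeds the threshold. -/
def Cmd.decide : Cmd := .seq .table (.seq .fillMatrix .psdTest)

/-- The decision algorithm. -/
def deciderProgram : Program :=
  .seq setSizes <| .seq (Cmd.prepare.compile 0) <| .seq (setSize 8 (.var 13)) <|
  .seq (Cmd.decide.compile 0) (mov (tmp 0) (adv 16) (tmp 1))

theorem Cmd.exec_prepare {I : Instance} {inp : Memory} (hinp : inp.nat = I.natInput) {st : St}
    (hs : HasSizes I st) (h0 : st.na 0 = fun _ => 0) (hv : st.nv 0 = 0) :
    ∃ st', Cmd.prepare.exec inp st = st' ∧ st'.sz = st.sz ∧ HasColumns I st' ∧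
      st'.na 7 = st.na 7 ∧ st'.nv 13 = 2 ^ I.b := by
  obtain ⟨h1, h2, h3, -, h5⟩ := Cmd.exec_dim hinp hs h0 hv
  obtain ⟨p1, p2, -, p4⟩ := Cmd.exec_pow (inp := inp) h5
    (by rw [h1, hs.sz1]; exact I.b_le_s)
  refine ⟨_, rfl, p1.trans h1, h2.congr p1 (congrFun p2 1), ?_, p4⟩
  exact (congrFun p2 7).trans (h3 7 (by decide) (by decide) (by decide))

theorem Cmd.exec_decide {I : Instance} {inp : Memory} (hinp : inp.nat = I.natInput) {c δ : ℝ}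
    (hreal : inp.real = I.realInput c δ) {st : St} (hs : HasSizes I st) (hc : HasColumns I st)
    (hk : st.sz 8 = 2 ^ I.b) (h7 : st.na 7 = fun _ => 0) :
    ∃ st', Cmd.decide.exec inp st = st' ∧ st'.nv 16 ≤ 1 ∧ (st'.nv 16 = 0 ↔ I.Val ≤ c) := by
  obtain ⟨rows, d, ht, hsz, -⟩ := Cmd.exec_table hinp hreal hs hc hk h7
  obtain ⟨st2, e2, hm, hM⟩ := Cmd.exec_fillMatrix hinp hreal ht (hs.congr hsz)
    ((congrFun hsz 8).trans hk)
  obtain ⟨h1, h2⟩ := Cmd.exec_psdTest (inp := inp) hm hM fun v w => formEntry_comm _ _ _ _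
  refine ⟨_, rfl, ?_⟩
  rw [Cmd.decide, Cmd.exec.eq_5, Cmd.exec.eq_5, e2]
  refine ⟨h1, h2.trans ?_⟩
  rw [← formEntry_nonneg_iff I c (D := 2 ^ I.b) (R := fun v => Pauli.restrict (rows v))]
  · simp only [quadFrom, Nat.Ico_zero_eq_range]
  · rintro p hp
    -- The rows of the table cover the full group, so their restrictions cover `witSpan`. They may
    -- repeat and may lie outside it, which the criterion allows.
    rw [Instance.witSpan, Submodule.mem_map] at hp
    obtain ⟨p', hp', rfl⟩ := hp
    obtain ⟨g, hg, rfl⟩ := ht.table.surj p' hp'.1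
    exact ⟨g, hg.trans_le ht.table.le, rfl⟩

/-- Commands do not change sizes, so the program has two phases: `b` and `2^b` are computed with
polynomial sizes only, and then size 8 is set to `2^b` for the exponential part. -/
theorem ends_deciderProgram {I : Instance} {inp : Memory} (hinp : inp.nat = I.natInput) {c δ : ℝ}
    (hreal : inp.real = I.realInput c δ) :
    Ends inp deciderProgram ⟨fun _ => 0, fun _ => 0⟩
      (100 + (Cmd.prepare.deg.val (4 * (I.n + I.s + 1)) 1 + (4 +
        (Cmd.decide.deg.val (4 * (I.n + I.s + 1)) (2 ^ I.b) + 2))))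
      (fun σ => σ.nat 0 = open scoped Classical in if c < I.Val then 1 else 0) := by
  refine (ends_setSizes hinp).seq fun σ1 ⟨st, hst, h1⟩ => ((Ends.cmd Cmd.prepare h1).mono
    (Cmd.cost_le (by omega) le_rfl hst.size_le _) fun _ h => h).seq fun σ2 h2 => ?_
  obtain ⟨st2, e2, hsz, hcol, hna, hv⟩ := Cmd.exec_prepare hinp hst.sizes (by rw [hst.na])
    (by rw [hst.nv])
  rw [e2] at h2
  refine ((Ends.setSize 8 (.var 13) h2).mono (C' := 4) le_rfl fun _ h => h).seq fun σ3 h3 => ?_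
  rw [show (NE.var 13).eval inp st2 = 2 ^ I.b from hv] at h3
  generalize hst3 : st2.setsz 8 (2 ^ I.b) = st3 at h3
  have hlow : ∀ k, k < 8 → st3.sz k = st.sz k := by
    intro k hk
    rw [← hst3, St.setsz_sz, if_neg (by omega), hsz]
  have hs := hst.sizes
  have hs3 : HasSizes I st3 := ⟨(hlow 0 (by omega)).trans hs.sz0, (hlow 1 (by omega)).trans hs.sz1,
    (hlow 2 (by omega)).trans hs.sz2, (hlow 3 (by omega)).trans hs.sz3,
    (hlow 4 (by omega)).trans hs.sz4⟩
  have hk : st3.sz 8 = 2 ^ I.b := by rw [← hst3, St.setsz_sz, if_pos rfl]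
  have hcol3 : HasColumns I st3 := by
    have hsz2 : st3.sz 2 = st2.sz 2 := (hlow 2 (by omega)).trans (by rw [hsz])
    have hna1 : st3.na 1 = st2.na 1 := by rw [← hst3]; rfl
    obtain ⟨a1, a2, a3⟩ := hcol
    exact ⟨by rwa [hsz2, hna1], by rwa [hsz2, hna1], by rwa [hsz2, hna1]⟩
  have hle : ∀ k, st3.sz k ≤ if k < 8 then 4 * (I.n + I.s + 1) else 2 ^ I.b := by
    intro k
    split_ifs with h
    · rw [hlow k h]; exact hst.le k
    · rw [← hst3, St.setsz_sz]
      split_ifs with h8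
      · exact le_rfl
      · rw [hsz, hst.zero k (by omega)]; exact Nat.zero_le _
  refine ((Ends.cmd Cmd.decide h3).mono (Cmd.cost_le (by omega) Nat.one_le_two_pow hle _)
    fun _ h => h).seq fun σ4 h4 => ?_
  obtain ⟨st4, e4, h16, hV⟩ := Cmd.exec_decide hinp hreal hs3 hcol3 hk
    (by rw [← hst3, St.setsz_na, hna, hst.na])
  rw [e4] at h4
  refine (Ends.output h4).mono le_rfl fun σ h => h.trans ?_
  split_ifs with hlt
  · have : st4.nv 16 ≠ 0 := fun h0 => absurd (hV.mp h0) (not_le.mpr hlt)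
    omega
  · exact hV.mpr (not_lt.mp hlt)

theorem exists_decider : ∃ (decider : Program) (K k : ℕ), ∀ (I : Instance) (c δ : ℝ),
    ∃ T y : ℕ, decider.HaltsWith ⟨I.natInput, I.realInput c δ⟩ T y ∧ (c < I.Val → y = 1) ∧
      (I.Val ≤ c → y = 0) ∧ T ≤ K * (I.n + I.s + 1) ^ k * 2 ^ (3 * I.b) := by
  -- The exponent of `2^b` is the greatest nesting depth of loops and sums over size 8. It is
  -- evaluated from the syntax; filling the matrix and eliminating both have depth three.
  have hd : Cmd.decide.deg.d = 3 := by decide +kernel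
  refine ⟨deciderProgram, 106 + Cmd.prepare.deg.k * 4 ^ Cmd.prepare.deg.l +
    Cmd.decide.deg.k * 4 ^ Cmd.decide.deg.l, Cmd.prepare.deg.l + Cmd.decide.deg.l,
    fun I c δ => ?_⟩
  obtain ⟨T, hT, h⟩ :=
    (ends_deciderProgram (I := I) (inp := ⟨I.natInput, I.realInput c δ⟩) rfl rfl).haltsWith
  refine ⟨T, _, h, fun hc => if_pos hc, fun hc => if_neg (not_lt.mpr hc), hT.trans ?_⟩
  have h1 := Cmd.prepare.deg.val_le (I.n + I.s + 1) 1
  have h2 := Cmd.decide.deg.val_le (I.n + I.s + 1) (2 ^ I.b)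
  rw [hd, ← pow_mul, mul_comm I.b] at h2
  rw [one_pow, mul_one] at h1
  generalize Cmd.prepare.deg.l = l₁ at *
  generalize Cmd.decide.deg.l = l₂ at *
  generalize Cmd.prepare.deg.k * 4 ^ l₁ = k₁ at *
  generalize Cmd.decide.deg.k * 4 ^ l₂ = k₂ at *
  have hw : 1 ≤ I.n + I.s + 1 := by omega
  generalize I.n + I.s + 1 = w at *
  have hE : 1 ≤ 2 ^ (3 * I.b) := Nat.one_le_two_pow
  generalize 2 ^ (3 * I.b) = E at *
  have h3 : w ^ l₁ ≤ w ^ (l₁ + l₂) * E := by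
    calc w ^ l₁ ≤ w ^ (l₁ + l₂) := Nat.pow_le_pow_right hw (by omega)
      _ ≤ _ := Nat.le_mul_of_pos_right _ hE
  have h4 : w ^ l₂ ≤ w ^ (l₁ + l₂) := Nat.pow_le_pow_right hw (by omega)
  have h5 : 1 ≤ w ^ (l₁ + l₂) * E := Nat.mul_pos (pow_pos hw _) hE
  calc _ ≤ 100 + (k₁ * w ^ l₁ + (4 + (k₂ * w ^ l₂ * E + 2))) := by omega
    _ = 106 + k₁ * w ^ l₁ + k₂ * (w ^ l₂ * E) := by ring
    _ ≤ 106 * (w ^ (l₁ + l₂) * E) + k₁ * (w ^ (l₁ + l₂) * E) + k₂ * (w ^ (l₁ + l₂) * E) := by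
      gcongr
      omega
    _ = _ := by ring

end QCSAT

/-! ### Assembly of the theorem -/

theorem mainTheorem7 :
    ∃ (decider routine : QCSAT.Program) (K k : ℕ), routine.IsDiscrete ∧
      ∀ I : QCSAT.Instance, I.t ≤ I.n →
        -- a basis of at most `t + 1` Paulis for `U† Z_out U`
        I.b ≤ I.t + 1 ∧
        (∃ (B : Fin I.b → QCSAT.Pauli (I.n + I.m)) (α : Finset (Fin I.b) → ℂ),
          LinearIndependent (ZMod 2) B ∧
          Submodule.span (ZMod 2) (Set.range B) = Submodule.span (ZMod 2) I.paulis ∧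
          {S | α S ≠ 0}.ncard ≤ 2 ^ I.t ∧
          I.observable = ∑ S : Finset (Fin I.b), α S • QCSAT.pauliProd B S) ∧
        -- a `2 ^ b`-dimensional Hamiltonian with the spectrum of `⟨0^m| U† Z_out U |0^m⟩`
        (∃ (r : ℕ) (P : Fin r → QCSAT.Pauli I.n) (A : Fin r → QCSAT.Pauli I.b)
            (β : Finset (Fin r) → ℂ) (H' : QCSAT.Op I.b),
          r ≤ I.b ∧
          LinearIndependent (ZMod 2) P ∧ LinearIndependent (ZMod 2) A ∧
          (∀ i j, Commute (A i).toOp (A j).toOp ↔ Commute (P i).toOp (P j).toOp) ∧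
          {S | β S ≠ 0}.ncard ≤ 2 ^ I.t ∧
          I.witnessObservable = ∑ S : Finset (Fin r), β S • QCSAT.pauliProd P S ∧
          H' = ∑ S : Finset (Fin r), β S • QCSAT.pauliProd A S ∧
          H'.IsHermitian ∧
          spectrum ℂ H' = spectrum ℂ I.witnessObservable ∧
          IsLeast {x : ℝ | (x : ℂ) ∈ spectrum ℂ H'} (1 - 2 * I.Val)) ∧
        -- `b` is computed in time `poly (n, s)`
        (∃ T : ℕ, T ≤ K * (I.n + I.s + 1) ^ k ∧
          routine.HaltsWith ⟨I.natInput, fun _ => 0⟩ T I.b) ∧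
        -- the decision algorithm and its running time
        ∀ c δ : ℝ, 0 < δ → ∃ T y : ℕ,
          decider.HaltsWith ⟨I.natInput, I.realInput c δ⟩ T y ∧
          (c < I.Val → y = 1) ∧ (I.Val < c - δ → y = 0) ∧
          (T : ℝ) ≤ K * (I.n + I.s + 1) ^ k * 2 ^ (3 * I.b) * max 1 (Real.log (I.t / δ)) ∧
          (T : ℝ) ≤ K * (I.n + I.s + 1) ^ k * 2 ^ (3 * I.t) * max 1 (Real.log (I.t / δ)) := by
  obtain ⟨routine, K₁, k₁, hdisc, hroutine⟩ := QCSAT.exists_routine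
  obtain ⟨decider, K₂, k₂, hdecider⟩ := QCSAT.exists_decider
  refine ⟨decider, routine, K₁ + 8 * K₂, k₁ + k₂, hdisc, fun I _ => ⟨I.b_le,
    I.exists_observable_expansion, I.exists_hamiltonian, ?_, fun c δ hδ => ?_⟩⟩
  · obtain ⟨T, hT, h⟩ := hroutine I
    refine ⟨T, hT.trans ?_, h⟩
    gcongr <;> omega
  · obtain ⟨T, y, h, h1, h0, hT⟩ := hdecider I c δ
    have hw : (1 : ℝ) ≤ I.n + I.s + 1 := by
      have : (0 : ℝ) ≤ I.n + I.s := by positivity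
      linarith
    have hT' : (T : ℝ) ≤ K₂ * (I.n + I.s + 1) ^ k₂ * 2 ^ (3 * I.b) := by exact_mod_cast hT
    -- From `b ≤ t + 1`; the factor 8 is the one included in the constant `K₁ + 8 * K₂`.
    have hb : (2 : ℝ) ^ (3 * I.b) ≤ 8 * 2 ^ (3 * I.t) := by
      calc (2 : ℝ) ^ (3 * I.b) ≤ 2 ^ (3 + 3 * I.t) :=
            pow_le_pow_right₀ one_le_two (by have := I.b_le; omega)
        _ = _ := by rw [pow_add]; norm_num
    have hpow : ((I.n : ℝ) + I.s + 1) ^ k₂ ≤ (I.n + I.s + 1) ^ (k₁ + k₂) :=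
      pow_le_pow_right₀ hw (by omega)
    have hone : (1 : ℝ) ≤ max 1 (Real.log (I.t / δ)) := le_max_left _ _
    -- The algorithm answers `0` whenever `Val ≤ c`, in particular when `Val < c - δ`. The
    -- logarithmic factor is at least one and only weakens the bound.
    refine ⟨T, y, h, h1, fun hc => h0 (by linarith), ?_, ?_⟩
    · calc (T : ℝ) ≤ K₂ * (I.n + I.s + 1) ^ k₂ * 2 ^ (3 * I.b) * 1 := by rwa [mul_one]
        _ ≤ _ := by
          push_cast
          gcongr
          have : (0 : ℝ) ≤ K₁ := by positivity
          have : (0 : ℝ) ≤ K₂ := by positivity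
          linarith
    · calc (T : ℝ) ≤ K₂ * (I.n + I.s + 1) ^ k₂ * (8 * 2 ^ (3 * I.t)) * 1 := by
            rw [mul_one]
            exact hT'.trans (by gcongr)
        _ = 8 * K₂ * (I.n + I.s + 1) ^ k₂ * 2 ^ (3 * I.t) * 1 := by ring
        _ ≤ _ := by
          push_cast
          gcongr
          have : (0 : ℝ) ≤ K₁ := by positivity
          linarith
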